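/- **Conventions.** A strict partition $\gamma=(\gamma_1>\dots>\gamma_\ell>0)$ is identified with its shifted diagram (French notation, row $i$ shifted $i-1$ columns to the right). A signed standard tableau $S\in\mathrm{SST}(\gamma)$, $|\gamma|=n$, is a bijective filling of this diagram by $1,\dots,n$, each letter marked or unmarked, increasing along rows and columns, with no marked letter on the main diagonal. Its hook reading word reads, for $i$ from largest to smallest, the marked letters of column $i$ from bottom to top and then the unmarked letters of row $i$ from left to right; $\mathrm{Des}(S)$ is the set of $i<n$ such that $i$ is to the right of $i+1$ in this word. Let $F_D$ be Gessel's fundamental quasisymmetric functions, $s_\lambda=\sum_{T\in\mathrm{SYT}(\lambda)}F_{\mathrm{Des}(T)}$ the Schur functions and $P_\gamma=\sum_{S\in \mathrm{SST}(\gamma)}F_{\mathrm{Des}(S)}$ the Schur $P$-functions. On $\mathrm{SST}(\gamma)$, $d_0$ toggles the mark of the letter $2$. For $1<i<n$, let $a\le b\le c$ be the diagonals (row minus column if unmarked, column minus row if marked) of the letters $i-1,i,i+1$; then $d_i$ fixes $S$ if $i$ is on diagonal $b$; otherwise it toggles the mark of the letter on $c$ (resp. $a$) if $a=b$ (resp.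 $b=c$); otherwise it toggles the marks of the letters on $a$ and $c$ if $\bigl||a|-|c|\bigr|=1$; otherwise it swaps the absolute values of the letters on $a$ and $c$, keeping the marks in their cells. For a finite set $\mathcal A$ and $\mathrm{Des}:\mathcal A\to 2^{[N-1]}$, a *dual equivalence* is a family of involutions $\psi_i$, $1<i<N$, on $\mathcal A$ such that $\psi_i\psi_j=\psi_j\psi_i$ for $|i-j|\ge3$ and, for $0\le i-h\le 3$, every class $C$ generated by $\psi_h,\dots,\psi_i$ satisfies $\sum_{U\in C}F_{D(U)}=s_\lambda$ for some partition $\lambda$ of $i-h+3$, where $D(U)$ is $\mathrm{Des}(U)\cap\{h-1,\dots,i\}$ shifted down by $h-2$. Let $[S]_{\le k}$ denote the class of $S$ generated by the $\psi_h$ with $h\le k$, $h\ne 1$. A *queer dual equivalence* is a dual equivalence together with an involution $\psi_0$ such that (i) for $i=1,2,3$, $i<N$, and every $S$ there is a strict partition $\gamma$ of $i+1$ with $\sum_{U\in[S]_{\le i}}F_{\mathrm{Des}(U)\cap[i]}=P_\gamma$; (ii) $\psi_0\psi_i=\psi_i\psi_0$ for $i>3$; (iii) for $k<N$ and $T\in[S]_{\le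 k}$, there is a sequence of indices from $\{0,2,\dots,k\}$, at most two of them equal to $k$, such that applying the corresponding $\psi$'s successively to $S$ gives $T$. The symmetric diagram $\mathrm{sym}(\gamma)$ is the Young diagram that is the union of the shifted diagram of $\gamma$ and its reflection in the main diagonal. For $S\in\mathrm{SST}(\gamma)$, an unmarked letter is placed in its own cell of $\mathrm{sym}(\gamma)$, a marked letter in the reflection of its cell. **Lemma.** Let $\{\psi_i\}_{i=0,2,\dots,n}$ be a queer dual equivalence for $(\mathcal A,\mathrm{Des})$, with $\mathrm{Des}:\mathcal A\to 2^{[n]}$ (so $N=n+1$). Let $T\in\mathcal A$, let $\gamma\neq(3)$ be a strict partition of $n$, and let $f:[T]_{\le n-1}\to\mathrm{SST}(\gamma)$ be a bijection such that for all $U\in[T]_{\le n-1}$ $$f(\psi_i(U))=d_i(f(U))\quad(i=0,2,\dots,n-1),\qquad \mathrm{Des}(f(U))\cap[n-1]=\mathrm{Des}(U)\cap[n-1].$$ Then there is a unique strict partition $\delta\supset\gamma$ of $n+1$ for which one of the embeddings $\mathrm{SST}(\gamma)\hookrightarrow\mathrm{SST}(\delta)$ that append the letter $n+1$ in the new cell,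 unmarked or (if the new cell is off the main diagonal) marked, satisfies: when $f(U)$ is regarded as an element of $\mathrm{SST}(\delta)$, $\mathrm{Des}(f(U))=\mathrm{Des}(U)$ for every $U\in[T]_{\le n-1}$. The embedding is unique as well. Moreover, there is a unique addable cell $c$ of $\mathrm{sym}(\gamma)$ such that for every $U\in[T]_{\le n-1}$, $n\in\mathrm{Des}(U)$ if and only if the cell of $\mathrm{sym}(\gamma)$ that holds the letter $n$ of $f(U)$ lies in a row strictly below that of $c$; the new cell of $\delta$ is $c$, with $n+1$ unmarked, if $c$ is weakly below the main diagonal, and it is the reflection of $c$, with $n+1$ marked, if $c$ is above the main diagonal. -/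

import Mathlib

namespace QueerDual

/-! ### Strict partitions and signed standard tableaux -/

/-- A strict partition of `n`: a strictly decreasing list of positive integers with sum `n`. -/
@[ext]
structure StrictPartition (n : ℕ) where
  parts : List ℕ
  strict : parts.Pairwise (· > ·)
  pos : ∀ p ∈ parts, 0 < p
  sum_eq : parts.sum = n

/-- The shifted diagram. Rows and columns are indexed from `0`, row `0` is the bottom row
(French notation), and row `r` is shifted `r` columns to the right. Cells are pairs
`(row, column)`. -/
def StrictPartition.shiftedCells {n : ℕ} (γ : StrictPartition n) : Set (ℕ × ℕ) :=
  {x | x.1 ≤ x.2 ∧ x.2 < x.1 + γ.parts.getD x.1 0}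

/-- A filling of cells by signed letters, stored letter by letter: `pos a` is the cell that
contains the letter with absolute value `a`, and `mark a` says whether that letter is marked. -/
@[ext]
structure SignedFilling where
  pos : ℕ → ℕ × ℕ
  mark : ℕ → Bool

/-- `S` is a signed standard tableau of shape `γ`. The letters are `1, …, n`; the last two fields
only fix the values that `S` takes, as a function, on numbers that are not letters. -/
structure IsSST {n : ℕ} (γ : StrictPartition n) (S : SignedFilling) : Prop where
  bijOn : Set.BijOn S.pos (Set.Icc 1 n) γ.shiftedCells
  row_inc : ∀ a ∈ Set.Icc 1 n, ∀ b ∈ Set.Icc 1 n,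
    (S.pos a).1 = (S.pos b).1 → (S.pos a).2 < (S.pos b).2 → a < b
  col_inc : ∀ a ∈ Set.Icc 1 n, ∀ b ∈ Set.Icc 1 n,
    (S.pos a).2 = (S.pos b).2 → (S.pos a).1 < (S.pos b).1 → a < b
  diag_unmarked : ∀ a ∈ Set.Icc 1 n, (S.pos a).1 = (S.pos a).2 → S.mark a = false
  pos_default : ∀ a ∉ Set.Icc 1 n, S.pos a = (0, 0)
  mark_default : ∀ a ∉ Set.Icc 1 n, S.mark a = false

/-- The set `SST(γ)` of signed standard tableaux of shape `γ`. -/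
abbrev SST {n : ℕ} (γ : StrictPartition n) : Type := {S : SignedFilling // IsSST γ S}

/-- The hook reading word is read in passes, from the largest index to the smallest: pass `i` reads
the marked letters of column `i` from bottom to top, then the unmarked letters of row `i` from
left to right. This is the pass in which the letter `a` is read. -/
def SignedFilling.hookPass (S : SignedFilling) (a : ℕ) : ℕ :=
  if S.mark a = true then (S.pos a).2 else (S.pos a).1

/-- The letter `a` stands to the left of the letter `b` in the hook reading word. -/
def SignedFilling.hookBefore (S : SignedFilling) (a b : ℕ) : Prop :=
  S.hookPass b < S.hookPass a ∨
  (S.hookPass a = S.hookPass b ∧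
    ((S.mark a = true ∧ S.mark b = false) ∨
     (S.mark a = true ∧ S.mark b = true ∧ (S.pos a).1 < (S.pos b).1) ∨
     (S.mark a = false ∧ S.mark b = false ∧ (S.pos a).2 < (S.pos b).2)))

/-- The descent set of a signed filling with letters `1, …, n`: all `i < n` such that `i` is to the
right of `i + 1` in the hook reading word. -/
def SignedFilling.des (n : ℕ) (S : SignedFilling) : Set ℕ :=
  {i | 1 ≤ i ∧ i < n ∧ S.hookBefore (i + 1) i}

theorem finite_letterwise {α : Type*} (n : ℕ) (C : Set α) (hC : C.Finite) (z : α) :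
    {p : ℕ → α | (∀ a ∈ Set.Icc 1 n, p a ∈ C) ∧ ∀ a ∉ Set.Icc 1 n, p a = z}.Finite := by
  have hpi : (Set.univ.pi (fun _ : Set.Icc 1 n => C)).Finite := Set.Finite.pi (fun _ => hC)
  refine Set.Finite.of_finite_image (f := fun p (a : Set.Icc 1 n) => p a)
    (hpi.subset ?_) ?_
  · rintro _ ⟨p, hp, rfl⟩ a _
    exact hp.1 a a.2
  · intro p hp q hq h
    funext a
    by_cases ha : a ∈ Set.Icc 1 n
    · exact congrFun h ⟨a, ha⟩
    · rw [hp.2 a ha, hq.2 a ha]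

instance finite_SST {n : ℕ} (γ : StrictPartition n) : Finite (SST γ) := by
  rcases isEmpty_or_nonempty (SST γ) with h | ⟨⟨S₀, h₀⟩⟩
  · infer_instance
  have hC : γ.shiftedCells.Finite := by
    rw [← h₀.bijOn.image_eq]
    exact (Set.finite_Icc 1 n).image _
  have h₁ := (finite_letterwise n γ.shiftedCells hC (0, 0)).prod
    (finite_letterwise n (Set.univ : Set Bool) Set.finite_univ false)
  have := h₁.to_subtype
  refine Finite.of_injective (β := _)
    (fun S : SST γ => (⟨(S.1.pos, S.1.mark),
      ⟨fun a ha => S.2.bijOn.mapsTo ha, S.2.pos_default⟩,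
      ⟨fun _ _ => Set.mem_univ _, S.2.mark_default⟩⟩ :
      ({p : ℕ → ℕ × ℕ | (∀ a ∈ Set.Icc 1 n, p a ∈ γ.shiftedCells) ∧
          ∀ a ∉ Set.Icc 1 n, p a = (0, 0)} ×ˢ
        {p : ℕ → Bool | (∀ a ∈ Set.Icc 1 n, p a ∈ (Set.univ : Set Bool)) ∧
          ∀ a ∉ Set.Icc 1 n, p a = false} : Set _))) ?_
  intro S T h
  have h' := congrArg Subtype.val h
  exact Subtype.ext (SignedFilling.ext (congrArg Prod.fst h') (congrArg Prod.snd h'))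

/-! ### The involutions on signed standard tableaux -/

/-- Change the mark of the letter `a`. -/
def SignedFilling.toggle (S : SignedFilling) (a : ℕ) : SignedFilling where
  pos := S.pos
  mark := Function.update S.mark a (!S.mark a)

/-- Swap the absolute values of the letters `a` and `b`; the marks stay in their cells. -/
def SignedFilling.swap (S : SignedFilling) (a b : ℕ) : SignedFilling where
  pos := fun k => S.pos (Equiv.swap a b k)
  mark := fun k => S.mark (Equiv.swap a b k)

/-- The diagonal of the letter `a`: row minus column if unmarked, column minus row if marked. -/
def SignedFilling.diag (S : SignedFilling) (a : ℕ) : ℤ :=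
  if S.mark a = true then ((S.pos a).2 : ℤ) - (S.pos a).1 else ((S.pos a).1 : ℤ) - (S.pos a).2

/-- The involutions `d_i` on signed standard tableaux with letters `1, …, n`: the elementary queer
involution for `i = 0`, and the elementary dual equivalence involutions for `1 < i < n`. If `i` is
not on the middle one of the three diagonals, it is on an extreme one, and the
letter on the other extreme diagonal is the letter `j` among `i - 1, i + 1` that is farther
from it. -/
def SignedFilling.d (n i : ℕ) (S : SignedFilling) : SignedFilling :=
  if i = 0 then (if 2 ≤ n then S.toggle 2 else S)
  else if 1 < i ∧ i < n then
    if (S.diag (i - 1) ≤ S.diag i ∧ S.diag i ≤ S.diag (i + 1)) ∨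
        (S.diag (i + 1) ≤ S.diag i ∧ S.diag i ≤ S.diag (i - 1)) then S
    else if S.diag (i - 1) = S.diag (i + 1) then S.toggle i
    else
      let j := if |S.diag (i + 1) - S.diag i| < |S.diag (i - 1) - S.diag i| then i - 1 else i + 1
      if abs (abs (S.diag j) - abs (S.diag i)) = 1 then (S.toggle i).toggle j
      else S.swap i j
  else S

/-! ### Quasisymmetric functions, Schur functions and Schur `P`-functions -/

/-- The fundamental quasisymmetric function `F_{n,D}` in the variables `x_0, x_1, …`: the
coefficient of a monomial is the number of sequences `i_1 ≤ ⋯ ≤ i_n` with product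
`x_{i_1} ⋯ x_{i_n}` equal to that monomial and with `i_j < i_{j+1}` for all `j ∈ D`. -/
noncomputable def fundamental (n : ℕ) (D : Set ℕ) : MvPowerSeries ℕ ℤ :=
  fun m => (Nat.card {s : Fin n → ℕ // Monotone s ∧
    (∀ j k : Fin n, (k : ℕ) = (j : ℕ) + 1 → (j : ℕ) + 1 ∈ D → s j < s k) ∧
    ∑ j, Finsupp.single (s j) 1 = m} : ℤ)

/-- `T` is a standard Young tableau of shape `μ`, given by the cell `T a` of each letter `a`;
cells are pairs `(row, column)`, and row `0` is the bottom row. -/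
structure IsSYT (μ : YoungDiagram) (T : ℕ → ℕ × ℕ) : Prop where
  bijOn : Set.BijOn T (Set.Icc 1 μ.card) {x | x ∈ μ.cells}
  row_inc : ∀ a ∈ Set.Icc 1 μ.card, ∀ b ∈ Set.Icc 1 μ.card,
    (T a).1 = (T b).1 → (T a).2 < (T b).2 → a < b
  col_inc : ∀ a ∈ Set.Icc 1 μ.card, ∀ b ∈ Set.Icc 1 μ.card,
    (T a).2 = (T b).2 → (T a).1 < (T b).1 → a < b
  pos_default : ∀ a ∉ Set.Icc 1 μ.card, T a = (0, 0)

/-- The set of standard Young tableaux of shape `μ`. -/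
abbrev SYT (μ : YoungDiagram) : Type := {T : ℕ → ℕ × ℕ // IsSYT μ T}

instance finite_SYT (μ : YoungDiagram) : Finite (SYT μ) :=
  ((finite_letterwise μ.card {x | x ∈ μ.cells} (Finset.finite_toSet _) (0, 0)).subset
    (fun _ hT => ⟨fun _ ha => hT.bijOn.mapsTo ha, hT.pos_default⟩)).to_subtype

/-- The descent set of a filling with letters `1, …, m`: all `i < m` such that `i` is to the right
of `i + 1` in the row reading word (rows from top to bottom, each from left to right). -/
def desSYT (m : ℕ) (T : ℕ → ℕ × ℕ) : Set ℕ :=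
  {i | 1 ≤ i ∧ i < m ∧ ((T i).1 < (T (i + 1)).1 ∨
    ((T i).1 = (T (i + 1)).1 ∧ (T (i + 1)).2 < (T i).2))}

/-- The Schur function `s_μ`. -/
noncomputable def schur (μ : YoungDiagram) : MvPowerSeries ℕ ℤ :=
  ∑ᶠ T : SYT μ, fundamental μ.card (desSYT μ.card T.1)

/-- The Schur `P`-function `P_γ`. -/
noncomputable def schurP {n : ℕ} (γ : StrictPartition n) : MvPowerSeries ℕ ℤ :=
  ∑ᶠ S : SST γ, fundamental n (S.1.des n)

/-! ### Dual equivalences and queer dual equivalences -/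

section

variable {A : Type*}

/-- The equivalence class of `T` generated by the maps `ψ_i` with `i ∈ I`. -/
def genClass (ψ : ℕ → A → A) (I : Set ℕ) (T : A) : Set A :=
  {U | Relation.EqvGen (fun V W => ∃ i ∈ I, ψ i V = W) T U}

/-- The restricted class `[T]_{≤ k}`, generated by the `ψ_i` with `i ≤ k`, `i ≠ 1`. -/
def restrictedClass (ψ : ℕ → A → A) (k : ℕ) (T : A) : Set A :=
  genClass ψ {i | i ≤ k ∧ i ≠ 1} T

/-- For a descent set `D`, delete the letters less than `h` and those at least `i`, and subtract
`h - 1` from the letters that remain. -/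
def desWindow (h i : ℕ) (D : Set ℕ) : Set ℕ :=
  {j | ∃ m ∈ D, h ≤ m ∧ m < i ∧ j + (h - 1) = m}

/-- The maps `φ_i`, `1 < i < N`, are a dual equivalence for `(A, Des)`, where `Des` takes values in
the subsets of `{1, …, N - 1}`. (The maps `φ_i` for other `i` play no role.) -/
structure IsDualEquivalence (N : ℕ) (Des : A → Set ℕ) (φ : ℕ → A → A) : Prop where
  des_subset : ∀ T, Des T ⊆ Set.Icc 1 (N - 1)
  involutive : ∀ i, 1 < i → i < N → Function.Involutive (φ i)
  schur_class : ∀ h i, 1 < h → h ≤ i → i < N → i - h ≤ 3 → ∀ T, ∃ μ : YoungDiagram,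
    μ.card = i - h + 3 ∧
    ∑ᶠ U ∈ genClass φ (Set.Icc h i) T, fundamental (i - h + 3) (desWindow (h - 1) (i + 1) (Des U))
      = schur μ
  comm : ∀ i j, 1 < i → i + 3 ≤ j → j < N → ∀ T, φ j (φ i T) = φ i (φ j T)

/-- The maps `ψ_i`, `i = 0, 2, …, N - 1`, are a queer dual equivalence for `(A, Des)`. -/
structure IsQueerDualEquivalence (N : ℕ) (Des : A → Set ℕ) (ψ : ℕ → A → A) : Prop where
  dual : IsDualEquivalence N Des ψ
  involutive_zero : Function.Involutive (ψ 0)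
  schurP_class : ∀ i, 1 ≤ i → i ≤ 3 → i < N → ∀ S, ∃ γ : StrictPartition (i + 1),
    ∑ᶠ U ∈ restrictedClass ψ i S, fundamental (i + 1) (Des U ∩ Set.Icc 1 i) = schurP γ
  comm_zero : ∀ i, 3 < i → i < N → ∀ S, ψ 0 (ψ i S) = ψ i (ψ 0 S)
  two_edge : ∀ k, k < N → ∀ S, ∀ T ∈ restrictedClass ψ k S, ∃ l : List ℕ,
    (∀ i ∈ l, i ≤ k ∧ i ≠ 1) ∧ l.count k ≤ 2 ∧ l.foldl (fun V i => ψ i V) S = T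

end

/-! ### Embeddings and the symmetric diagram -/

/-- `e` is the embedding of `SST(γ)` into `SST(δ)` that appends the letter `n + 1` in the new cell,
marked if `ε` is true and unmarked if `ε` is false. (The letters `1, …, n` keep their cells and
marks, so the cell of `n + 1` is forced and `e` is injective.) -/
structure IsAppendEmbedding {n : ℕ} (γ : StrictPartition n) (δ : StrictPartition (n + 1))
    (ε : Bool) (e : SST γ → SST δ) : Prop where
  pos_eq : ∀ S, ∀ a ∈ Set.Icc 1 n, (e S).1.pos a = S.1.pos a
  mark_eq : ∀ S, ∀ a ∈ Set.Icc 1 n, (e S).1.mark a = S.1.mark a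
  mark_new : ∀ S, (e S).1.mark (n + 1) = ε

/-- `γ ⊂ δ`, and the embedding of `SST(γ)` into `SST(δ)` with mark `ε` exists and turns `f` into a
map that preserves the full descent sets on the class `C`. -/
def IsDescentExtension {A : Type*} {n : ℕ} (Des : A → Set ℕ) (C : Set A) (γ : StrictPartition n)
    (f : A → SST γ) (δ : StrictPartition (n + 1)) (ε : Bool) : Prop :=
  γ.shiftedCells ⊆ δ.shiftedCells ∧
  ∃ e : SST γ → SST δ, IsAppendEmbedding γ δ ε e ∧ ∀ U ∈ C, (e (f U)).1.des (n + 1) = Des U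

/-- The length of row `r` (counted from `0`) of the symmetric diagram `sym(γ)`. -/
def StrictPartition.symRow {n : ℕ} (γ : StrictPartition n) (r : ℕ) : ℕ :=
  if r < γ.parts.length then γ.parts.getD r 0 + r
  else ((Finset.range γ.parts.length).filter (fun j => r < γ.parts.getD j 0 + j)).card

/-- `c` is an addable cell of the Young diagram `sym(γ)`. -/
def StrictPartition.IsSymAddable {n : ℕ} (γ : StrictPartition n) (c : ℕ × ℕ) : Prop :=
  c.2 = γ.symRow c.1 ∧ (c.1 = 0 ∨ γ.symRow c.1 < γ.symRow (c.1 - 1))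

/-- The cell of `sym(γ)` that holds the letter `a`: unmarked letters stay in place, marked letters
are reflected across the main diagonal. -/
def SignedFilling.symCell (S : SignedFilling) (a : ℕ) : ℕ × ℕ :=
  if S.mark a = true then (S.pos a).swap else S.pos a

end QueerDual

open QueerDual

namespace QueerDual

/-! ### Walks of signed contents -/

/-- Adding a cell of content `c`: the bead `|c|` moves to `|c| + 1`. -/
def mv (G : Finset ℕ) (c : ℤ) : Finset ℕ := insert (c.natAbs + 1) (G.erase c.natAbs)

def Addable (G : Finset ℕ) (c : ℤ) : Prop := (c = 0 ∨ c.natAbs ∈ G) ∧ c.natAbs + 1 ∉ G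

def Removable (G : Finset ℕ) (c : ℤ) : Prop := c.natAbs + 1 ∈ G ∧ c.natAbs ∉ G

/-- The set of parts (beads) reached after the first `k` letters of a content walk. -/
def sh (s : ℕ → ℤ) : ℕ → Finset ℕ
  | 0 => ∅
  | k + 1 => mv (sh s k) (s (k + 1))

def IsWalk (m : ℕ) (s : ℕ → ℤ) : Prop := ∀ k < m, Addable (sh s k) (s (k + 1))

/-- The elementary dual equivalence on three consecutive contents. -/
def tr (x y z : ℤ) : ℤ × ℤ × ℤ :=
  if (x ≤ y ∧ y ≤ z) ∨ (z ≤ y ∧ y ≤ x) then (x, y, z)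
  else if x = z then (x, -y, z)
  else if (z - y).natAbs < (x - y).natAbs then
    if x.natAbs = y.natAbs + 1 ∨ y.natAbs = x.natAbs + 1 then (-x, -y, z) else (y, x, z)
  else if z.natAbs = y.natAbs + 1 ∨ y.natAbs = z.natAbs + 1 then (x, -y, -z) else (x, z, y)

/-- The involution `d_i` on content walks. -/
def dd (i : ℕ) (s : ℕ → ℤ) (j : ℕ) : ℤ :=
  if i = 0 then (if j = 2 then -s 2 else s j)
  else if j + 1 = i then (tr (s (i - 1)) (s i) (s (i + 1))).1
  else if j = i then (tr (s (i - 1)) (s i) (s (i + 1))).2.1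
  else if j = i + 1 then (tr (s (i - 1)) (s i) (s (i + 1))).2.2
  else s j

theorem mem_mv {G : Finset ℕ} {c : ℤ} {k : ℕ} :
    k ∈ mv G c ↔ k = c.natAbs + 1 ∨ (k ≠ c.natAbs ∧ k ∈ G) := by
  simp [mv]

theorem zero_notMem_mv {G : Finset ℕ} {c : ℤ} (h : 0 ∉ G) : 0 ∉ mv G c := by
  rw [mem_mv]; rintro (h1 | h1)
  · omega
  · exact h h1.2

theorem zero_notMem_sh (s : ℕ → ℤ) (k : ℕ) : 0 ∉ sh s k := by
  induction k with
  | zero => simp [sh]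
  | succ k ih => exact zero_notMem_mv ih

theorem mem_sh_succ {s : ℕ → ℤ} {k j : ℕ} :
    j ∈ sh s (k + 1) ↔ j = (s (k + 1)).natAbs + 1 ∨ (j ≠ (s (k + 1)).natAbs ∧ j ∈ sh s k) :=
  mem_mv

theorem sh_congr {s t : ℕ → ℤ} {k : ℕ} (h : ∀ j, 1 ≤ j → j ≤ k → s j = t j) : sh s k = sh t k := by
  induction k with
  | zero => rfl
  | succ k ih =>
    simp only [sh]
    rw [ih (fun j h1 h2 => h j h1 (by omega)), h (k + 1) (by omega) le_rfl]

theorem mv_congr_natAbs {G : Finset ℕ} {c c' : ℤ} (h : c.natAbs = c'.natAbs) : mv G c = mv G c' := by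
  simp [mv, h]

theorem addable_congr {G : Finset ℕ} {c c' : ℤ} (h : c.natAbs = c'.natAbs) :
    Addable G c ↔ Addable G c' := by
  have : c = 0 ↔ c' = 0 := by omega
  simp [Addable, h, this]

theorem addable_neg {G : Finset ℕ} {c : ℤ} : Addable G (-c) ↔ Addable G c :=
  addable_congr (by simp)

theorem IsWalk.mono {m k : ℕ} {s : ℕ → ℤ} (h : IsWalk m s) (hk : k ≤ m) : IsWalk k s :=
  fun j hj => h j (lt_of_lt_of_le hj hk)

theorem IsWalk.removable {m : ℕ} {s : ℕ → ℤ} (h : IsWalk m s) {k : ℕ} (hk : k < m) :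
    Removable (sh s (k + 1)) (s (k + 1)) := by
  have h1 := h k hk
  have h0 := zero_notMem_sh s k
  refine ⟨mem_sh_succ.2 (Or.inl rfl), ?_⟩
  rw [mem_sh_succ]; rintro (h2 | h2)
  · omega
  · exact h2.1 rfl

theorem Removable.sub {s : ℕ → ℤ} {k : ℕ} (h1 : Addable (sh s k) (s (k + 1))) {w : ℤ}
    (hw : Removable (sh s (k + 1)) w) (hne : w.natAbs ≠ (s (k + 1)).natAbs) :
    Removable (sh s k) w := by
  have h3 := hw.1; have h4 := hw.2
  rw [mem_sh_succ] at h3 h4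
  refine ⟨?_, ?_⟩
  · rcases h3 with h3 | h3
    · omega
    · exact h3.2
  · intro h5
    exact h4 (Or.inr ⟨hne, h5⟩)

theorem mem_sh_pred {s : ℕ → ℤ} {k : ℕ} (h : Addable (sh s k) (s (k + 1))) {j : ℕ} :
    j ∈ sh s k ↔ j ≠ 0 ∧ j ≠ (s (k + 1)).natAbs + 1 ∧ (j = (s (k + 1)).natAbs ∨ j ∈ sh s (k + 1)) := by
  obtain ⟨h1, h2⟩ := h
  have h0 := zero_notMem_sh s k
  rw [mem_sh_succ]
  by_cases hj0 : j = 0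
  · subst hj0; tauto
  by_cases hj1 : j = (s (k + 1)).natAbs + 1
  · subst hj1; tauto
  by_cases hj2 : j = (s (k + 1)).natAbs
  · subst hj2
    rcases h1 with h1 | h1
    · exact absurd (by simp [h1]) hj0
    · tauto
  · tauto

theorem sh_pred_congr {s t : ℕ → ℤ} {k : ℕ} (hs : Addable (sh s k) (s (k + 1)))
    (ht : Addable (sh t k) (t (k + 1))) (h : s (k + 1) = t (k + 1)) (h' : sh s (k + 1) = sh t (k + 1)) :
    sh s k = sh t k := by
  ext j; rw [mem_sh_pred hs, mem_sh_pred ht, h, h']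

theorem sum_mv {G : Finset ℕ} {c : ℤ} (h : Addable G c) : ∑ i ∈ mv G c, i = ∑ i ∈ G, i + 1 := by
  obtain ⟨h1, h2⟩ := h
  rw [mv, Finset.sum_insert (by simp [h2])]
  rcases Decidable.em (c.natAbs ∈ G) with h3 | h3
  · rw [← Finset.add_sum_erase G _ h3]; omega
  · rw [Finset.erase_eq_of_notMem h3]
    have : c = 0 := by tauto
    subst this; simp; omega

theorem IsWalk.sum_sh {m : ℕ} {s : ℕ → ℤ} (h : IsWalk m s) : ∑ i ∈ sh s m, i = m := by
  induction m with
  | zero => rfl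
  | succ m ih =>
    rw [sh, sum_mv (h m (by omega)), ih (h.mono (by omega))]

theorem IsWalk.one {m : ℕ} {s : ℕ → ℤ} (h : IsWalk m s) (hm : 1 ≤ m) : s 1 = 0 := by
  have := (h 0 (by omega)).1
  simpa [sh] using this

/-- The bottom of the run of consecutive beads ending at `p`. -/
theorem exists_run_bottom {G : Finset ℕ} (h0 : 0 ∉ G) {p : ℕ} (hp : p ∈ G) :
    ∃ f, f + 1 ≤ p ∧ f + 1 ∈ G ∧ f ∉ G ∧ ∀ j, f < j → j ≤ p → j ∈ G := by
  induction p with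
  | zero => exact absurd hp h0
  | succ p ih =>
    by_cases h : p ∈ G
    · obtain ⟨f, h1, h2, h3, h4⟩ := ih h
      refine ⟨f, by omega, h2, h3, fun j hj hj' => ?_⟩
      rcases Nat.lt_or_ge p j with h5 | h5
      · have : j = p + 1 := by omega
        rwa [this]
      · exact h4 j hj h5
    · refine ⟨p, le_rfl, hp, h, fun j hj hj' => ?_⟩
      have : j = p + 1 := by omega
      rwa [this]

/-- Between two addable contents there is a removable one. -/
theorem exists_removable_between {G : Finset ℕ} (h0 : 0 ∉ G) {a b : ℤ} (ha : Addable G a)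
    (hb : Addable G b) (hab : a < b) : ∃ w, Removable G w ∧ a < w ∧ w < b := by
  rcases le_or_gt a.natAbs b.natAbs with h | h
  · have hb0 : 0 < b := by omega
    have hbG : b.natAbs ∈ G := by rcases hb.1 with h1 | h1 <;> [omega; exact h1]
    obtain ⟨f, h1, h2, h3, h4⟩ := exists_run_bottom h0 hbG
    refine ⟨f, ⟨by simpa using h2, by simpa using h3⟩, ?_, by omega⟩
    by_contra hc
    exact ha.2 (h4 _ (by omega) (by omega))
  · have ha0 : a < 0 := by omega
    have haG : a.natAbs ∈ G := by rcases ha.1 with h1 | h1 <;> [omega; exact h1]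
    obtain ⟨f, h1, h2, h3, h4⟩ := exists_run_bottom h0 haG
    refine ⟨-f, ⟨by simpa using h2, by simpa using h3⟩, by omega, ?_⟩
    by_contra hc
    exact hb.2 (h4 _ (by omega) (by omega))

/-- The top of the run of consecutive beads starting at `p`. -/
theorem exists_run_top {G : Finset ℕ} {p : ℕ} (hp : p ∈ G) :
    ∃ f, p ≤ f ∧ f ∈ G ∧ f + 1 ∉ G ∧ ∀ j, p ≤ j → j ≤ f → j ∈ G := by
  by_contra hcon
  push Not at hcon
  have : ∀ k, ∀ j, p ≤ j → j ≤ p + k → j ∈ G := by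
    intro k
    induction k with
    | zero => intro j h1 h2; have : j = p := by omega
              rwa [this]
    | succ k ih =>
      intro j h1 h2
      rcases Nat.lt_or_ge (p + k) j with h3 | h3
      · have hj : j = p + k + 1 := by omega
        by_contra h4
        obtain ⟨j', h5, h6, h7⟩ := hcon (p + k) (by omega) (ih _ (by omega) le_rfl) (hj ▸ h4)
        exact h7 (ih j' h5 h6)
      · exact ih j h1 h3
  have h1 := this (∑ i ∈ G, i + 1) (p + (∑ i ∈ G, i) + 1) (by omega) (by omega)
  have := Finset.single_le_sum (f := fun i => i) (fun i _ => Nat.zero_le i) h1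
  omega

/-- Between two removable contents there is an addable one. -/
theorem exists_addable_between {G : Finset ℕ} {a b : ℤ} (ha : Removable G a)
    (hb : Removable G b) (hab : a < b) : ∃ w, Addable G w ∧ a < w ∧ w < b := by
  have key : ∀ p q : ℕ, p + 1 ∈ G → q ∉ G → p < q → ∃ w : ℕ, w ∈ G ∧ w + 1 ∉ G ∧ p < w ∧ w < q := by
    intro p q h1 h2 h3
    obtain ⟨f, h4, h5, h6, h7⟩ := exists_run_top h1
    refine ⟨f, h5, h6, by omega, ?_⟩
    by_contra hc
    exact h2 (h7 q (by omega) (by omega))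
  rcases le_or_gt 0 a with h | h
  · obtain ⟨w, h1, h2, h3, h4⟩ := key a.natAbs b.natAbs ha.1 hb.2 (by omega)
    exact ⟨w, ⟨Or.inr (by simpa using h1), by simpa using h2⟩, by omega, by omega⟩
  rcases le_or_gt b 0 with h' | h'
  · obtain ⟨w, h1, h2, h3, h4⟩ := key b.natAbs a.natAbs hb.1 ha.2 (by omega)
    exact ⟨-w, ⟨Or.inr (by simpa using h1), by simpa using h2⟩, by omega, by omega⟩
  by_cases h1 : 1 ∈ G
  · rcases lt_trichotomy a.natAbs b.natAbs with h2 | h2 | h2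
    · obtain ⟨w, h3, h4, h5, h6⟩ := key a.natAbs b.natAbs ha.1 hb.2 (by omega)
      exact ⟨w, ⟨Or.inr (by simpa using h3), by simpa using h4⟩, by omega, by omega⟩
    · rcases Nat.lt_or_ge 1 b.natAbs with h3 | h3
      · obtain ⟨w, h4, h5, h6, h7⟩ := key 0 b.natAbs h1 hb.2 (by omega)
        exact ⟨w, ⟨Or.inr (by simpa using h4), by simpa using h5⟩, by omega, by omega⟩
      · have : b.natAbs = 1 := by omega
        exact absurd h1 (this ▸ hb.2)
    · obtain ⟨w, h3, h4, h5, h6⟩ := key b.natAbs a.natAbs hb.1 ha.2 (by omega)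
      exact ⟨-w, ⟨Or.inr (by simpa using h3), by simpa using h4⟩, by omega, by omega⟩
  · exact ⟨0, ⟨Or.inl rfl, by simpa using h1⟩, h, h'⟩

/-! ### The elementary move on three letters -/

theorem tr_mid {x y z : ℤ} (h : (x ≤ y ∧ y ≤ z) ∨ (z ≤ y ∧ y ≤ x)) : tr x y z = (x, y, z) := by
  rw [tr, if_pos h]

theorem tr_tie {x y : ℤ} (h : x ≠ y) : tr x y x = (x, -y, x) := by
  rw [tr, if_neg (by omega), if_pos rfl]

theorem tr_swap_right {x y z : ℤ} (h : (y < x ∧ x < z) ∨ (z < x ∧ x < y))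
    (ha : z.natAbs ≠ y.natAbs + 1) (hb : y.natAbs ≠ z.natAbs + 1) : tr x y z = (x, z, y) := by
  rw [tr, if_neg (by omega), if_neg (by omega), if_neg (by omega), if_neg (by omega)]

theorem tr_neg_right {x y z : ℤ} (h : (y < x ∧ x < z) ∨ (z < x ∧ x < y))
    (ha : z.natAbs = y.natAbs + 1 ∨ y.natAbs = z.natAbs + 1) : tr x y z = (x, -y, -z) := by
  rw [tr, if_neg (by omega), if_neg (by omega), if_neg (by omega), if_pos ha]

theorem tr_swap_left {x y z : ℤ} (h : (y < z ∧ z < x) ∨ (x < z ∧ z < y))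
    (ha : x.natAbs ≠ y.natAbs + 1) (hb : y.natAbs ≠ x.natAbs + 1) : tr x y z = (y, x, z) := by
  rw [tr, if_neg (by omega), if_neg (by omega), if_pos (by omega), if_neg (by omega)]

theorem tr_neg_left {x y z : ℤ} (h : (y < z ∧ z < x) ∨ (x < z ∧ z < y))
    (ha : x.natAbs = y.natAbs + 1 ∨ y.natAbs = x.natAbs + 1) : tr x y z = (-x, -y, z) := by
  rw [tr, if_neg (by omega), if_neg (by omega), if_pos (by omega), if_pos ha]

theorem tr_neg (x y z : ℤ) : tr (-x) (-y) (-z) = (-(tr x y z).1, -(tr x y z).2.1, -(tr x y z).2.2) := by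
  simp only [tr]
  split_ifs <;> first | omega | simp

theorem dd_neg (i : ℕ) (s : ℕ → ℤ) (j : ℕ) : dd i (fun k => -s k) j = -dd i s j := by
  simp only [dd, tr_neg]; split_ifs <;> simp

theorem dd_zero_two (s : ℕ → ℤ) : dd 0 s 2 = -s 2 := by simp [dd]

theorem dd_zero_of_ne {s : ℕ → ℤ} {j : ℕ} (h : j ≠ 2) : dd 0 s j = s j := by simp [dd, h]

theorem dd_of_lt {i j : ℕ} {s : ℕ → ℤ} (h : j + 1 < i) : dd i s j = s j := by
  simp only [dd]; split_ifs <;> omega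

theorem dd_of_gt {i j : ℕ} {s : ℕ → ℤ} (h1 : 2 ≤ j) (h2 : i + 1 < j) (h3 : i = 0 → j ≠ 2) :
    dd i s j = s j := by
  simp only [dd]; split_ifs <;> omega

theorem dd_pred (i : ℕ) (s : ℕ → ℤ) : dd (i + 2) s (i + 1) = (tr (s (i + 1)) (s (i + 2)) (s (i + 3))).1 := by
  simp [dd]

theorem dd_self (i : ℕ) (s : ℕ → ℤ) : dd (i + 2) s (i + 2) = (tr (s (i + 1)) (s (i + 2)) (s (i + 3))).2.1 := by
  simp [dd]

theorem dd_succ (i : ℕ) (s : ℕ → ℤ) : dd (i + 2) s (i + 3) = (tr (s (i + 1)) (s (i + 2)) (s (i + 3))).2.2 := by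
  simp [dd]

theorem dd_congr {i : ℕ} {s t : ℕ → ℤ} (h1 : i ≠ 1) (h : ∀ j, j ≤ max 2 (i + 1) → s j = t j) (j : ℕ)
    (hj : s j = t j) : dd i s j = dd i t j := by
  simp only [dd]
  rw [h 2 (by omega), h (i - 1) (by omega), h i (by omega), h (i + 1) (by omega), hj]

theorem mv_comm {G : Finset ℕ} {c d : ℤ} (h2 : c.natAbs ≠ d.natAbs + 1)
    (h3 : d.natAbs ≠ c.natAbs + 1) : mv (mv G c) d = mv (mv G d) c := by
  ext k
  simp only [mem_mv]
  by_cases hk : k ∈ G <;> simp only [hk, and_true, and_false, or_false] <;> omega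

theorem Addable.natAbs_ne {G : Finset ℕ} {c d : ℤ} (h : Addable (mv G c) d) :
    c.natAbs ≠ d.natAbs := by
  intro h1
  exact h.2 (mem_mv.2 (Or.inl (by omega)))

theorem Addable.swap {G : Finset ℕ} {c d : ℤ} (hc : Addable G c) (hd : Addable (mv G c) d)
    (h2 : c.natAbs ≠ d.natAbs + 1) (h3 : d.natAbs ≠ c.natAbs + 1) :
    Addable G d ∧ Addable (mv G d) c := by
  have h1 := hd.natAbs_ne
  obtain ⟨h4, h5⟩ := hd
  obtain ⟨h6, h7⟩ := hc
  simp only [mem_mv, not_or, not_and] at h4 h5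
  refine ⟨⟨?_, h5.2 (by omega)⟩, ⟨?_, ?_⟩⟩
  · rcases h4 with h | h | h
    · exact Or.inl h
    · omega
    · exact Or.inr h.2
  · rcases h6 with h | h
    · exact Or.inl h
    · exact Or.inr (mem_mv.2 (Or.inr ⟨by omega, h⟩))
  · rw [mem_mv]; rintro (h | h)
    · omega
    · exact h7 h.2

/-- The move `tr` preserves addability and the resulting shape. -/
theorem tr_walk {G : Finset ℕ} {x y z : ℤ} (hx : Addable G x) (hy : Addable (mv G x) y)
    (hz : Addable (mv (mv G x) y) z) :
    Addable G (tr x y z).1 ∧ Addable (mv G (tr x y z).1) (tr x y z).2.1 ∧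
    Addable (mv (mv G (tr x y z).1) (tr x y z).2.1) (tr x y z).2.2 ∧
    mv (mv (mv G (tr x y z).1) (tr x y z).2.1) (tr x y z).2.2 = mv (mv (mv G x) y) z := by
  have e1 : ∀ (H : Finset ℕ) (c : ℤ), mv H (-c) = mv H c := fun H c => mv_congr_natAbs (by simp)
  unfold tr
  split_ifs with h1 h2 h3 h4 h5
  · exact ⟨hx, hy, hz, by first | rfl | trivial⟩
  · simp only [e1, addable_neg]; exact ⟨hx, hy, hz, by first | rfl | trivial⟩
  · simp only [e1, addable_neg]; exact ⟨hx, hy, hz, by first | rfl | trivial⟩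
  · obtain ⟨h6, h7⟩ := hx.swap hy (by omega) (by omega)
    have h8 : mv (mv G y) x = mv (mv G x) y := mv_comm (by omega) (by omega)
    exact ⟨h6, h7, by simpa only [h8] using hz, by simp only [h8]⟩
  · simp only [e1, addable_neg]; exact ⟨hx, hy, hz, by first | rfl | trivial⟩
  · obtain ⟨h6, h7⟩ := hy.swap hz (by omega) (by omega)
    refine ⟨hx, h6, h7, ?_⟩
    change mv (mv (mv G x) z) y = _
    exact mv_comm (by omega) (by omega)

theorem sh_dd {i : ℕ} {s : ℕ → ℤ} (hw : IsWalk (i + 3) s) :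
    sh (dd (i + 2) s) (i + 3) = sh s (i + 3) ∧ IsWalk (i + 3) (dd (i + 2) s) := by
  have h0 : ∀ k ≤ i, sh (dd (i + 2) s) k = sh s k :=
    fun k hk => sh_congr (fun j _ h2 => dd_of_lt (by omega))
  have hx := hw i (by omega)
  have hy := hw (i + 1) (by omega)
  have hz := hw (i + 2) (by omega)
  simp only [sh, Nat.add_assoc] at hx hy hz
  obtain ⟨h1, h2, h3, h4⟩ := tr_walk hx hy hz
  have e := h0 i le_rfl
  refine ⟨?_, ?_⟩
  · simp only [sh, Nat.reduceAdd, Nat.add_assoc, e, dd_pred, dd_self, dd_succ]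
    exact h4
  · intro k hk
    rcases Nat.lt_or_ge k i with h | h
    · rw [h0 k h.le, dd_of_lt (by omega)]; exact hw k (by omega)
    · obtain rfl | rfl | rfl : k = i ∨ k = i + 1 ∨ k = i + 2 := by omega
      · rw [e, dd_pred]; exact h1
      · simp only [sh, Nat.reduceAdd, Nat.add_assoc, e, dd_pred, dd_self]; exact h2
      · simp only [sh, Nat.reduceAdd, Nat.add_assoc, e, dd_pred, dd_self, dd_succ]; exact h3

/-! ### Typings: descent-preserving maps to content walks -/

section Typing

variable {A : Type*}

/-- `i` is one of the indices `0, 2, …, k - 1` (none if `k < 2`). -/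
def IsGen (k i : ℕ) : Prop := i < k ∧ i ≠ 1 ∧ 2 ≤ k

theorem IsGen.mono {k l i : ℕ} (h : IsGen k i) (hk : k ≤ l) : IsGen l i := by
  unfold IsGen at *; omega

/-- `y` is obtained from `x` by applying maps `ψ i` with `i ∈ {0, 2, …, k - 1}`. -/
def Reach (ψ : ℕ → A → A) (k : ℕ) : A → A → Prop :=
  Relation.ReflTransGen (fun a b => ∃ i, IsGen k i ∧ b = ψ i a)

theorem Reach.mono {ψ : ℕ → A → A} {k l : ℕ} {x y : A} (h : Reach ψ k x y) (hk : k ≤ l) :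
    Reach ψ l x y := by
  induction h with
  | refl => exact Relation.ReflTransGen.refl
  | tail _ hs ih =>
    obtain ⟨i, h1, h2⟩ := hs
    exact ih.tail ⟨i, h1.mono hk, h2⟩

theorem Reach.step {ψ : ℕ → A → A} {k i : ℕ} (x : A) (h : IsGen k i) : Reach ψ k x (ψ i x) :=
  Relation.ReflTransGen.single ⟨i, h, rfl⟩

/-- `S` assigns to each element a content walk of length `m` whose ascents are the bits `β`,
equivariantly for `ψ i`, `i ∈ {0, 2, …, k - 1}`. -/
structure Typed (ψ : ℕ → A → A) (β : ℕ → A → Prop) (k m : ℕ) (S : A → ℕ → ℤ) : Prop where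
  le : k ≤ m
  walk : ∀ x, IsWalk m (S x)
  bit : ∀ x j, 1 ≤ j → j < m → (β j x ↔ S x j < S x (j + 1))
  act : ∀ x i, IsGen k i → ∀ j ≤ m, S (ψ i x) j = dd i (S x) j

variable {ψ : ℕ → A → A} {β : ℕ → A → Prop} {k m : ℕ} {S : A → ℕ → ℤ}

namespace Typed

theorem mono_left (h : Typed ψ β k m S) {l : ℕ} (hl : l ≤ k) : Typed ψ β l m S :=
  ⟨hl.trans h.le, h.walk, h.bit, fun x i hi => h.act x i (hi.mono hl)⟩

theorem sh_gen (h : Typed ψ β k m S) {l i : ℕ} (hi : IsGen l i) (hl : l ≤ k) (x : A) {j : ℕ}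
    (hj : l ≤ j) (hjm : j ≤ m) : sh (S (ψ i x)) j = sh (S x) j := by
  have hact := h.act x i (hi.mono hl)
  obtain ⟨h1, h2, h3⟩ := hi
  have hlm := h.le
  have base : sh (S (ψ i x)) l = sh (S x) l := by
    rcases Nat.eq_zero_or_pos i with rfl | hpos
    · have e2 : sh (S (ψ 0 x)) 2 = sh (S x) 2 := by
        simp only [sh, Nat.reduceAdd]
        rw [hact 1 (by omega), hact 2 (by omega), dd_zero_two, dd_zero_of_ne (by omega)]
        exact mv_congr_natAbs (by simp)
      obtain ⟨d, rfl⟩ : ∃ d, l = 2 + d := ⟨l - 2, by omega⟩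
      clear hj
      induction d with
      | zero => exact e2
      | succ d ih =>
        rw [← Nat.add_assoc, sh, sh, ih (by omega) (by omega) (by omega), hact _ (by omega),
          dd_zero_of_ne (by omega)]
    · obtain ⟨p, rfl⟩ : ∃ p, i = p + 2 := ⟨i - 2, by omega⟩
      have e3 : sh (S (ψ (p + 2) x)) (p + 3) = sh (S x) (p + 3) := by
        rw [← (sh_dd ((h.walk x).mono (show p + 3 ≤ m by omega))).1]
        exact sh_congr (fun j _ h2 => hact j (by omega))
      obtain ⟨d, rfl⟩ : ∃ d, l = p + 3 + d := ⟨l - (p + 3), by omega⟩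
      clear hj
      induction d with
      | zero => exact e3
      | succ d ih =>
        rw [← Nat.add_assoc, sh, sh, ih (by omega) (by omega) (by omega), hact _ (by omega),
          dd_of_gt (by omega) (by omega) (by omega)]
  obtain ⟨d, rfl⟩ : ∃ d, j = l + d := ⟨j - l, by omega⟩
  clear hj
  induction d with
  | zero => exact base
  | succ d ih =>
    rw [← Nat.add_assoc, sh, sh, ih (by omega), hact _ (by omega),
      dd_of_gt (by omega) (by omega) (by omega)]

theorem reach_letter (h : Typed ψ β k m S) {l : ℕ} (hl : l ≤ k) {x y : A} (hr : Reach ψ l x y)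
    {j : ℕ} (hj : l < j) (hjm : j ≤ m) : S y j = S x j := by
  induction hr with
  | refl => rfl
  | tail _ hs ih =>
    obtain ⟨i, hi, rfl⟩ := hs
    rw [h.act _ i (hi.mono hl) j hjm, ← ih]
    obtain ⟨h1, h2, h3⟩ := hi
    exact dd_of_gt (by omega) (by omega) (by omega)

theorem reach_sh (h : Typed ψ β k m S) {l : ℕ} (hl : l ≤ k) {x y : A} (hr : Reach ψ l x y)
    {j : ℕ} (hj : l ≤ j) (hjm : j ≤ m) : sh (S y) j = sh (S x) j := by
  induction hr with
  | refl => rfl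
  | tail _ hs ih =>
    obtain ⟨i, hi, rfl⟩ := hs
    rw [h.sh_gen hi hl _ hj hjm, ih]

/-- The last letter of the first `p` letters can be moved to any removable content. -/
theorem exists_letter (h : Typed ψ β k m S) {p : ℕ} (hp : p ≤ k) (x : A) {w : ℤ}
    (hw : Removable (sh (S x) p) w) : ∃ y, Reach ψ p x y ∧ S y p = w := by
  have hkm := h.le
  induction p using Nat.strong_induction_on generalizing x w with
  | _ p ih =>
  obtain rfl | ⟨p, rfl⟩ : p = 0 ∨ ∃ q, p = q + 1 := by
    cases p; exacts [Or.inl rfl, Or.inr ⟨_, rfl⟩]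
  · simp [sh, Removable] at hw
  have stepA : ∀ (x : A) (w : ℤ), Removable (sh (S x) (p + 1)) w →
      w.natAbs ≠ (S x (p + 1)).natAbs → ∃ y, Reach ψ (p + 1) x y ∧ S y (p + 1) = w := by
    intro x w hw hne
    have hwalk := h.walk x
    have hw1 := Removable.sub (hwalk p (by omega)) hw hne
    have hc := hwalk.removable (show p < m by omega)
    obtain ⟨x1, hr1, hx1⟩ := ih p (by omega) (by omega) x hw1
    obtain rfl | ⟨q, rfl⟩ : p = 0 ∨ ∃ q, p = q + 1 := by
      cases p; exacts [Or.inl rfl, Or.inr ⟨_, rfl⟩]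
    · simp [sh, Removable] at hw1
    have hl1 := h.reach_letter (by omega) hr1 (show q + 1 < q + 1 + 1 by omega) (by omega)
    have ha1 := h.walk x1 q (by omega)
    have ha2 := h.walk x1 (q + 1) (by omega)
    rw [hl1] at ha2
    rw [hx1] at ha1
    simp only [sh, hx1] at ha2
    have hn1 : w.natAbs ≠ (S x (q + 1 + 1)).natAbs + 1 := fun e => hw.2 (e ▸ hc.1)
    have hn2 : (S x (q + 1 + 1)).natAbs ≠ w.natAbs + 1 := fun e => hc.2 (e ▸ hw.1)
    have ha3 := (ha1.swap ha2 hn1 hn2).1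
    obtain ⟨z, hz, hz1⟩ : ∃ z, Removable (sh (S x1) q) z ∧
        ((w < z ∧ z < S x (q + 1 + 1)) ∨ (S x (q + 1 + 1) < z ∧ z < w)) := by
      rcases lt_or_gt_of_ne (show w ≠ S x (q + 1 + 1) by rintro rfl; exact hne rfl) with h1 | h1
      · obtain ⟨z, h2, h3, h4⟩ := exists_removable_between (zero_notMem_sh _ _) ha1 ha3 h1
        exact ⟨z, h2, Or.inl ⟨h3, h4⟩⟩
      · obtain ⟨z, h2, h3, h4⟩ := exists_removable_between (zero_notMem_sh _ _) ha3 ha1 h1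
        exact ⟨z, h2, Or.inr ⟨h3, h4⟩⟩
    obtain ⟨x2, hr2, hx2⟩ := ih q (by omega) (by omega) x1 hz
    obtain rfl | ⟨r, rfl⟩ : q = 0 ∨ ∃ r, q = r + 1 := by
      cases q; exacts [Or.inl rfl, Or.inr ⟨_, rfl⟩]
    · simp [sh, Removable] at hz
    have hg : IsGen (r + 1 + 1 + 1) (r + 2) := ⟨by omega, by omega, by omega⟩
    refine ⟨ψ (r + 2) x2, ((hr1.mono (by omega)).trans (hr2.mono (by omega))).trans (Reach.step x2 hg), ?_⟩
    rw [h.act x2 _ (hg.mono hp) _ (by omega)]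
    change dd (r + 2) (S x2) (r + 3) = w
    rw [dd_succ, hx2, h.reach_letter (by omega) hr2 (show r + 1 < r + 2 by omega) (by omega),
      h.reach_letter (by omega) hr2 (show r + 1 < r + 3 by omega) (by omega), hx1, hl1,
      tr_swap_right hz1 (by omega) (by omega)]
  by_cases hne : w.natAbs = (S x (p + 1)).natAbs
  swap
  · exact stepA x w hw hne
  by_cases hEq : w = S x (p + 1)
  · exact ⟨x, Relation.ReflTransGen.refl, hEq.symm⟩
  by_cases hz : ∃ z, Removable (sh (S x) (p + 1)) z ∧ z.natAbs ≠ w.natAbs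
  · obtain ⟨z, hz1, hz2⟩ := hz
    obtain ⟨x1, hr1, hx1⟩ := stepA x z hz1 (by omega)
    obtain ⟨x2, hr2, hx2⟩ := stepA x1 w (by rwa [h.reach_sh hp hr1 le_rfl (by omega)]) (by omega)
    exact ⟨x2, hr1.trans hr2, hx2⟩
  push Not at hz
  have hwc : w = -S x (p + 1) := by omega
  have hwalk := h.walk x
  have hc := hwalk.removable (show p < m by omega)
  set c := S x (p + 1) with hcdef
  have hc0 : c ≠ 0 := by omega
  obtain rfl | rfl | ⟨q, rfl⟩ : p = 0 ∨ p = 1 ∨ ∃ q, p = q + 2 := by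
    rcases p with _ | _ | q; exacts [Or.inl rfl, Or.inr (Or.inl rfl), Or.inr (Or.inr ⟨q, rfl⟩)]
  · exact absurd (hwalk.one (by omega)) hc0
  · have hg : IsGen 2 0 := ⟨by omega, by omega, by omega⟩
    refine ⟨ψ 0 x, Reach.step x hg, ?_⟩
    rw [h.act x 0 (hg.mono hp) _ (by omega), dd_zero_two, hwc]
  have hg : IsGen (q + 2 + 1) (q + 2) := ⟨by omega, by omega, by omega⟩
  have key : ∀ y : ℤ, Removable (sh (S x) (q + 2)) y →
      (∀ x1, sh (S x1) (q + 2) = sh (S x) (q + 2) → S x1 (q + 2) = y →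
        ∃ z, Removable (sh (S x1) (q + 1)) z ∧ ((y < z ∧ z < c) ∨ (c < z ∧ z < y))) →
      (c.natAbs = y.natAbs + 1 ∨ y.natAbs = c.natAbs + 1) →
      ∃ y, Reach ψ (q + 2 + 1) x y ∧ S y (q + 2 + 1) = w := by
    intro y hy hz hadj
    obtain ⟨x1, hr1, hx1⟩ := ih (q + 2) (by omega) (by omega) x hy
    obtain ⟨z, hz, hb⟩ := hz x1 (h.reach_sh (by omega) hr1 le_rfl (by omega)) hx1
    obtain ⟨x2, hr2, hx2⟩ := ih (q + 1) (by omega) (by omega) x1 hz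
    refine ⟨ψ (q + 2) x2, ((hr1.mono (by omega)).trans (hr2.mono (by omega))).trans (Reach.step x2 hg), ?_⟩
    rw [h.act x2 _ (hg.mono hp) _ (by omega)]
    change dd (q + 2) (S x2) (q + 3) = w
    rw [dd_succ, hx2, h.reach_letter (by omega) hr2 (show q + 1 < q + 2 by omega) (by omega),
      h.reach_letter (by omega) hr2 (show q + 1 < q + 3 by omega) (by omega), hx1,
      h.reach_letter (by omega) hr1 (show q + 2 < q + 3 by omega) (by omega),
      tr_neg_right hb hadj, hwc]
  have hsum := (h.walk x).mono (show q + 2 + 1 ≤ m by omega)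
  have hK : ∀ j, j ∈ sh (S x) (q + 2 + 1) ↔ j = c.natAbs + 1 ∨ (j ≠ c.natAbs ∧ j ∈ sh (S x) (q + 2)) :=
    fun j => mem_sh_succ
  have hcG := hwalk (q + 2) (by omega)
  rcases Nat.lt_or_ge 1 c.natAbs with hc1 | hc1
  · have hn : c.natAbs - 1 ∉ sh (S x) (q + 2 + 1) := by
      intro hmem
      obtain ⟨f, h1, h2, h3, -⟩ := exists_run_bottom (zero_notMem_sh _ _) hmem
      have := hz f ⟨by simpa using h2, by simpa using h3⟩
      omega
    rw [hK] at hn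
    push Not at hn
    have hcm : c.natAbs ∈ sh (S x) (q + 2) := by rcases hcG.1 with e | e <;> [omega; exact e]
    obtain ⟨y, hyc, hyn⟩ : ∃ y : ℤ, ((c > 0 ∧ y = -(c - 1)) ∨ (c < 0 ∧ y = -(c + 1))) ∧
        y.natAbs + 1 = c.natAbs := by
      rcases lt_or_gt_of_ne hc0 with h1 | h1
      · exact ⟨-(c + 1), Or.inr ⟨h1, rfl⟩, by omega⟩
      · exact ⟨-(c - 1), Or.inl ⟨h1, rfl⟩, by omega⟩
    have hy : Removable (sh (S x) (q + 2)) y :=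
      ⟨by rwa [hyn], fun h1 => hn.2 (by omega) (by rwa [show c.natAbs - 1 = y.natAbs by omega])⟩
    refine key y hy (fun x1 _ hx1 => ?_) (by omega)
    have ha := h.walk x1 (q + 1) (by omega)
    rw [show S x1 (q + 1 + 1) = y from hx1] at ha
    rcases lt_or_gt_of_ne (show y ≠ -y by omega) with h1 | h1
    · obtain ⟨z, h2, h3, h4⟩ := exists_removable_between (zero_notMem_sh _ _) ha (addable_neg.2 ha) h1
      exact ⟨z, h2, by omega⟩
    · obtain ⟨z, h2, h3, h4⟩ := exists_removable_between (zero_notMem_sh _ _) (addable_neg.2 ha) ha h1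
      exact ⟨z, h2, by omega⟩
  · have hcabs : c.natAbs = 1 := by omega
    have h2K : 2 ∈ sh (S x) (q + 2 + 1) := by have := hc.1; rwa [hcabs] at this
    have h1K : 1 ∉ sh (S x) (q + 2 + 1) := by have := hc.2; rwa [hcabs] at this
    have h3K : 3 ∈ sh (S x) (q + 2 + 1) := by
      by_contra h3
      have : sh (S x) (q + 2 + 1) = {2} := by
        ext b
        simp only [Finset.mem_singleton]
        refine ⟨fun hb => ?_, fun hb => hb ▸ h2K⟩
        obtain ⟨f, h4, h5, h6, h7⟩ := exists_run_bottom (zero_notMem_sh _ _) hb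
        have h8 := hz f ⟨by simpa using h5, by simpa using h6⟩
        by_contra hb2
        exact h3 (h7 3 (by omega) (by omega))
      have h9 := hsum.sum_sh
      rw [this] at h9
      simp at h9
    rw [hK] at h3K
    have h3G : 3 ∈ sh (S x) (q + 2) := by rcases h3K with e | e <;> [omega; exact e.2]
    have h1G : 1 ∈ sh (S x) (q + 2) := by
      rcases hcG.1 with e | e
      · omega
      · rwa [hcabs] at e
    have h2G : 2 ∉ sh (S x) (q + 2) := by have := hcG.2; rwa [hcabs] at this
    obtain ⟨y, hy, hy2⟩ : ∃ y : ℤ, ((c > 0 ∧ y = -2) ∨ (c < 0 ∧ y = 2)) ∧ y.natAbs = 2 := by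
      rcases lt_or_gt_of_ne hc0 with h1 | h1
      · exact ⟨2, by omega, by omega⟩
      · exact ⟨-2, by omega, by omega⟩
    refine key y ⟨by rwa [hy2], by rwa [hy2]⟩
      (fun x1 e1 e2 => ⟨0, ⟨?_, zero_notMem_sh _ _⟩, by omega⟩) (by omega)
    have h4 := h1G
    rw [← e1, mem_sh_succ, show S x1 (q + 1 + 1) = y from e2] at h4
    rcases h4 with h4 | h4
    · omega
    · exact h4.2

end Typed

end Typing

/-- The local consequences of the axioms of a queer dual equivalence, in terms of the descent bits
`β j x` ("`j` is a descent of `x`"). All of them are invariant under complementing the bits. -/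
structure Loc {A : Type*} (N : ℕ) (β : ℕ → A → Prop) (ψ : ℕ → A → A) : Prop where
  inv : ∀ i, i ≠ 1 → i < N → ∀ x, ψ i (ψ i x) = x
  comm : ∀ i j, i ≠ 1 → i + 3 ≤ j → 4 ≤ j → j < N → ∀ x, ψ j (ψ i x) = ψ i (ψ j x)
  fix : ∀ i, i + 2 < N → ∀ x, (β (i + 1) x ↔ β (i + 2) x) → ψ (i + 2) x = x
  flip : ∀ i, i + 2 < N → ∀ x, ¬(β (i + 1) x ↔ β (i + 2) x) →
    (β (i + 1) (ψ (i + 2) x) ↔ ¬β (i + 1) x) ∧ (β (i + 2) (ψ (i + 2) x) ↔ ¬β (i + 2) x)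
  alt : ∀ i, i + 3 < N → ∀ x, ¬(β (i + 1) x ↔ β (i + 2) x) → ¬(β (i + 2) x ↔ β (i + 3) x) →
    (¬(β (i + 3) (ψ (i + 2) x) ↔ β (i + 3) x) ∧ ψ (i + 3) x = ψ (i + 2) x) ∨
    ((β (i + 3) (ψ (i + 2) x) ↔ β (i + 3) x) ∧ (β (i + 1) (ψ (i + 3) x) ↔ β (i + 1) x))
  keep_right : ∀ i, i + 3 < N → ∀ x, (β (i + 2) x ↔ β (i + 3) x) →
    (β (i + 3) (ψ (i + 2) x) ↔ β (i + 3) x)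
  keep_left : ∀ i, i + 3 < N → ∀ x, (β (i + 1) x ↔ β (i + 2) x) →
    (β (i + 1) (ψ (i + 3) x) ↔ β (i + 1) x)
  far_right : ∀ i, i + 4 < N → ∀ x, (β (i + 4) (ψ (i + 2) x) ↔ β (i + 4) x)
  far_left : ∀ i, i + 4 < N → ∀ x, (β (i + 1) (ψ (i + 4) x) ↔ β (i + 1) x)
  pin : ∀ i, i + 4 < N → ∀ x, ¬(β (i + 1) x ↔ β (i + 2) x) → (β (i + 2) x ↔ β (i + 3) x) →
    ¬(β (i + 3) x ↔ β (i + 4) x) →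
    (β (i + 3) (ψ (i + 2) (ψ (i + 4) x)) ↔ β (i + 4) (ψ (i + 3) (ψ (i + 2) x)))
  hook : ∀ i, i + 4 < N → ∀ x, ¬(β (i + 1) x ↔ β (i + 2) x) → (β (i + 2) x ↔ β (i + 3) x) →
    ¬(β (i + 3) x ↔ β (i + 4) x) →
    ¬(β (i + 4) (ψ (i + 3) (ψ (i + 2) x)) ↔ β (i + 2) x) →
    ψ (i + 2) (ψ (i + 4) x) = ψ (i + 4) (ψ (i + 2) x)
  rigid : ∀ i, i + 5 < N → ∀ x y,
    Relation.ReflTransGen (fun a b => ∃ j, i + 2 ≤ j ∧ j ≤ i + 5 ∧ b = ψ j a) x y →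
    (∀ l : List ℕ, (∀ j ∈ l, i + 2 ≤ j ∧ j ≤ i + 4) → ∀ j, i + 1 ≤ j → j ≤ i + 4 →
      (β j (l.foldl (fun a j => ψ j a) x) ↔ β j (l.foldl (fun a j => ψ j a) y))) → x = y
  two_edge : ∀ k, 2 ≤ k → k < N → ∀ x y, Reach ψ (k + 1) x y → ∃ l : List ℕ,
    (∀ i ∈ l, i ≤ k ∧ i ≠ 1) ∧ l.count k ≤ 2 ∧ l.foldl (fun a i => ψ i a) x = y
  base : 4 < N → ∃ S, Typed ψ β 4 4 S ∧ (∀ x, S x 0 = 0) ∧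
    ∀ x y, Reach ψ 4 x y → (∀ j, 1 ≤ j → j ≤ 4 → S x j = S y j) → x = y

section

variable {A : Type*} {N : ℕ} {β : ℕ → A → Prop} {ψ : ℕ → A → A} {k m : ℕ} {S : A → ℕ → ℤ}

theorem sh_neg (s : ℕ → ℤ) (k : ℕ) : sh (fun j => -s j) k = sh s k := by
  induction k with
  | zero => rfl
  | succ k ih => simp only [sh, ih]; exact mv_congr_natAbs (by simp)

theorem IsWalk.neg {s : ℕ → ℤ} (h : IsWalk m s) : IsWalk m (fun j => -s j) := by
  intro k hk; rw [sh_neg]; exact addable_neg.2 (h k hk)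

theorem IsWalk.ne_succ {s : ℕ → ℤ} (h : IsWalk m s) {j : ℕ} (hj : 1 ≤ j) (hj' : j < m) :
    (s j).natAbs ≠ (s (j + 1)).natAbs := by
  obtain ⟨i, rfl⟩ : ∃ i, j = i + 1 := ⟨j - 1, by omega⟩
  exact (h (i + 1) hj').natAbs_ne

theorem Typed.neg (h : Typed ψ β k m S) :
    Typed ψ (fun j x => ¬β j x) k m (fun x j => -S x j) where
  le := h.le
  walk x := (h.walk x).neg
  bit x j h1 h2 := by
    have := (h.walk x).ne_succ h1 h2
    rw [h.bit x j h1 h2]; omega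
  act x i hi j hj := by rw [h.act x i hi j hj, ← dd_neg]

theorem Loc.neg (h : Loc N β ψ) : Loc N (fun j x => ¬β j x) ψ where
  inv := h.inv
  comm := h.comm
  fix i hi x h1 := h.fix i hi x (by tauto)
  flip i hi x h1 := by have := h.flip i hi x (by tauto); tauto
  alt i hi x h1 h2 := by have := h.alt i hi x (by tauto) (by tauto); tauto
  keep_right i hi x h1 := by have := h.keep_right i hi x (by tauto); tauto
  keep_left i hi x h1 := by have := h.keep_left i hi x (by tauto); tauto
  far_right i hi x := by have := h.far_right i hi x; tauto
  far_left i hi x := by have := h.far_left i hi x; tauto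
  pin i hi x h1 h2 h3 := by have := h.pin i hi x (by tauto) (by tauto) (by tauto); tauto
  hook i hi x h1 h2 h3 h4 := h.hook i hi x (by tauto) (by tauto) (by tauto) (by tauto)
  rigid i hi x y h1 h2 := h.rigid i hi x y h1
    (fun l hl j h3 h4 => by have := h2 l hl j h3 h4; tauto)
  two_edge := h.two_edge
  base hN := by
    obtain ⟨S, h1, h0, h2⟩ := h.base hN
    exact ⟨_, h1.neg, fun x => by simp [h0 x], fun x y h3 h4 => h2 x y h3 (fun j hj hj2 => by simpa using h4 j hj hj2)⟩

namespace Loc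

theorem reach_symm (h : Loc N β ψ) (hk : k ≤ N) {x y : A} (hr : Reach ψ k x y) : Reach ψ k y x := by
  induction hr with
  | refl => exact Relation.ReflTransGen.refl
  | tail _ hs ih =>
    obtain ⟨i, hi, rfl⟩ := hs
    refine Relation.ReflTransGen.head ⟨i, hi, ?_⟩ ih
    obtain ⟨h1, h2, h3⟩ := hi
    exact (h.inv i h2 (by omega) _).symm

theorem fix_iff (h : Loc N β ψ) {i : ℕ} (hi : i + 2 < N) (x : A) :
    ψ (i + 2) x = x ↔ (β (i + 1) x ↔ β (i + 2) x) := by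
  refine ⟨fun e => ?_, h.fix i hi x⟩
  by_contra hc
  have := (h.flip i hi x hc).1
  rw [e] at this
  tauto

/-- `ψ j` commutes with everything generated by `ψ i`, `i ≤ j - 3`. -/
theorem reach_comm (h : Loc N β ψ) {j : ℕ} (hj : 4 ≤ j) (hjN : j < N) {x y : A}
    (hr : Reach ψ (j - 2) x y) : Reach ψ (j - 2) (ψ j x) (ψ j y) := by
  induction hr with
  | refl => exact Relation.ReflTransGen.refl
  | tail _ hs ih =>
    obtain ⟨i, hi, rfl⟩ := hs
    refine ih.tail ⟨i, hi, ?_⟩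
    obtain ⟨h1, h2, h3⟩ := hi
    exact h.comm i j h2 (by omega) hj hjN _

/-- `ψ m` does not change the bits below `m - 2`. -/
theorem bit_low (h : Loc N β ψ) (hm : 4 ≤ m) (hmN : m < N) (x : A) {j : ℕ} (hj : 1 ≤ j)
    (hjm : j + 3 ≤ m) : β j (ψ m x) ↔ β j x := by
  obtain ⟨p, rfl⟩ : ∃ p, m = p + 4 := ⟨m - 4, by omega⟩
  obtain ⟨d, hd⟩ : ∃ d, j + d = p + 1 := ⟨p + 1 - j, by omega⟩
  induction d generalizing j with
  | zero => obtain rfl : j = p + 1 := by omega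
            exact h.far_left p hmN x
  | succ d ih =>
    have h1 := ih (j := j + 1) (by omega) (by omega) (by omega)
    obtain ⟨q, rfl⟩ : ∃ q, j = q + 1 := ⟨j - 1, by omega⟩
    have h2 := h.fix_iff (i := q) (by omega) x
    have h3 := h.fix_iff (i := q) (by omega) (ψ (p + 4) x)
    have h4 : ψ (q + 2) (ψ (p + 4) x) = ψ (p + 4) x ↔ ψ (q + 2) x = x := by
      rw [← h.comm (q + 2) (p + 4) (by omega) (by omega) (by omega) hmN]
      refine ⟨fun e => ?_, fun e => by rw [e]⟩
      have := congrArg (ψ (p + 4)) e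
      rwa [h.inv _ (by omega) hmN, h.inv _ (by omega) hmN] at this
    simp only [Nat.add_assoc, Nat.reduceAdd] at h1 h2 h3
    tauto

/-- The maps `ψ i`, `i ≤ m - 2`, do not change the bit `m` on a typed set. -/
theorem bit_high (h : Loc N β ψ) (ht : Typed ψ β m m S) (hm : 4 ≤ m) (hmN : m < N) {x y : A}
    (hr : Reach ψ (m - 1) x y) : β m y ↔ β m x := by
  obtain ⟨p, rfl⟩ : ∃ p, m = p + 4 := ⟨m - 4, by omega⟩
  induction hr with
  | refl => rfl
  | @tail b c _ hs ih =>
    rw [← ih]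
    obtain ⟨i, hi, rfl⟩ := hs
    obtain ⟨h1, h2, h3⟩ := hi
    rcases eq_or_ne i (p + 2) with rfl | hne
    · exact h.far_right p hmN b
    have e1 := h.fix_iff (i := p + 2) (by omega) b
    have e2 := h.fix_iff (i := p + 2) (by omega) (ψ i b)
    have e3 : ψ (p + 4) (ψ i b) = ψ i b ↔ ψ (p + 4) b = b := by
      rw [h.comm i (p + 4) (by omega) (by omega) (by omega) hmN]
      refine ⟨fun e => ?_, fun e => by rw [e]⟩
      have := congrArg (ψ i) e
      rwa [h.inv _ h2 (by omega), h.inv _ h2 (by omega)] at this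
    have hg : IsGen (p + 4) i := ⟨by omega, h2, by omega⟩
    have e4 : β (p + 3) (ψ i b) ↔ β (p + 3) b := by
      rw [ht.bit _ _ (by omega) (by omega), ht.bit _ _ (by omega) (by omega),
        ht.act _ _ hg _ (by omega), ht.act _ _ hg _ (by omega), dd_of_gt (by omega) (by omega) (by omega),
        dd_of_gt (by omega) (by omega) (by omega)]
    simp only [Nat.add_assoc, Nat.reduceAdd] at e1 e2 e3 e4
    tauto

end Loc

/-- Two typings agree along a relation that is compatible with the maps and the bits. -/
theorem Typed.letters_unique {B : Type*} {ψ' : ℕ → B → B} {β' : ℕ → B → Prop} {T : B → ℕ → ℤ}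
    {k' m' : ℕ} (hS : Typed ψ β k m S) (hT : Typed ψ' β' k' m' T) {p : ℕ} (hp : p ≤ k) (hp' : p ≤ k')
    {R : A → B → Prop} (hR : ∀ a b i, R a b → IsGen p i → R (ψ i a) (ψ' i b))
    (hbit : ∀ a b j, R a b → 1 ≤ j → j < p → (β j a ↔ β' j b)) {a : A} {b : B} (hab : R a b)
    {j : ℕ} (hj : 1 ≤ j) (hjp : j ≤ p) : S a j = T b j := by
  have hkm := hS.le
  have hkm' := hT.le
  induction p generalizing a b j with
  | zero => omega
  | succ p ih =>
    have ih' : ∀ {a b}, R a b → ∀ j, 1 ≤ j → j ≤ p → S a j = T b j := fun hab j h1 h2 =>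
      ih (by omega) (by omega) (fun a b i h1 h2 => hR a b i h1 (h2.mono (by omega)))
        (fun a b j h1 h2 h3 => hbit a b j h1 h2 (by omega)) hab h1 h2
    rcases Nat.lt_or_ge p j with h | h
    swap
    · exact ih' hab j hj h
    obtain rfl : j = p + 1 := by omega
    have hK : sh (S a) p = sh (T b) p := sh_congr (ih' hab)
    have h1 := hS.walk a p (by omega)
    have h2 := hT.walk b p (by omega)
    by_contra hne
    have key : ∀ w, Removable (sh (S a) p) w → (w < S a (p + 1) ↔ w < T b (p + 1)) := by
      intro w hw
      obtain ⟨a', hr, ha'⟩ := hS.exists_letter (by omega) a hw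
      obtain rfl | ⟨q, rfl⟩ : p = 0 ∨ ∃ q, p = q + 1 := by
        cases p; exacts [Or.inl rfl, Or.inr ⟨_, rfl⟩]
      · simp [sh, Removable] at hw
      have : ∃ b', Reach ψ' (q + 1) b b' ∧ R a' b' := by
        clear ha'
        induction hr with
        | refl => exact ⟨b, Relation.ReflTransGen.refl, hab⟩
        | tail _ hs ih2 =>
          obtain ⟨i, hi, rfl⟩ := hs
          obtain ⟨b1, h3, h4⟩ := ih2
          exact ⟨ψ' i b1, h3.tail ⟨i, hi, rfl⟩, hR _ _ i h4 (hi.mono (by omega))⟩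
      obtain ⟨b', hr', hab'⟩ := this
      have e1 := hbit a' b' (q + 1) hab' (by omega) (by omega)
      rw [hS.bit _ _ (by omega) (by omega), hT.bit _ _ (by omega) (by omega),
        ← ih' hab' _ (by omega) le_rfl, ha', hS.reach_letter (by omega) hr (by omega) (by omega),
        hT.reach_letter (by omega) hr' (by omega) (by omega)] at e1
      exact e1
    rw [← hK] at h2
    rcases lt_or_gt_of_ne hne with h3 | h3
    · obtain ⟨w, h4, h5, h6⟩ := exists_removable_between (zero_notMem_sh _ _) h1 h2 h3
      have := key w h4; omega
    · obtain ⟨w, h4, h5, h6⟩ := exists_removable_between (zero_notMem_sh _ _) h2 h1 h3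
      have := key w h4; omega

/-- `ψ m` does not change the letters below `m - 1`. -/
theorem Loc.letters_low (h : Loc N β ψ) (hS : Typed ψ β k m S) {p : ℕ} (hp : 4 ≤ p) (hpk : p ≤ k + 2)
    (hpN : p < N) (x : A) {j : ℕ} (hj : 1 ≤ j) (hjp : j + 2 ≤ p) : S (ψ p x) j = S x j := by
  refine hS.letters_unique hS (p := p - 2) (by omega) (by omega) (R := fun a b => a = ψ p b) ?_ ?_ rfl hj
    (by omega)
  · rintro _ b i rfl ⟨h1, h2, h3⟩
    exact (h.comm i p h2 (by omega) hp hpN b).symm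
  · rintro _ b j rfl h1 h2
    exact h.bit_low hp hpN b h1 (by omega)

/-- Removing a cell of content `c`. -/
def rmv (K : Finset ℕ) (c : ℤ) : Finset ℕ :=
  (insert c.natAbs (K.erase (c.natAbs + 1))).erase 0

theorem mem_rmv {K : Finset ℕ} {c : ℤ} {j : ℕ} :
    j ∈ rmv K c ↔ j ≠ 0 ∧ (j = c.natAbs ∨ (j ≠ c.natAbs + 1 ∧ j ∈ K)) := by
  simp [rmv]

theorem rmv_sh {s : ℕ → ℤ} {k : ℕ} (h : Addable (sh s k) (s (k + 1))) :
    rmv (sh s (k + 1)) (s (k + 1)) = sh s k := by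
  ext j
  rw [mem_rmv, mem_sh_pred h]
  have : ¬(j = (s (k + 1)).natAbs ∧ j = (s (k + 1)).natAbs + 1) := by omega
  tauto

namespace Typed

theorem act_self (h : Typed ψ β k m S) {p : ℕ} (hp : p + 2 < k) (x : A) :
    S (ψ (p + 2) x) (p + 2) = (tr (S x (p + 1)) (S x (p + 2)) (S x (p + 3))).2.1 := by
  have hkm := h.le
  rw [h.act _ _ ⟨hp, by omega, by omega⟩ _ (by omega), dd_self]

theorem act_tr (h : Typed ψ β k m S) {p : ℕ} (hp : p + 2 < k) {x : A} {a b c a' b' c' : ℤ}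
    (ha : S x (p + 1) = a) (hb : S x (p + 2) = b) (hc : S x (p + 3) = c)
    (ht : tr a b c = (a', b', c')) : S (ψ (p + 2) x) (p + 1) = a' ∧ S (ψ (p + 2) x) (p + 2) = b' ∧
      S (ψ (p + 2) x) (p + 3) = c' := by
  have hkm := h.le
  have hg : IsGen k (p + 2) := ⟨hp, by omega, by omega⟩
  rw [h.act _ _ hg _ (by omega), h.act _ _ hg _ (by omega), h.act _ _ hg _ (by omega), dd_pred, dd_self,
    dd_succ, ha, hb, hc, ht]
  exact ⟨rfl, rfl, rfl⟩

theorem act_ne (h : Typed ψ β k m S) {p : ℕ} (hp : p + 2 < k) (x : A) {j : ℕ} (hjm : j ≤ m)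
    (hj : j ≤ p ∨ p + 4 ≤ j) : S (ψ (p + 2) x) j = S x j := by
  rw [h.act _ _ ⟨hp, by omega, by omega⟩ _ hjm]
  rcases hj with hj | hj
  · exact dd_of_lt (by omega)
  · exact dd_of_gt (by omega) (by omega) (by omega)

/-- The four letters `p + 1, …, p + 4`. -/
def _root_.QueerDual.Letters4 (s : ℕ → ℤ) (p : ℕ) (a b c d : ℤ) : Prop :=
  s (p + 1) = a ∧ s (p + 2) = b ∧ s (p + 3) = c ∧ s (p + 4) = d

theorem letters4_left (h : Typed ψ β k m S) {p : ℕ} (hp : p + 2 < k) (hpm : p + 4 ≤ m) {x : A}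
    {a b c d a' b' c' : ℤ} (hx : Letters4 (S x) p a b c d) (ht : tr a b c = (a', b', c')) :
    Letters4 (S (ψ (p + 2) x)) p a' b' c' d := by
  obtain ⟨h1, h2, h3, h4⟩ := hx
  obtain ⟨a1, a2, a3⟩ := h.act_tr hp h1 h2 h3 ht
  exact ⟨a1, a2, a3, by rw [h.act_ne hp x hpm (by omega), h4]⟩

theorem letters4_right (h : Typed ψ β k m S) {p : ℕ} (hp : p + 3 < k) {x : A}
    {a b c d b' c' d' : ℤ} (hx : Letters4 (S x) p a b c d) (ht : tr b c d = (b', c', d')) :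
    Letters4 (S (ψ (p + 3) x)) p a b' c' d' := by
  have := h.le
  obtain ⟨h1, h2, h3, h4⟩ := hx
  obtain ⟨a1, a2, a3⟩ := h.act_tr (p := p + 1) hp h2 h3 h4 ht
  exact ⟨by rw [h.act_ne (p := p + 1) hp x (by omega) (by omega), h1], a1, a2, a3⟩

theorem letters4_bits (h : Typed ψ β k m S) {p : ℕ} (hp : p + 4 ≤ m) {x : A} {a b c d : ℤ}
    (hx : Letters4 (S x) p a b c d) :
    (β (p + 1) x ↔ a < b) ∧ (β (p + 2) x ↔ b < c) ∧ (β (p + 3) x ↔ c < d) := by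
  obtain ⟨h1, h2, h3, h4⟩ := hx
  rw [h.bit x (p + 1) (by omega) (by omega), h.bit x (p + 2) (by omega) (by omega),
    h.bit x (p + 3) (by omega) (by omega), ← h1, ← h2, ← h3, ← h4]
  exact ⟨Iff.rfl, Iff.rfl, Iff.rfl⟩

theorem exists_pred (h : Typed ψ β k m S) {p : ℕ} (hp : p < k) {x : A} {c w : ℤ}
    (hc : S x (p + 1) = c) (hw : Removable (rmv (sh (S x) (p + 1)) c) w) :
    ∃ y, Reach ψ p x y ∧ S y p = w ∧ S y (p + 1) = c ∧
      (∀ j, p < j → j ≤ m → S y j = S x j) ∧ sh (S y) p = rmv (sh (S x) (p + 1)) c := by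
  have hkm := h.le
  have e : sh (S x) p = rmv (sh (S x) (p + 1)) c := by
    rw [← hc]; exact (rmv_sh (h.walk x p (by omega))).symm
  obtain ⟨y, h1, h2⟩ := h.exists_letter hp.le x (w := w) (by rwa [e])
  exact ⟨y, h1, h2, by rw [h.reach_letter hp.le h1 (by omega) (by omega), hc],
    fun j h3 h4 => h.reach_letter hp.le h1 h3 h4, by rw [h.reach_sh hp.le h1 le_rfl (by omega), e]⟩

/-- The last four letters can be chosen. -/
theorem exists_letters4 (h : Typed ψ β k m S) {p : ℕ} (hp : p + 4 ≤ k) (x : A) {a b c d : ℤ}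
    (hd : Removable (sh (S x) (p + 4)) d) (hc : Removable (rmv (sh (S x) (p + 4)) d) c)
    (hb : Removable (rmv (rmv (sh (S x) (p + 4)) d) c) b)
    (ha : Removable (rmv (rmv (rmv (sh (S x) (p + 4)) d) c) b) a) :
    ∃ y, Reach ψ (p + 4) x y ∧ Letters4 (S y) p a b c d := by
  have hkm := h.le
  obtain ⟨x1, r1, l1⟩ := h.exists_letter hp x hd
  have e1 : sh (S x1) (p + 4) = sh (S x) (p + 4) := h.reach_sh hp r1 le_rfl (by omega)
  obtain ⟨x2, r2, l2, m2, -, e2⟩ := h.exists_pred (p := p + 3) (by omega) l1 (by rwa [e1])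
  obtain ⟨x3, r3, l3, -, m3, e3⟩ := h.exists_pred (p := p + 2) (by omega) l2 (by rwa [e2, e1])
  obtain ⟨x4, r4, l4, -, m4, e4⟩ := h.exists_pred (p := p + 1) (by omega) l3 (by rwa [e3, e2, e1])
  refine ⟨x4, ((r1.trans (r2.mono (by omega))).trans (r3.mono (by omega))).trans (r4.mono (by omega)),
    l4, by rw [m4 _ (by omega) (by omega), l3], by rw [m4 _ (by omega) (by omega), m3 _ (by omega) (by omega), l2],
    by rw [m4 _ (by omega) (by omega), m3 _ (by omega) (by omega), m2]⟩

/-- Any walk of the same shape can be reached. -/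
theorem exists_walk (h : Typed ψ β k m S) {p : ℕ} (hp : p ≤ k) (x : A) {t : ℕ → ℤ} (ht : IsWalk p t)
    (hs : sh t p = sh (S x) p) : ∃ y, Reach ψ p x y ∧ ∀ j, 1 ≤ j → j ≤ p → S y j = t j := by
  have hkm := h.le
  induction p generalizing x with
  | zero => exact ⟨x, Relation.ReflTransGen.refl, fun j h1 h2 => by omega⟩
  | succ p ih =>
    obtain ⟨x1, hr1, hx1⟩ := h.exists_letter hp x (w := t (p + 1))
      (by rw [← hs]; exact ht.removable (by omega))
    have e : sh t p = sh (S x1) p :=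
      sh_pred_congr (ht p (by omega)) (h.walk x1 p (by omega)) hx1.symm
        (by rw [h.reach_sh hp hr1 le_rfl (by omega), hs])
    obtain ⟨y, hr2, hy⟩ := ih (by omega) x1 (ht.mono (by omega)) e
    refine ⟨y, hr1.trans (hr2.mono (by omega)), fun j h1 h2 => ?_⟩
    rcases Nat.lt_or_ge p j with h3 | h3
    · obtain rfl : j = p + 1 := by omega
      rw [h.reach_letter (by omega) hr2 h3 (by omega), hx1]
    · exact hy j h1 h3

theorem _root_.QueerDual.sh_eq_of_letters {s t : ℕ → ℤ} (hs : IsWalk m s) (ht : IsWalk m t)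
    {r q : ℕ} (hq : q ≤ m) (hr : r ≤ q) (hK : sh s q = sh t q) (h : ∀ j, r < j → j ≤ q → s j = t j) :
    sh s r = sh t r := by
  obtain ⟨d, rfl⟩ : ∃ d, q = r + d := ⟨q - r, by omega⟩
  induction d with
  | zero => exact hK
  | succ d ih =>
    exact ih (by omega) (by omega) (sh_pred_congr (hs _ (by omega)) (ht _ (by omega))
      (h (r + d + 1) (by omega) (by omega)) hK) (fun j h1 h2 => h j h1 (by omega))

/-- The prefix of `x` can be replaced by that of `y`. -/
theorem exists_splice (h : Typed ψ β k m S) {r q : ℕ} (hr : r ≤ k) (hrq : r ≤ q) (hqm : q ≤ m) {x y : A}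
    (hK : sh (S x) q = sh (S y) q) (hl : ∀ j, r < j → j ≤ q → S x j = S y j) :
    ∃ z, Reach ψ r x z ∧ (∀ j, 1 ≤ j → j ≤ q → S z j = S y j) ∧
      ∀ j, r < j → j ≤ m → S z j = S x j := by
  obtain ⟨z, h1, h2⟩ := h.exists_walk hr x ((h.walk y).mono (hrq.trans hqm))
    (sh_eq_of_letters (h.walk y) (h.walk x) hqm hrq hK.symm (fun j h1 h2 => (hl j h1 h2).symm))
  have h3 : ∀ j, r < j → j ≤ m → S z j = S x j := fun j h3 h4 => h.reach_letter hr h1 h3 h4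
  refine ⟨z, h1, fun j h4 h5 => ?_, h3⟩
  rcases Nat.lt_or_ge r j with h6 | h6
  · rw [h3 j h6 (by omega), hl j h6 h5]
  · exact h2 j h4 h6

/-- Two removable contents `v < a` of a shape are linked if they can be exchanged by an elementary
move that keeps the letter before the last two. -/
theorem exists_link (h : Typed ψ β k m S) {p : ℕ} (hp : p + 3 ≤ k) {x : A} {a v : ℤ}
    (ha : S x (p + 3) = a) (hv : Removable (sh (S x) (p + 3)) v) (hva : v < a)
    (hgood : v.natAbs ≠ a.natAbs ∨ (2 ≤ a.natAbs ∧ a.natAbs - 1 ∉ sh (S x) (p + 3)) ∨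
      a.natAbs + 2 ∈ sh (S x) (p + 3)) :
    ∃ x' z y y', Reach ψ (p + 2) x x' ∧ S x' (p + 1) = z ∧ S x' (p + 2) = y ∧ S x' (p + 3) = a ∧
      tr z y a = (z, y', v) ∧ y < z ∧ z < y' ∧ y < a ∧ v < y' ∧
      ((y = v ∧ y' = a) ∨ (y' = -y ∧ v = -a ∧ (a.natAbs = y.natAbs + 1 ∨ y.natAbs = a.natAbs + 1))) := by
  have hkm := h.le
  have hwalk := h.walk x
  have hc := hwalk.removable (show p + 2 < m by omega)
  have hcG := hwalk (p + 2) (by omega)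
  rw [show S x (p + 2 + 1) = a from ha] at hc hcG
  have hK : ∀ j, j ∈ sh (S x) (p + 3) ↔ j = a.natAbs + 1 ∨ (j ≠ a.natAbs ∧ j ∈ sh (S x) (p + 2)) :=
    fun j => by rw [mem_sh_succ, show S x (p + 2 + 1) = a from ha]
  have main : ∀ y : ℤ, Removable (sh (S x) (p + 2)) y →
      (∀ x1, sh (S x1) (p + 2) = sh (S x) (p + 2) → S x1 (p + 2) = y → S x1 (p + 3) = a →
        ∃ z y', Removable (sh (S x1) (p + 1)) z ∧ tr z y a = (z, y', v) ∧ y < z ∧ z < y' ∧ y < a ∧ v < y' ∧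
      ((y = v ∧ y' = a) ∨ (y' = -y ∧ v = -a ∧ (a.natAbs = y.natAbs + 1 ∨ y.natAbs = a.natAbs + 1)))) →
      ∃ x' z y y', Reach ψ (p + 2) x x' ∧ S x' (p + 1) = z ∧ S x' (p + 2) = y ∧ S x' (p + 3) = a ∧
      tr z y a = (z, y', v) ∧ y < z ∧ z < y' ∧ y < a ∧ v < y' ∧
      ((y = v ∧ y' = a) ∨ (y' = -y ∧ v = -a ∧ (a.natAbs = y.natAbs + 1 ∨ y.natAbs = a.natAbs + 1))) := by
    intro y hy hz
    obtain ⟨x1, hr1, hx1⟩ := h.exists_letter (by omega) x hy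
    have hx1' : S x1 (p + 3) = a := by rw [h.reach_letter (by omega) hr1 (by omega) (by omega), ha]
    obtain ⟨z, y', hz1, hz2⟩ := hz x1 (h.reach_sh (by omega) hr1 le_rfl (by omega)) hx1 hx1'
    obtain ⟨x2, hr2, hx2⟩ := h.exists_letter (by omega) x1 hz1
    refine ⟨x2, z, y, y', hr1.trans (hr2.mono (by omega)), hx2, ?_, ?_, hz2⟩
    · rw [h.reach_letter (by omega) hr2 (by omega) (by omega), hx1]
    · rw [h.reach_letter (by omega) hr2 (by omega) (by omega), hx1']
  by_cases hne : v.natAbs = a.natAbs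
  swap
  · have hw1 := Removable.sub (hwalk (p + 2) (by omega)) hv
      (by rw [show S x (p + 2 + 1) = a from ha]; exact hne)
    refine main v hw1 (fun x1 e1 e2 e3 => ?_)
    have ha1 := h.walk x1 (p + 1) (by omega)
    have ha2 := h.walk x1 (p + 2) (by omega)
    rw [show S x1 (p + 1 + 1) = v from e2] at ha1
    rw [show S x1 (p + 2 + 1) = a from e3, show sh (S x1) (p + 2) = mv (sh (S x1) (p + 1)) v by
      rw [← e2]; rfl] at ha2
    have hn1 : v.natAbs ≠ a.natAbs + 1 := fun e => hv.2 (e ▸ hc.1)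
    have hn2 : a.natAbs ≠ v.natAbs + 1 := fun e => hc.2 (e ▸ hv.1)
    obtain ⟨z, h2, h3, h4⟩ := exists_removable_between (zero_notMem_sh _ _) ha1 (ha1.swap ha2 hn1 hn2).1 hva
    exact ⟨z, a, h2, tr_swap_right (Or.inl ⟨h3, h4⟩) (by omega) (by omega), h3, h4, hva, hva,
      Or.inl ⟨rfl, rfl⟩⟩
  have hva' : v = -a := by omega
  have ha0 : 0 < a := by omega
  have haG : a.natAbs ∈ sh (S x) (p + 2) := by rcases hcG.1 with e | e <;> [omega; exact e]
  rcases hgood with hg | ⟨hg1, hg2⟩ | hg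
  · exact absurd hne hg
  · rw [hK] at hg2
    push Not at hg2
    refine main (-(a - 1)) ⟨by rwa [show (-(a - 1)).natAbs + 1 = a.natAbs by omega], fun h1 =>
      hg2.2 (by omega) (by rwa [show a.natAbs - 1 = (-(a - 1)).natAbs by omega])⟩ (fun x1 e1 e2 e3 => ?_)
    have ha1 := h.walk x1 (p + 1) (by omega)
    rw [show S x1 (p + 1 + 1) = -(a - 1) from e2] at ha1
    obtain ⟨z, h2, h3, h4⟩ := exists_removable_between (zero_notMem_sh _ _) ha1
      (addable_neg.1 ha1) (by omega)
    refine ⟨z, a - 1, h2, ?_, h3, h4, by omega, by omega, Or.inr ⟨by omega, hva', by omega⟩⟩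
    rw [tr_neg_right (by omega) (by omega), neg_neg, hva']
  · rw [hK] at hg
    have hg' : a.natAbs + 2 ∈ sh (S x) (p + 2) := by rcases hg with e | e <;> [omega; exact e.2]
    refine main (-(a + 1)) ⟨by rwa [show (-(a + 1)).natAbs + 1 = a.natAbs + 2 by omega], fun h1 =>
      hcG.2 (by rwa [show a.natAbs + 1 = (-(a + 1)).natAbs by omega])⟩ (fun x1 e1 e2 e3 => ?_)
    have ha1 := h.walk x1 (p + 1) (by omega)
    rw [show S x1 (p + 1 + 1) = -(a + 1) from e2] at ha1
    obtain ⟨z, h2, h3, h4⟩ := exists_removable_between (zero_notMem_sh _ _) ha1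
      (addable_neg.1 ha1) (by omega)
    have hz : z.natAbs ≠ a.natAbs := by
      intro e
      apply h2.2
      rw [e]
      rw [← e1, mem_sh_succ, show S x1 (p + 1 + 1) = -(a + 1) from e2] at haG
      rcases haG with e | e
      · omega
      · exact e.2
    refine ⟨z, a + 1, h2, ?_, h3, h4, by omega, by omega, Or.inr ⟨by omega, hva', by omega⟩⟩
    rw [tr_neg_right (by omega) (by omega), neg_neg, hva']

end Typed

/-- A typing separates the elements of each class. -/
def Separates (ψ : ℕ → A → A) (m : ℕ) (S : A → ℕ → ℤ) : Prop :=
  ∀ x y, Reach ψ m x y → (∀ j, 1 ≤ j → j ≤ m → S x j = S y j) → x = y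

namespace Loc

/-- The bit `m` depends only on the last letter. -/
theorem last_bit_congr (h : Loc N β ψ) (ht : Typed ψ β m m S) (hs : Separates ψ m S) (hm : 4 ≤ m)
    (hmN : m < N) {x y : A} (hr : Reach ψ m x y) (e : S x m = S y m) : β m x ↔ β m y := by
  obtain ⟨p, rfl⟩ : ∃ p, m = p + 1 := ⟨m - 1, by omega⟩
  have e1 : sh (S x) (p + 1) = sh (S y) (p + 1) := (ht.reach_sh le_rfl hr le_rfl le_rfl).symm
  have hw : IsWalk p (S x) := (ht.walk x).mono (by omega)
  have e2 : sh (S x) p = sh (S y) p :=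
    sh_pred_congr (ht.walk x p (by omega)) (ht.walk y p (by omega)) e e1
  obtain ⟨z, hr2, hz⟩ := ht.exists_walk (p := p) (by omega) y hw e2
  have : x = z := by
    refine hs x z (hr.trans (hr2.mono (by omega))) (fun j h1 h2 => ?_)
    rcases Nat.lt_or_ge p j with h3 | h3
    · obtain rfl : j = p + 1 := by omega
      rw [ht.reach_letter (by omega) hr2 h3 (by omega), e]
    · rw [hz j h1 h3]
  rw [this]
  exact h.bit_high ht hm hmN hr2

set_option maxHeartbeats 1000000 in
/-- Contents `-1` and `1` whose bits are in the wrong order give a contradiction: the next part is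
at least `5`. -/
theorem no_bad_pair_far (h : Loc N β ψ) {p : ℕ} (ht : Typed ψ β (p + 4) (p + 4) S)
    (hN : p + 4 < N) {x : A} {f : ℕ} (hf3 : 4 ≤ f) (h2 : 2 ∈ sh (S x) (p + 4))
    (h1 : 1 ∉ sh (S x) (p + 4)) (hf : f + 1 ∈ sh (S x) (p + 4)) (hf' : f ∉ sh (S x) (p + 4))
    (hff : f - 1 ∉ sh (S x) (p + 4)) (hff' : f = 4 ∨ f - 2 ∉ sh (S x) (p + 4))
    (e0 : ∀ u, Reach ψ (p + 4) x u → S u (p + 4) = -f → β (p + 4) u)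
    (e1 : ∀ u, Reach ψ (p + 4) x u → S u (p + 4) = 1 → β (p + 4) u)
    (e2 : ∀ u, Reach ψ (p + 4) x u → S u (p + 4) = -1 → ¬β (p + 4) u) : False := by
  obtain ⟨u, ru, lu⟩ := ht.exists_letters4 le_rfl x (a := 0) (b := 1) (c := -((f - 1 : ℕ) : ℤ)) (d := -(f : ℤ))
    (by simp [Removable] <;> grind) (by simp [Removable, mem_rmv] <;> grind)
    (by simp [Removable, mem_rmv] <;> grind) (by simp [Removable, mem_rmv])
  obtain ⟨v0, rv0, lv0⟩ := ht.exists_letters4 le_rfl x (a := -((f - 2 : ℕ) : ℤ)) (b := -1)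
    (c := -((f - 1 : ℕ) : ℤ)) (d := -(f : ℤ))
    (by simp [Removable] <;> grind) (by simp [Removable, mem_rmv] <;> grind)
    (by simp [Removable, mem_rmv] <;> grind) (by simp [Removable, mem_rmv] <;> grind)
  obtain ⟨v, rv, lv1, lv2⟩ := ht.exists_splice (r := p + 2) (q := p + 4) (by omega) (by omega) le_rfl
    (x := u) (y := v0) (by rw [ht.reach_sh le_rfl ru le_rfl le_rfl, ht.reach_sh le_rfl rv0 le_rfl le_rfl])
    (fun j h3 h4 => by
      obtain rfl | rfl : j = p + 3 ∨ j = p + 4 := by omega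
      · rw [lu.2.2.1, lv0.2.2.1]
      · rw [lu.2.2.2, lv0.2.2.2])
  have lv : Letters4 (S v) p (-((f - 2 : ℕ) : ℤ)) (-1) (-((f - 1 : ℕ) : ℤ)) (-(f : ℤ)) :=
    ⟨by rw [lv1 _ (by omega) (by omega), lv0.1], by rw [lv1 _ (by omega) (by omega), lv0.2.1],
      by rw [lv1 _ (by omega) (by omega), lv0.2.2.1], by rw [lv1 _ (by omega) (by omega), lv0.2.2.2]⟩
  have G2 : ∀ u, Reach ψ (p + 4) u (ψ (p + 2) u) := fun u => Reach.step u ⟨by omega, by omega, by omega⟩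
  have G3 : ∀ u, Reach ψ (p + 4) u (ψ (p + 3) u) := fun u => Reach.step u ⟨by omega, by omega, by omega⟩
  have rv' : Reach ψ (p + 4) x v := ru.trans (rv.mono (by omega))
  clear hf hf' hff hff' h1 h2 rv0 lv0 lv1 lv2
  -- the element `u`
  have u1 := ht.letters4_left (by omega) le_rfl lu (tr_swap_right (by omega) (by omega) (by omega))
  have u2 := ht.letters4_right (by omega) u1 (tr_swap_right (by omega) (by omega) (by omega))
  obtain ⟨b1, b2, b3⟩ := ht.letters4_bits le_rfl lu
  obtain ⟨c1, c2, c3⟩ := ht.letters4_bits le_rfl u1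
  have hk := h.hook p hN u (by rw [b1, b2]; omega) (by rw [b2, b3]; omega)
    (by have := e0 u ru lu.2.2.2
        rw [b3]; simp only [this, iff_true]; omega)
    (by have := e1 _ ((ru.trans (G2 u)).trans (G3 _)) u2.2.2.2
        rw [b2]; simp only [this, true_iff]; omega)
  have y1 : S (ψ (p + 4) u) (p + 1) = 0 := by
    rw [h.letters_low ht (by omega) (by omega) hN u (by omega) (by omega), lu.1]
  have y2 : S (ψ (p + 4) u) (p + 2) = 1 := by
    rw [h.letters_low ht (by omega) (by omega) hN u (by omega) (by omega), lu.2.1]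
  have z2 : S (ψ (p + 4) (ψ (p + 2) u)) (p + 2) = -((f - 1 : ℕ) : ℤ) := by
    rw [h.letters_low ht (by omega) (by omega) hN _ (by omega) (by omega), u1.2.1]
  have d2 := ht.act_self (p := p) (by omega) (ψ (p + 4) u)
  rw [hk, z2, y1, y2] at d2
  obtain ⟨r, hr⟩ : ∃ r, S (ψ (p + 4) u) (p + 3) = r := ⟨_, rfl⟩
  obtain ⟨q, hq⟩ : ∃ q, S (ψ (p + 4) u) (p + 4) = q := ⟨_, rfl⟩
  rw [hr] at d2
  have hr' : r = -((f - 1 : ℕ) : ℤ) := by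
    unfold tr at d2; split_ifs at d2 <;> simp only at d2 <;> omega
  subst hr'
  have ly : Letters4 (S (ψ (p + 4) u)) p _ _ _ _ := ⟨y1, y2, hr, hq⟩
  have y3 := ht.letters4_left (by omega) le_rfl ly (tr_swap_right (by omega) (by omega) (by omega))
  have f1 : β (p + 3) (ψ (p + 2) (ψ (p + 4) u)) := by
    rw [hk]
    have hb3 : ¬β (p + 3) (ψ (p + 2) u) := by rw [c3]; omega
    have hb4 := e0 _ (ru.trans (G2 u)) u1.2.2.2
    have := (h.flip (p + 2) hN (ψ (p + 2) u) (by
      simp only [Nat.add_assoc, Nat.reduceAdd]; tauto)).1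
    simp only [Nat.add_assoc, Nat.reduceAdd] at this
    tauto
  rw [(ht.letters4_bits le_rfl y3).2.2] at f1
  -- the element `v`
  have v1 := ht.letters4_left (by omega) le_rfl lv (tr_swap_right (by omega) (by omega) (by omega))
  have v2 := ht.letters4_right (by omega) v1 (tr_swap_right (by omega) (by omega) (by omega))
  obtain ⟨b1, b2, b3⟩ := ht.letters4_bits le_rfl lv
  have hp := h.pin p hN v (by rw [b1, b2]; omega) (by rw [b2, b3]; omega)
    (by have := e0 v rv' lv.2.2.2
        rw [b3]; simp only [this, iff_true]; omega)
  have hn := e2 _ ((rv'.trans (G2 v)).trans (G3 _)) v2.2.2.2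
  have rw4 : Reach ψ (p + 2) (ψ (p + 4) u) (ψ (p + 4) v) := h.reach_comm (by omega) hN rv
  have lw : Letters4 (S (ψ (p + 4) v)) p (-((f - 2 : ℕ) : ℤ)) (-1) (-((f - 1 : ℕ) : ℤ)) q :=
    ⟨by rw [h.letters_low ht (by omega) (by omega) hN _ (by omega) (by omega), lv.1],
      by rw [h.letters_low ht (by omega) (by omega) hN _ (by omega) (by omega), lv.2.1],
      by rw [ht.reach_letter (by omega) rw4 (by omega) (by omega), hr],
      by rw [ht.reach_letter (by omega) rw4 (by omega) (by omega), hq]⟩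
  have w1 := ht.letters4_left (by omega) le_rfl lw (tr_swap_right (by omega) (by omega) (by omega))
  rw [(ht.letters4_bits le_rfl w1).2.2] at hp
  have := hp.not.2 hn
  omega

/-- Contents `-1` and `1` whose bits are in the wrong order give a contradiction: the next part
is `4`. -/
theorem no_bad_pair_near (h : Loc N β ψ) {p : ℕ} (ht : Typed ψ β (p + 4) (p + 4) S)
    (hN : p + 4 < N) {x : A} (h2 : 2 ∈ sh (S x) (p + 4))
    (h1 : 1 ∉ sh (S x) (p + 4)) (hf : 4 ∈ sh (S x) (p + 4)) (hf' : 3 ∉ sh (S x) (p + 4))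
    (e0 : ∀ u, Reach ψ (p + 4) x u → S u (p + 4) = -3 → β (p + 4) u)
    (e1 : ∀ u, Reach ψ (p + 4) x u → S u (p + 4) = 1 → β (p + 4) u)
    (e2 : ∀ u, Reach ψ (p + 4) x u → S u (p + 4) = -1 → ¬β (p + 4) u) : False := by
  have G2 : ∀ u, Reach ψ (p + 4) u (ψ (p + 2) u) := fun u => Reach.step u ⟨by omega, by omega, by omega⟩
  have G3 : ∀ u, Reach ψ (p + 4) u (ψ (p + 3) u) := fun u => Reach.step u ⟨by omega, by omega, by omega⟩
  obtain ⟨u, ru, lu⟩ := ht.exists_letters4 le_rfl x (a := 0) (b := -2) (c := -1) (d := -3)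
    (by simp [Removable] <;> grind) (by simp [Removable, mem_rmv] <;> grind)
    (by simp [Removable, mem_rmv] <;> grind) (by simp [Removable, mem_rmv])
  obtain ⟨v0, rv0, lv0⟩ := ht.exists_letters4 le_rfl x (a := 0) (b := 2) (c := -1) (d := -3)
    (by simp [Removable] <;> grind) (by simp [Removable, mem_rmv] <;> grind)
    (by simp [Removable, mem_rmv] <;> grind) (by simp [Removable, mem_rmv])
  obtain ⟨v, rv, lv1, lv2⟩ := ht.exists_splice (r := p + 2) (q := p + 4) (by omega) (by omega) le_rfl
    (x := u) (y := v0) (by rw [ht.reach_sh le_rfl ru le_rfl le_rfl, ht.reach_sh le_rfl rv0 le_rfl le_rfl])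
    (fun j h3 h4 => by
      obtain rfl | rfl : j = p + 3 ∨ j = p + 4 := by omega
      · rw [lu.2.2.1, lv0.2.2.1]
      · rw [lu.2.2.2, lv0.2.2.2])
  have lv : Letters4 (S v) p 0 2 (-1) (-3) :=
    ⟨by rw [lv1 _ (by omega) (by omega), lv0.1], by rw [lv1 _ (by omega) (by omega), lv0.2.1],
      by rw [lv1 _ (by omega) (by omega), lv0.2.2.1], by rw [lv1 _ (by omega) (by omega), lv0.2.2.2]⟩
  have rv' : Reach ψ (p + 4) x v := ru.trans (rv.mono (by omega))
  clear hf hf' h1 h2 rv0 lv0 lv1 lv2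
  -- the element `u`
  have u1 := ht.letters4_right (by omega) lu (by decide : tr (-2) (-1) (-3) = (-2, -3, -1))
  obtain ⟨b1, b2, b3⟩ := ht.letters4_bits le_rfl lu
  have hu1 := e2 _ (ru.trans (G3 u)) u1.2.2.2
  have hu0 := e0 _ ru lu.2.2.2
  have hc : ψ (p + 4) u = ψ (p + 3) u := by
    have := h.alt (p + 1) hN u (by simp only [Nat.add_assoc, Nat.reduceAdd]; rw [b2, b3]; omega)
      (by simp only [Nat.add_assoc, Nat.reduceAdd]; rw [b3]; simp only [hu0, iff_true]; omega)
    simp only [Nat.add_assoc, Nat.reduceAdd] at this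
    tauto
  have rw4 : Reach ψ (p + 2) (ψ (p + 4) u) (ψ (p + 4) v) := h.reach_comm (by omega) hN rv
  rw [hc] at rw4
  have lw : Letters4 (S (ψ (p + 4) v)) p 0 2 (-3) (-1) :=
    ⟨by rw [h.letters_low ht (by omega) (by omega) hN _ (by omega) (by omega), lv.1],
      by rw [h.letters_low ht (by omega) (by omega) hN _ (by omega) (by omega), lv.2.1],
      by rw [ht.reach_letter (by omega) rw4 (by omega) (by omega), u1.2.2.1],
      by rw [ht.reach_letter (by omega) rw4 (by omega) (by omega), u1.2.2.2]⟩
  have w1 := ht.letters4_left (by omega) le_rfl lw (by decide : tr 0 2 (-3) = (0, -2, 3))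
  -- the element `v`
  have v1 := ht.letters4_left (by omega) le_rfl lv (by decide : tr 0 2 (-1) = (0, -2, 1))
  have v2 := ht.letters4_right (by omega) v1 (by decide : tr (-2) 1 (-3) = (-2, -3, 1))
  obtain ⟨b1, b2, b3⟩ := ht.letters4_bits le_rfl lv
  have hk := h.hook p hN v (by rw [b1, b2]; omega) (by rw [b2, b3]; omega)
    (by have := e0 v rv' lv.2.2.2
        rw [b3]; simp only [this, iff_true]; omega)
    (by have := e1 _ ((rv'.trans (G2 v)).trans (G3 _)) v2.2.2.2
        rw [b2]; simp only [this, true_iff]; omega)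
  have hb3 : ¬β (p + 3) (ψ (p + 2) v) := by rw [(ht.letters4_bits le_rfl v1).2.2]; omega
  have hb4 := e0 _ (rv'.trans (G2 v)) v1.2.2.2
  have := (h.flip (p + 2) hN (ψ (p + 2) v) (by
      simp only [Nat.add_assoc, Nat.reduceAdd]; tauto)).1
  simp only [Nat.add_assoc, Nat.reduceAdd] at this
  rw [← hk, (ht.letters4_bits le_rfl w1).2.2] at this
  have := this.2 hb3
  omega

/-- The set of last letters for which `m` is a descent is a lower set. -/
theorem last_bit_mono (h : Loc N β ψ) (ht : Typed ψ β m m S) (hs : Separates ψ m S) (hm : 4 ≤ m)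
    (hmN : m < N) {x y : A} (hr : Reach ψ m x y) (hle : S y m ≤ S x m) (hx : β m x) : β m y := by
  obtain ⟨p, rfl⟩ : ∃ p, m = p + 4 := ⟨m - 4, by omega⟩
  set K := sh (S x) (p + 4) with hK
  have hKu : ∀ u, Reach ψ (p + 4) x u → sh (S u) (p + 4) = K :=
    fun u hu => ht.reach_sh le_rfl hu le_rfl le_rfl
  let E : ℤ → Prop := fun c => ∃ u, Reach ψ (p + 4) x u ∧ S u (p + 4) = c ∧ β (p + 4) u
  have hE : ∀ u c, Reach ψ (p + 4) x u → S u (p + 4) = c → (β (p + 4) u ↔ E c) := by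
    intro u c hu hc
    refine ⟨fun h1 => ⟨u, hu, hc, h1⟩, ?_⟩
    rintro ⟨u', hu', hc', h1⟩
    rwa [h.last_bit_congr ht hs hm hmN ((h.reach_symm (by omega) hu).trans hu') (by rw [hc, hc'])]
  have hbit := fun u j h1 h2 => ht.bit u j h1 h2
  have step : ∀ a v, E a → Removable K v → v < a → (v.natAbs ≠ a.natAbs ∨
      (2 ≤ a.natAbs ∧ a.natAbs - 1 ∉ K) ∨ a.natAbs + 2 ∈ K) → E v := by
    rintro a v ⟨u, hu, hua, hub⟩ hv hva hgood
    rw [← hKu u hu] at hv hgood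
    obtain ⟨x', z, y, y', hr', h1, h2, h3, h4, h5, h6, h7, h8, -⟩ :=
      ht.exists_link (p := p + 1) le_rfl hua hv hva hgood
    have hx' : Reach ψ (p + 4) x x' := hu.trans (hr'.mono (by omega))
    have hb : β (p + 4) x' := (hE x' a hx' h3).2 ⟨u, hu, hua, hub⟩
    obtain ⟨h9, h10, h11⟩ := ht.act_tr (p := p + 1) (by omega) h1 h2 h3 h4
    have b2 : β (p + 3) x' := by
      rw [hbit x' (p + 3) (by omega) (by omega)]
      change S x' (p + 1 + 2) < S x' (p + 1 + 3); omega
    have := h.keep_right (p + 1) (by omega) x' (by simp only [Nat.add_assoc, Nat.reduceAdd]; tauto)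
    refine ⟨ψ (p + 3) x', hx'.tail ⟨p + 3, ⟨by omega, by omega, by omega⟩, rfl⟩, h11, ?_⟩
    simp only [Nat.add_assoc, Nat.reduceAdd] at this
    tauto
  have hsum : ∑ i ∈ K, i = p + 4 := (ht.walk x).sum_sh
  have h0K : 0 ∉ K := zero_notMem_sh _ _
  have all : ∀ a v, E a → Removable K v → Removable K a → v < a → E v := by
    intro a v hEa hv hKa hva
    by_cases hgood : v.natAbs ≠ a.natAbs ∨ (2 ≤ a.natAbs ∧ a.natAbs - 1 ∉ K) ∨ a.natAbs + 2 ∈ K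
    · exact step a v hEa hv hva hgood
    push Not at hgood
    obtain ⟨g1, g2, g3⟩ := hgood
    rcases Nat.lt_or_ge 1 a.natAbs with h1 | h1
    · obtain ⟨f, f1, f2, f3, -⟩ := exists_run_bottom h0K (g2 (by omega))
      have hf : Removable K f := ⟨by simpa using f2, by simpa using f3⟩
      exact step f v (step a f hEa hf (by omega) (Or.inl (by omega))) hv (by omega) (Or.inl (by omega))
    obtain rfl : a = 1 := by omega
    obtain rfl : v = -1 := by omega
    have h2K : 2 ∈ K := hv.1
    have h1K : 1 ∉ K := hv.2
    have h3K : 3 ∉ K := g3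
    by_contra hEv
    have hex : ∃ s, s ∈ K ∧ 4 ≤ s := by
      by_contra hc
      push Not at hc
      have : K = {2} := by
        ext b
        simp only [Finset.mem_singleton]
        refine ⟨fun hb => ?_, fun hb => hb ▸ h2K⟩
        have := hc b hb
        have h5 : b ≠ 0 := fun e => h0K (e ▸ hb)
        have h6 : b ≠ 1 := fun e => h1K (e ▸ hb)
        have h7 : b ≠ 3 := fun e => h3K (e ▸ hb)
        omega
      rw [this] at hsum
      simp at hsum
    classical
    obtain ⟨hsK, hs4⟩ := Nat.find_spec hex
    have hsmin : ∀ j, 4 ≤ j → j < Nat.find hex → j ∉ K := fun j h5 h6 h7 =>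
      Nat.find_min hex h6 ⟨h7, h5⟩
    set s := Nat.find hex with hsdef
    obtain ⟨f, hf⟩ : ∃ f : ℕ, s = f + 1 := ⟨s - 1, by omega⟩
    rw [hf] at hsK hs4 hsmin
    have hfK : f ∉ K := by
      rcases Nat.lt_or_ge 3 f with h5 | h5
      · exact hsmin f (by omega) (by omega)
      · rwa [show f = 3 by omega]
    obtain ⟨u, hu, huf, hub⟩ := step 1 (-f) hEa ⟨by simpa using hsK, by simpa using hfK⟩ (by omega)
      (Or.inl (by omega))
    have hEf : E (-f) := ⟨u, hu, huf, hub⟩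
    have hu4 : sh (S u) (p + 4) = K := hKu u hu
    have hub' := fun v c hv hc => hE v c (hu.trans hv) hc
    have hK2 := hKu u hu
    rcases Nat.lt_or_ge 3 f with h5 | h5
    · refine h.no_bad_pair_far (x := u) ht hmN h5 (hK2 ▸ h2K) (hK2 ▸ h1K) (hK2 ▸ hsK) (hK2 ▸ hfK) (hK2 ▸ ?_)
        (hK2 ▸ ?_) (fun v hv hc => (hub' v _ hv hc).2 hEf) (fun v hv hc => (hub' v _ hv hc).2 hEa)
        (fun v hv hc => (hub' v _ hv hc).not.2 hEv)
      · rcases Nat.lt_or_ge 4 f with h6 | h6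
        · exact hsmin _ (by omega) (by omega)
        · rwa [show f - 1 = 3 by omega]
      · rcases Nat.lt_or_ge 5 f with h6 | h6
        · exact Or.inr (hsmin _ (by omega) (by omega))
        · rcases Nat.lt_or_ge 4 f with h7 | h7
          · right; rwa [show f - 2 = 3 by omega]
          · exact Or.inl (by omega)
    · obtain rfl : f = 3 := by omega
      exact h.no_bad_pair_near (x := u) ht hmN (hK2 ▸ h2K) (hK2 ▸ h1K) (hK2 ▸ hsK) (hK2 ▸ hfK)
        (fun v hv hc => (hub' v _ hv hc).2 hEf) (fun v hv hc => (hub' v _ hv hc).2 hEa)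
        (fun v hv hc => (hub' v _ hv hc).not.2 hEv)
  rcases eq_or_lt_of_le hle with e | hlt
  · exact (h.last_bit_congr ht hs hm hmN hr e.symm).1 hx
  · exact (hE y _ hr rfl).2 (all (S x (p + 4)) (S y (p + 4)) ⟨x, Relation.ReflTransGen.refl, rfl, hx⟩
      (by rw [← hKu y hr]; exact (ht.walk y).removable (show p + 3 < p + 4 by omega))
      ((ht.walk x).removable (show p + 3 < p + 4 by omega)) hlt)

end Loc

/-- A lower set of removable contents is cut out by an addable content. -/
theorem exists_addable_cut {K : Finset ℕ} (hne : K.Nonempty) (P : ℤ → Prop)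
    (hP : ∀ a b, Removable K a → Removable K b → a ≤ b → P b → P a) :
    ∃ c, Addable K c ∧ ∀ a, Removable K a → (P a ↔ a < c) := by
  have hM := K.max'_mem hne
  set M := K.max' hne with hMdef
  have hle : ∀ j ∈ K, j ≤ M := fun j hj => K.le_max' j hj
  have hM1 : M + 1 ∉ K := fun h => by have := hle _ h; omega
  have hb : ∀ a, Removable K a → -(M : ℤ) < a ∧ a < M := fun a ha => by
    have := hle _ ha.1; omega
  by_cases h1 : ∃ a, Removable K a ∧ P a
  · by_cases h2 : ∃ a, Removable K a ∧ ¬P a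
    · obtain ⟨a, ⟨ha, hPa⟩, hamax⟩ := Int.exists_greatest_of_bdd (P := fun a => Removable K a ∧ P a)
        ⟨M, fun z hz => (hb z hz.1).2.le⟩ h1
      obtain ⟨b, ⟨hb', hPb⟩, hbmin⟩ := Int.exists_least_of_bdd (P := fun a => Removable K a ∧ ¬P a)
        ⟨-M, fun z hz => (hb z hz.1).1.le⟩ h2
      have hab : a < b := by
        by_contra hc
        exact hPb (hP b a hb' ha (by omega) hPa)
      obtain ⟨c, hc, h3, h4⟩ := exists_addable_between ha hb' hab
      refine ⟨c, hc, fun d hd => ⟨fun h5 => ?_, fun h5 => ?_⟩⟩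
      · have := hamax d ⟨hd, h5⟩; omega
      · by_contra h6
        have := hbmin d ⟨hd, h6⟩; omega
    · push Not at h2
      refine ⟨M, ⟨Or.inr (by simpa using hM), by simpa using hM1⟩, fun a ha => ?_⟩
      simp only [h2 a ha, (hb a ha).2]
  · push Not at h1
    refine ⟨-M, ⟨Or.inr (by simpa using hM), by simpa using hM1⟩, fun a ha => ?_⟩
    have := (hb a ha).1
    simp only [h1 a ha, false_iff]; omega

theorem addable_cut_unique {K : Finset ℕ} (h0 : 0 ∉ K) {P : ℤ → Prop} {c d : ℤ} (hc : Addable K c)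
    (hd : Addable K d) (h1 : ∀ a, Removable K a → (P a ↔ a < c))
    (h2 : ∀ a, Removable K a → (P a ↔ a < d)) : c = d := by
  by_contra hne
  rcases lt_or_gt_of_ne hne with h | h
  · obtain ⟨w, h3, h4, h5⟩ := exists_removable_between h0 hc hd h
    have := (h1 w h3).symm.trans (h2 w h3); omega
  · obtain ⟨w, h3, h4, h5⟩ := exists_removable_between h0 hd hc h
    have := (h1 w h3).symm.trans (h2 w h3); omega

/-- The bit `m` on a class is given by an addable content. -/
theorem Loc.exists_next (h : Loc N β ψ) (ht : Typed ψ β m m S) (hs : Separates ψ m S) (hm : 4 ≤ m)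
    (hmN : m < N) (x : A) :
    ∃ c, Addable (sh (S x) m) c ∧ (∀ y, Reach ψ m x y → (β m y ↔ S y m < c)) ∧
      ∀ a, Removable (sh (S x) m) a → ((∃ y, Reach ψ m x y ∧ S y m = a ∧ β m y) ↔ a < c) := by
  obtain ⟨q, rfl⟩ : ∃ q, m = q + 1 := ⟨m - 1, by omega⟩
  have hne : (sh (S x) (q + 1)).Nonempty := ⟨_, ((ht.walk x).removable (Nat.lt_succ_self q)).1⟩
  obtain ⟨c, hc, h1⟩ := exists_addable_cut hne
    (fun a => ∃ y, Reach ψ (q + 1) x y ∧ S y (q + 1) = a ∧ β (q + 1) y) (by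
      rintro a b ha hb hab ⟨y, hy, rfl, hby⟩
      obtain ⟨z, hz, rfl⟩ := ht.exists_letter le_rfl x ha
      exact ⟨z, hz, rfl, h.last_bit_mono ht hs hm hmN ((h.reach_symm hmN.le hy).trans hz) hab hby⟩)
  refine ⟨c, hc, fun y hy => ?_, h1⟩
  rw [← h1 (S y (q + 1)) (by
    rw [← ht.reach_sh le_rfl hy le_rfl le_rfl]; exact (ht.walk y).removable (Nat.lt_succ_self q))]
  refine ⟨fun hb => ⟨y, hy, rfl, hb⟩, ?_⟩
  rintro ⟨z, hz, hzy, hb⟩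
  exact (h.last_bit_congr ht hs hm hmN ((h.reach_symm hmN.le hz).trans hy) hzy).1 hb

/-- A typing can be extended by one letter. -/
theorem Loc.exists_extension (h : Loc N β ψ) (ht : Typed ψ β m m S) (hs : Separates ψ m S) (hm : 4 ≤ m)
    (hmN : m < N) : ∃ S', Typed ψ β m (m + 1) S' ∧ ∀ x, ∀ j ≤ m, S' x j = S x j := by
  choose c hc hbit hcut using h.exists_next ht hs hm hmN
  refine ⟨fun x j => if j = m + 1 then c x else S x j, ?_, fun x j hj => if_neg (by omega)⟩
  have hsh : ∀ x, ∀ j ≤ m, sh (fun j => if j = m + 1 then c x else S x j) j = sh (S x) j :=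
    fun x j hj => sh_congr (fun i _ h2 => if_neg (by omega))
  have hcc : ∀ x i, IsGen m i → c (ψ i x) = c x := by
    intro x i hi
    have hr : Reach ψ m x (ψ i x) := Reach.step x hi
    have e := ht.reach_sh le_rfl hr le_rfl le_rfl
    have h2 := hcut (ψ i x)
    have h3 := hc (ψ i x)
    rw [e] at h2 h3
    refine addable_cut_unique (zero_notMem_sh _ _) h3 (hc x) h2 (fun a ha => ?_)
    rw [← hcut x a ha]
    exact ⟨fun ⟨y, h4, h5⟩ => ⟨y, hr.trans h4, h5⟩,
      fun ⟨y, h4, h5⟩ => ⟨y, (h.reach_symm hmN.le hr).trans h4, h5⟩⟩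
  refine ⟨by omega, fun x j hj => ?_, fun x j h1 h2 => ?_, fun x i hi j hj => ?_⟩
  · rw [hsh x j (by omega)]
    rcases Nat.lt_or_ge j m with h1 | h1
    · simpa [show j ≠ m by omega] using ht.walk x j h1
    · obtain rfl : j = m := by omega
      simpa using hc x
  · rcases Nat.lt_or_ge j m with h3 | h3
    · simpa [show j ≠ m by omega, show j ≠ m + 1 by omega] using ht.bit x j h1 h3
    · obtain rfl : j = m := by omega
      simpa using hbit x x Relation.ReflTransGen.refl
  · have hi' := hi
    obtain ⟨i1, i2, i3⟩ := hi'
    rcases Nat.lt_or_ge m j with h3 | h3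
    · obtain rfl : j = m + 1 := by omega
      rw [dd_of_gt (by omega) (by omega) (by omega)]
      simpa using hcc x i hi
    · rw [if_neg (by omega), ht.act x i hi j h3]
      exact dd_congr i2 (fun l hl => (if_neg (by omega)).symm) j (if_neg (by omega)).symm

end

/-- Three consecutive letters of a walk. -/
theorem addable_tie {G : Finset ℕ} {x y z : ℤ} (hy : Addable (mv G x) y)
    (hz : Addable (mv (mv G x) y) z) : x.natAbs ≠ z.natAbs ∨ (x = 0 ∧ y.natAbs = 1) := by
  by_cases h : x.natAbs = z.natAbs
  swap
  · exact Or.inl h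
  right
  have h1 := hy.natAbs_ne
  have h2 := hz.natAbs_ne
  obtain ⟨h3, h4⟩ := hz
  rw [← h] at h3 h4
  have h5 : x.natAbs + 1 = y.natAbs := by
    by_contra hc
    exact h4 (mem_mv.2 (Or.inr ⟨hc, mem_mv.2 (Or.inl rfl)⟩))
  rcases h3 with h3 | h3
  · omega
  · rw [mem_mv, mem_mv] at h3
    omega

theorem IsWalk.tie {m : ℕ} {s : ℕ → ℤ} (h : IsWalk m s) {p : ℕ} (hp : p + 3 ≤ m) :
    (s (p + 1)).natAbs ≠ (s (p + 3)).natAbs ∨ (s (p + 1) = 0 ∧ (s (p + 2)).natAbs = 1) :=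
  addable_tie (h (p + 1) (by omega)) (h (p + 2) (by omega))

section

variable {w a b c v y y' : ℤ}

theorem lt_tr_first (h1 : w.natAbs ≠ a.natAbs) (h2 : a.natAbs ≠ b.natAbs)
    (h3 : b.natAbs ≠ c.natAbs) (h4 : w.natAbs ≠ b.natAbs ∨ (w = 0 ∧ a.natAbs = 1))
    (h5 : a.natAbs ≠ c.natAbs ∨ (a = 0 ∧ b.natAbs = 1)) (h6 : a < b) (h7 : c < b) (h8 : w < a) :
    w < (tr a b c).1 := by
  unfold tr
  split_ifs <;> simp only <;> omega

theorem lt_tr_first_of_lt (h1 : w.natAbs ≠ a.natAbs) (h2 : a.natAbs ≠ b.natAbs)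
    (h3 : b.natAbs ≠ c.natAbs) (h4 : w.natAbs ≠ b.natAbs ∨ (w = 0 ∧ a.natAbs = 1))
    (h5 : a.natAbs ≠ c.natAbs ∨ (a = 0 ∧ b.natAbs = 1)) (h6 : a < b) (h7 : c < b) (h8 : a < w)
    (h9 : (tr w a b).2.2 < c) : w < (tr a b c).1 := by
  unfold tr at *
  split_ifs at * <;> simp only at * <;> omega

theorem tr_first_le_of_le (h1 : w.natAbs ≠ a.natAbs) (h2 : a.natAbs ≠ b.natAbs)
    (h3 : b.natAbs ≠ c.natAbs) (h4 : w.natAbs ≠ b.natAbs ∨ (w = 0 ∧ a.natAbs = 1))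
    (h5 : a.natAbs ≠ c.natAbs ∨ (a = 0 ∧ b.natAbs = 1)) (h6 : a < b) (h7 : c < b) (h8 : a < w)
    (h9 : ¬(tr w a b).2.2 < c) : (tr a b c).1 ≤ w := by
  unfold tr at *
  split_ifs at * <;> simp only at * <;> omega

theorem tr_shift (h1 : w.natAbs ≠ a.natAbs) (h2 : a.natAbs ≠ b.natAbs)
    (h3 : b.natAbs ≠ c.natAbs) (h4 : w.natAbs ≠ b.natAbs ∨ (w = 0 ∧ a.natAbs = 1))
    (h5 : a.natAbs ≠ c.natAbs ∨ (a = 0 ∧ b.natAbs = 1)) (h6 : a < b) (h7 : c < b) (h8 : a < w)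
    (h9 : w < (tr a b c).1) : tr w a b = (w, (tr a b c).1, (tr a b c).2.1) ∧ (tr a b c).2.2 = c := by
  have hac : a < c := by
    by_contra hc
    have : (tr a b c).1 = a := by
      unfold tr
      split_ifs <;> simp only <;> omega
    omega
  by_cases hadj : a.natAbs = b.natAbs + 1 ∨ b.natAbs = a.natAbs + 1
  · rw [tr_neg_left (Or.inr ⟨hac, h7⟩) hadj] at h9 ⊢
    simp only at h9 ⊢
    rw [tr_neg_right (by omega) (by omega)]
    exact ⟨rfl, trivial⟩
  · rw [tr_swap_left (Or.inr ⟨hac, h7⟩) (by omega) (by omega)] at h9 ⊢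
    simp only at h9 ⊢
    rw [tr_swap_right (by omega) (by omega) (by omega)]
    exact ⟨rfl, trivial⟩

theorem tr_first_eq (h1 : c ≤ a) (h2 : a < b) : (tr a b c).1 = a := by
  unfold tr
  split_ifs <;> simp only <;> omega

theorem tr_second_lt (h1 : c ≤ a) (h2 : a < b) (h3 : b.natAbs ≠ c.natAbs)
    (h4 : a.natAbs ≠ b.natAbs) (h5 : a.natAbs ≠ c.natAbs ∨ (a = 0 ∧ b.natAbs = 1)) :
    (tr a b c).2.1 < a := by
  unfold tr
  split_ifs <;> simp only <;> omega

theorem tr_pin_of_lt (h1 : c ≤ a) (h2 : a < b) (h3 : b.natAbs ≠ c.natAbs)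
    (h4 : a.natAbs ≠ b.natAbs) (h5 : a.natAbs ≠ c.natAbs ∨ (a = 0 ∧ b.natAbs = 1))
    (hv : v < a) (hvb : v.natAbs ≠ b.natAbs) (hvc : v.natAbs ≠ c.natAbs ∨ (v = 0 ∧ b.natAbs = 1))
    (hy : v < y') (hya : y < a) (hyv : y'.natAbs ≠ v.natAbs) (hyy : y < y')
    (hyb : y'.natAbs ≠ b.natAbs ∨ (y' = 0 ∧ v.natAbs = 1))
    (hcase : (y = v ∧ y' = a) ∨ (y' = -y ∧ v = -a ∧ (a.natAbs = y.natAbs + 1 ∨ y.natAbs = a.natAbs + 1)))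
    (h : (tr y' v b).2.2 < c) : v < (tr a b c).2.1 := by
  have hyb' : y' < b ∨ (v < b ∧ b < y') := by omega
  unfold tr at *
  split_ifs at * <;> simp only at * <;> omega

theorem tr_pin_of_le (h1 : c ≤ a) (h2 : a < b) (h3 : b.natAbs ≠ c.natAbs)
    (h4 : a.natAbs ≠ b.natAbs) (h5 : a.natAbs ≠ c.natAbs ∨ (a = 0 ∧ b.natAbs = 1))
    (hv : v < a) (hvb : v.natAbs ≠ b.natAbs) (hvc : v.natAbs ≠ c.natAbs ∨ (v = 0 ∧ b.natAbs = 1))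
    (hy : v < y') (hya : y < a) (hyv : y'.natAbs ≠ v.natAbs) (hyy : y < y')
    (hyb : y'.natAbs ≠ b.natAbs ∨ (y' = 0 ∧ v.natAbs = 1))
    (hcase : (y = v ∧ y' = a) ∨ (y' = -y ∧ v = -a ∧ (a.natAbs = y.natAbs + 1 ∨ y.natAbs = a.natAbs + 1)))
    (h : c ≤ (tr y' v b).2.2) : (tr a b c).2.1 ≤ v := by
  have hyb' : y' < b ∨ (v < b ∧ b < y') := by omega
  unfold tr at *
  split_ifs at * <;> simp only at * <;> omega

theorem tr_second_congr (h1 : c ≤ a) (h2 : a < b) (h3 : b.natAbs ≠ c.natAbs)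
    (h4 : a.natAbs ≠ b.natAbs) (h5 : a.natAbs ≠ c.natAbs ∨ (a = 0 ∧ b.natAbs = 1))
    (hv : v < b) (hvb : v.natAbs ≠ b.natAbs) (hvc : v.natAbs ≠ c.natAbs ∨ (v = 0 ∧ b.natAbs = 1))
    (hcv : c ≤ v) : (tr v b c).2.1 = (tr a b c).2.1 := by
  unfold tr
  split_ifs <;> simp only <;> omega

theorem le_of_tr_second_le (h1 : c ≤ a) (h2 : a < b) (h3 : b.natAbs ≠ c.natAbs)
    (h4 : a.natAbs ≠ b.natAbs) (h5 : a.natAbs ≠ c.natAbs ∨ (a = 0 ∧ b.natAbs = 1))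
    (hvq : (tr a b c).2.1 < v) : c ≤ v := by
  unfold tr at *
  split_ifs at * <;> simp only at * <;> omega

end

section

variable {A : Type*} {N : ℕ} {β : ℕ → A → Prop} {ψ : ℕ → A → A} {k m p : ℕ} {S : A → ℕ → ℤ}

namespace Loc

theorem top_reach (h : Loc N β ψ) (hN : p + 4 < N) {x z : A} (hr : Reach ψ (p + 2) x z) :
    Reach ψ (p + 2) (ψ (p + 4) x) (ψ (p + 4) z) :=
  h.reach_comm (j := p + 4) (by omega) hN hr

theorem top_low (h : Loc N β ψ) (ht : Typed ψ β (p + 4) (p + 5) S) (hN : p + 4 < N) (x : A) {j : ℕ}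
    (h1 : 1 ≤ j) (h2 : j ≤ p + 2) : S (ψ (p + 4) x) j = S x j :=
  h.letters_low ht (by omega) (by omega) hN x h1 (by omega)

/-- The images under the top map of two elements with the same last letters differ in a prefix. -/
theorem top_congr (h : Loc N β ψ) (ht : Typed ψ β (p + 4) (p + 5) S) (hs : Separates ψ (p + 4) S)
    (hN : p + 4 < N) {x z : A} (hr : Reach ψ (p + 4) x z) (h3 : S x (p + 3) = S z (p + 3))
    (h4 : S x (p + 4) = S z (p + 4)) : Reach ψ (p + 2) (ψ (p + 4) x) (ψ (p + 4) z) := by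
  obtain ⟨z', r1, r2, r3⟩ := ht.exists_splice (r := p + 2) (q := p + 4) (by omega) (by omega) (by omega)
    (x := x) (y := z) (ht.reach_sh le_rfl hr le_rfl (by omega)).symm (fun j h1 h2 => by
      obtain rfl | rfl : j = p + 3 ∨ j = p + 4 := by omega
      exacts [h3, h4])
  have : z' = z := hs z' z (((h.reach_symm (by omega) r1).mono (by omega)).trans hr) r2
  rw [← this]
  exact h.top_reach hN r1

theorem top_bit (h : Loc N β ψ) (ht : Typed ψ β (p + 4) (p + 5) S)
    (hN : p + 4 < N) (x : A) (hab : S x (p + 3) < S x (p + 4)) (hcb : S x (p + 5) < S x (p + 4)) :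
    (β (p + 2) (ψ (p + 4) x) ↔ S x (p + 2) < (tr (S x (p + 3)) (S x (p + 4)) (S x (p + 5))).1) ∧
    (S x (p + 3) < S x (p + 2) → (tr (S x (p + 2)) (S x (p + 3)) (S x (p + 4))).2.2 < S x (p + 5) →
      ψ (p + 4) x = ψ (p + 3) x) := by
  have n1 := (ht.walk x).ne_succ (j := p + 2) (by omega) (by omega)
  have n2 := (ht.walk x).ne_succ (j := p + 3) (by omega) (by omega)
  have n3 := (ht.walk x).ne_succ (j := p + 4) (by omega) (by omega)
  have t1 := (ht.walk x).tie (p := p + 1) (by omega)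
  have t2 := (ht.walk x).tie (p := p + 2) (by omega)
  have b1 := ht.bit x (p + 2) (by omega) (by omega)
  have b2 := ht.bit x (p + 3) (by omega) (by omega)
  have b3 := ht.bit x (p + 4) (by omega) (by omega)
  simp only [Nat.add_assoc, Nat.reduceAdd] at *
  have c2 : β (p + 3) x := b2.2 hab
  have c3 : ¬β (p + 4) x := by rw [b3]; omega
  rcases lt_or_gt_of_ne (show S x (p + 2) ≠ S x (p + 3) by omega) with h1 | h1
  · have c1 : β (p + 2) x := b1.2 h1
    have := h.keep_left (p + 1) hN x (by simp [Nat.add_assoc, c1, c2])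
    simp only [Nat.add_assoc, Nat.reduceAdd] at this
    have h2 := lt_tr_first n1 n2 n3 t1 t2 hab hcb h1
    exact ⟨by simp only [this, c1, h2], fun h3 => by omega⟩
  · have c1 : ¬β (p + 2) x := by rw [b1]; omega
    have ha := h.alt (p + 1) hN x (by simp [Nat.add_assoc, c1, c2])
      (by simp [Nat.add_assoc, c2, c3])
    have hf := h.flip (p + 1) (by omega) x (by simp [Nat.add_assoc, c1, c2])
    have d := ht.bit (ψ (p + 3) x) (p + 4) (by omega) (by omega)
    have d1 : S (ψ (p + 3) x) (p + 4) = (tr (S x (p + 2)) (S x (p + 3)) (S x (p + 4))).2.2 := by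
      rw [ht.act x (p + 3) ⟨by omega, by omega, by omega⟩ _ (by omega)]
      exact dd_succ (p + 1) _
    have d2 := ht.act_ne (p := p + 1) (by omega) x (j := p + 5) (by omega) (by omega)
    simp only [Nat.add_assoc, Nat.reduceAdd] at ha hf d d2
    rw [d1, d2] at d
    by_cases h3 : (tr (S x (p + 2)) (S x (p + 3)) (S x (p + 4))).2.2 < S x (p + 5)
    · have h2 := lt_tr_first_of_lt n1 n2 n3 t1 t2 hab hcb h1 h3
      have h4 : ψ (p + 4) x = ψ (p + 3) x := by simpa [d, h3, c3] using ha
      refine ⟨?_, fun _ _ => h4⟩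
      rw [h4]
      simp only [hf.1, c1, h2, not_false_eq_true]
    · have h2 := tr_first_le_of_le n1 n2 n3 t1 t2 hab hcb h1 h3
      refine ⟨?_, fun _ h => absurd h h3⟩
      simp only [d, h3, c3, c1, not_true_eq_false, false_and, iff_false, false_or, true_and] at ha
      simp only [ha, false_iff, not_lt, h2]

/-- The top map acts correctly on the first of the three letters it involves. -/
theorem top_first (h : Loc N β ψ) (ht : Typed ψ β (p + 4) (p + 5) S)
    (hN : p + 4 < N) (x : A) (hab : S x (p + 3) < S x (p + 4)) (hcb : S x (p + 5) < S x (p + 4)) :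
    S (ψ (p + 4) x) (p + 3) = (tr (S x (p + 3)) (S x (p + 4)) (S x (p + 5))).1 := by
  have hw := ht.walk x
  have a1 := (tr_walk (hw (p + 2) (by omega)) (hw (p + 3) (by omega)) (hw (p + 4) (by omega))).1
  have a2 := ht.walk (ψ (p + 4) x) (p + 2) (by omega)
  rw [sh_congr (fun j h1 h2 => h.top_low ht hN x h1 h2)] at a2
  simp only [Nat.add_assoc, Nat.reduceAdd] at a1 a2
  have key : ∀ w, Removable (sh (S x) (p + 2)) w →
      (w < S (ψ (p + 4) x) (p + 3) ↔ w < (tr (S x (p + 3)) (S x (p + 4)) (S x (p + 5))).1) := by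
    intro w hw
    obtain ⟨z, hr, hz⟩ := ht.exists_letter (by omega) x hw
    have e : ∀ j, p + 2 < j → j ≤ p + 5 → S z j = S x j :=
      fun j h1 h2 => ht.reach_letter (by omega) hr h1 h2
    have e3 := e (p + 3) (by omega) (by omega)
    have e4 := e (p + 4) (by omega) (by omega)
    have e5 := e (p + 5) (by omega) (by omega)
    have h1 := (h.top_bit ht hN z (by omega) (by omega)).1
    rw [ht.bit _ _ (by omega) (by omega), h.top_low ht hN z (by omega) le_rfl, hz, e3, e4, e5,
      ht.reach_letter (by omega) (h.top_reach hN hr) (by omega) (by omega)] at h1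
    exact h1
  rcases lt_trichotomy (S (ψ (p + 4) x) (p + 3))
    (tr (S x (p + 3)) (S x (p + 4)) (S x (p + 5))).1 with h1 | h1 | h1
  · obtain ⟨w, hw, h2, h3⟩ := exists_removable_between (zero_notMem_sh _ _) a2 a1 h1
    have := key w hw; omega
  · exact h1
  · obtain ⟨w, hw, h2, h3⟩ := exists_removable_between (zero_notMem_sh _ _) a1 a2 h1
    have := key w hw; omega

/-- If the first of the three letters changes, then the top map stays in a class of the lower maps. -/
theorem top_of_ne (h : Loc N β ψ) (ht : Typed ψ β (p + 4) (p + 5) S)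
    (hN : p + 4 < N) (x : A) (hab : S x (p + 3) < S x (p + 4)) (hcb : S x (p + 5) < S x (p + 4))
    (hne : S (ψ (p + 4) x) (p + 3) ≠ S x (p + 3)) :
    S (ψ (p + 4) x) (p + 4) = (tr (S x (p + 3)) (S x (p + 4)) (S x (p + 5))).2.1 ∧
    S (ψ (p + 4) x) (p + 5) = (tr (S x (p + 3)) (S x (p + 4)) (S x (p + 5))).2.2 ∧
    Reach ψ (p + 4) x (ψ (p + 4) x) := by
  rw [h.top_first ht hN x hab hcb] at hne
  have hw := ht.walk x
  have a1 := (tr_walk (hw (p + 2) (by omega)) (hw (p + 3) (by omega)) (hw (p + 4) (by omega))).1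
  have a2 := hw (p + 2) (by omega)
  have n2 := hw.ne_succ (j := p + 3) (by omega) (by omega)
  have n3 := hw.ne_succ (j := p + 4) (by omega) (by omega)
  simp only [Nat.add_assoc, Nat.reduceAdd] at a1 a2 n2 n3
  have hlt : S x (p + 3) < (tr (S x (p + 3)) (S x (p + 4)) (S x (p + 5))).1 := by
    unfold tr at *
    split_ifs at * <;> simp only at * <;> omega
  obtain ⟨w, hw, h2, h3⟩ := exists_removable_between (zero_notMem_sh _ _) a2 a1 hlt
  obtain ⟨z, hr, hz⟩ := ht.exists_letter (by omega) x hw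
  have e : ∀ j, p + 2 < j → j ≤ p + 5 → S z j = S x j :=
    fun j h1 h2 => ht.reach_letter (by omega) hr h1 h2
  have e3 := e (p + 3) (by omega) (by omega)
  have e4 := e (p + 4) (by omega) (by omega)
  have e5 := e (p + 5) (by omega) (by omega)
  have n1 := (ht.walk z).ne_succ (j := p + 2) (by omega) (by omega)
  have t1 := (ht.walk z).tie (p := p + 1) (by omega)
  have t2 := (ht.walk z).tie (p := p + 2) (by omega)
  have hb := (h.top_bit ht hN z (by omega) (by omega)).2
  simp only [Nat.add_assoc, Nat.reduceAdd] at n1 t1 t2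
  rw [hz, e3, e4, e5] at hb
  rw [hz, e3] at n1
  rw [hz, e3, e4] at t1
  rw [e3, e4, e5] at t2
  obtain ⟨s1, s2⟩ := tr_shift n1 n2 n3 t1 t2 hab hcb h2 h3
  rw [s1] at hb
  have hq : (tr (S x (p + 3)) (S x (p + 4)) (S x (p + 5))).2.1 < S x (p + 5) := by
    clear s1 s2 hb
    unfold tr at *
    split_ifs at * <;> simp only at * <;> omega
  have e6 := hb h2 hq
  have d1 := ht.act_tr (p := p + 1) (by omega) (x := z) hz e3 e4 s1
  have d2 := ht.act_ne (p := p + 1) (by omega) z (j := p + 5) (by omega) (by omega)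
  have hr' := h.top_reach hN hr
  simp only [Nat.add_assoc, Nat.reduceAdd] at d1 d2
  rw [← e6] at d1 d2
  refine ⟨?_, ?_, ?_⟩
  · rw [← d1.2.2, ht.reach_letter (by omega) hr' (by omega) (by omega)]
  · rw [s2, ← e5, ← d2, ht.reach_letter (by omega) hr' (by omega) (by omega)]
  · refine ((hr.mono (by omega)).trans (e6 ▸ Reach.step z ⟨?_, ?_, ?_⟩)).trans
      ((h.reach_symm (by omega) hr').mono (by omega)) <;> omega

end Loc

theorem Addable.removable_ne {K : Finset ℕ} {b v : ℤ} (hb : Addable K b) (hv : Removable K v) :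
    v.natAbs ≠ b.natAbs := fun e => hb.2 (e ▸ hv.1)

theorem removable_tie {K : Finset ℕ} {b c v : ℤ} (hb : Addable K b) (hc : Addable (mv K b) c)
    (hv : Removable K v) : v.natAbs ≠ c.natAbs ∨ (v = 0 ∧ b.natAbs = 1) := by
  by_cases e : v.natAbs = c.natAbs
  swap
  · exact Or.inl e
  have h1 := hv.1
  have h2 := hv.2
  have h3 := hc.1
  have h4 := hc.2
  rw [mem_mv] at h3 h4
  rw [e] at h1 h2
  have h5 : c.natAbs + 1 = b.natAbs := by
    by_contra h5
    exact h4 (Or.inr ⟨h5, h1⟩)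
  rcases h3 with h3 | h3 | h3
  · omega
  · omega
  · exact absurd h3.2 h2

namespace Loc

theorem top_le (h : Loc N β ψ) (ht : Typed ψ β (p + 4) (p + 5) S)
    (hN : p + 4 < N) {x : A} (hab : S x (p + 3) < S x (p + 4)) (hcb : S x (p + 5) < S x (p + 4))
    (he : S (ψ (p + 4) x) (p + 3) = S x (p + 3)) : S x (p + 5) ≤ S x (p + 3) := by
  have hw := ht.walk x
  rw [h.top_first ht hN x hab hcb] at he
  have n2 := hw.ne_succ (j := p + 3) (by omega) (by omega)
  have n3 := hw.ne_succ (j := p + 4) (by omega) (by omega)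
  simp only [Nat.add_assoc, Nat.reduceAdd] at n2 n3
  unfold tr at he
  split_ifs at he <;> simp only at he <;> omega

/-- The second of the three letters, after the top map, is on the right side of the contents that
are linked to the first one. -/
theorem top_pin (h : Loc N β ψ) (ht : Typed ψ β (p + 4) (p + 5) S)
    (hN : p + 4 < N) {x : A} (hab : S x (p + 3) < S x (p + 4)) (hcb : S x (p + 5) < S x (p + 4))
    (he : S (ψ (p + 4) x) (p + 3) = S x (p + 3)) {v : ℤ} (hv : Removable (sh (S x) (p + 3)) v)
    (hva : v < S x (p + 3)) (hgood : v.natAbs ≠ (S x (p + 3)).natAbs ∨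
      (2 ≤ (S x (p + 3)).natAbs ∧ (S x (p + 3)).natAbs - 1 ∉ sh (S x) (p + 3)) ∨
      (S x (p + 3)).natAbs + 2 ∈ sh (S x) (p + 3)) :
    (v < S (ψ (p + 4) x) (p + 4) ↔ v < (tr (S x (p + 3)) (S x (p + 4)) (S x (p + 5))).2.1) ∧
    (¬v < (tr (S x (p + 3)) (S x (p + 4)) (S x (p + 5))).2.1 → ∃ z, Reach ψ (p + 3) x z ∧
      S z (p + 3) = v ∧ S z (p + 4) = S x (p + 4) ∧ S z (p + 5) = S x (p + 5) ∧
      S (ψ (p + 4) z) (p + 3) = v ∧ S (ψ (p + 4) z) (p + 4) = S (ψ (p + 4) x) (p + 4) ∧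
      S (ψ (p + 4) z) (p + 5) = S (ψ (p + 4) x) (p + 5) ∧
      Reach ψ (p + 4) (ψ (p + 4) x) (ψ (p + 4) z)) := by
  have hca := h.top_le ht hN hab hcb he
  have hw := ht.walk x
  have hbA := hw (p + 3) (by omega)
  have hcA := hw (p + 4) (by omega)
  have n2 := hw.ne_succ (j := p + 3) (by omega) (by omega)
  have n3 := hw.ne_succ (j := p + 4) (by omega) (by omega)
  have t2 := hw.tie (p := p + 2) (by omega)
  have v1 := hbA.removable_ne hv
  have v2 := removable_tie hbA hcA hv
  simp only [Nat.add_assoc, Nat.reduceAdd] at v1 v2 n2 n3 t2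
  obtain ⟨x', z, y, y', hr, h1, h2, h3, h4, h5, h6, h7, h8, h9⟩ :=
    ht.exists_link (p := p) (by omega) rfl hv hva hgood
  have e4 : S x' (p + 4) = S x (p + 4) := ht.reach_letter (by omega) hr (by omega) (by omega)
  have e5 : S x' (p + 5) = S x (p + 5) := ht.reach_letter (by omega) hr (by omega) (by omega)
  have hr' := h.top_reach hN hr
  have f3 : S (ψ (p + 4) x') (p + 3) = S x (p + 3) := by
    rw [ht.reach_letter (by omega) hr' (by omega) (by omega), he]
  have f4 : S (ψ (p + 4) x') (p + 4) = S (ψ (p + 4) x) (p + 4) :=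
    ht.reach_letter (by omega) hr' (by omega) (by omega)
  have f5 : S (ψ (p + 4) x') (p + 5) = S (ψ (p + 4) x) (p + 5) :=
    ht.reach_letter (by omega) hr' (by omega) (by omega)
  obtain ⟨g1, g2, g3⟩ := ht.act_tr (by omega) h1 h2 h3 h4
  have g4 : S (ψ (p + 2) x') (p + 4) = S x (p + 4) := by
    rw [ht.act_ne (by omega) x' (by omega) (by omega), e4]
  have g5 : S (ψ (p + 2) x') (p + 5) = S x (p + 5) := by
    rw [ht.act_ne (by omega) x' (by omega) (by omega), e5]
  obtain ⟨k1, k2, k3⟩ := ht.act_tr (by omega)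
    (by rw [h.top_low ht hN x' (by omega) (by omega), h1] : S (ψ (p + 4) x') (p + 1) = z)
    (by rw [h.top_low ht hN x' (by omega) (by omega), h2]) f3 h4
  have k4 : S (ψ (p + 2) (ψ (p + 4) x')) (p + 4) = S (ψ (p + 4) x) (p + 4) := by
    rw [ht.act_ne (by omega) _ (by omega) (by omega), f4]
  have k5 : S (ψ (p + 2) (ψ (p + 4) x')) (p + 5) = S (ψ (p + 4) x) (p + 5) := by
    rw [ht.act_ne (by omega) _ (by omega) (by omega), f5]
  have l4 : S (ψ (p + 3) (ψ (p + 2) x')) (p + 4) = (tr y' v (S x (p + 4))).2.2 := by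
    rw [ht.act _ (p + 3) ⟨by omega, by omega, by omega⟩ _ (by omega), ← g2, ← g3, ← g4]
    exact dd_succ (p + 1) _
  have l5 : S (ψ (p + 3) (ψ (p + 2) x')) (p + 5) = S x (p + 5) := by
    rw [ht.act_ne (p := p + 1) (by omega) _ (by omega) (by omega), g5]
  have m1 := (ht.walk (ψ (p + 2) x')).ne_succ (j := p + 2) (by omega) (by omega)
  have m2 := (ht.walk (ψ (p + 2) x')).tie (p := p + 1) (by omega)
  simp only [Nat.add_assoc, Nat.reduceAdd] at m1 m2
  rw [g2, g3] at m1
  rw [g2, g3, g4] at m2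
  have b1 := ht.bit x' (p + 1) (by omega) (by omega)
  have b2 := ht.bit x' (p + 2) (by omega) (by omega)
  have b3 := ht.bit x' (p + 3) (by omega) (by omega)
  have b4 := ht.bit x' (p + 4) (by omega) (by omega)
  simp only [Nat.add_assoc, Nat.reduceAdd] at b1 b2 b3 b4
  rw [h1, h2] at b1
  rw [h2, h3] at b2
  rw [h3, e4] at b3
  rw [e4, e5] at b4
  have c1 : ¬β (p + 1) x' := by rw [b1]; omega
  have c2 : β (p + 2) x' := by rw [b2]; omega
  have c3 : β (p + 3) x' := by rw [b3]; omega
  have c4 : ¬β (p + 4) x' := by rw [b4]; omega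
  have key : β (p + 4) (ψ (p + 3) (ψ (p + 2) x')) ↔ v < (tr (S x (p + 3)) (S x (p + 4)) (S x (p + 5))).2.1 := by
    rw [ht.bit _ _ (by omega) (by omega), l4, l5]
    rcases lt_or_ge (tr y' v (S x (p + 4))).2.2 (S x (p + 5)) with hlt | hge
    · exact iff_of_true hlt
        (tr_pin_of_lt hca hab n3 n2 t2 hva v1 v2 h8 h7 m1 (h5.trans h6) m2 h9 hlt)
    · exact iff_of_false (by omega)
        (not_lt.2 (tr_pin_of_le hca hab n3 n2 t2 hva v1 v2 h8 h7 m1 (h5.trans h6) m2 h9 hge))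
  refine ⟨?_, fun hn => ?_⟩
  · rw [← key, ← h.pin p hN x' (by simp [c1, c2]) (by simp [c2, c3]) (by simp [c3, c4]),
      ht.bit _ _ (by omega) (by omega), k3, k4]
  · have hk := h.hook p hN x' (by simp [c1, c2]) (by simp [c2, c3]) (by simp [c3, c4])
      (by simp only [key, c2, hn, iff_true, not_false_eq_true])
    refine ⟨ψ (p + 2) x', (hr.mono (by omega)).trans (Reach.step x' ⟨by omega, by omega, by omega⟩),
      g3, g4, g5, ?_, ?_, ?_, ?_⟩
    · rw [← hk, k3]
    · rw [← hk, k4]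
    · rw [← hk, k5]
    · rw [← hk]
      exact (hr'.mono (by omega)).trans (Reach.step _ ⟨by omega, by omega, by omega⟩)

theorem top_flip (h : Loc N β ψ) (ht : Typed ψ β (p + 4) (p + 5) S)
    (hN : p + 4 < N) {x : A} (hab : S x (p + 3) < S x (p + 4)) (hcb : S x (p + 5) < S x (p + 4)) :
    S (ψ (p + 4) x) (p + 4) < S (ψ (p + 4) x) (p + 3) ∧
      S (ψ (p + 4) x) (p + 4) < S (ψ (p + 4) x) (p + 5) := by
  have b3 := ht.bit x (p + 3) (by omega) (by omega)
  have b4 := ht.bit x (p + 4) (by omega) (by omega)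
  have c3 := ht.bit (ψ (p + 4) x) (p + 3) (by omega) (by omega)
  have c4 := ht.bit (ψ (p + 4) x) (p + 4) (by omega) (by omega)
  have n2 := (ht.walk (ψ (p + 4) x)).ne_succ (j := p + 3) (by omega) (by omega)
  simp only [Nat.add_assoc, Nat.reduceAdd] at b3 b4 c3 c4 n2
  have d3 : β (p + 3) x := b3.2 hab
  have d4 : ¬β (p + 4) x := by rw [b4]; omega
  have := h.flip (p + 2) hN x (by simp [Nat.add_assoc, d3, d4])
  simp only [Nat.add_assoc, Nat.reduceAdd] at this
  rw [c3, c4] at this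
  simp only [d3, d4, not_true_eq_false, iff_false, not_false_eq_true, iff_true] at this
  omega

/-- An element with another first letter and the same behaviour under the top map. -/
theorem top_move (h : Loc N β ψ) (ht : Typed ψ β (p + 4) (p + 5) S) (hs : Separates ψ (p + 4) S)
    (hN : p + 4 < N) {x : A} (hab : S x (p + 3) < S x (p + 4)) (hcb : S x (p + 5) < S x (p + 4))
    (he : S (ψ (p + 4) x) (p + 3) = S x (p + 3)) {v : ℤ} (hv : Removable (sh (S x) (p + 3)) v)
    (hvb : v < S x (p + 4)) (hvq : (tr (S x (p + 3)) (S x (p + 4)) (S x (p + 5))).2.1 < v)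
    (hgood : v.natAbs ≠ (S x (p + 3)).natAbs ∨ (v < S x (p + 3) ∧
      ((2 ≤ (S x (p + 3)).natAbs ∧ (S x (p + 3)).natAbs - 1 ∉ sh (S x) (p + 3)) ∨
      (S x (p + 3)).natAbs + 2 ∈ sh (S x) (p + 3)))) :
    ∃ z, Reach ψ (p + 3) x z ∧
      S z (p + 3) = v ∧ S z (p + 4) = S x (p + 4) ∧ S z (p + 5) = S x (p + 5) ∧
      S (ψ (p + 4) z) (p + 3) = v ∧ S (ψ (p + 4) z) (p + 4) = S (ψ (p + 4) x) (p + 4) ∧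
      S (ψ (p + 4) z) (p + 5) = S (ψ (p + 4) x) (p + 5) := by
  rcases lt_trichotomy v (S x (p + 3)) with hlt | heq | hlt
  · obtain ⟨z, z1, z2, z3, z4, z5, z6, z7, -⟩ := (h.top_pin ht hN hab hcb he hv hlt (by tauto)).2 (by omega)
    exact ⟨z, z1, z2, z3, z4, z5, z6, z7⟩
  · exact absurd (congrArg Int.natAbs heq) (by omega)
  have hca := h.top_le ht hN hab hcb he
  obtain ⟨z, hr, hz⟩ := ht.exists_letter (by omega) x hv
  have e4 : S z (p + 4) = S x (p + 4) := ht.reach_letter (by omega) hr (by omega) (by omega)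
  have e5 : S z (p + 5) = S x (p + 5) := ht.reach_letter (by omega) hr (by omega) (by omega)
  have hK : sh (S z) (p + 3) = sh (S x) (p + 3) := ht.reach_sh (by omega) hr (by omega) (by omega)
  have hf := h.top_first ht hN z (by omega) (by omega)
  have n2 := (ht.walk x).ne_succ (j := p + 3) (by omega) (by omega)
  have n3 := (ht.walk x).ne_succ (j := p + 4) (by omega) (by omega)
  have t2 := (ht.walk x).tie (p := p + 2) (by omega)
  have hbA := (ht.walk x) (p + 3) (by omega)
  have hcA := (ht.walk x) (p + 4) (by omega)
  have v1 := hbA.removable_ne hv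
  have v2 := removable_tie hbA hcA hv
  simp only [Nat.add_assoc, Nat.reduceAdd] at v1 v2 n2 n3 t2
  rw [hz, e4, e5, tr_first_eq (by omega) hvb] at hf
  have hsec := tr_second_lt hca hab n3 n2 t2
  obtain ⟨z', hr', h1, h2, h3, h4, h5, h6, -⟩ := (h.top_pin ht hN (x := z) (v := S x (p + 3)) (by omega) (by omega)
    (by omega) (by rw [hK]; exact (ht.walk x).removable (show p + 2 < p + 5 by omega)) (by omega)
    (Or.inl (by omega))).2 (by
      rw [hz, e4, e5, tr_second_congr hca hab n3 n2 t2 hvb v1 v2 (by omega)]; omega)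
  have hrr := h.top_congr ht hs hN (x := x) (z := z') (Reach.mono (hr.trans hr') (by omega)) h1.symm (by omega)
  refine ⟨z, hr, hz, e4, e5, hf, ?_, ?_⟩
  · rw [← h5, ht.reach_letter (by omega) hrr (by omega) (by omega)]
  · rw [← h6, ht.reach_letter (by omega) hrr (by omega) (by omega)]

/-- The top map acts correctly on the second of the three letters, with one possible exception. -/
theorem top_second (h : Loc N β ψ) (ht : Typed ψ β (p + 4) (p + 5) S) (hs : Separates ψ (p + 4) S)
    (hN : p + 4 < N) {x : A} (hab : S x (p + 3) < S x (p + 4)) (hcb : S x (p + 5) < S x (p + 4))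
    (he : S (ψ (p + 4) x) (p + 3) = S x (p + 3)) :
    S (ψ (p + 4) x) (p + 4) = (tr (S x (p + 3)) (S x (p + 4)) (S x (p + 5))).2.1 ∨
    (S x (p + 3) = 1 ∧ S x (p + 4) = 2 ∧ 2 ∈ sh (S x) (p + 3) ∧ 1 ∉ sh (S x) (p + 3) ∧
      3 ∉ sh (S x) (p + 3) ∧ ((S x (p + 5) = 0 ∧ S (ψ (p + 4) x) (p + 4) = -2) ∨
        (S x (p + 5) = -3 ∧ S (ψ (p + 4) x) (p + 4) = 0))) := by
  have hca := h.top_le ht hN hab hcb he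
  have hw := ht.walk x
  have hbA := hw (p + 3) (by omega)
  have hqA := ht.walk (ψ (p + 4) x) (p + 3) (by omega)
  have hK : sh (S (ψ (p + 4) x)) (p + 3) = sh (S x) (p + 3) :=
    sh_congr (fun j h1 h2 => by
      rcases Nat.lt_or_ge j (p + 3) with h3 | h3
      · exact h.top_low ht hN x h1 (by omega)
      · obtain rfl : j = p + 3 := by omega
        exact he)
  have hq'A := (tr_walk (hw (p + 2) (by omega)) (hw (p + 3) (by omega)) (hw (p + 4) (by omega))).2.1
  have n2 := hw.ne_succ (j := p + 3) (by omega) (by omega)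
  have n3 := hw.ne_succ (j := p + 4) (by omega) (by omega)
  have t2 := hw.tie (p := p + 2) (by omega)
  have hqa := (h.top_flip ht hN hab hcb).1
  rw [he] at hqa
  rw [hK] at hqA
  have hKd : mv (sh (S x) (p + 2)) (S x (p + 3)) = sh (S x) (p + 3) := rfl
  simp only [Nat.add_assoc, Nat.reduceAdd] at hq'A hqA hbA n2 n3 t2
  rw [tr_first_eq hca hab, hKd] at hq'A
  have hq'a := tr_second_lt hca hab n3 n2 t2
  have haR : Removable (sh (S x) (p + 3)) (S x (p + 3)) := hw.removable (show p + 2 < p + 5 by omega)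
  have hpin := fun v => h.top_pin ht hN hab hcb he (v := v)
  have hmove := fun v => h.top_move ht hs hN hab hcb he (v := v)
  obtain ⟨a, ha⟩ : ∃ a, S x (p + 3) = a := ⟨_, rfl⟩
  obtain ⟨b, hb⟩ : ∃ b, S x (p + 4) = b := ⟨_, rfl⟩
  obtain ⟨c, hc⟩ : ∃ c, S x (p + 5) = c := ⟨_, rfl⟩
  obtain ⟨q, hq⟩ : ∃ q, S (ψ (p + 4) x) (p + 4) = q := ⟨_, rfl⟩
  obtain ⟨K, hKe⟩ : ∃ K, sh (S x) (p + 3) = K := ⟨_, rfl⟩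
  have h0 : 0 ∉ K := hKe ▸ zero_notMem_sh _ _
  simp only [ha, hb, hc, hq, hKe] at hab hcb he hca hqa hq'A hqA hbA n2 n3 t2 hq'a haR hpin hmove ⊢
  obtain ⟨q', hq'⟩ : ∃ q', (tr a b c).2.1 = q' := ⟨_, rfl⟩
  simp only [hq'] at hq'A hq'a hpin hmove ⊢
  by_cases hne : q = q'
  · exact Or.inl hne
  right
  have between : ∀ v, Removable K v → v < a → (v < q ↔ ¬v < q') →
      v = -a ∧ ¬((2 ≤ a.natAbs ∧ a.natAbs - 1 ∉ K) ∨ a.natAbs + 2 ∈ K) := by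
    intro v hv hva hiff
    by_contra hcon
    have := (hpin v hv hva (by by_contra hc2; exact hcon (by constructor <;> [omega; tauto]))).1
    tauto
  obtain ⟨hva, hRm⟩ : Removable K (-a) ∧ (-a < a ∧ (-a < q ↔ ¬-a < q') ∧
      ¬((2 ≤ a.natAbs ∧ a.natAbs - 1 ∉ K) ∨ a.natAbs + 2 ∈ K)) := by
    rcases lt_or_gt_of_ne hne with h1 | h1
    · obtain ⟨v, hv, h2, h3⟩ := exists_removable_between h0 hqA hq'A h1
      obtain ⟨rfl, h4⟩ := between v hv (by omega) (by omega)
      exact ⟨hv, by omega, by omega, h4⟩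
    · obtain ⟨v, hv, h2, h3⟩ := exists_removable_between h0 hq'A hqA h1
      obtain ⟨rfl, h4⟩ := between v hv (by omega) (by omega)
      exact ⟨hv, by omega, by omega, h4⟩
  obtain ⟨ha0, hiff, hbad⟩ := hRm
  have nomove : ∀ v, Removable K v → v.natAbs ≠ a.natAbs → -a < v → q' < v → v < b → False := by
    intro v hv hne2 hav hqv hvb
    obtain ⟨z, hr, z3, z4, z5, z6, z7, z8⟩ := hmove v hv hvb hqv (Or.inl hne2)
    have hKz : sh (S z) (p + 3) = K := by
      rw [← hKe]; exact ht.reach_sh (by omega) hr (by omega) (by omega)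
    have hz := (h.top_pin ht hN (x := z) (v := -a) (by omega) (by omega) (by omega) (by rw [hKz]; exact hva)
      (by omega) (Or.inl (by omega))).1
    have v1 := hbA.removable_ne hv
    have v2 := removable_tie hbA (c := c) (by
      have := hw (p + 4) (by omega)
      rw [show S x (p + 4 + 1) = c from hc] at this
      rw [← hb, ← hKe]; exact this) hv
    have hcv := le_of_tr_second_le hca hab n3 n2 t2 (v := v) (by omega)
    rw [z7, z3, z4, z5, tr_second_congr hca hab n3 n2 t2 hvb v1 v2 hcv, hq'] at hz
    omega
  have ha1 : a = 1 := by
    by_contra ha1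
    have h1 : a.natAbs - 1 ∈ K := by
      by_contra h1; exact hbad (Or.inl ⟨by omega, h1⟩)
    obtain ⟨f, f1, f2, f3, -⟩ := exists_run_bottom h0 h1
    have hf : Removable K f := ⟨by simpa using f2, by simpa using f3⟩
    have hb2 := mt (between f hf (by omega)) (by omega)
    rcases lt_or_ge q' f with h4 | h4
    · exact nomove f hf (by omega) (by omega) h4 (by omega)
    · have := hq'A.removable_ne hf
      omega
  subst ha1
  have h3K : 3 ∉ K := fun h3 => hbad (Or.inr h3)
  have h2K : 2 ∈ K := haR.1
  have h1K : 1 ∉ K := haR.2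
  have hb2 : b = 2 := by
    by_contra hb2
    have h2A : Addable K 2 := ⟨Or.inr h2K, h3K⟩
    obtain ⟨v, hv, h4, h5⟩ := exists_removable_between h0 h2A hbA (by omega)
    exact nomove v hv (by omega) (by omega) (by omega) h5
  subst hb2
  refine ⟨rfl, rfl, h2K, h1K, h3K, ?_⟩
  have h2A : Addable K (-2) := ⟨Or.inr h2K, h3K⟩
  have hq'c : (c = -3 ∧ q' = -2) ∨ (c ≠ -3 ∧ q' = c) := by
    clear hpin hmove between nomove hiff hne
    unfold tr at hq'
    split_ifs at hq' <;> simp only at hq' <;> omega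
  rcases hq'c with ⟨h4, h5⟩ | ⟨h4, h5⟩
  · exact Or.inr ⟨h4, by omega⟩
  · left
    have nb : ∀ v, Removable K v → v < -1 → ¬(v < q ↔ ¬v < q') := fun v hv hv1 hi => by
      have := (between v hv (by omega) hi).1; omega
    rcases lt_or_ge c (-1) with h6 | h6
    · exfalso
      have hc3 : c < -2 := by omega
      obtain ⟨v, hv, h7, h8⟩ := exists_removable_between h0 hq'A h2A (by omega)
      exact nb v hv (by omega) (by omega)
    · refine ⟨by omega, ?_⟩
      by_contra h7
      have hq2 : q < -2 := by
        have : q ≠ -1 := fun e => by have := hqA.removable_ne hva; omega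
        omega
      obtain ⟨v, hv, h8, h9⟩ := exists_removable_between h0 hqA h2A (by omega)
      exact nb v hv (by omega) (by omega)

end Loc

theorem Separates.neg (hs : Separates ψ m S) : Separates ψ m (fun x j => -S x j) :=
  fun x y h1 h2 => hs x y h1 (fun j h3 h4 => by simpa using h2 j h3 h4)

namespace Loc

/-- The last of the three letters, after the top map. -/
theorem top_third (h : Loc N β ψ) (ht : Typed ψ β (p + 4) (p + 5) S) (hs : Separates ψ (p + 4) S)
    (hN : p + 4 < N) {x : A} (hab : S x (p + 3) < S x (p + 4)) (hcb : S x (p + 5) < S x (p + 4))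
    (he : S (ψ (p + 4) x) (p + 3) = S x (p + 3)) :
    S x (p + 3) ≤ S (ψ (p + 4) x) (p + 5) ∧
    (S x (p + 4) = (tr (S x (p + 3)) (S (ψ (p + 4) x) (p + 4)) (S (ψ (p + 4) x) (p + 5))).2.1 ∨
    (S x (p + 3) = -1 ∧ S (ψ (p + 4) x) (p + 4) = -2 ∧ 2 ∈ sh (S (ψ (p + 4) x)) (p + 3) ∧
      1 ∉ sh (S (ψ (p + 4) x)) (p + 3) ∧ 3 ∉ sh (S (ψ (p + 4) x)) (p + 3) ∧
      ((S (ψ (p + 4) x) (p + 5) = 0 ∧ S x (p + 4) = 2) ∨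
        (S (ψ (p + 4) x) (p + 5) = 3 ∧ S x (p + 4) = 0)))) := by
  obtain ⟨f1, f2⟩ := h.top_flip ht hN hab hcb
  have hinv : ψ (p + 4) (ψ (p + 4) x) = x := h.inv _ (by omega) hN x
  have h1 := h.neg.top_le ht.neg hN (x := ψ (p + 4) x) (by simpa using f1) (by simpa using f2)
    (by rw [hinv, he])
  have h2 := h.neg.top_second ht.neg hs.neg hN (x := ψ (p + 4) x) (by simpa using f1) (by simpa using f2)
    (by rw [hinv, he])
  rw [hinv, he, tr_neg, sh_neg, neg_inj] at h2
  refine ⟨by simpa [he] using h1, h2.imp_right ?_⟩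
  rintro ⟨h3, h4, h5, h6, h7, h8⟩
  exact ⟨by omega, by omega, h5, h6, h7, by omega⟩

/-- The top map is correct if it has to exchange letters one of which is large. -/
theorem top_swap (h : Loc N β ψ) (ht : Typed ψ β (p + 4) (p + 5) S) (hs : Separates ψ (p + 4) S)
    (hN : p + 4 < N) {x : A} {a b c : ℤ} (ha : S x (p + 3) = a) (hb : S x (p + 4) = b)
    (hc : S x (p + 5) = c) (hca : c < a) (hab : a < b) (h1 : b.natAbs ≠ c.natAbs + 1)
    (h2 : c.natAbs ≠ b.natAbs + 1) (hl : 3 ≤ b ∨ c ≤ -3) :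
    S (ψ (p + 4) x) (p + 3) = a ∧ S (ψ (p + 4) x) (p + 4) = c ∧ S (ψ (p + 4) x) (p + 5) = b := by
  have htr : tr a b c = (a, c, b) := tr_swap_right (Or.inr ⟨hca, hab⟩) (by omega) (by omega)
  have e1 := h.top_first ht hN x (by omega) (by omega)
  rw [ha, hb, hc, htr] at e1
  simp only at e1
  have e2 := h.top_second ht hs hN (x := x) (by omega) (by omega) (by omega)
  obtain ⟨h3, e3⟩ := h.top_third ht hs hN (x := x) (by omega) (by omega) (by omega)
  have n2 := (ht.walk (ψ (p + 4) x)).ne_succ (j := p + 4) (by omega) (by omega)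
  have n1 := (ht.walk x).ne_succ (j := p + 4) (by omega) (by omega)
  have t2 := (ht.walk (ψ (p + 4) x)).tie (p := p + 2) (by omega)
  simp only [Nat.add_assoc, Nat.reduceAdd] at n2 t2 n1
  rw [ha, hb, hc, htr] at e2
  simp only at e2
  have e4 : S (ψ (p + 4) x) (p + 4) = c := by omega
  rw [e1, e4] at t2
  rw [hb, hc] at n1
  rw [ha, hb, e4] at e3
  rw [e4] at n2
  rw [ha] at h3
  refine ⟨e1, e4, ?_⟩
  generalize S (ψ (p + 4) x) (p + 5) = r at *
  rcases e3 with e3 | e3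
  · clear e2 htr
    unfold tr at e3
    split_ifs at e3 <;> simp only at e3 <;> omega
  · omega

theorem top_swap_down (h : Loc N β ψ) (ht : Typed ψ β (p + 4) (p + 5) S) (hs : Separates ψ (p + 4) S)
    (hN : p + 4 < N) {x : A} {a b c : ℤ} (ha : S x (p + 3) = a) (hb : S x (p + 4) = b)
    (hc : S x (p + 5) = c) (hca : b < a) (hab : a < c) (h1 : b.natAbs ≠ c.natAbs + 1)
    (h2 : c.natAbs ≠ b.natAbs + 1) (hl : 3 ≤ c ∨ b ≤ -3) :
    S (ψ (p + 4) x) (p + 3) = a ∧ S (ψ (p + 4) x) (p + 4) = c ∧ S (ψ (p + 4) x) (p + 5) = b := by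
  have := h.neg.top_swap ht.neg hs.neg hN (x := x) (a := -a) (b := -b) (c := -c) (by rw [ha]) (by rw [hb])
    (by rw [hc]) (by omega) (by omega) (by omega) (by omega) (by omega)
  omega

end Loc

/-! ### Loops through six consecutive letters -/

/-- The element `y` is reached from `x` by the maps `ψ (p + 2), …, ψ (p + 5)`, and the letters
`p + 1, …, p + 6` of `y` are given. -/
def Window (ψ : ℕ → A → A) (S : A → ℕ → ℤ) (p : ℕ) (x y : A) (a b c d e f : ℤ) : Prop :=
  Relation.ReflTransGen (fun u v => ∃ j, p + 2 ≤ j ∧ j ≤ p + 5 ∧ v = ψ j u) x y ∧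
  S y (p + 1) = a ∧ S y (p + 2) = b ∧ S y (p + 3) = c ∧ S y (p + 4) = d ∧ S y (p + 5) = e ∧ S y (p + 6) = f

namespace Window

variable {x y : A} {a b c d e f a' b' c' d' e' f' : ℤ}

theorem left (ht : Typed ψ β (p + 5) (p + 6) S) (h : Window ψ S p x y a b c d e f)
    (hr : tr a b c = (a', b', c')) : Window ψ S p x (ψ (p + 2) y) a' b' c' d e f := by
  obtain ⟨r, h1, h2, h3, h4, h5, h6⟩ := h
  obtain ⟨k1, k2, k3⟩ := ht.act_tr (p := p) (by omega) h1 h2 h3 hr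
  exact ⟨r.tail ⟨_, by omega, by omega, rfl⟩, k1, k2, k3,
    by rw [ht.act_ne (p := p) (by omega) y (by omega) (by omega), h4],
    by rw [ht.act_ne (p := p) (by omega) y (by omega) (by omega), h5],
    by rw [ht.act_ne (p := p) (by omega) y (by omega) (by omega), h6]⟩

theorem mid (ht : Typed ψ β (p + 5) (p + 6) S) (h : Window ψ S p x y a b c d e f)
    (hr : tr b c d = (b', c', d')) : Window ψ S p x (ψ (p + 3) y) a b' c' d' e f := by
  obtain ⟨r, h1, h2, h3, h4, h5, h6⟩ := h
  obtain ⟨k1, k2, k3⟩ := ht.act_tr (p := p + 1) (by omega) h2 h3 h4 hr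
  exact ⟨r.tail ⟨_, by omega, by omega, rfl⟩,
    by rw [ht.act_ne (p := p + 1) (by omega) y (by omega) (by omega), h1], k1, k2, k3,
    by rw [ht.act_ne (p := p + 1) (by omega) y (by omega) (by omega), h5],
    by rw [ht.act_ne (p := p + 1) (by omega) y (by omega) (by omega), h6]⟩

theorem right (ht : Typed ψ β (p + 5) (p + 6) S) (h : Window ψ S p x y a b c d e f)
    (hr : tr c d e = (c', d', e')) : Window ψ S p x (ψ (p + 4) y) a b c' d' e' f := by
  obtain ⟨r, h1, h2, h3, h4, h5, h6⟩ := h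
  obtain ⟨k1, k2, k3⟩ := ht.act_tr (p := p + 2) (by omega) h3 h4 h5 hr
  exact ⟨r.tail ⟨_, by omega, by omega, rfl⟩,
    by rw [ht.act_ne (p := p + 2) (by omega) y (by omega) (by omega), h1],
    by rw [ht.act_ne (p := p + 2) (by omega) y (by omega) (by omega), h2], k1, k2, k3,
    by rw [ht.act_ne (p := p + 2) (by omega) y (by omega) (by omega), h6]⟩

theorem top (h : Loc N β ψ) (ht : Typed ψ β (p + 5) (p + 6) S) (hs : Separates ψ (p + 5) S)
    (hN : p + 5 < N) (hw : Window ψ S p x y a b c d e f) (hr : (f < d ∧ d < e) ∨ (e < d ∧ d < f))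
    (h1 : e.natAbs ≠ f.natAbs + 1) (h2 : f.natAbs ≠ e.natAbs + 1)
    (hl : 3 ≤ max e f ∨ min e f ≤ -3) : Window ψ S p x (ψ (p + 5) y) a b c d f e := by
  obtain ⟨r, k1, k2, k3, k4, k5, k6⟩ := hw
  have hk : S (ψ (p + 5) y) (p + 4) = d ∧ S (ψ (p + 5) y) (p + 5) = f ∧ S (ψ (p + 5) y) (p + 6) = e := by
    rcases hr with hr | hr
    · exact h.top_swap (p := p + 1) ht hs hN k4 k5 k6 hr.1 hr.2 h1 h2 (by omega)
    · exact h.top_swap_down (p := p + 1) ht hs hN k4 k5 k6 hr.1 hr.2 h1 h2 (by omega)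
  exact ⟨r.tail ⟨_, by omega, by omega, rfl⟩,
    by rw [h.top_low (p := p + 1) ht hN y (by omega) (by omega), k1],
    by rw [h.top_low (p := p + 1) ht hN y (by omega) (by omega), k2],
    by rw [h.top_low (p := p + 1) ht hN y (by omega) (by omega), k3], hk⟩

theorem fold_congr (ht : Typed ψ β (p + 5) (p + 6) S) (l : List ℕ)
    (hl : ∀ j ∈ l, p + 2 ≤ j ∧ j ≤ p + 4) {x y : A} (hxy : ∀ j, p + 1 ≤ j → j ≤ p + 5 → S x j = S y j)
    (j : ℕ) (h1 : p + 1 ≤ j) (h2 : j ≤ p + 5) :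
    S (l.foldl (fun a j => ψ j a) x) j = S (l.foldl (fun a j => ψ j a) y) j := by
  induction l generalizing x y with
  | nil => exact hxy j h1 h2
  | cons i l ih =>
    refine ih (fun j hj => hl j (List.mem_cons_of_mem _ hj)) (fun j h1 h2 => ?_)
    obtain ⟨h3, h4⟩ := hl i List.mem_cons_self
    rw [ht.act x i ⟨by omega, by omega, by omega⟩ j (by omega),
      ht.act y i ⟨by omega, by omega, by omega⟩ j (by omega)]
    simp only [dd]
    rw [if_neg (show ¬i = 0 by omega), if_neg (show ¬i = 0 by omega), hxy (i - 1) (by omega) (by omega), hxy i (by omega) (by omega), hxy (i + 1) (by omega) (by omega),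
      hxy j h1 h2]

/-- A path whose end has the expected letters under the top map is closed by the top map. -/
theorem close (h : Loc N β ψ) (ht : Typed ψ β (p + 5) (p + 6) S)
    (hN : p + 5 < N) (hx : Window ψ S p x x a b c d e f) (hy : Window ψ S p x y a b c d' e' f')
    (h4 : S (ψ (p + 5) y) (p + 4) = d) (h5 : S (ψ (p + 5) y) (p + 5) = e) : ψ (p + 5) x = y := by
  obtain ⟨-, x1, x2, x3, x4, x5, x6⟩ := hx
  obtain ⟨r, y1, y2, y3, y4, y5, y6⟩ := hy
  have e1 := h.top_low (p := p + 1) ht hN y (j := p + 1) (by omega) (by omega)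
  have e2 := h.top_low (p := p + 1) ht hN y (j := p + 2) (by omega) (by omega)
  have e3 := h.top_low (p := p + 1) ht hN y (j := p + 3) (by omega) (by omega)
  simp only [Nat.add_assoc, Nat.reduceAdd] at e1 e2 e3
  have hl : ∀ j, p + 1 ≤ j → j ≤ p + 5 → S x j = S (ψ (p + 5) y) j := by
    intro j h1 h2
    obtain rfl | rfl | rfl | rfl | rfl : j = p + 1 ∨ j = p + 2 ∨ j = p + 3 ∨ j = p + 4 ∨ j = p + 5 := by omega
    · rw [e1, x1, y1]
    · rw [e2, x2, y2]
    · rw [e3, x3, y3]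
    · rw [h4, x4]
    · rw [h5, x5]
  have : x = ψ (p + 5) y := h.rigid p hN x _ (r.tail ⟨p + 5, by omega, by omega, rfl⟩) (fun l h1 j h2 h3 => by
    rw [ht.bit _ j (by omega) (by omega), ht.bit _ j (by omega) (by omega),
      fold_congr ht l h1 hl j (by omega) (by omega), fold_congr ht l h1 hl (j + 1) (by omega) (by omega)])
  rw [this, h.inv _ (by omega) hN]

end Window

namespace Loc

/-- A loop that uses a large content `e` and its predecessor. -/
theorem loop_far (h : Loc N β ψ) (ht : Typed ψ β (p + 5) (p + 6) S) (hs : Separates ψ (p + 5) S)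
    (hN : p + 5 < N) {x : A} {y e a b c b' c' : ℤ} (hx : Window ψ S p x x y (e - 1) e a b c)
    (he : 3 ≤ e) (hy : a < y) (hy' : y < e - 1) (ha : a.natAbs + 2 < e) (hb : b.natAbs + 1 < e)
    (hc : c.natAbs + 1 < e) (hb' : b'.natAbs + 1 < e) (hc' : c'.natAbs + 1 < e) (hcb : c < b)
    (hba : b' < a) (htr : tr a b c = (a, b', c')) (hv : b'.natAbs + 2 = e → c' < -b')
    (hend : ∀ z, S z (p + 4) = a → S z (p + 5) = b' → S z (p + 6) = c' →
      S (ψ (p + 5) z) (p + 4) = a ∧ S (ψ (p + 5) z) (p + 5) = b) :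
    S (ψ (p + 5) x) (p + 5) = b' ∧ S (ψ (p + 5) x) (p + 6) = c' := by
  obtain ⟨u, v, h1, h2, h3, h4⟩ : ∃ u v, tr a (e - 1) b' = (a, u, v) ∧ tr a u v = (a, e - 1, b') ∧
      c' < v ∧ v < e := by
    by_cases hadj : b'.natAbs + 2 = e
    · refine ⟨_, _, tr_neg_right (by omega) (by omega), ?_, hv hadj, by omega⟩
      rw [tr_neg_right (by omega) (by omega), neg_neg, neg_neg]
    · exact ⟨_, _, tr_swap_right (by omega) (by omega) (by omega),
        tr_swap_right (by omega) (by omega) (by omega), by omega, by omega⟩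
  have w1 := hx.mid ht (tr_swap_right (by omega) (by omega) (by omega))
  have w2 := w1.left ht (tr_swap_right (by omega) (by omega) (by omega))
  have w3 := w2.right ht (tr_swap_right (by omega) (by omega) (by omega))
  have w4 := w3.left ht (tr_swap_right (by omega) (by omega) (by omega))
  have w5 := w4.top h ht hs hN (by omega) (by omega) (by omega) (by omega)
  have w6 := w5.right ht htr
  have w7 := w6.left ht (tr_swap_right (by omega) (by omega) (by omega))
  have w8 := w7.mid ht h1
  have w9 := w8.top h ht hs hN (by omega) (by omega) (by omega) (by omega)
  have w10 := w9.mid ht h2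
  have w11 := w10.left ht (tr_swap_right (by omega) (by omega) (by omega))
  have w12 := w11.right ht (tr_swap_right (by omega) (by omega) (by omega))
  have w13 := w12.mid ht (tr_swap_right (by omega) (by omega) (by omega))
  have hz := w13.2
  obtain ⟨g1, g2⟩ := hend _ hz.2.2.2.1 hz.2.2.2.2.1 hz.2.2.2.2.2
  have := Window.close h ht hN hx w13 g1 g2
  rw [this]
  exact ⟨hz.2.2.2.2.1, hz.2.2.2.2.2⟩

/-- A loop that uses the largest part `b` of the shape. -/
theorem loop_near (h : Loc N β ψ) (ht : Typed ψ β (p + 5) (p + 6) S) (hs : Separates ψ (p + 5) S)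
    (hN : p + 5 < N) {x : A} {y z w a b s t u v : ℤ} (hx : Window ψ S p x x y z w a b (-(b + 1)))
    (hb : 3 ≤ b) (h1 : tr y z w = (y, s, t)) (h1' : tr y s t = (y, z, w)) (h2 : tr z w b = (z, u, v))
    (h2' : tr z u v = (z, w, b)) (hat : a < t) (htb : t.natAbs + 1 < b) (ha : a.natAbs + 1 < b)
    (hw : -b < w) (hwa : w < a) (hs1 : -b < s) (hst : s < t) (hv : -(b + 1) < v) (hva : v < a)
    (hend : ∀ z, S z (p + 4) = a → S z (p + 5) = -b → S z (p + 6) = b + 1 →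
      S (ψ (p + 5) z) (p + 4) = a ∧ S (ψ (p + 5) z) (p + 5) = b) :
    S (ψ (p + 5) x) (p + 6) = b + 1 := by
  have w1 := hx.left ht h1
  have w2 := w1.right ht (tr_swap_right (by omega) (by omega) (by omega))
  have w3 := w2.left ht h1'
  have w4 := w3.mid ht h2
  have w5 := w4.top h ht hs hN (by omega) (by omega) (by omega) (by omega)
  have w6 := w5.mid ht h2'
  have w7 := w6.left ht h1
  have w8 := w7.right ht (tr_neg_right (by omega) (by omega))
  have w9 := w8.mid ht (tr_swap_right (by omega) (by omega) (by omega))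
  have w10 := w9.top h ht hs hN (by omega) (by omega) (by omega) (by omega)
  have w11 := w10.mid ht (tr_swap_right (by omega) (by omega) (by omega))
  have w12 := w11.left ht h1'
  have w13 := w12.right ht (tr_swap_right (by omega) (by omega) (by omega))
  rw [neg_neg] at w13
  have hz := w13.2
  obtain ⟨g1, g2⟩ := hend _ hz.2.2.2.1 hz.2.2.2.2.1 hz.2.2.2.2.2
  have := Window.close h ht hN hx w13 g1 g2
  rw [this]
  exact hz.2.2.2.2.2

end Loc

theorem add_le_sum_of_mem {K : Finset ℕ} {i j : ℕ} (hi : i ∈ K) (hj : j ∈ K) (hij : i ≠ j) :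
    i + j ≤ ∑ l ∈ K, l := by
  rw [← Finset.sum_pair (f := fun l => l) hij]
  exact Finset.sum_le_sum_of_subset (fun l hl => by
    rcases Finset.mem_insert.1 hl with rfl | hl
    · exact hi
    · rwa [Finset.mem_singleton.1 hl])

/-- The smallest part above a bound. -/
theorem exists_least_above {K : Finset ℕ} {t : ℕ} (h : ∃ s ∈ K, t ≤ s) :
    ∃ s ∈ K, t ≤ s ∧ ∀ j, t ≤ j → j < s → j ∉ K := by
  classical
  obtain ⟨h1, h2⟩ := Nat.find_spec h
  exact ⟨_, h1, h2, fun j h3 h4 h5 => Nat.find_min h h4 ⟨h5, h3⟩⟩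

theorem Typed.exists_prefix_far (h : Typed ψ β k m S) (hp : p + 3 ≤ k) (x : A) {s : ℕ} {a : ℤ}
    (hs : s ∈ sh (S x) (p + 3)) (h1 : s - 1 ∉ sh (S x) (p + 3)) (h2 : s - 2 ∉ sh (S x) (p + 3))
    (ha : Addable (sh (S x) (p + 3)) a) (has : a.natAbs + 3 < s) :
    ∃ z y, Reach ψ (p + 3) x z ∧ S z (p + 1) = y ∧ S z (p + 2) = (s : ℤ) - 1 - 1 ∧ S z (p + 3) = (s : ℤ) - 1 ∧
      a < y ∧ y < (s : ℤ) - 1 - 1 := by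
  have hkm := h.le
  have e1 : ((s : ℤ) - 1).natAbs = s - 1 := by omega
  have e2 : ((s : ℤ) - 1 - 1).natAbs = s - 2 := by omega
  obtain ⟨x1, r1, l1⟩ := h.exists_letter hp x (w := (s : ℤ) - 1)
    ⟨by rwa [e1, show s - 1 + 1 = s by omega], by rwa [e1]⟩
  have k1 := h.reach_sh hp r1 (j := p + 3) le_rfl (by omega)
  obtain ⟨x2, r2, l2, m2, n2, k2⟩ := h.exists_pred (p := p + 2) (by omega) l1 (w := (s : ℤ) - 1 - 1) (by
    rw [k1]
    simp only [Removable, mem_rmv, e1, e2]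
    refine ⟨⟨by omega, by omega⟩, fun h3 => ?_⟩
    rcases h3 with ⟨-, h3 | h3⟩
    · omega
    · exact h2 h3.2)
  rw [k1] at k2
  have a2 := h.walk x2 (p + 1) (by omega)
  rw [show S x2 (p + 1 + 1) = (s : ℤ) - 1 - 1 from l2] at a2
  have a3 : Addable (sh (S x2) (p + 1)) a := by
    have e3 := rmv_sh (h.walk x2 (p + 1) (by omega))
    rw [show S x2 (p + 1 + 1) = (s : ℤ) - 1 - 1 from l2, k2] at e3
    rw [← e3]
    simp only [Addable, mem_rmv, e1, e2]
    obtain ⟨a4, a5⟩ := ha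
    refine ⟨?_, ?_⟩
    · rcases a4 with a4 | a4
      · exact Or.inl a4
      · by_cases h0 : a = 0
        · exact Or.inl h0
        · exact Or.inr ⟨by omega, Or.inr ⟨by omega, by omega, Or.inr ⟨by omega, a4⟩⟩⟩
    · rintro ⟨-, h3 | ⟨-, -, h3 | ⟨-, h3⟩⟩⟩
      · omega
      · omega
      · exact a5 h3
  obtain ⟨y, hy, h3, h4⟩ := exists_removable_between (zero_notMem_sh _ _) a3 a2 (by omega)
  obtain ⟨z, r3, l3⟩ := h.exists_letter (p := p + 1) (by omega) x2 hy
  exact ⟨z, y, (r1.trans (r2.mono (by omega))).trans (r3.mono (by omega)), l3,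
    by rw [h.reach_letter (by omega) r3 (by omega) (by omega), l2],
    by rw [h.reach_letter (by omega) r3 (by omega) (by omega), m2], h3, h4⟩

namespace Loc

theorem top_far (h : Loc N β ψ) (ht : Typed ψ β (p + 5) (p + 6) S) (hs : Separates ψ (p + 5) S)
    (hN : p + 5 < N) {x : A} {s : ℕ} {a b c b' c' : ℤ} (h4 : S x (p + 4) = a) (h5 : S x (p + 5) = b)
    (h6 : S x (p + 6) = c) (hsG : s ∈ sh (S x) (p + 3)) (h1 : s - 1 ∉ sh (S x) (p + 3))
    (h2 : s - 2 ∉ sh (S x) (p + 3)) (ha : a.natAbs + 3 < s) (hb : b.natAbs + 2 < s)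
    (hc : c.natAbs + 2 < s) (hb' : b'.natAbs + 2 < s) (hc' : c'.natAbs + 2 < s) (hcb : c < b)
    (hba : b' < a) (htr : tr a b c = (a, b', c')) (hv : b'.natAbs + 3 = s → c' < -b')
    (hend : ∀ z, S z (p + 4) = a → S z (p + 5) = b' → S z (p + 6) = c' →
      S (ψ (p + 5) z) (p + 4) = a ∧ S (ψ (p + 5) z) (p + 5) = b) :
    S (ψ (p + 5) x) (p + 5) = b' ∧ S (ψ (p + 5) x) (p + 6) = c' := by
  have haA := ht.walk x (p + 3) (by omega)
  rw [show S x (p + 3 + 1) = a from h4] at haA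
  obtain ⟨z, y, hr, k1, k2, k3, k4, k5⟩ := ht.exists_prefix_far (p := p) (by omega) x hsG h1 h2 haA ha
  have hl : ∀ j, p + 3 < j → j ≤ p + 6 → S z j = S x j :=
    fun j h1 h2 => ht.reach_letter (by omega) hr h1 h2
  have hr' := h.top_reach (p := p + 1) hN hr
  have hw : Window ψ S p z z y ((s : ℤ) - 1 - 1) ((s : ℤ) - 1) a b c :=
    ⟨Relation.ReflTransGen.refl, k1, k2, k3, by rw [hl _ (by omega) (by omega), h4],
      by rw [hl _ (by omega) (by omega), h5], by rw [hl _ (by omega) (by omega), h6]⟩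
  have := h.loop_far ht hs hN hw (by omega) k4 k5 (by omega) (by omega) (by omega) (by omega) (by omega) hcb hba
    htr (fun h3 => hv (by omega)) hend
  rw [← ht.reach_letter (by omega) hr' (j := p + 5) (by omega) (by omega),
    ← ht.reach_letter (by omega) hr' (j := p + 6) (by omega) (by omega)]
  exact this

theorem top_sh (h : Loc N β ψ) (ht : Typed ψ β (p + 4) (p + 5) S)
    (hN : p + 4 < N) {x : A} (he : S (ψ (p + 4) x) (p + 3) = S x (p + 3)) :
    sh (S (ψ (p + 4) x)) (p + 3) = sh (S x) (p + 3) :=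
  sh_congr (fun j h1 h2 => by
      rcases Nat.lt_or_ge j (p + 3) with h3 | h3
      · exact h.top_low ht hN x h1 (by omega)
      · obtain rfl : j = p + 3 := by omega
        exact he)

theorem exists_part_of_notMem (ht : Typed ψ β (p + 4) (p + 5) S) {x : A}
    (h1 : 1 ∉ sh (S x) (p + 3)) (h3 : 3 ∉ sh (S x) (p + 3)) (h4 : 4 ∉ sh (S x) (p + 3)) :
    ∃ s ∈ sh (S x) (p + 3), 5 ≤ s := by
  by_contra hcon
  push Not at hcon
  have hsum := ((ht.walk x).mono (show p + 3 ≤ p + 5 by omega)).sum_sh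
  have : sh (S x) (p + 3) ⊆ {2} := fun j hj => by
    have := hcon j hj
    have h0 : j ≠ 0 := fun e => zero_notMem_sh (S x) (p + 3) (e ▸ hj)
    have h1' : j ≠ 1 := fun e => h1 (e ▸ hj)
    have h3' : j ≠ 3 := fun e => h3 (e ▸ hj)
    have h4' : j ≠ 4 := fun e => h4 (e ▸ hj)
    simp only [Finset.mem_singleton]; omega
  have := Finset.sum_le_sum_of_subset (f := fun l => l) this
  simp only [Finset.sum_singleton] at this
  omega

/-- The parts that are used in the exceptional case. -/
theorem exists_far_part (ht : Typed ψ β (p + 4) (p + 5) S) {x : A} (ha : S x (p + 3) = 1)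
    (h2 : 2 ∈ sh (S x) (p + 3)) (h1 : 1 ∉ sh (S x) (p + 3)) (h3 : 3 ∉ sh (S x) (p + 3))
    (h4 : 4 ∉ sh (S x) (p + 3)) : (∃ q, p = q + 1) ∧
    ∃ s, 5 ≤ s ∧ s ∈ sh (S x) (p + 2) ∧ s - 1 ∉ sh (S x) (p + 2) ∧ s - 2 ∉ sh (S x) (p + 2) := by
  obtain ⟨s, k1, k2, k3⟩ := exists_least_above (exists_part_of_notMem ht h1 h3 h4)
  have hsum := ((ht.walk x).mono (show p + 3 ≤ p + 5 by omega)).sum_sh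
  have := add_le_sum_of_mem h2 k1 (by omega)
  have hm := fun j => mem_sh_pred (ht.walk x (p + 2) (by omega)) (j := j)
  rw [show S x (p + 2 + 1) = 1 from ha] at hm
  have hne : ∀ j, 3 ≤ j → j < s → j ∉ sh (S x) (p + 3) := fun j j1 j2 j3 => by
    obtain rfl | rfl | j4 : j = 3 ∨ j = 4 ∨ 5 ≤ j := by omega
    · exact h3 j3
    · exact h4 j3
    · exact k3 j j4 j2 j3
  refine ⟨⟨p - 1, by omega⟩, s, k2, ?_, ?_, ?_⟩
  · rw [hm]; exact ⟨by omega, by simp; omega, Or.inr k1⟩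
  · rw [hm]; rintro ⟨-, -, j1 | j1⟩
    · simp at j1; omega
    · exact hne (s - 1) (by omega) (by omega) j1
  · rw [hm]; rintro ⟨-, -, j1 | j1⟩
    · simp at j1; omega
    · exact hne (s - 2) (by omega) (by omega) j1

theorem no_exception_zero (h : Loc N β ψ) (ht : Typed ψ β (p + 4) (p + 5) S) (hs : Separates ψ (p + 4) S)
    (hN : p + 4 < N) {x : A} (ha : S x (p + 3) = 1) (hb : S x (p + 4) = 2) (hc : S x (p + 5) = 0)
    (h2 : 2 ∈ sh (S x) (p + 3)) (h1 : 1 ∉ sh (S x) (p + 3)) (h3 : 3 ∉ sh (S x) (p + 3)) :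
    S (ψ (p + 4) x) (p + 4) ≠ -2 := by
  intro hq
  have he : S (ψ (p + 4) x) (p + 3) = S x (p + 3) := by
    rw [h.top_first ht hN x (by omega) (by omega), ha, hb, hc]; rfl
  obtain ⟨l1, l2⟩ := h.top_third ht hs hN (x := x) (by omega) (by omega) he
  have n2 := (ht.walk (ψ (p + 4) x)).ne_succ (j := p + 4) (by omega) (by omega)
  have t2 := (ht.walk (ψ (p + 4) x)).tie (p := p + 2) (by omega)
  have hK := h.top_sh ht hN he
  have hA := (ht.walk (ψ (p + 4) x) (p + 4) (by omega)).2
  rw [mem_sh_succ, hK] at hA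
  simp only [Nat.add_assoc, Nat.reduceAdd] at n2 hA t2
  rw [ha, hb, hq] at l2
  rw [ha] at l1
  rw [he, ha] at t2
  rw [hq] at n2 hA
  have hr : S (ψ (p + 4) x) (p + 5) = 3 := by
    generalize S (ψ (p + 4) x) (p + 5) = r at *
    rcases l2 with l2 | l2
    · unfold tr at l2
      split_ifs at l2 <;> simp only at l2 <;> omega
    · omega
  rw [hr] at hA
  have h4 : 4 ∉ sh (S x) (p + 3) := fun h4 => hA (Or.inr ⟨by simp, by simpa using h4⟩)
  obtain ⟨⟨q, rfl⟩, s, s1, s2, s3, s4⟩ := exists_far_part ht ha h2 h1 h3 h4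
  have := (h.top_far (p := q) (b' := 0) (c' := 2) ht hs hN ha hb hc s2 s3 s4 (by omega) (by omega) (by omega) (by omega)
    (by omega) (by omega) (by omega) rfl (fun _ => by omega) (fun z z1 z2 z3 => by
      have f1 := h.neg.top_first (p := q + 1) ht.neg hN z (by simp [Nat.add_assoc, z1, z2])
        (by simp [Nat.add_assoc, z3, z2])
      have f2 := h.neg.top_second (p := q + 1) ht.neg hs.neg hN (x := z)
        (by simp [Nat.add_assoc, z1, z2]) (by simp [Nat.add_assoc, z3, z2])
      simp only [Nat.add_assoc, Nat.reduceAdd, z1, z2, z3] at f1 f2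
      rw [show (tr (-1) (-0) (-2)).1 = -1 from rfl] at f1
      rw [show (tr (-1) (-0) (-2)).2.1 = -2 from rfl] at f2
      have := f2 f1
      exact ⟨by omega, by omega⟩)).1
  simp only [Nat.add_assoc, Nat.reduceAdd] at hq
  omega

theorem no_exception_three (h : Loc N β ψ) (ht : Typed ψ β (p + 4) (p + 5) S) (hs : Separates ψ (p + 4) S)
    (hN : p + 4 < N) {x : A} (ha : S x (p + 3) = 1) (hb : S x (p + 4) = 2) (hc : S x (p + 5) = -3)
    (h2 : 2 ∈ sh (S x) (p + 3)) (h1 : 1 ∉ sh (S x) (p + 3)) (h3 : 3 ∉ sh (S x) (p + 3)) :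
    S (ψ (p + 4) x) (p + 4) ≠ 0 := by
  intro hq
  have he : S (ψ (p + 4) x) (p + 3) = S x (p + 3) := by
    rw [h.top_first ht hN x (by omega) (by omega), ha, hb, hc]; rfl
  obtain ⟨l1, l2⟩ := h.top_third ht hs hN (x := x) (by omega) (by omega) he
  have n2 := (ht.walk (ψ (p + 4) x)).ne_succ (j := p + 4) (by omega) (by omega)
  have hK := h.top_sh ht hN he
  have hA := (ht.walk x (p + 4) (by omega)).2
  rw [mem_sh_succ] at hA
  simp only [Nat.add_assoc, Nat.reduceAdd] at n2 hA
  rw [ha, hb, hq] at l2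
  rw [ha] at l1
  rw [hq] at n2
  rw [hb, hc] at hA
  have hr : S (ψ (p + 4) x) (p + 5) = 2 := by
    generalize S (ψ (p + 4) x) (p + 5) = r at *
    rcases l2 with l2 | l2
    · unfold tr at l2
      split_ifs at l2 <;> simp only at l2 <;> omega
    · omega
  have h4 : 4 ∉ sh (S x) (p + 3) := fun h4 => hA (Or.inr ⟨by simp, by simpa using h4⟩)
  rw [← hK] at h1 h2 h3 h4
  obtain ⟨⟨q, rfl⟩, s, s1, s2, s3, s4⟩ := exists_far_part ht (he.trans ha) h2 h1 h3 h4
  rw [← sh_neg] at s2 s3 s4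
  have := (h.neg.top_far (p := q) (x := ψ (q + 1 + 4) x) (a := -1) (b := 0) (c := -2) (b' := -2) (c' := 0) ht.neg hs.neg hN
    (by simpa [ha] using he) (by simpa using hq) (by simpa using hr) s2 s3 s4 (by omega) (by omega) (by omega) (by omega)
    (by omega) (by omega) (by omega) rfl (fun _ => by omega) (fun z z1 z2 z3 => by
      have z1' : S z (q + 4) = 1 := by omega
      have z2' : S z (q + 5) = 2 := by omega
      have z3' : S z (q + 6) = 0 := by omega
      have f1 := h.top_first (p := q + 1) ht hN z (by simp [Nat.add_assoc, z1', z2'])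
        (by simp [Nat.add_assoc, z3', z2'])
      have f2 := h.top_second (p := q + 1) ht hs hN (x := z)
        (by simp [Nat.add_assoc, z1', z2']) (by simp [Nat.add_assoc, z3', z2'])
      have f3 := h.no_exception_zero (p := q + 1) ht hs hN (x := z)
      simp only [Nat.add_assoc, Nat.reduceAdd, z1', z2', z3'] at f1 f2 f3
      rw [show (tr 1 2 0).1 = 1 from rfl] at f1
      rw [show (tr 1 2 0).2.1 = 0 from rfl] at f2
      refine ⟨by omega, ?_⟩
      rcases f2 f1 with f2 | ⟨-, -, f4, f5, f6, f7⟩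
      · omega
      · have := f3 trivial trivial trivial f4 f5 f6
        omega)).2
  have hinv := h.inv (q + 1 + 4) (by omega) hN x
  simp only [Nat.add_assoc, Nat.reduceAdd] at hinv hc this
  rw [hinv, hc] at this
  omega

/-- The top map acts correctly on the second of the three letters. -/
theorem top_second_eq (h : Loc N β ψ) (ht : Typed ψ β (p + 4) (p + 5) S) (hs : Separates ψ (p + 4) S)
    (hN : p + 4 < N) {x : A} (hab : S x (p + 3) < S x (p + 4)) (hcb : S x (p + 5) < S x (p + 4))
    (he : S (ψ (p + 4) x) (p + 3) = S x (p + 3)) :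
    S (ψ (p + 4) x) (p + 4) = (tr (S x (p + 3)) (S x (p + 4)) (S x (p + 5))).2.1 := by
  rcases h.top_second ht hs hN hab hcb he with h1 | ⟨h1, h2, h3, h4, h5, ⟨h6, h7⟩ | ⟨h6, h7⟩⟩
  · exact h1
  · exact absurd h7 (h.no_exception_zero ht hs hN h1 h2 h6 h3 h4 h5)
  · exact absurd h7 (h.no_exception_three ht hs hN h1 h2 h6 h3 h4 h5)

theorem top_third_eq (h : Loc N β ψ) (ht : Typed ψ β (p + 4) (p + 5) S) (hs : Separates ψ (p + 4) S)
    (hN : p + 4 < N) {x : A} (hab : S x (p + 3) < S x (p + 4)) (hcb : S x (p + 5) < S x (p + 4))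
    (he : S (ψ (p + 4) x) (p + 3) = S x (p + 3)) :
    S x (p + 3) ≤ S (ψ (p + 4) x) (p + 5) ∧
    S x (p + 4) = (tr (S x (p + 3)) (S (ψ (p + 4) x) (p + 4)) (S (ψ (p + 4) x) (p + 5))).2.1 := by
  obtain ⟨f1, f2⟩ := h.top_flip ht hN hab hcb
  have hinv : ψ (p + 4) (ψ (p + 4) x) = x := h.inv _ (by omega) hN x
  have h2 := h.neg.top_second_eq ht.neg hs.neg hN (x := ψ (p + 4) x) (by simpa using f1) (by simpa using f2)
    (by rw [hinv, he])
  rw [hinv, he, tr_neg, neg_inj] at h2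
  exact ⟨(h.top_third ht hs hN hab hcb he).1, h2⟩

end Loc

theorem exists_tr_of_lt {x y z : ℤ} (h1 : y < x) (h2 : x < -y) (h3 : -y < z) :
    ∃ u v, tr x y z = (x, u, v) ∧ tr x u v = (x, y, z) ∧ (v = y ∨ v = -z) := by
  by_cases hadj : z = -y + 1
  · refine ⟨-y, -z, ?_, ?_, Or.inr rfl⟩
    · rw [tr_neg_right (by omega) (by omega)]
    · rw [tr_neg_right (by omega) (by omega), neg_neg, neg_neg]
  · refine ⟨z, y, ?_, ?_, Or.inl rfl⟩
    · rw [tr_swap_right (by omega) (by omega) (by omega)]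
    · rw [tr_swap_right (by omega) (by omega) (by omega)]

namespace Loc

theorem top_end (h : Loc N β ψ) (ht : Typed ψ β (p + 4) (p + 5) S) (hs : Separates ψ (p + 4) S)
    (hN : p + 4 < N) {a b c : ℤ} (hab : a < b) (hca : c ≤ a) {z : A} {b' c' : ℤ} (htr : tr a b c = (a, b', c'))
    (hb : b' < a) (hc : b' < c') (htr' : tr a b' c' = (a, b, c))
    (h1 : S z (p + 3) = a) (h2 : S z (p + 4) = b') (h3 : S z (p + 5) = c') :
    S (ψ (p + 4) z) (p + 3) = a ∧ S (ψ (p + 4) z) (p + 4) = b := by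
  have f1 := h.neg.top_first ht.neg hN z (by simp [h1, h2, hb]) (by simp [h3, h2, hc])
  simp only [tr_neg, h1, h2, h3, htr', neg_inj] at f1
  have f2 := h.neg.top_second_eq ht.neg hs.neg hN (x := z) (by simp [h1, h2, hb]) (by simp [h3, h2, hc])
    (by simp [f1, h1])
  simp only [tr_neg, h1, h2, h3, htr', neg_inj] at f2
  exact ⟨f1, f2⟩

theorem no_wrong_far (h : Loc N β ψ) (ht : Typed ψ β (p + 4) (p + 5) S) (hs : Separates ψ (p + 4) S)
    (hN : p + 4 < N) {x : A} {a b : ℤ} (hb1 : 1 ≤ b) (hab : a < b) (hca : -(b - 1) ≤ a)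
    (ha : S x (p + 3) = a) (hb : S x (p + 4) = b) (hc : S x (p + 5) = -(b - 1))
    (hq : S (ψ (p + 4) x) (p + 4) = -b) (hH : sh (S (ψ (p + 4) x)) (p + 4) = sh (S x) (p + 4))
    (hs' : ∃ s ∈ sh (S x) (p + 4), b.natAbs + 3 ≤ s) : S (ψ (p + 4) x) (p + 5) ≠ b + 1 := by
  intro hr
  obtain ⟨s, s1, s2, s3⟩ := exists_least_above hs'
  have hsum := ((ht.walk x).mono (show p + 4 ≤ p + 5 by omega)).sum_sh
  have hbH := ((ht.walk x).removable (show p + 3 < p + 5 by omega)).1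
  have hA := (ht.walk (ψ (p + 4) x) (p + 4) (by omega)).2
  simp only [Nat.add_assoc, Nat.reduceAdd] at hA hbH
  rw [hb] at hbH
  rw [hr, hH] at hA
  have := add_le_sum_of_mem s1 hbH (by omega)
  have hbA := (ht.walk x (p + 3) (by omega)).2
  have hm := fun j => mem_sh_pred (ht.walk x (p + 2) (by omega)) (j := j)
  have hm' := fun j => mem_sh_pred (ht.walk x (p + 3) (by omega)) (j := j)
  rw [show S x (p + 2 + 1) = a from ha] at hm
  rw [show S x (p + 3 + 1) = b from hb] at hm' hbA
  have n1 := (ht.walk x).ne_succ (j := p + 3) (by omega) (by omega)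
  simp only [Nat.add_assoc, Nat.reduceAdd] at hbA hm hm' n1
  rw [ha, hb] at n1
  obtain ⟨q, rfl⟩ : ∃ q, p = q + 1 := ⟨p - 1, by omega⟩
  have hne : ∀ j, b.natAbs + 1 ≤ j → j < s → j ∉ sh (S x) (q + 1 + 2) := fun j j1 j2 j3 => by
    have j4 := (hm j).1 j3
    obtain rfl | rfl | j5 : j = b.natAbs + 1 ∨ j = b.natAbs + 2 ∨ b.natAbs + 3 ≤ j := by omega
    · rcases j4.2.2 with j6 | j6
      · omega
      · exact hbA j6
    · rcases j4.2.2 with j6 | j6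
      · omega
      · rw [hm'] at j6
        exact hA (by rw [show (b + 1).natAbs + 1 = b.natAbs + 2 by omega]; exact j6.2.2.resolve_left (by omega))
    · rcases j4.2.2 with j6 | j6
      · omega
      · rw [hm'] at j6
        exact s3 j j5 j2 (j6.2.2.resolve_left (by omega))
  have htr : tr a b (-(b - 1)) = (a, -b, b - 1) := by
    rcases eq_or_lt_of_le hca with e | e
    · have t := (ht.walk x).tie (p := q + 1 + 2) (by omega)
      simp only [Nat.add_assoc, Nat.reduceAdd] at t hc ha hb
      rw [hc, ha, hb] at t
      rw [← e, tr_tie (by omega)]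
      ext <;> simp only
      omega
    · rw [tr_neg_right (by omega) (by omega), neg_neg]
  have htr' : tr a (-b) (b - 1) = (a, b, -(b - 1)) := by
    rcases eq_or_lt_of_le hca with e | e
    · have t := (ht.walk x).tie (p := q + 1 + 2) (by omega)
      simp only [Nat.add_assoc, Nat.reduceAdd] at t hc ha hb
      rw [hc, ha, hb] at t
      have h0 : a = 0 := by omega
      have h1 : b = 1 := by omega
      subst h0 h1
      rfl
    · have t := (ht.walk x).tie (p := q + 1 + 2) (by omega)
      simp only [Nat.add_assoc, Nat.reduceAdd] at t hc ha hb
      rw [hc, ha, hb] at t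
      rcases eq_or_lt_of_le (show a ≤ b - 1 by omega) with e' | e'
      · omega
      · rw [tr_neg_right (by omega) (by omega), neg_neg]
  have := (h.top_far (p := q) (s := s) (a := a) (b := b) (c := -(b - 1)) (b' := -b) (c' := b - 1) ht hs hN
    ha hb hc ?_ (hne _ (by omega) (by omega)) (hne _ (by omega) (by omega)) (by omega) (by omega) (by omega)
    (by omega) (by omega) (by omega) (by omega) htr (fun _ => by omega) (fun z z1 z2 z3 =>
      h.top_end (p := q + 1) ht hs hN hab hca htr (by omega) (by omega) htr' z1 z2 z3)).2
  · simp only [Nat.add_assoc, Nat.reduceAdd] at hr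
    omega
  · rw [hm]
    refine ⟨by omega, by omega, Or.inr ?_⟩
    rw [hm']
    exact ⟨by omega, by omega, Or.inr s1⟩

theorem no_wrong_near (h : Loc N β ψ) (ht : Typed ψ β (p + 4) (p + 5) S) (hs : Separates ψ (p + 4) S)
    (hN : p + 4 < N) {x : A} {a b : ℤ} (hb3 : 3 ≤ b) (hab : a < b) (hca : -(b + 1) ≤ a)
    (ha : S x (p + 3) = a) (hb : S x (p + 4) = b) (hc : S x (p + 5) = -(b + 1))
    (he : S (ψ (p + 4) x) (p + 3) = a)
    (hb1 : b.natAbs - 1 ∈ sh (S x) (p + 4))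
    (hs' : ∀ s ∈ sh (S x) (p + 4), s ≤ b.natAbs + 2) : S (ψ (p + 4) x) (p + 5) ≠ b - 1 := by
  intro hr
  have hm' := fun j => mem_sh_pred (ht.walk x (p + 3) (by omega)) (j := j)
  have hbA := (ht.walk x (p + 3) (by omega))
  have n1 := (ht.walk x).ne_succ (j := p + 3) (by omega) (by omega)
  have n3 := (ht.walk x).ne_succ (j := p + 4) (by omega) (by omega)
  have t2 := (ht.walk x).tie (p := p + 2) (by omega)
  have hcA := (ht.walk x (p + 4) (by omega)).2
  rw [show S x (p + 3 + 1) = b from hb] at hm' hbA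
  simp only [Nat.add_assoc, Nat.reduceAdd] at hm' hbA n1 n3 t2 hcA
  rw [ha, hb] at n1
  rw [hb, hc] at n3
  rw [ha, hb, hc] at t2
  rw [hc] at hcA
  have h0 := zero_notMem_sh (S x) (p + 3)
  have hbK : b.natAbs ∈ sh (S x) (p + 3) := hbA.1.resolve_left (by omega)
  have hb1K : b.natAbs - 1 ∈ sh (S x) (p + 3) := by
    rw [hm']; exact ⟨by omega, by omega, Or.inr hb1⟩
  have hsum := ((ht.walk x).mono (show p + 3 ≤ p + 5 by omega)).sum_sh
  have hpos := add_le_sum_of_mem hbK hb1K (by omega)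
  have hmax : ∀ j ∈ sh (S x) (p + 3), j ≤ b.natAbs := fun j hj => by
    by_contra hcon
    rw [hm'] at hj
    obtain ⟨-, j1, j2 | j2⟩ := hj
    · omega
    · have := hs' j j2
      refine hcA ?_
      rwa [show (-(b + 1)).natAbs + 1 = j by omega]
  obtain ⟨f, f1, f2, f3, f4⟩ := exists_run_bottom h0 hb1K
  have hrun : ∀ j, f < j → j ≤ b.natAbs → j ∈ sh (S x) (p + 3) := fun j j1 j2 => by
    rcases Nat.lt_or_ge (b.natAbs - 1) j with j3 | j3
    · rwa [show j = b.natAbs by omega]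
    · exact f4 j j1 j3
  have htr : ∀ v, -(b + 1) < v → v < b → tr v b (-(b + 1)) = (v, -b, b + 1) := fun v v1 v2 => by
    rw [tr_neg_right (by omega) (by omega), neg_neg]
  have htr' : ∀ v, -b < v → v < b → tr v (-b) (b + 1) = (v, b, -(b + 1)) := fun v v1 v2 => by
    rw [tr_neg_right (by omega) (by omega), neg_neg]
  have hca' : -(b + 1) < a := by omega
  -- move the first of the three letters to `-f`
  obtain ⟨x1, r1, l3, l4, l5, l6⟩ : ∃ z, Reach ψ (p + 3) x z ∧ S z (p + 3) = -(f : ℤ) ∧ S z (p + 4) = b ∧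
      S z (p + 5) = -(b + 1) ∧ S (ψ (p + 4) z) (p + 5) = b - 1 := by
    by_cases haf : a = -(f : ℤ)
    · exact ⟨x, Relation.ReflTransGen.refl, ha.trans haf, hb, hc, hr⟩
    · obtain ⟨z, k1, k2, k3, k4, -, -, k5⟩ := h.top_move ht hs hN (x := x) (v := -(f : ℤ)) (by omega)
        (by omega) (by omega) ⟨by simpa using f2, by simpa using f3⟩ (by omega)
        (by rw [ha, hb, hc, htr a hca' hab]; simp only; omega)
        (by
          rw [ha]
          by_cases e : (-(f : ℤ)).natAbs = a.natAbs
          · exact Or.inr ⟨by omega, Or.inr (hrun _ (by omega) (by omega))⟩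
          · exact Or.inl e)
      exact ⟨z, k1, k2, by omega, by omega, by omega⟩
  obtain ⟨q, rfl⟩ : ∃ q, p = q + 1 := ⟨p - 1, by omega⟩
  have hK1 : sh (S x1) (q + 1 + 3) = sh (S x) (q + 1 + 3) := ht.reach_sh (by omega) r1 le_rfl (by omega)
  obtain ⟨K, hK⟩ : ∃ K, sh (S x) (q + 1 + 3) = K := ⟨_, rfl⟩
  rw [hK] at hK1 hrun h0 f2 f3 hmax
  have hend : ∀ z, S z (q + 4) = -(f : ℤ) → S z (q + 5) = -b → S z (q + 6) = b + 1 →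
      S (ψ (q + 5) z) (q + 4) = -(f : ℤ) ∧ S (ψ (q + 5) z) (q + 5) = b := fun z z1 z2 z3 =>
    h.top_end (p := q + 1) ht hs hN (by omega) (by omega) (htr _ (by omega) (by omega)) (by omega) (by omega)
      (htr' _ (by omega) (by omega)) z1 z2 z3
  have fin : ∀ (z : A) (u1 u2 u3 s t u v : ℤ), Reach ψ (q + 3) x1 z → S z (q + 1) = u1 → S z (q + 2) = u2 →
      S z (q + 3) = u3 → tr u1 u2 u3 = (u1, s, t) → tr u1 s t = (u1, u2, u3) → tr u2 u3 b = (u2, u, v) →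
      tr u2 u v = (u2, u3, b) → -(f : ℤ) < t → t.natAbs + 1 < b → -b < u3 → u3 < -(f : ℤ) → -b < s → s < t →
      -(b + 1) < v → v < -(f : ℤ) → False := by
    intro z u1 u2 u3 s t u v hr2 e1 e2 e3 g1 g2 g3 g4 g5 g6 g7 g8 g9 g10 g11 g12
    have hl : ∀ j, q + 3 < j → j ≤ q + 6 → S z j = S x1 j :=
      fun j h1 h2 => ht.reach_letter (by omega) hr2 h1 h2
    have hr' := h.top_reach (p := q + 1) hN hr2
    have hw : Window ψ S q z z u1 u2 u3 (-(f : ℤ)) b (-(b + 1)) :=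
      ⟨Relation.ReflTransGen.refl, e1, e2, e3, by rw [hl _ (by omega) (by omega)]; exact l3,
        by rw [hl _ (by omega) (by omega)]; exact l4, by rw [hl _ (by omega) (by omega)]; exact l5⟩
    have := h.loop_near ht hs hN hw hb3 g1 g2 g3 g4 g5 g6 (by omega) g7 g8 g9 g10 g11 g12 hend
    have h6 := ht.reach_letter (by omega) hr' (j := q + 6) (by omega) (by omega)
    simp only [Nat.add_assoc, Nat.reduceAdd] at l6 h6
    omega
  rcases Nat.eq_zero_or_pos f with rfl | hf
  · obtain ⟨x2, r2, m2, -, -, k2⟩ := ht.exists_pred (p := q + 1 + 2) (by omega) l3 (w := -1) (by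
      rw [hK1]
      have := hrun 2 (by omega) (by omega)
      simp [Removable, mem_rmv, this])
    rw [hK1] at k2
    obtain ⟨x3, r3, m3, n3, -, k3⟩ := ht.exists_pred (p := q + 2) (by omega) m2 (w := 2) (by
      have := hrun 3 (by omega) (by omega)
      rw [show q + 2 + 1 = q + 1 + 2 by omega, k2]
      simp [Removable, mem_rmv, this])
    rw [show q + 2 + 1 = q + 1 + 2 by omega, k2] at k3
    obtain ⟨x4, r4, m4, n4, n4', -⟩ := ht.exists_pred (p := q + 1) (by omega) m3 (w := 0) (by
      rw [show q + 1 + 1 = q + 2 by omega, k3]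
      simp [Removable, mem_rmv])
    have g3 : tr 2 (-1) b = (2, b, -1) := tr_swap_right (Or.inl ⟨by omega, by omega⟩) (by omega) (by omega)
    have g4 : tr 2 b (-1) = (2, -1, b) := tr_swap_right (Or.inr ⟨by omega, by omega⟩) (by omega) (by omega)
    exact fin x4 0 2 (-1) (-2) 1 b (-1) ((r2.trans (r3.mono (by omega))).trans (r4.mono (by omega))) m4 n4
      (by rw [n4' _ (by omega) (by omega)]; exact n3) rfl rfl g3 g4 (by omega) (by omega) (by omega) (by omega) (by omega)
      (by omega) (by omega) (by omega)
  · obtain ⟨x2, r2, m2, -, -, k2⟩ := ht.exists_pred (p := q + 1 + 2) (by omega) l3 (w := -((f + 1 : ℕ) : ℤ)) (by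
      rw [hK1]
      have := hrun (f + 2) (by omega) (by omega)
      simp only [Removable, mem_rmv, Int.natAbs_neg, Int.natAbs_natCast]
      refine ⟨⟨by omega, Or.inr ⟨by omega, this⟩⟩, by omega⟩)
    rw [hK1] at k2
    obtain ⟨G, hG⟩ : ∃ G, sh (S x2) (q + 1 + 2) = G := ⟨_, rfl⟩
    have hmG : ∀ j, j ∈ rmv G (-((f + 1 : ℕ) : ℤ)) ↔ j ≠ 0 ∧ (j = f ∨ j = f + 1 ∨ (j ≠ f + 2 ∧ j ∈ K)) := by
      intro j
      rw [← hG, k2]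
      simp only [mem_rmv, Int.natAbs_neg, Int.natAbs_natCast]
      by_cases hj : j = f + 1
      · subst hj; simp
      · simp only [hj, false_or, not_false_eq_true, true_and, ne_eq]
        by_cases hj2 : j = f
        · subst hj2; simp; omega
        · simp [hj2]; tauto
    obtain ⟨g, g1, g2, g3, g4⟩ := exists_run_bottom (G := rmv G (-((f + 1 : ℕ) : ℤ))) (p := f)
      (by rw [hmG]; omega) (by rw [hmG]; omega)
    obtain ⟨x3, r3, m3, n3, -, k3⟩ := ht.exists_pred (p := q + 2) (by omega) m2 (w := (g : ℤ)) (by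
      rw [show q + 2 + 1 = q + 1 + 2 by omega, hG]
      exact ⟨by simpa using g2, by simpa using g3⟩)
    rw [show q + 2 + 1 = q + 1 + 2 by omega, hG] at k3
    have hg2 : g + 2 ∈ rmv G (-((f + 1 : ℕ) : ℤ)) := by
      rcases Nat.lt_or_ge f (g + 2) with e | e
      · rw [hmG]; omega
      · exact g4 _ (by omega) e
    obtain ⟨x4, r4, m4, n4, n4', -⟩ := ht.exists_pred (p := q + 1) (by omega) m3 (w := -((g + 1 : ℕ) : ℤ)) (by
      rw [show q + 1 + 1 = q + 2 by omega, k3]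
      simp only [Removable, mem_rmv (K := rmv G _), Int.natAbs_neg, Int.natAbs_natCast]
      exact ⟨⟨by omega, Or.inr ⟨by omega, hg2⟩⟩, by omega⟩)
    obtain ⟨w, hw⟩ : ∃ w : ℤ, w = -((f + 1 : ℕ) : ℤ) := ⟨_, rfl⟩
    obtain ⟨y, hy⟩ : ∃ y : ℤ, y = -((g + 1 : ℕ) : ℤ) := ⟨_, rfl⟩
    rw [← hw] at n3 m2
    rw [← hy] at m4
    have hgw : tr y g w = (y, w, (g : ℤ)) := tr_swap_right (by omega) (by omega) (by omega)
    have hwg : tr y w g = (y, (g : ℤ), w) := tr_swap_right (by omega) (by omega) (by omega)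
    obtain ⟨u, v, e1, e2, e3⟩ : ∃ u v, tr (g : ℤ) w b = ((g : ℤ), u, v) ∧
        tr (g : ℤ) u v = ((g : ℤ), w, b) ∧ (v = w ∨ v = -b) :=
      exists_tr_of_lt (by omega) (by omega) (by omega)
    exact fin x4 y g w w g u v ((r2.trans (r3.mono (by omega))).trans (r4.mono (by omega))) m4 n4
      (by rw [n4' _ (by omega) (by omega)]; exact n3) hgw hwg e1 e2 (by omega) (by omega) (by omega) (by omega)
      (by omega) (by omega) (by omega) (by omega)

/-- The last two of four letters that build the parts `1, 3`. -/
theorem letters_three_one (ht : Typed ψ β 4 5 S) {z : A} (hz : ∀ j, j ∈ sh (S z) 4 ↔ j = 1 ∨ j = 3) :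
    ((S z 3 = 2 ∨ S z 3 = -2) ∧ S z 4 = 0) ∨ (S z 3 = 0 ∧ (S z 4 = 2 ∨ S z 4 = -2)) := by
  have h4 := (ht.walk z).removable (show 3 < 5 by omega)
  have h3 := (ht.walk z).removable (show 2 < 5 by omega)
  have hm := fun j => mem_sh_pred (ht.walk z 3 (by omega)) (j := j)
  simp only [Nat.reduceAdd] at h3 h4 hm
  obtain ⟨h5, h6⟩ := h4
  obtain ⟨h7, h8⟩ := h3
  rw [hz] at h5 h6
  rw [hm, hz] at h7 h8
  omega

theorem no_wrong_small (h : Loc N β ψ) (ht : Typed ψ β 4 5 S) (hs : Separates ψ 4 S)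
    (hN : 4 < N) {x : A} (hx : ∀ j, j ∈ sh (S x) 4 ↔ j = 1 ∨ j = 3) (ha : S x 3 = 0) (hb : S x 4 = 2)
    (hc : S x 5 = -3) (ha' : S (ψ 4 x) 3 = 0) (hb' : S (ψ 4 x) 4 = -2) : S (ψ 4 x) 5 ≠ 1 := by
  intro hr
  obtain ⟨y, hy⟩ : ∃ y, ψ 4 x = y := ⟨_, rfl⟩
  have hyx : ψ 4 y = x := by rw [← hy]; exact h.inv 4 (by omega) hN x
  rw [hy] at ha' hb' hr
  have hy4 : ∀ j, j ∈ sh (S y) 4 ↔ j = 1 ∨ j = 3 := by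
    intro j
    rw [← hx j]
    have e2 : sh (S y) 2 = sh (S x) 2 := sh_congr (fun j h1 h2 => by
      rw [← hy]; exact h.top_low (p := 0) ht hN x h1 h2)
    simp only [sh, Nat.reduceAdd] at e2 ⊢
    rw [ha', hb', ha, hb, e2, mv_congr_natAbs (c := -2) (c' := 2) (by omega)]
  have hbits : ∀ z, (β 3 z ↔ S z 3 < S z 4) ∧ (β 4 z ↔ S z 4 < S z 5) := fun z =>
    ⟨ht.bit z 3 (by omega) (by omega), ht.bit z 4 (by omega) (by omega)⟩
  have hfix : ∀ z, (S z 3 < S z 4 ↔ S z 4 < S z 5) → ψ 4 z = z := fun z hz =>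
    h.fix 2 hN z (by rw [(hbits z).1, (hbits z).2]; exact hz)
  have l5 : ∀ z w, Reach ψ 4 z w → S w 5 = S z 5 := fun z w hr =>
    ht.reach_letter le_rfl hr (by omega) le_rfl
  have hsh : ∀ z w, Reach ψ 4 z w → sh (S w) 4 = sh (S z) 4 := fun z w hr =>
    ht.reach_sh le_rfl hr le_rfl (by omega)
  have stepA : ∀ z, Reach ψ 4 y z → Reach ψ 4 y (ψ 4 z) ∨ Reach ψ 4 x (ψ 4 z) := by
    intro z hz
    have e5 := l5 _ _ hz
    rw [hr] at e5
    rcases letters_three_one ht (z := z) (by rw [hsh _ _ hz]; exact hy4) with ⟨e3 | e3, e4⟩ | ⟨e3, e4 | e4⟩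
    · left
      have f := h.neg.top_first (p := 0) ht.neg hN z (by simp [e3, e4]) (by simp [e4, e5])
      have g := h.neg.top_of_ne (p := 0) ht.neg hN z (by simp [e3, e4]) (by simp [e4, e5])
      simp only [Nat.zero_add, e3, e4, e5] at f g
      rw [show (tr (-2) (-0) (-1)).1 = 0 from rfl] at f
      exact hz.trans (g (by omega)).2.2
    · left; rwa [hfix z (by omega)]
    · left
      have f := h.top_first (p := 0) ht hN z (by simp [e3, e4]) (by simp [e4, e5])
      have g := h.top_of_ne (p := 0) ht hN z (by simp [e3, e4]) (by simp [e4, e5])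
      simp only [Nat.zero_add, e3, e4, e5] at f g
      rw [show (tr 0 2 1).1 = 2 from rfl] at f
      exact hz.trans (g (by omega)).2.2
    · right
      have := h.top_congr (p := 0) ht hs hN hz (by simp [ha', e3]) (by simp [hb', e4])
      simp only [Nat.zero_add, hyx] at this
      exact this.mono (by omega)
  have stepB : ∀ z, Reach ψ 4 x z → S (ψ 4 z) 5 ≠ 3 := by
    intro z hz
    have e5 := l5 _ _ hz
    rw [hc] at e5
    rcases letters_three_one ht (z := z) (by rw [hsh _ _ hz]; exact hx) with ⟨e3 | e3, e4⟩ | ⟨e3, e4 | e4⟩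
    · rw [hfix z (by omega)]; omega
    · have := (h.top_swap (p := 0) ht hs hN e3 e4 e5 (by omega) (by omega) (by omega) (by omega) (by omega)).2.2
      simp only [Nat.zero_add] at this
      omega
    · have := h.top_congr (p := 0) ht hs hN hz (by simp [ha, e3]) (by simp [hb, e4])
      simp only [Nat.zero_add, hy] at this
      rw [l5 _ _ (this.mono (by omega))]
      omega
    · rw [hfix z (by omega)]; omega
  have path : ∀ (l : List ℕ), (∀ i ∈ l, i ≤ 4 ∧ i ≠ 1) → ∀ c, l.count 4 ≤ c → c ≤ 2 → ∀ z,
      (2 ≤ c → Reach ψ 4 y z) → (1 ≤ c → Reach ψ 4 y z ∨ Reach ψ 4 x z) → S z 5 ≠ 3 →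
      S (l.foldl (fun a i => ψ i a) z) 5 ≠ 3 := by
    intro l
    induction l with
    | nil => intro _ c _ _ z _ _ h3; exact h3
    | cons i l ih =>
      intro hl c hcount hc2 z q2 q1 q0
      have hi := hl i List.mem_cons_self
      have hl' : ∀ i ∈ l, i ≤ 4 ∧ i ≠ 1 := fun j hj => hl j (List.mem_cons_of_mem _ hj)
      rw [List.foldl_cons]
      by_cases h4 : i = 4
      · subst h4
        rw [List.count_cons_self] at hcount
        obtain ⟨c, rfl⟩ : ∃ d, c = d + 1 := ⟨c - 1, by omega⟩
        refine ih hl' c (by omega) (by omega) _ (fun h2 => by omega) (fun h1 => stepA z (q2 (by omega))) ?_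
        rcases q1 (by omega) with q1 | q1
        · rcases stepA z q1 with q3 | q3
          · rw [l5 _ _ q3]; omega
          · rw [l5 _ _ q3]; omega
        · exact stepB z q1
      · rw [List.count_cons_of_ne h4] at hcount
        have hg : Reach ψ 4 z (ψ i z) := Reach.step z ⟨by omega, hi.2, by omega⟩
        refine ih hl' c hcount hc2 _ (fun h2 => (q2 h2).trans hg)
          (fun h1 => (q1 h1).imp (fun h => h.trans hg) (fun h => h.trans hg)) ?_
        rwa [l5 _ _ hg]
  -- a path with three top edges
  obtain ⟨x1, r1, m1⟩ := ht.exists_letter le_rfl x (w := 0)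
    ⟨by rw [hx]; simp, by rw [hx]; simp⟩
  have k1 : sh (S x1) 4 = sh (S x) 4 := ht.reach_sh le_rfl r1 le_rfl (by omega)
  obtain ⟨x2, r2, m2, n2, n2', -⟩ := ht.exists_pred (p := 3) (by omega) m1 (w := -2)
    (by simp only [Nat.reduceAdd, k1, Removable, mem_rmv, hx]; simp)
  have n5 : S x2 5 = -3 := by rw [n2' _ (by omega) le_rfl, l5 _ _ r1, hc]
  obtain ⟨t3, t4, t5⟩ := h.top_swap (p := 0) ht hs hN m2 n2 n5 (by omega) (by omega) (by omega) (by omega)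
    (by omega)
  simp only [Nat.zero_add] at t3 t4 t5
  have k2 : ∀ j, j ∈ sh (S (ψ 4 x2)) 4 ↔ j = 4 := by
    have hx2 : sh (S x2) 4 = sh (S x) 4 := (hsh _ _ (r2.mono (by omega))).trans k1
    have hm := fun j => mem_sh_pred (ht.walk x2 3 (by omega)) (j := j)
    have e3 := h.top_sh (p := 0) ht hN (x := x2) (by simp [t3, m2])
    intro j
    simp only [Nat.zero_add] at e3
    simp only [Nat.reduceAdd] at hm
    rw [mem_sh_succ, e3, hm, hx2, hx, show S (ψ 4 x2) (3 + 1) = -3 from t4, n2]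
    omega
  obtain ⟨x3, r3, m3⟩ := ht.exists_letter le_rfl (ψ 4 x2) (w := 3)
    ⟨by rw [k2]; simp, by rw [k2]; simp⟩
  have k3 : sh (S x3) 4 = sh (S (ψ 4 x2)) 4 := ht.reach_sh le_rfl r3 le_rfl (by omega)
  obtain ⟨x4, r4, m4, n4, n4', -⟩ := ht.exists_pred (p := 3) (by omega) m3 (w := 2)
    (by simp only [Nat.reduceAdd, k3, Removable, mem_rmv, k2]; simp)
  have p5 : S x4 5 = 0 := by rw [n4' _ (by omega) le_rfl, l5 _ _ r3, t5]
  have hend := (h.top_swap (p := 0) ht hs hN m4 n4 p5 (by omega) (by omega) (by omega) (by omega)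
    (by omega)).2.2
  simp only [Nat.zero_add] at hend
  have g4 : ∀ z, Reach ψ 5 z (ψ 4 z) := fun z => Reach.step z ⟨by omega, by omega, by omega⟩
  obtain ⟨l, hl, hcount, hfold⟩ := h.two_edge 4 (by omega) hN y (ψ 4 x4)
    ((((((hyx ▸ g4 y).trans (r1.mono (by omega))).trans (r2.mono (by omega))).trans (g4 x2)).trans
      (r3.mono (by omega))).trans (r4.mono (by omega)) |>.trans (g4 x4))
  refine path l hl 2 hcount le_rfl y (fun _ => Relation.ReflTransGen.refl)
    (fun _ => Or.inl Relation.ReflTransGen.refl) (by omega) ?_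
  rw [hfold, hend]

theorem no_wrong_toggle (h : Loc N β ψ) (ht : Typed ψ β (p + 4) (p + 5) S) (hs : Separates ψ (p + 4) S)
    (hN : p + 4 < N) {x : A} {a b : ℤ} (hb1 : 1 ≤ b) (hab : a < b) (hca : -(b + 1) ≤ a)
    (ha : S x (p + 3) = a) (hb : S x (p + 4) = b) (hc : S x (p + 5) = -(b + 1))
    (he : S (ψ (p + 4) x) (p + 3) = a) (hq : S (ψ (p + 4) x) (p + 4) = -b) :
    S (ψ (p + 4) x) (p + 5) ≠ b - 1 := by
  intro hr
  have hinv : ψ (p + 4) (ψ (p + 4) x) = x := h.inv _ (by omega) hN x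
  have hf := (h.top_third ht hs hN (x := x) (by omega) (by omega) (by omega)).1
  have hsh : sh (S (ψ (p + 4) x)) (p + 4) = sh (S x) (p + 4) := by
    have := h.top_sh ht hN (x := x) (by omega)
    change mv (sh (S (ψ (p + 4) x)) (p + 3)) (S (ψ (p + 4) x) (p + 4)) = mv (sh (S x) (p + 3)) (S x (p + 4))
    rw [this]
    exact mv_congr_natAbs (by omega)
  by_cases hfar : ∃ s ∈ sh (S x) (p + 4), b.natAbs + 3 ≤ s
  · refine h.neg.no_wrong_far ht.neg hs.neg hN (x := ψ (p + 4) x) (a := -a) (b := b) hb1 ?_ (by omega) (by omega)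
      (by omega) (by omega) (by rw [hinv]; omega) ?_ ?_ (by rw [hinv]; omega)
    · have := (h.top_flip ht hN (x := x) (by omega) (by omega)).1; omega
    · rw [hinv, sh_neg, sh_neg, hsh]
    · rw [sh_neg, hsh]; exact hfar
  push Not at hfar
  have hmax : ∀ s ∈ sh (S x) (p + 4), s ≤ b.natAbs + 2 := fun s hs => by have := hfar s hs; omega
  have hA := ht.walk (ψ (p + 4) x) (p + 4) (by omega)
  rw [hsh, show S (ψ (p + 4) x) (p + 4 + 1) = b - 1 from hr] at hA
  have hR := (ht.walk x).removable (show p + 3 < p + 5 by omega)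
  rw [show S x (p + 3 + 1) = b from hb, show p + 3 + 1 = p + 4 from rfl] at hR
  have hcA := (ht.walk x (p + 4) (by omega)).2
  rw [show S x (p + 4 + 1) = -(b + 1) from hc] at hcA
  have h0 := zero_notMem_sh (S x) (p + 4)
  have hsum := ((ht.walk x).mono (show p + 4 ≤ p + 5 by omega)).sum_sh
  rcases lt_trichotomy b 2 with hb2 | rfl | hb2
  · obtain rfl : b = 1 := by omega
    have hR2 : 1 ∉ sh (S x) (p + 4) := hR.2
    have hc2 : 3 ∉ sh (S x) (p + 4) := hcA
    have : sh (S x) (p + 4) ⊆ {2} := fun j hj => by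
      have := hmax j hj
      have h1 : j ≠ 0 := fun e => h0 (e ▸ hj)
      have h2 : j ≠ 1 := fun e => hR2 (e ▸ hj)
      have h3 : j ≠ 3 := fun e => hc2 (e ▸ hj)
      simp only [Finset.mem_singleton]
      simp at this
      omega
    have := Finset.sum_le_sum_of_subset (f := fun l => l) this
    simp only [Finset.sum_singleton] at this
    omega
  · have hx : ∀ j, j ∈ sh (S x) (p + 4) ↔ j = 1 ∨ j = 3 := by
      have h1 : 1 ∈ sh (S x) (p + 4) := hA.1.resolve_left (by omega)
      have h3 : 3 ∈ sh (S x) (p + 4) := hR.1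
      have hR2 : 2 ∉ sh (S x) (p + 4) := hR.2
      have hc2 : 4 ∉ sh (S x) (p + 4) := hcA
      refine fun j => ⟨fun hj => ?_, fun hj => by rcases hj with rfl | rfl <;> assumption⟩
      have := hmax j hj
      have h1 : j ≠ 0 := fun e => h0 (e ▸ hj)
      have h2 : j ≠ 2 := fun e => hR2 (e ▸ hj)
      have h3 : j ≠ 4 := fun e => hc2 (e ▸ hj)
      simp at this
      omega
    have e : sh (S x) (p + 4) = {1, 3} := by ext j; rw [hx]; simp
    rw [e] at hsum
    simp at hsum
    obtain rfl : p = 0 := by omega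
    have e3 : a = 0 := by
      rcases letters_three_one ht (by simpa using hx) with h1 | h1 <;> simp only [Nat.zero_add] at ha hb h1 <;> omega
    subst e3
    exact h.no_wrong_small ht hs hN (by simpa using hx) ha hb hc he hq hr
  · refine h.no_wrong_near ht hs hN (by omega) hab hca ha hb hc he ?_ hmax hr
    have := hA.1.resolve_left (by omega)
    rwa [show (b - 1).natAbs = b.natAbs - 1 by omega] at this

theorem top_up (h : Loc N β ψ) (ht : Typed ψ β (p + 4) (p + 5) S) (hs : Separates ψ (p + 4) S)
    (hN : p + 4 < N) {x : A} (hab : S x (p + 3) < S x (p + 4)) (hcb : S x (p + 5) < S x (p + 4)) :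
    (S (ψ (p + 4) x) (p + 3), S (ψ (p + 4) x) (p + 4), S (ψ (p + 4) x) (p + 5)) =
      tr (S x (p + 3)) (S x (p + 4)) (S x (p + 5)) := by
  have f1 := h.top_first ht hN x hab hcb
  by_cases he : S (ψ (p + 4) x) (p + 3) = S x (p + 3)
  swap
  · obtain ⟨f2, f3, -⟩ := h.top_of_ne ht hN x hab hcb he
    rw [f1, f2, f3]
  have f2 := h.top_second_eq ht hs hN hab hcb he
  obtain ⟨f3, f4⟩ := h.top_third_eq ht hs hN hab hcb he
  have hca := h.top_le ht hN hab hcb he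
  have n2 := (ht.walk x).ne_succ (j := p + 3) (by omega) (by omega)
  have n3 := (ht.walk x).ne_succ (j := p + 4) (by omega) (by omega)
  have t2 := (ht.walk x).tie (p := p + 2) (by omega)
  have n2' := (ht.walk (ψ (p + 4) x)).ne_succ (j := p + 3) (by omega) (by omega)
  have n3' := (ht.walk (ψ (p + 4) x)).ne_succ (j := p + 4) (by omega) (by omega)
  have t2' := (ht.walk (ψ (p + 4) x)).tie (p := p + 2) (by omega)
  have hfl := h.top_flip ht hN hab hcb
  have w1 := h.no_wrong_toggle ht hs hN (x := x) (a := S x (p + 3)) (b := S x (p + 4))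
  have w2 := h.neg.no_wrong_toggle ht.neg hs.neg hN (x := ψ (p + 4) x) (a := -S x (p + 3)) (b := S x (p + 4))
  have hinv : ψ (p + 4) (ψ (p + 4) x) = x := h.inv _ (by omega) hN x
  rw [hinv] at w2
  rw [he] at n2' t2' hfl w1 w2 ⊢
  simp only [Nat.add_assoc, Nat.reduceAdd] at n2 n3 t2 n2' n3' t2'
  generalize S (ψ (p + 4) x) (p + 4) = q at *
  generalize S (ψ (p + 4) x) (p + 5) = r at *
  generalize S x (p + 3) = a at *
  generalize S x (p + 4) = b at *
  generalize S x (p + 5) = c at *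
  clear he f1 hs ht h
  by_cases hadj : b.natAbs = c.natAbs + 1 ∨ c.natAbs = b.natAbs + 1
  · have htr : tr a b c = (a, -b, -c) := by
      rcases eq_or_lt_of_le hca with e | e
      · subst e
        rw [tr_tie (by omega)]
        ext <;> simp only
        omega
      · rw [tr_neg_right (by omega) (by omega)]
    rw [htr] at f2 ⊢
    simp only at f2
    subst f2
    have hr : r = -c ∨ (c = -(b + 1) ∧ r = b - 1) ∨ (c = -(b - 1) ∧ r = b + 1) := by
      clear w1 w2 htr
      unfold tr at f4
      split_ifs at f4 <;> simp only at f4 <;> omega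
    have hb1 : 1 ≤ b := by omega
    rcases hr with hr | ⟨hr, hr'⟩ | ⟨hr, hr'⟩
    · rw [hr]
    · exact absurd hr' (w1 hb1 hab (by omega) rfl rfl hr rfl rfl)
    · exact absurd (show -c = b - 1 by omega) (w2 hb1 (by omega) (by omega) rfl (by omega) (by omega) rfl rfl)
  · have htr : tr a b c = (a, c, b) := tr_swap_right (by omega) (by omega) (by omega)
    rw [htr] at f2 ⊢
    simp only at f2
    subst f2
    have hr : r = b := by
      clear w1 w2 htr
      unfold tr at f4
      split_ifs at f4 <;> simp only at f4 <;> omega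
    rw [hr]

/-- The top map acts correctly. -/
theorem top_act (h : Loc N β ψ) (ht : Typed ψ β (p + 4) (p + 5) S) (hs : Separates ψ (p + 4) S)
    (hN : p + 4 < N) (h0 : ∀ x, S x 0 = 0) : Typed ψ β (p + 5) (p + 5) S := by
  refine ⟨le_rfl, ht.walk, ht.bit, fun x i hi j hj => ?_⟩
  by_cases hi4 : i = p + 4
  swap
  · obtain ⟨h1, h2, h3⟩ := hi
    exact ht.act x i ⟨by omega, h2, by omega⟩ j hj
  subst hi4
  have key : (S (ψ (p + 4) x) (p + 3), S (ψ (p + 4) x) (p + 4), S (ψ (p + 4) x) (p + 5)) =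
      tr (S x (p + 3)) (S x (p + 4)) (S x (p + 5)) := by
    have n2 := (ht.walk x).ne_succ (j := p + 3) (by omega) (by omega)
    have n3 := (ht.walk x).ne_succ (j := p + 4) (by omega) (by omega)
    simp only [Nat.add_assoc, Nat.reduceAdd] at n2 n3
    rcases lt_or_gt_of_ne (show S x (p + 3) ≠ S x (p + 4) by omega) with h1 | h1 <;>
    rcases lt_or_gt_of_ne (show S x (p + 5) ≠ S x (p + 4) by omega) with h2 | h2
    · exact h.top_up ht hs hN h1 h2
    · rw [h.fix (p + 2) hN x, tr_mid (by omega)]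
      simp only [Nat.add_assoc, Nat.reduceAdd]
      rw [ht.bit _ _ (by omega) (by omega), ht.bit _ _ (by omega) (by omega)]
      exact iff_of_true h1 h2
    · rw [h.fix (p + 2) hN x, tr_mid (by omega)]
      simp only [Nat.add_assoc, Nat.reduceAdd]
      rw [ht.bit _ _ (by omega) (by omega), ht.bit _ _ (by omega) (by omega)]
      exact iff_of_false (by simp only [Nat.add_assoc, Nat.reduceAdd]; omega) (by simp only [Nat.add_assoc, Nat.reduceAdd]; omega)
    · have := h.neg.top_up ht.neg hs.neg hN (x := x) (by omega) (by omega)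
      rw [tr_neg] at this
      simp only [Prod.mk.injEq, neg_inj] at this
      ext
      exacts [this.1, this.2.1, this.2.2]
  rcases Nat.eq_zero_or_pos j with rfl | hj0
  · rw [h0, dd_of_lt (by omega), h0]
  rcases Nat.lt_or_ge j (p + 3) with h1 | h1
  · rw [h.top_low ht hN x hj0 (by omega), dd_of_lt (by omega)]
  · obtain rfl | rfl | rfl : j = p + 3 ∨ j = p + 4 ∨ j = p + 5 := by omega
    · rw [dd_pred (p + 2)]; exact congrArg Prod.fst key
    · rw [dd_self (p + 2)]; exact congrArg (fun t => t.2.1) key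
    · rw [dd_succ (p + 2)]; exact congrArg (fun t => t.2.2) key

end Loc

theorem Typed.act_triple (h : Typed ψ β k m S) {p : ℕ} (hp : p + 2 < k) (x : A) :
    S (ψ (p + 2) x) (p + 1) = (tr (S x (p + 1)) (S x (p + 2)) (S x (p + 3))).1 ∧
    S (ψ (p + 2) x) (p + 2) = (tr (S x (p + 1)) (S x (p + 2)) (S x (p + 3))).2.1 ∧
    S (ψ (p + 2) x) (p + 3) = (tr (S x (p + 1)) (S x (p + 2)) (S x (p + 3))).2.2 := by
  have hkm := h.le
  have hg : IsGen k (p + 2) := ⟨hp, by omega, by omega⟩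
  rw [h.act _ _ hg _ (by omega), h.act _ _ hg _ (by omega), h.act _ _ hg _ (by omega), dd_pred, dd_self,
    dd_succ]
  exact ⟨rfl, rfl, rfl⟩

namespace Loc

theorem step_comm_merge (h : Loc N β ψ) (ht : Typed ψ β (p + 5) (p + 5) S) (hs : Separates ψ (p + 4) S)
    (hN : p + 4 < N) {x z : A} {a b c v : ℤ} (hr : Reach ψ (p + 3) x z) (ha : S x (p + 3) = a)
    (hv : S z (p + 3) = v) (hb : S x (p + 4) = b) (hc : S x (p + 5) = c) (hcv : c < v) (hva : v < a)
    (hab : a < b) (hgood : v.natAbs ≠ a.natAbs ∨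
      (2 ≤ a.natAbs ∧ a.natAbs - 1 ∉ sh (S x) (p + 3)) ∨ a.natAbs + 2 ∈ sh (S x) (p + 3)) :
    Reach ψ (p + 4) (ψ (p + 4) x) (ψ (p + 4) z) := by
  have ht' := ht.mono_left (l := p + 4) (by omega)
  have he : S (ψ (p + 4) x) (p + 3) = S x (p + 3) := by
    rw [(ht.act_tr (p := p + 2) (a' := (tr a b c).1) (b' := (tr a b c).2.1) (c' := (tr a b c).2.2)
      (by omega) ha hb hc rfl).1, tr_first_eq (by omega) hab, ha]
  have hvR : Removable (sh (S x) (p + 3)) v := by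
    rw [← hv, ← ht.reach_sh (by omega) hr le_rfl (by omega)]
    exact (ht.walk z).removable (show p + 2 < p + 5 by omega)
  have hq : ¬v < (tr a b c).2.1 := by
    have := (ht.walk x).ne_succ (j := p + 4) (by omega) (by omega)
    have n3 : b.natAbs ≠ c.natAbs := by rw [← hb, ← hc]; exact this
    by_cases h1 : b.natAbs = c.natAbs + 1 ∨ c.natAbs = b.natAbs + 1
    · rw [tr_neg_right (by omega) (by omega)]; simp only; omega
    · rw [tr_swap_right (by omega) (by omega) (by omega)]; simp only; omega
  obtain ⟨z', r1, k3, k4, -, -, -, -, r2⟩ := (h.top_pin ht' hN (x := x) (by omega) (by omega) he hvR (by omega)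
    (by rw [ha]; exact hgood)).2 (by rw [ha, hb, hc]; exact hq)
  have hz4 := ht.reach_letter (by omega) hr (j := p + 4) (by omega) (by omega)
  exact r2.trans ((h.top_congr ht' hs hN (x := z') (z := z)
    ((h.reach_symm (by omega) (r1.mono (by omega))).trans (hr.mono (by omega))) (by rw [k3, hv])
    (by rw [k4, hz4])).mono (by omega))

theorem gap_merge_up (h : Loc N β ψ) (ht : Typed ψ β (p + 5) (p + 5) S) (hs : Separates ψ (p + 4) S)
    (hN : p + 4 < N) {x z : A} {a b c v : ℤ} (hr : Reach ψ (p + 3) x z) (ha : S x (p + 3) = a)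
    (hv : S z (p + 3) = v) (hb : S x (p + 4) = b) (hc : S x (p + 5) = c) (hcv : c < v) (hvb : v < b)
    (hca : c < a) (hab : a < b) (hex : ¬(b = 2 ∧ c = -3)) :
    Reach ψ (p + 4) (ψ (p + 4) x) (ψ (p + 4) z) := by
  have ht' := ht.mono_left (l := p + 4) (by omega)
  have hz4 := ht.reach_letter (by omega) hr (j := p + 4) (by omega) (by omega)
  have hz5 := ht.reach_letter (by omega) hr (j := p + 5) (by omega) (by omega)
  have hsh := ht.reach_sh (by omega) hr le_rfl (by omega)
  have step : ∀ {x z : A} {a v : ℤ}, Reach ψ (p + 3) x z → S x (p + 3) = a → S z (p + 3) = v →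
      S x (p + 4) = b → S x (p + 5) = c → c < v → v < b → c < a → a < b → (v.natAbs ≠ a.natAbs ∨ v = a) →
      Reach ψ (p + 4) (ψ (p + 4) x) (ψ (p + 4) z) := by
    intro x z a v hr ha hv hb hc hcv hvb hca hab hne
    have hz4 := ht.reach_letter (by omega) hr (j := p + 4) (by omega) (by omega)
    have hz5 := ht.reach_letter (by omega) hr (j := p + 5) (by omega) (by omega)
    rcases lt_trichotomy v a with h1 | h1 | h1
    · exact h.step_comm_merge ht hs hN hr ha hv hb hc hcv h1 hab (Or.inl (by omega))
    · exact (h.top_congr ht' hs hN (hr.mono (by omega)) (by rw [ha, hv, h1]) hz4.symm).mono (by omega)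
    · exact h.reach_symm (by omega) (h.step_comm_merge ht hs hN (h.reach_symm (by omega) hr) hv ha
        (by rw [hz4, hb]) (by rw [hz5, hc]) hca h1 hvb (Or.inl (by omega)))
  by_cases h1 : v.natAbs ≠ a.natAbs ∨ v = a
  · exact step hr ha hv hb hc hcv hvb hca hab h1
  obtain ⟨h2, h3⟩ : v = -a ∧ a ≠ 0 := by omega
  obtain ⟨K, hK⟩ : ∃ K, sh (S x) (p + 3) = K := ⟨_, rfl⟩
  have h0 : 0 ∉ K := hK ▸ zero_notMem_sh _ _
  have hbA := ht.walk x (p + 3) (by omega)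
  have hcA := ht.walk x (p + 4) (by omega)
  have haR : Removable K a := by
    rw [← hK, ← ha]; exact (ht.walk x).removable (show p + 2 < p + 5 by omega)
  rw [show S x (p + 3 + 1) = b from hb, hK] at hbA
  rw [show S x (p + 4 + 1) = c from hc, show sh (S x) (p + 4) = mv K b by rw [sh, hK]; exact congrArg _ hb] at hcA
  by_cases hg : (2 ≤ a.natAbs ∧ a.natAbs - 1 ∉ K) ∨ a.natAbs + 2 ∈ K
  · rcases lt_or_gt_of_ne (show v ≠ a by omega) with h4 | h4
    · exact h.step_comm_merge ht hs hN hr ha hv hb hc hcv h4 hab (Or.inr (by rwa [hK]))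
    · exact h.reach_symm (by omega) (h.step_comm_merge ht hs hN (h.reach_symm (by omega) hr) hv ha
        (by rw [hz4, hb]) (by rw [hz5, hc]) hca h4 hvb (Or.inr (by
          rw [hsh, hK, show v.natAbs = a.natAbs by omega]; exact hg)))
  obtain ⟨w, hw, hwa, hcw, hwb⟩ : ∃ w, Removable K w ∧ w.natAbs ≠ a.natAbs ∧ c < w ∧ w < b := by
    rcases Nat.lt_or_ge 1 a.natAbs with h4 | h4
    · have h5 : a.natAbs - 1 ∈ K := by
        by_contra h5; exact hg (Or.inl ⟨h4, h5⟩)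
      obtain ⟨f, f1, f2, f3, -⟩ := exists_run_bottom h0 h5
      exact ⟨f, ⟨by simpa using f2, by simpa using f3⟩, by omega, by omega, by omega⟩
    · have h5 : a.natAbs = 1 := by omega
      have h6 : a.natAbs + 2 ∉ K := fun h6 => hg (Or.inr h6)
      have h7 := haR.1
      rw [h5] at h6 h7
      have h2A : Addable K 2 := ⟨Or.inr h7, h6⟩
      have hb2 : 2 ≤ b := by omega
      rcases eq_or_lt_of_le hb2 with h8 | h8
      · subst h8
        have hcK : Addable K c := by
          have n3 := hcA.natAbs_ne
          obtain ⟨g1, g2⟩ := hcA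
          simp only [mem_mv, not_or, not_and] at g1 g2
          refine ⟨?_, g2.2 (by omega)⟩
          rcases g1 with g1 | g1 | g1
          · exact Or.inl g1
          · omega
          · exact Or.inr g1.2
        have hcn : c ≠ -1 := by rintro rfl; omega
        have n3 := hcA.natAbs_ne
        obtain ⟨w, w1, w2, w3⟩ := exists_removable_between h0 hcK (addable_neg.2 h2A) (by omega)
        exact ⟨w, w1, by omega, w2, by omega⟩
      · obtain ⟨w, w1, w2, w3⟩ := exists_removable_between h0 h2A hbA h8
        exact ⟨w, w1, by omega, by omega, w3⟩
  obtain ⟨y, r1, y1⟩ := ht.exists_letter (p := p + 3) (by omega) x (w := w) (by rwa [hK])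
  have hy4 := ht.reach_letter (by omega) r1 (j := p + 4) (by omega) (by omega)
  have hy5 := ht.reach_letter (by omega) r1 (j := p + 5) (by omega) (by omega)
  exact (step r1 ha y1 hb hc hcw hwb hca hab (Or.inl hwa)).trans
    (step ((h.reach_symm (by omega) r1).trans hr) y1 hv (by rw [hy4, hb]) (by rw [hy5, hc]) hcv hvb hcw hwb
      (Or.inl (by omega)))

/-- Elements of a piece with the same last two letters, for which the top map moves these
letters, are sent to the same piece. -/
theorem gap_merge (h : Loc N β ψ) (ht : Typed ψ β (p + 5) (p + 5) S) (hs : Separates ψ (p + 4) S)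
    (hN : p + 4 < N) {x z : A} {b c : ℤ} (hr : Reach ψ (p + 4) x z)
    (hb : S x (p + 4) = b) (hc : S x (p + 5) = c) (hb' : S z (p + 4) = b)
    (h1 : (b < S x (p + 3) ∧ S x (p + 3) < c) ∨ (c < S x (p + 3) ∧ S x (p + 3) < b))
    (h2 : (b < S z (p + 3) ∧ S z (p + 3) < c) ∨ (c < S z (p + 3) ∧ S z (p + 3) < b))
    (hex : ¬(b = 2 ∧ c = -3)) (hex' : ¬(b = -2 ∧ c = 3)) :
    Reach ψ (p + 4) (ψ (p + 4) x) (ψ (p + 4) z) := by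
  have hr3 : Reach ψ (p + 3) x z := by
    obtain ⟨z', r1, r2, r3⟩ := ht.exists_splice (r := p + 3) (q := p + 4) (by omega) (by omega) (by omega)
      (x := x) (y := z) (ht.reach_sh (by omega) hr le_rfl (by omega)).symm (fun j h1 h2 => by
        obtain rfl : j = p + 4 := by omega
        rw [hb, hb'])
    have : z' = z := hs z' z (((h.reach_symm (by omega) r1).mono (by omega)).trans hr) r2
    rwa [← this]
  rcases h1 with h1 | h1
  · refine h.neg.gap_merge_up ht.neg hs.neg hN hr3 rfl rfl rfl rfl ?_ ?_ ?_ ?_ ?_ <;> simp only [hb, hc] <;> omega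
  · exact h.gap_merge_up ht hs hN hr3 rfl rfl hb hc (by omega) (by omega) (by omega) (by omega) hex

theorem tr_third {a b c κ : ℤ} (h : (tr a b c).2.2 = κ) (hne : κ ≠ c) :
    ((b < a ∧ a < c) ∨ (c < a ∧ a < b)) ∧
    ((κ = b ∧ ¬(b.natAbs = c.natAbs + 1 ∨ c.natAbs = b.natAbs + 1)) ∨
      (κ = -c ∧ (b.natAbs = c.natAbs + 1 ∨ c.natAbs = b.natAbs + 1))) := by
  unfold tr at h
  split_ifs at h <;> simp only at h <;> omega

/-- Elements of a piece whose images have the same last letter of a new absolute value are sent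
to the same piece. -/
theorem swap_merge (h : Loc N β ψ) (ht : Typed ψ β (p + 5) (p + 5) S) (hs : Separates ψ (p + 4) S)
    (hN : p + 4 < N) {x z : A} {κ : ℤ} (hr : Reach ψ (p + 4) x z) (hx : S (ψ (p + 4) x) (p + 5) = κ)
    (hz : S (ψ (p + 4) z) (p + 5) = κ) (hκ : κ.natAbs ≠ (S x (p + 5)).natAbs) :
    Reach ψ (p + 4) (ψ (p + 4) x) (ψ (p + 4) z) := by
  have h5 := ht.reach_letter (by omega) hr (j := p + 5) (by omega) (by omega)
  have hx' := (ht.act_triple (p := p + 2) (by omega) x).2.2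
  have hz' := (ht.act_triple (p := p + 2) (by omega) z).2.2
  simp only [Nat.add_assoc, Nat.reduceAdd, h5] at hx' hz'
  rw [hx'] at hx
  rw [hz'] at hz
  obtain ⟨h6, h7⟩ := tr_third hx (by omega)
  obtain ⟨h8, h9⟩ := tr_third hz (by omega)
  exact h.gap_merge ht hs hN (b := κ) hr (by omega) rfl (by omega) (by omega) (by omega) (by omega) (by omega)

end Loc

namespace Window

variable {x y : A} {a b c d e f a' b' c' d' e' f' : ℤ}

theorem last (ht : Typed ψ β (p + 6) (p + 6) S) (h : Window ψ S p x y a b c d e f)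
    (hr : tr d e f = (d', e', f')) : Window ψ S p x (ψ (p + 5) y) a b c d' e' f' := by
  obtain ⟨r, h1, h2, h3, h4, h5, h6⟩ := h
  obtain ⟨k1, k2, k3⟩ := ht.act_tr (p := p + 3) (by omega) h4 h5 h6 hr
  exact ⟨r.tail ⟨_, by omega, by omega, rfl⟩,
    by rw [ht.act_ne (p := p + 3) (by omega) y (by omega) (by omega), h1],
    by rw [ht.act_ne (p := p + 3) (by omega) y (by omega) (by omega), h2],
    by rw [ht.act_ne (p := p + 3) (by omega) y (by omega) (by omega), h3], k1, k2, k3⟩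

theorem eq_of_letters (h : Loc N β ψ) (ht : Typed ψ β (p + 5) (p + 6) S) (hN : p + 5 < N)
    (hx : Window ψ S p x x a b c d e f) (hy : Window ψ S p x y a b c d e f') : x = y := by
  obtain ⟨-, x1, x2, x3, x4, x5, x6⟩ := hx
  obtain ⟨r, y1, y2, y3, y4, y5, y6⟩ := hy
  have hl : ∀ j, p + 1 ≤ j → j ≤ p + 5 → S x j = S y j := by
    intro j h1 h2
    obtain rfl | rfl | rfl | rfl | rfl : j = p + 1 ∨ j = p + 2 ∨ j = p + 3 ∨ j = p + 4 ∨ j = p + 5 := by omega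
    · rw [x1, y1]
    · rw [x2, y2]
    · rw [x3, y3]
    · rw [x4, y4]
    · rw [x5, y5]
  exact h.rigid p hN x _ r (fun l h1 j h2 h3 => by
    rw [ht.bit _ j (by omega) (by omega), ht.bit _ j (by omega) (by omega),
      fold_congr ht l h1 hl j (by omega) (by omega), fold_congr ht l h1 hl (j + 1) (by omega) (by omega)])

end Window

theorem Typed.exists_letters3 (h : Typed ψ β k m S) (hp : p + 3 ≤ k) (x : A) {a b c : ℤ}
    (hc : Removable (sh (S x) (p + 3)) c) (hb : Removable (rmv (sh (S x) (p + 3)) c) b)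
    (ha : Removable (rmv (rmv (sh (S x) (p + 3)) c) b) a) :
    ∃ y, Reach ψ (p + 3) x y ∧ S y (p + 1) = a ∧ S y (p + 2) = b ∧ S y (p + 3) = c := by
  have hkm := h.le
  obtain ⟨x1, r1, l1⟩ := h.exists_letter hp x hc
  have e1 := h.reach_sh hp r1 le_rfl (by omega)
  obtain ⟨x2, r2, l2, m2, -, e2⟩ := h.exists_pred (p := p + 2) (by omega) l1 (by rwa [e1])
  obtain ⟨x3, r3, l3, -, m3, e3⟩ := h.exists_pred (p := p + 1) (by omega) l2 (by rwa [e2, e1])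
  exact ⟨x3, (r1.trans (r2.mono (by omega))).trans (r3.mono (by omega)), l3,
    by rw [m3 _ (by omega) (by omega), l2], by rw [m3 _ (by omega) (by omega), m2]⟩

theorem Reach.foldl {l : List ℕ} (hk : 2 ≤ k) (hl : ∀ i ∈ l, i < k ∧ i ≠ 1) (x : A) :
    Reach ψ k x (l.foldl (fun a i => ψ i a) x) := by
  induction l generalizing x with
  | nil => exact Relation.ReflTransGen.refl
  | cons i l ih =>
    obtain ⟨h1, h2⟩ := hl i List.mem_cons_self
    exact (Reach.step x ⟨h1, h2, hk⟩).trans (ih (fun j hj => hl j (List.mem_cons_of_mem _ hj)) _)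

/-- A path that uses `ψ k` at most `n` times, and otherwise only the maps below it. -/
def PathTop (ψ : ℕ → A → A) (k : ℕ) : ℕ → A → A → Prop
  | 0, x, y => Reach ψ k x y
  | n + 1, x, y => Reach ψ k x y ∨ ∃ u, Reach ψ k x u ∧ PathTop ψ k n (ψ k u) y

theorem PathTop.of_reach {n : ℕ} {x y : A} (h : Reach ψ k x y) : PathTop ψ k n x y := by
  cases n
  exacts [h, Or.inl h]

theorem PathTop.head {n : ℕ} {x y z : A} (h : Reach ψ k x y) (h' : PathTop ψ k n y z) :
    PathTop ψ k n x z := by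
  cases n with
  | zero => exact h.trans h'
  | succ n =>
    rcases h' with h1 | ⟨u, h1, h2⟩
    exacts [Or.inl (h.trans h1), Or.inr ⟨u, h.trans h1, h2⟩]

theorem pathTop_foldl {l : List ℕ} (hk : 2 ≤ k) (hl : ∀ i ∈ l, i ≤ k ∧ i ≠ 1) {n : ℕ} (hn : l.count k ≤ n)
    (x : A) : PathTop ψ k n x (l.foldl (fun a i => ψ i a) x) := by
  induction l generalizing x n with
  | nil => exact PathTop.of_reach Relation.ReflTransGen.refl
  | cons i l ih =>
    obtain ⟨h1, h2⟩ := hl i List.mem_cons_self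
    have hl' := fun j hj => hl j (List.mem_cons_of_mem i hj)
    rcases Nat.lt_or_ge i k with h3 | h3
    · rw [List.count_cons_of_ne (by omega)] at hn
      exact PathTop.head (Reach.step x ⟨h3, h2, hk⟩) (ih hl' hn _)
    · obtain rfl : i = k := by omega
      rw [List.count_cons_self] at hn
      cases n with
      | zero => omega
      | succ n => exact Or.inr ⟨x, Relation.ReflTransGen.refl, ih hl' (by omega) _⟩

namespace Loc

theorem top_first_ne (h : Loc N β ψ) (ht : Typed ψ β (p + 4) (p + 5) S) (hN : p + 4 < N) (x : A)
    (hne : S (ψ (p + 4) x) (p + 3) ≠ S x (p + 3)) : Reach ψ (p + 4) x (ψ (p + 4) x) := by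
  have n2 := (ht.walk x).ne_succ (j := p + 3) (by omega) (by omega)
  have n3 := (ht.walk x).ne_succ (j := p + 4) (by omega) (by omega)
  simp only [Nat.add_assoc, Nat.reduceAdd] at n2 n3
  by_cases h1 : S x (p + 3) < S x (p + 4)
  · by_cases h2 : S x (p + 5) < S x (p + 4)
    · exact (h.top_of_ne ht hN x h1 h2 hne).2.2
    · rw [h.fix (p + 2) (by omega) x (by
        rw [ht.bit x _ (by omega) (by omega), ht.bit x _ (by omega) (by omega)]
        exact iff_of_true h1 (by simp only [Nat.add_assoc, Nat.reduceAdd]; omega))]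
      exact Relation.ReflTransGen.refl
  · by_cases h2 : S x (p + 4) < S x (p + 5)
    · exact (h.neg.top_of_ne ht.neg hN x (by omega) (by omega) (by simpa using hne)).2.2
    · rw [h.fix (p + 2) (by omega) x (by
        rw [ht.bit x _ (by omega) (by omega), ht.bit x _ (by omega) (by omega)]
        exact iff_of_false h1 h2)]
      exact Relation.ReflTransGen.refl

/-- A loop through a large content shows how the top map acts between pieces. -/
theorem far_path (h : Loc N β ψ) (ht : Typed ψ β (p + 6) (p + 6) S)
    (hN : p + 5 < N) {x : A} {s : ℕ} {a b c b' c' : ℤ} (h4 : S x (p + 4) = a) (h5 : S x (p + 5) = b)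
    (h6 : S x (p + 6) = c) (hsG : s ∈ sh (S x) (p + 3)) (h1 : s - 1 ∉ sh (S x) (p + 3))
    (h2 : s - 2 ∉ sh (S x) (p + 3)) (ha : a.natAbs + 3 < s) (hb : b.natAbs + 2 < s)
    (hc : c.natAbs + 2 < s) (hb' : b'.natAbs + 2 < s) (hc' : c'.natAbs + 2 < s) (hcb : c < b)
    (hba : b' < a) (htr : tr a b c = (a, b', c')) (hv : b'.natAbs + 3 = s → c' < -b') :
    ∃ u v, Reach ψ (p + 5) x u ∧ S (ψ (p + 5) u) (p + 6) = (s : ℤ) - 1 ∧ Reach ψ (p + 5) (ψ (p + 5) u) v ∧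
      S (ψ (p + 5) v) (p + 6) = c' ∧ Reach ψ (p + 5) (ψ (p + 5) v) (ψ (p + 5) x) := by
  have ht' := ht.mono_left (l := p + 5) (by omega)
  have haA := ht.walk x (p + 3) (by omega)
  rw [show S x (p + 3 + 1) = a from h4] at haA
  obtain ⟨z, y, hr, k1, k2, k3, k4, k5⟩ := ht.exists_prefix_far (p := p) (by omega) x hsG h1 h2 haA ha
  have hl : ∀ j, p + 3 < j → j ≤ p + 6 → S z j = S x j :=
    fun j h1 h2 => ht.reach_letter (by omega) hr h1 h2
  have hr' := h.top_reach (p := p + 1) hN hr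
  have hw : Window ψ S p z z y ((s : ℤ) - 1 - 1) ((s : ℤ) - 1) a b c :=
    ⟨Relation.ReflTransGen.refl, k1, k2, k3, by rw [hl _ (by omega) (by omega), h4],
      by rw [hl _ (by omega) (by omega), h5], by rw [hl _ (by omega) (by omega), h6]⟩
  clear h4 h5 h6 hsG h1 h2 haA hl k1 k2 k3
  obtain ⟨e, he⟩ : ∃ e : ℤ, e = (s : ℤ) - 1 := ⟨_, rfl⟩
  rw [← he] at hw k5 ⊢
  obtain ⟨r, t, q1, q2, q3, q4⟩ : ∃ r t, tr a (e - 1) b' = (a, r, t) ∧ tr a r t = (a, e - 1, b') ∧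
      c' < t ∧ t < e := by
    by_cases hadj : b'.natAbs + 2 = e
    · refine ⟨_, _, tr_neg_right (by omega) (by omega), ?_, hv (by omega), by omega⟩
      rw [tr_neg_right (by omega) (by omega), neg_neg, neg_neg]
    · exact ⟨_, _, tr_swap_right (by omega) (by omega) (by omega),
        tr_swap_right (by omega) (by omega) (by omega), by omega, by omega⟩
  have w1 := hw.mid ht' (tr_swap_right (by omega) (by omega) (by omega))
  have w2 := w1.left ht' (tr_swap_right (by omega) (by omega) (by omega))
  have w3 := w2.right ht' (tr_swap_right (by omega) (by omega) (by omega))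
  have w4 := w3.left ht' (tr_swap_right (by omega) (by omega) (by omega))
  have w5 := w4.last ht (tr_swap_right (by omega) (by omega) (by omega))
  have w6 := w5.right ht' htr
  have w7 := w6.left ht' (tr_swap_right (by omega) (by omega) (by omega))
  have w8 := w7.mid ht' q1
  have w9 := w8.last ht (tr_swap_right (by omega) (by omega) (by omega))
  have w10 := w9.mid ht' q2
  have w11 := w10.left ht' (tr_swap_right (by omega) (by omega) (by omega))
  have w12 := w11.right ht' (tr_swap_right (by omega) (by omega) (by omega))
  have w13 := w12.mid ht' (tr_swap_right (by omega) (by omega) (by omega))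
  have v1 := hw.last ht htr
  have heq : ψ (p + 5) z = _ := Window.eq_of_letters h ht' hN ⟨Relation.ReflTransGen.refl, v1.2⟩
    ⟨Relation.ReflTransGen.head ⟨p + 5, by omega, by omega, (h.inv _ (by omega) hN z).symm⟩ w13.1, w13.2⟩
  refine ⟨_, _, (hr.mono (by omega)).trans (Reach.foldl (l := [p + 3, p + 2, p + 4, p + 2]) (by omega) (by simp) z),
    w5.2.2.2.2.2.2, Reach.foldl (l := [p + 4, p + 2, p + 3]) (by omega) (by simp) _, w9.2.2.2.2.2.2, ?_⟩
  refine (Reach.foldl (l := [p + 3, p + 2, p + 4, p + 3]) (by omega) (by simp) _).trans ?_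
  simp only [List.foldl_cons, List.foldl_nil]
  rw [← heq]
  exact h.reach_symm (by omega) (hr'.mono (by omega))

theorem tie_loop (h : Loc N β ψ) (ht : Typed ψ β (p + 6) (p + 6) S) (hs : Separates ψ (p + 5) S)
    (hN : p + 5 < N) {x : A} (hx : Window ψ S p x x 0 1 2 0 (-1) 0) : Reach ψ (p + 5) x (ψ (p + 5) x) := by
  have ht' := ht.mono_left (l := p + 5) (by omega)
  have w1 := hx.last ht (show tr 0 (-1) 0 = (0, 1, 0) by decide)
  have w2 := w1.mid ht' (show tr 1 2 0 = (1, 0, 2) by decide)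
  have w3 := w2.left ht' (show tr 0 1 0 = (0, -1, 0) by decide)
  have w4 := w3.right ht' (show tr 0 2 1 = (2, 0, 1) by decide)
  have w5 := w4.last ht (show tr 0 1 0 = (0, -1, 0) by decide)
  have w6 := w5.left ht' (show tr 0 (-1) 2 = (0, 1, -2) by decide)
  have w7 := w6.right ht' (show tr (-2) 0 (-1) = (0, -2, -1) by decide)
  have w8 := w7.left ht' (show tr 0 1 0 = (0, -1, 0) by decide)
  have w9 := w8.mid ht' (show tr (-1) 0 (-2) = (-1, -2, 0) by decide)
  have w10 := w9.last ht (show tr 0 (-1) 0 = (0, 1, 0) by decide)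
  have w11 := w10.mid ht' (show tr (-1) (-2) 0 = (-1, 0, -2) by decide)
  have w12 := w11.left ht' (show tr 0 (-1) 0 = (0, 1, 0) by decide)
  have w13 := w12.right ht' (show tr 0 (-2) 1 = (0, 2, -1) by decide)
  have w14 := w13.mid ht' (show tr 1 0 2 = (1, 2, 0) by decide)
  have heq := Window.eq_of_letters h ht' hN hx w14
  have r1 : Reach ψ (p + 5) (ψ (p + 5) x) _ := Reach.foldl (l := [p + 3, p + 2, p + 4]) (by omega) (by simp) _
  have r2 := (h.top_congr (p := p + 1) ht' hs hN r1 (w1.2.2.2.2.1.trans w4.2.2.2.2.1.symm)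
    (w1.2.2.2.2.2.1.trans w4.2.2.2.2.2.1.symm)).mono (l := p + 5) (by omega)
  rw [h.inv _ (by omega) hN] at r2
  have r3 := r2.trans (Reach.foldl (l := [p + 2, p + 4, p + 2, p + 3]) (by omega) (by simp) _)
  have r4 := (h.top_congr (p := p + 1) ht' hs hN r3 (hx.2.2.2.2.1.trans w9.2.2.2.2.1.symm)
    (hx.2.2.2.2.2.1.trans w9.2.2.2.2.2.1.symm)).mono (l := p + 5) (by omega)
  have r5 := r4.trans (Reach.foldl (l := [p + 3, p + 2, p + 4, p + 3]) (by omega) (by simp) _)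
  simp only [List.foldl_cons, List.foldl_nil] at r5
  rw [← heq] at r5
  exact h.reach_symm (by omega) r5

theorem toggle_loop (h : Loc N β ψ) (ht : Typed ψ β (p + 6) (p + 6) S)
    (hN : p + 5 < N) {x : A} {a κ : ℤ} (hκ : 2 ≤ κ) (ha : a.natAbs + 2 = κ)
    (hx : Window ψ S p x x (-(κ - 1)) (-κ) (-(κ + 1)) a (κ - 1) (-κ)) :
    ∃ w, Reach ψ (p + 5) x w ∧ S w (p + 4) = -(κ - 1) ∧ S w (p + 5) = κ + 1 ∧ S w (p + 6) = -κ ∧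
      Reach ψ (p + 5) (ψ (p + 5) x) (ψ (p + 5) w) := by
  have ht' := ht.mono_left (l := p + 5) (by omega)
  have w1 := hx.last ht (tr_neg_right (by omega) (by omega))
  rw [neg_neg] at w1
  have w2 := w1.mid ht' (tr_swap_right (by omega) (by omega) (by omega))
  have w3 := w2.left ht' (tr_swap_right (by omega) (by omega) (by omega))
  have w4 := w3.right ht' (tr_swap_right (by omega) (by omega) (by omega))
  have w5 := w4.last ht (tr_neg_right (by omega) (by omega))
  rw [neg_neg] at w5
  have w6 := w5.left ht' (tr_swap_right (by omega) (by omega) (by omega))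
  have w7 := w6.right ht' (tr_swap_right (by omega) (by omega) (by omega))
  have w8 := w7.left ht' (tr_swap_right (by omega) (by omega) (by omega))
  have w9 := w8.mid ht' (tr_neg_right (by omega) (by omega))
  rw [neg_neg] at w9
  have w10 := w9.last ht (tr_swap_left (by omega) (by omega) (by omega))
  have w11 := w10.mid ht' (tr_neg_right (by omega) (by omega))
  rw [neg_neg] at w11
  have w12 := w11.left ht' (tr_swap_right (by omega) (by omega) (by omega))
  have w13 := w12.right ht' (tr_swap_right (by omega) (by omega) (by omega))
  have w14 := w13.mid ht' (tr_swap_right (by omega) (by omega) (by omega))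
  have heq := Window.eq_of_letters h ht' hN hx w14
  have r10 := h.top_first_ne (p := p + 1) ht' hN _ (by
    rw [show p + 1 + 3 = p + 4 from rfl, w9.2.2.2.2.1, show p + 1 + 4 = p + 5 from rfl, w10.2.2.2.2.1]; omega)
  have r5 := (Reach.foldl (ψ := ψ) (k := p + 5) (l := [p + 2, p + 4, p + 2, p + 3]) (by omega) (by simp) _).trans
    (r10.trans (Reach.foldl (l := [p + 3, p + 2, p + 4, p + 3]) (by omega) (by simp) _))
  simp only [List.foldl_cons, List.foldl_nil] at r5
  rw [← heq] at r5
  refine ⟨_, h.reach_symm (by omega) r5, w5.2.2.2.2.1, w5.2.2.2.2.2.1, w5.2.2.2.2.2.2, ?_⟩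
  rw [h.inv _ (by omega) hN]
  exact Reach.foldl (l := [p + 3, p + 2, p + 4]) (by omega) (by simp) _

theorem tie_reach_neg (h : Loc N β ψ) (ht : Typed ψ β (p + 5) (p + 5) S) (hs : Separates ψ (p + 4) S)
    (hN : p + 4 < N) {x : A} (ha : S x (p + 3) = 0) (hb : S x (p + 4) = -1) (hc : S x (p + 5) = 0) :
    Reach ψ (p + 4) x (ψ (p + 4) x) := by
  have m1 := fun j => mem_sh_succ (s := S x) (k := p + 2) (j := j)
  have m2 := fun j => mem_sh_succ (s := S x) (k := p + 3) (j := j)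
  have a1 := (ht.walk x) (p + 2) (by omega)
  have a2 := (ht.walk x) (p + 3) (by omega)
  have a3 := (ht.walk x) (p + 4) (by omega)
  have hsum := ((ht.walk x).mono (m := p + 5) (k := p + 2) (by omega)).sum_sh
  simp only [Nat.add_assoc, Nat.reduceAdd, ha, hb] at m1 m2 a1 a2
  simp only [Nat.add_assoc, Nat.reduceAdd, hc] at a3
  have g1 : 1 ∉ sh (S x) (p + 2) := by simpa using a1.2
  have g2 : 2 ∉ sh (S x) (p + 2) := by
    intro hc2
    exact a2.2 (by rw [m1]; exact Or.inr ⟨by omega, by simpa using hc2⟩)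
  have g0 := zero_notMem_sh (S x) (p + 2)
  obtain ⟨s, hs1, hs3⟩ : ∃ s ∈ sh (S x) (p + 2), 3 ≤ s := by
    by_contra hcon
    push Not at hcon
    have : sh (S x) (p + 2) = ∅ := by
      ext j
      simp only [Finset.notMem_empty, iff_false]
      intro hj
      have := hcon j hj
      interval_cases j <;> contradiction
    rw [this] at hsum
    simp at hsum
  obtain ⟨q, rfl⟩ : ∃ q, p = q + 1 := by
    have := Finset.single_le_sum (f := fun i => i) (fun i _ => Nat.zero_le i) hs1
    exact ⟨p - 1, by omega⟩
  simp only [Nat.add_assoc, Nat.reduceAdd] at *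
  by_cases h3 : 3 ∈ sh (S x) (q + 3)
  · obtain ⟨z, r, z1, z2, z3⟩ := ht.exists_letters3 (p := q) (by omega) x (a := 0) (b := 1) (c := 2)
      ⟨by simpa using h3, by simpa using g2⟩
      ⟨by rw [mem_rmv]; simp, by rw [mem_rmv]; simp [g1]⟩
      ⟨by simp [mem_rmv], by simp [mem_rmv]⟩
    have hl : ∀ j, q + 3 < j → j ≤ q + 6 → S z j = S x j :=
      fun j h1 h2 => ht.reach_letter (by omega) r h1 h2
    have hz := h.tie_loop ht hs hN (x := z) ⟨Relation.ReflTransGen.refl, z1, z2, z3,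
      by rw [hl _ (by omega) (by omega), ha], by rw [hl _ (by omega) (by omega), hb],
      by rw [hl _ (by omega) (by omega), hc]⟩
    exact ((r.mono (by omega)).trans hz).trans
      (h.reach_symm (by omega) ((h.top_reach (p := q + 1) hN r).mono (by omega)))
  · obtain ⟨s, s1, s2, s3⟩ := exists_least_above ⟨s, hs1, hs3⟩
    have hs4 : 4 ≤ s := by
      rcases eq_or_lt_of_le s2 with e | e
      · exact absurd (e ▸ s1) h3
      · exact e
    have n1 : ∀ j, j < s → j ∉ sh (S x) (q + 3) := by
      intro j hj hm
      rcases Nat.lt_or_ge j 3 with h4 | h4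
      · interval_cases j <;> contradiction
      · exact s3 j h4 hj hm
    obtain ⟨k1, k2, k3⟩ := ht.act_tr (p := q + 3) (by omega) ha hb hc (show tr 0 (-1) 0 = (0, 1, 0) by decide)
    have hsh : sh (S (ψ (q + 5) x)) (q + 3) = sh (S x) (q + 3) :=
      sh_congr (fun j _ h2 => ht.act_ne (p := q + 3) (by omega) x (by omega) (by omega))
    obtain ⟨u, v, r1, r2, r3, r4, r5⟩ := h.far_path ht hN (x := ψ (q + 5) x) (s := s) (b' := -1) (c' := 0) k1 k2 k3
      (by rwa [hsh]) (by rw [hsh]; exact n1 _ (by omega)) (by rw [hsh]; exact n1 _ (by omega))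
      (by omega) (by omega) (by omega) (by omega) (by omega)
      (by omega) (by omega) (by decide) (by omega)
    rw [h.inv _ (by omega) hN] at r5
    have hu : S u (q + 6) = 0 := by rw [ht.reach_letter (by omega) r1 (by omega) (by omega)]; exact k3
    have r6 := h.swap_merge (p := q + 1) ht hs hN (κ := 0) r3
      (by rw [show q + 1 + 4 = q + 5 from rfl, h.inv _ (by omega) hN]; exact hu) r4
      (by rw [show S (ψ (q + 5) u) (q + 1 + 5) = (s : ℤ) - 1 from r2]; omega)
    rw [show q + 1 + 4 = q + 5 from rfl, h.inv _ (by omega) hN] at r6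
    exact h.reach_symm (by omega) ((r1.trans r6).trans r5)

theorem tie_reach (h : Loc N β ψ) (ht : Typed ψ β (p + 5) (p + 5) S) (hs : Separates ψ (p + 4) S)
    (hN : p + 4 < N) {x : A} (ha : S x (p + 3) = 0) (hb : (S x (p + 4)).natAbs = 1) (hc : S x (p + 5) = 0) :
    Reach ψ (p + 4) x (ψ (p + 4) x) := by
  rcases (show S x (p + 4) = -1 ∨ S x (p + 4) = 1 by omega) with h1 | h1
  · exact h.tie_reach_neg ht hs hN ha h1 hc
  · exact h.neg.tie_reach_neg ht.neg hs.neg hN (by simp [ha]) (by simp [h1]) (by simp [hc])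

/-- The top map fixes every piece that contains an image with the same last letter. -/
theorem top_same (h : Loc N β ψ) (ht : Typed ψ β (p + 5) (p + 5) S) (hs : Separates ψ (p + 4) S)
    (hN : p + 4 < N) {x : A} (hx : S (ψ (p + 4) x) (p + 5) = S x (p + 5)) :
    Reach ψ (p + 4) x (ψ (p + 4) x) := by
  have ht' := ht.mono_left (l := p + 4) (by omega)
  by_cases hne : S (ψ (p + 4) x) (p + 3) = S x (p + 3)
  swap
  · exact h.top_first_ne ht' hN x hne
  obtain ⟨h1, h2, h3⟩ := ht.act_triple (p := p + 2) (by omega) x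
  have n2 := (ht.walk x).ne_succ (j := p + 3) (by omega) (by omega)
  have n3 := (ht.walk x).ne_succ (j := p + 4) (by omega) (by omega)
  have t2 := (ht.walk x).tie (p := p + 2) (by omega)
  simp only [Nat.add_assoc, Nat.reduceAdd] at h1 h2 h3 n2 n3 t2
  obtain ⟨a, ha⟩ : ∃ a, S x (p + 3) = a := ⟨_, rfl⟩
  obtain ⟨b, hb⟩ : ∃ b, S x (p + 4) = b := ⟨_, rfl⟩
  obtain ⟨c, hc⟩ : ∃ c, S x (p + 5) = c := ⟨_, rfl⟩
  rw [hne] at h1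
  rw [hx] at h3
  simp only [ha, hb, hc] at h1 h2 h3 n2 n3 t2
  by_cases hmid : (a ≤ b ∧ b ≤ c) ∨ (c ≤ b ∧ b ≤ a)
  · rw [h.fix (p + 2) (by omega) x (by
      rw [ht.bit x _ (by omega) (by omega), ht.bit x _ (by omega) (by omega)]
      simp only [Nat.add_assoc, Nat.reduceAdd, ha, hb, hc]; omega)]
    exact Relation.ReflTransGen.refl
  obtain ⟨rfl, rfl, hb1⟩ : a = 0 ∧ c = 0 ∧ b.natAbs = 1 := by
    unfold tr at h1 h3
    split_ifs at h1 h3 <;> simp only at h1 h3 <;> omega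
  exact h.tie_reach ht hs hN ha (by rw [hb]; exact hb1) hc

theorem exists_toggle_link (h : Loc N β ψ) (ht : Typed ψ β (p + 5) (p + 5) S)
    (hN : p + 4 < N) {x : A} {a κ : ℤ} (hκ : 2 ≤ κ) (hmin : ∀ j ∈ sh (S x) (p + 5), κ + 1 ≤ (j : ℤ))
    (hnext : κ.natAbs + 2 ∈ sh (S x) (p + 5)) (ha : S x (p + 3) = a) (hb : S x (p + 4) = κ - 1)
    (hc : S x (p + 5) = -κ) (ha1 : -κ < a) (ha2 : a < κ - 1) :
    ∃ w, Reach ψ (p + 4) x w ∧ S w (p + 3) = -(κ - 1) ∧ S w (p + 4) = κ + 1 ∧ S w (p + 5) = -κ ∧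
      Reach ψ (p + 4) (ψ (p + 4) x) (ψ (p + 4) w) := by
  have w3 := (ht.walk x) (p + 2) (by omega)
  have w4 := (ht.walk x) (p + 3) (by omega)
  have w5 := (ht.walk x) (p + 4) (by omega)
  have m3 := fun j => mem_sh_pred w3 (j := j)
  have m4 := fun j => mem_sh_pred w4 (j := j)
  have m5 := fun j => mem_sh_pred w5 (j := j)
  have r3 := (ht.walk x).removable (show p + 2 < p + 5 by omega)
  have hsum := (ht.walk x).sum_sh
  simp only [Nat.add_assoc, Nat.reduceAdd, ha, hb, hc] at m3 m4 m5 r3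
  clear w3 w4 w5
  have hp : 2 ≤ p := by
    have h5 := (ht.walk x).removable (show p + 4 < p + 5 by omega)
    simp only [Nat.add_assoc, Nat.reduceAdd, hc] at h5
    have := add_le_sum_of_mem hnext h5.1 (by omega)
    omega
  have hγ : ∀ j : ℕ, (j : ℤ) ≤ κ → j ∉ sh (S x) (p + 5) := fun j hj hm => by have := hmin j hm; omega
  have e4 : ∀ j : ℕ, (j : ℤ) < κ → j ∉ sh (S x) (p + 4) := by
    intro j hj hm
    rw [m5] at hm
    rcases hm.2.2 with h1 | h1
    · omega
    · exact hγ j (by omega) h1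
  have e3 : ∀ j : ℕ, (j : ℤ) ≤ κ → j ∈ sh (S x) (p + 3) → (j : ℤ) = κ - 1 := by
    intro j hj hm
    rw [m4] at hm
    by_contra hne
    rcases hm.2.2 with h1 | h1
    · omega
    · exact e4 j (by omega) h1
  have haκ : a.natAbs + 2 = κ := by
    have h1 := e3 (a.natAbs + 1) (by omega) r3.1
    omega
  have g2 : κ.natAbs + 2 ∈ sh (S x) (p + 2) := by
    rw [m3, m4, m5]
    exact ⟨by omega, by omega, Or.inr ⟨by omega, by omega, Or.inr ⟨by omega, by omega, Or.inr hnext⟩⟩⟩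
  have g1 : κ.natAbs + 1 ∉ sh (S x) (p + 2) := by
    intro h1
    rw [m3] at h1
    rcases h1.2.2 with h2 | h2
    · omega
    · rw [m4] at h2
      rcases h2.2.2 with h3 | h3
      · omega
      · rw [m5] at h3
        omega
  have g0 : κ.natAbs ∉ sh (S x) (p + 2) := by
    intro h1
    rw [m3] at h1
    rcases h1.2.2 with h2 | h2
    · omega
    · have := e3 _ (by omega) h2
      omega
  have gm : κ.natAbs - 1 ∉ sh (S x) (p + 2) := by
    intro h1
    rw [m3] at h1
    omega
  obtain ⟨q, rfl⟩ : ∃ q, p = q + 1 := ⟨p - 1, by omega⟩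
  simp only [Nat.add_assoc, Nat.reduceAdd] at *
  obtain ⟨z, r, z1, z2, z3⟩ := ht.exists_letters3 (p := q) (by omega) x (a := -(κ - 1)) (b := -κ) (c := -(κ + 1))
    ⟨by rwa [show (-(κ + 1)).natAbs + 1 = κ.natAbs + 2 by omega],
      by rwa [show (-(κ + 1)).natAbs = κ.natAbs + 1 by omega]⟩
    ⟨by rw [mem_rmv]; exact ⟨by omega, Or.inl (by omega)⟩,
      by rw [mem_rmv, Int.natAbs_neg]; rintro ⟨-, h1 | h1⟩ <;> [omega; exact g0 h1.2]⟩
    ⟨by rw [mem_rmv]; exact ⟨by omega, Or.inl (by omega)⟩, by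
      rw [mem_rmv, mem_rmv, show (-(κ - 1)).natAbs = κ.natAbs - 1 by omega]
      rintro ⟨-, h1 | ⟨-, -, h1 | h1⟩⟩ <;> [omega; omega; exact gm h1.2]⟩
  have hl : ∀ j, q + 3 < j → j ≤ q + 6 → S z j = S x j :=
    fun j h1 h2 => ht.reach_letter (by omega) r h1 h2
  obtain ⟨w, k1, k2, k3, k4, k5⟩ := h.toggle_loop ht hN (x := z) hκ haκ ⟨Relation.ReflTransGen.refl, z1, z2, z3,
      by rw [hl _ (by omega) (by omega), ha], by rw [hl _ (by omega) (by omega), hb],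
      by rw [hl _ (by omega) (by omega), hc]⟩
  exact ⟨w, (r.mono (by omega)).trans k1, k2, k3, k4, ((h.top_reach (p := q + 1) hN r).mono (by omega)).trans k5⟩

theorem toggle_far (h : Loc N β ψ) (ht : Typed ψ β (p + 5) (p + 5) S) (hs : Separates ψ (p + 4) S)
    (hN : p + 4 < N) {x z : A} (hr : Reach ψ (p + 4) x z) (hmin : ∀ j ∈ sh (S x) (p + 5), 4 ≤ j)
    (hnext : 5 ∉ sh (S x) (p + 5)) (ha : (S x (p + 3)).natAbs = 1) (ha' : (S z (p + 3)).natAbs = 1)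
    (hb : S x (p + 4) = 2) (hb' : S z (p + 4) = 2) (hc : S x (p + 5) = -3) :
    Reach ψ (p + 4) (ψ (p + 4) x) (ψ (p + 4) z) := by
  have hc' : S z (p + 5) = -3 := by rw [ht.reach_letter (by omega) hr (by omega) (by omega), hc]
  have hsh := ht.reach_sh (by omega) hr (j := p + 5) (by omega) (by omega)
  have h4 := (ht.walk x).removable (show p + 4 < p + 5 by omega)
  have hsum := (ht.walk x).sum_sh
  simp only [Nat.add_assoc, Nat.reduceAdd, hc] at h4
  obtain ⟨s, hs1, hs2, hs3⟩ : ∃ s ∈ sh (S x) (p + 5), 5 ≤ s ∧ ∀ j, 5 ≤ j → j < s → j ∉ sh (S x) (p + 5) := by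
    refine exists_least_above ?_
    by_contra hcon
    push Not at hcon
    have : sh (S x) (p + 5) = {4} := by
      ext j
      simp only [Finset.mem_singleton]
      refine ⟨fun hj => ?_, fun hj => hj ▸ h4.1⟩
      have := hcon j hj
      have := hmin j hj
      omega
    rw [this] at hsum
    simp at hsum
  have hs5 : 6 ≤ s := by
    rcases eq_or_lt_of_le hs2 with e | e
    · exact absurd (e ▸ hs1) hnext
    · exact e
  obtain ⟨q, rfl⟩ : ∃ q, p = q + 1 := by
    have := Finset.single_le_sum (f := fun i => i) (fun i _ => Nat.zero_le i) hs1
    exact ⟨p - 1, by omega⟩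
  have key : ∀ y : A, sh (S y) (q + 6) = sh (S x) (q + 6) → (S y (q + 4)).natAbs = 1 → S y (q + 5) = 2 →
      S y (q + 6) = -3 → ∃ u v, Reach ψ (q + 5) y u ∧ S (ψ (q + 5) u) (q + 6) = (s : ℤ) - 1 ∧
        Reach ψ (q + 5) (ψ (q + 5) u) v ∧
        S (ψ (q + 5) v) (q + 6) = 3 ∧ Reach ψ (q + 5) (ψ (q + 5) v) (ψ (q + 5) y) := by
    intro y hy y1 y2 y3
    have w3 := (ht.walk y) (q + 3) (by omega)
    have w4 := (ht.walk y) (q + 4) (by omega)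
    have w5 := (ht.walk y) (q + 5) (by omega)
    have m3 := fun j => mem_sh_pred w3 (j := j)
    have m4 := fun j => mem_sh_pred w4 (j := j)
    have m5 := fun j => mem_sh_pred w5 (j := j)
    simp only [Nat.add_assoc, Nat.reduceAdd, y1, y2, y3, hy] at m3 m4 m5
    have n1 : ∀ j, 3 < j → j < s → j ∉ sh (S y) (q + 3) := by
      intro j hj1 hj2 hm
      rw [m3] at hm
      rcases hm.2.2 with h1 | h1
      · omega
      · rw [m4] at h1
        rcases h1.2.2 with h2 | h2
        · simp at h2; omega
        · rw [m5] at h2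
          rcases h2.2.2 with h5 | h5
          · simp at h5; omega
          · rcases Nat.lt_or_ge j 5 with h6 | h6
            · exact h2.2.1 (by simp; omega)
            · exact hs3 j h6 hj2 h5
    refine h.far_path ht hN rfl y2 y3 (s := s) (b' := -2) (c' := 3) ?_ (n1 _ (by omega) (by omega))
      (n1 _ (by omega) (by omega)) (by omega) (by omega) (by omega) (by omega) (by omega) (by omega) (by omega)
      (tr_neg_right (by omega) (by omega)) (by omega)
    rw [m3, m4, m5]
    exact ⟨by omega, by omega, Or.inr ⟨by omega, by simp; omega, Or.inr ⟨by omega, by simp; omega, Or.inr hs1⟩⟩⟩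
  simp only [Nat.add_assoc, Nat.reduceAdd] at *
  obtain ⟨u, v, r1, r2, r3, r4, r5⟩ := key x rfl ha hb hc
  obtain ⟨u', v', r1', r2', r3', r4', r5'⟩ := key z hsh ha' hb' hc'
  have hu : S u (q + 6) = -3 := by rw [ht.reach_letter (by omega) r1 (by omega) (by omega), hc]
  have k1 := h.swap_merge (p := q + 1) ht hs hN (x := u) (z := u')
    ((h.reach_symm (by omega) r1).trans (hr.trans r1')) r2 r2'
    (by rw [show S u (q + 1 + 5) = -3 from hu]; omega)
  have hv : S v (q + 6) = (s : ℤ) - 1 := by rw [ht.reach_letter (by omega) r3 (by omega) (by omega), r2]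
  have k2 := h.swap_merge (p := q + 1) ht hs hN (x := v) (z := v')
    ((h.reach_symm (by omega) r3).trans (Relation.ReflTransGen.trans k1 r3')) r4 r4'
    (by rw [show S v (q + 1 + 5) = (s : ℤ) - 1 from hv]; omega)
  exact (h.reach_symm (by omega) r5).trans (Relation.ReflTransGen.trans k2 r5')

/-- Elements of a piece whose last letter is toggled, for the smallest part of the shape. -/
theorem toggle_merge (h : Loc N β ψ) (ht : Typed ψ β (p + 5) (p + 5) S) (hs : Separates ψ (p + 4) S)
    (hN : p + 4 < N) {x z : A} {κ : ℤ} (hκ : 1 ≤ κ) (hr : Reach ψ (p + 4) x z)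
    (hmin : ∀ j ∈ sh (S x) (p + 5), κ + 1 ≤ (j : ℤ))
    (hc : S x (p + 5) = -κ) (hx : S (ψ (p + 4) x) (p + 5) = κ) (hz : S (ψ (p + 4) z) (p + 5) = κ) :
    Reach ψ (p + 4) (ψ (p + 4) x) (ψ (p + 4) z) := by
  have hsh := ht.reach_sh (by omega) hr (j := p + 5) (by omega) (by omega)
  have type : ∀ y, S y (p + 5) = -κ → S (ψ (p + 4) y) (p + 5) = κ →
      -κ < S y (p + 3) ∧ S y (p + 3) < S y (p + 4) ∧ (S y (p + 4) = κ - 1 ∨ S y (p + 4) = κ + 1) := by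
    intro y y5 hy
    have h3 := (ht.act_triple (p := p + 2) (by omega) y).2.2
    simp only [Nat.add_assoc, Nat.reduceAdd] at h3
    rw [h3, y5] at hy
    obtain ⟨h6, h7⟩ := tr_third hy (by omega)
    have := (ht.walk y).ne_succ (j := p + 4) (by omega) (by omega)
    simp only [Nat.add_assoc, Nat.reduceAdd, y5] at this
    omega
  have hc' : S z (p + 5) = -κ := by rw [ht.reach_letter (by omega) hr (by omega) (by omega), hc]
  obtain ⟨x1, x2, x3⟩ := type x hc hx
  obtain ⟨z1, z2, z3⟩ := type z hc' hz
  have hh : ∀ {x z : A} {b : ℤ}, Reach ψ (p + 4) x z → S x (p + 4) = b → S z (p + 4) = b → S x (p + 5) = -κ →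
      -κ < S x (p + 3) → S x (p + 3) < S x (p + 4) → -κ < S z (p + 3) → S z (p + 3) < S z (p + 4) →
      ¬(b = 2 ∧ κ = 3) → Reach ψ (p + 4) (ψ (p + 4) x) (ψ (p + 4) z) := by
    intro x z b r e1 e2 e3 e4 e5 e6 e7 e8
    exact h.gap_merge ht hs hN r e1 e3 e2 (by omega) (by omega) (by omega) (by omega)
  by_cases hn : κ.natAbs + 2 ∈ sh (S x) (p + 5)
  · have link : ∀ y, Reach ψ (p + 4) x y → S y (p + 5) = -κ → -κ < S y (p + 3) → S y (p + 3) < S y (p + 4) →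
        (S y (p + 4) = κ - 1 ∨ S y (p + 4) = κ + 1) → ∃ w, Reach ψ (p + 4) y w ∧ -κ < S w (p + 3) ∧
          S w (p + 3) < S w (p + 4) ∧ S w (p + 4) = κ + 1 ∧ S w (p + 5) = -κ ∧
          Reach ψ (p + 4) (ψ (p + 4) y) (ψ (p + 4) w) := by
      intro y ry y5 y3 y4 hy
      have hyh := ht.reach_sh (by omega) ry (j := p + 5) (by omega) (by omega)
      rcases hy with hy | hy
      · have hκ2 : 2 ≤ κ := by
          by_contra h1
          omega
        obtain ⟨w, k1, k2, k3, k4, k5⟩ := h.exists_toggle_link ht hN hκ2 (by rwa [hyh]) (by rwa [hyh]) rfl hy y5 y3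
          (by omega)
        exact ⟨w, k1, by omega, by omega, k3, k4, k5⟩
      · exact ⟨y, Relation.ReflTransGen.refl, y3, y4, hy, y5, Relation.ReflTransGen.refl⟩
    obtain ⟨w, k1, k2, k3, k4, k5, k6⟩ := link x Relation.ReflTransGen.refl hc x1 x2 x3
    obtain ⟨w', l1, l2, l3, l4, l5, l6⟩ := link z hr hc' z1 z2 z3
    have := hh (((h.reach_symm (by omega) k1).trans hr).trans l1) k4 l4 k5 k2 k3 l2 l3 (by omega)
    exact (k6.trans this).trans (h.reach_symm (by omega) l6)
  · have hA : ∀ y, sh (S y) (p + 5) = sh (S x) (p + 5) → S y (p + 5) = -κ → S y (p + 4) ≠ κ + 1 := by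
      intro y hy y5 y4
      have h4 := (ht.walk y).removable (show p + 3 < p + 5 by omega)
      have m5 := fun j => mem_sh_pred ((ht.walk y) (p + 4) (by omega)) (j := j)
      simp only [Nat.add_assoc, Nat.reduceAdd, y5, y4, hy] at m5 h4
      have := h4.1
      rw [m5] at this
      rcases this.2.2 with h1 | h1
      · omega
      · exact hn (by rwa [show κ.natAbs + 2 = (κ + 1).natAbs + 1 by omega])
    have x4 : S x (p + 4) = κ - 1 := x3.resolve_right (hA x rfl hc)
    have z4 : S z (p + 4) = κ - 1 := z3.resolve_right (hA z hsh hc')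
    by_cases h3 : κ = 3
    · subst h3
      have habs : ∀ y, sh (S y) (p + 5) = sh (S x) (p + 5) → S y (p + 4) = 2 → S y (p + 5) = -3 →
          -3 < S y (p + 3) → S y (p + 3) < 2 → (S y (p + 3)).natAbs = 1 := by
        intro y hy y4 y5 y3 y3'
        have h3 := (ht.walk y).removable (show p + 2 < p + 5 by omega)
        have m4 := fun j => mem_sh_pred ((ht.walk y) (p + 3) (by omega)) (j := j)
        have m5 := fun j => mem_sh_pred ((ht.walk y) (p + 4) (by omega)) (j := j)
        have hne := (ht.walk y).ne_succ (j := p + 3) (by omega) (by omega)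
        simp only [Nat.add_assoc, Nat.reduceAdd, y5, y4, hy] at m5 h3 m4 hne
        have := h3.1
        rw [m4, m5] at this
        rcases this.2.2 with h1 | ⟨-, -, h1 | h1⟩
        · simp at h1; omega
        · simp at h1; omega
        · have := hmin _ h1
          omega
      refine h.toggle_far ht hs hN hr (fun j hj => ?_) (by simpa using hn) (habs x rfl (by omega) hc x1 (by omega))
        (habs z hsh (by omega) hc' z1 (by omega)) (by omega) (by omega) hc
      have := hmin j hj
      omega
    · exact hh hr x4 z4 hc x1 x2 z1 z2 (by omega)

/-- The piece of the content of the smallest part is unique. -/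
theorem piece_unique_least (h : Loc N β ψ) (ht : Typed ψ β (p + 5) (p + 5) S) (hs : Separates ψ (p + 4) S)
    (hN : p + 4 < N) {x y : A} {κ : ℤ} (hκ : 0 ≤ κ) (hr : Reach ψ (p + 5) x y)
    (hmin : ∀ j ∈ sh (S x) (p + 5), κ + 1 ≤ (j : ℤ))
    (hx : S x (p + 5) = κ) (hy : S y (p + 5) = κ) : Reach ψ (p + 4) x y := by
  obtain ⟨l, hl1, hl2, rfl⟩ := h.two_edge (p + 4) (by omega) hN x y hr
  rcases pathTop_foldl (by omega) hl1 hl2 x with h1 | ⟨u, h1, h2⟩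
  · exact h1
  have hu : S u (p + 5) = κ := by rw [ht.reach_letter (by omega) h1 (by omega) (by omega), hx]
  rcases h2 with h2 | ⟨v, h2, h3⟩
  · exact (h1.trans (h.top_same ht hs hN (by
      rw [hu, ← hy, ht.reach_letter (by omega) h2 (by omega) (by omega)]))).trans h2
  have hv : S (ψ (p + 4) v) (p + 5) = κ := by rw [← hy, ht.reach_letter (by omega) h3 (by omega) (by omega)]
  have hc : S v (p + 5) = S (ψ (p + 4) u) (p + 5) := ht.reach_letter (by omega) h2 (by omega) (by omega)
  have hinv : ψ (p + 4) (ψ (p + 4) u) = u := h.inv _ (by omega) hN u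
  by_cases e1 : S (ψ (p + 4) u) (p + 5) = κ
  · exact ((((h1.trans (h.top_same ht hs hN (by rw [hu, e1]))).trans h2).trans
      (h.top_same ht hs hN (by rw [hv, hc, e1])))).trans h3
  by_cases e2 : S (ψ (p + 4) u) (p + 5) = -κ
  · have hsh : sh (S (ψ (p + 4) u)) (p + 5) = sh (S x) (p + 5) :=
      ht.reach_sh le_rfl ((h1.mono (by omega)).trans (Reach.step u ⟨by omega, by omega, by omega⟩)) le_rfl le_rfl
    have := h.toggle_merge ht hs hN (κ := κ) (by omega) h2 (by rwa [hsh]) e2 (by rw [hinv, hu]) hv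
    rw [hinv] at this
    exact (h1.trans this).trans h3
  · have := h.swap_merge ht hs hN (κ := κ) h2 (by rw [hinv, hu]) hv (by omega)
    rw [hinv] at this
    exact (h1.trans this).trans h3

/-- Elements of a class with the same last letter are in the same piece. -/
theorem piece_unique (h : Loc N β ψ) (ht : Typed ψ β (p + 5) (p + 5) S) (hs : Separates ψ (p + 4) S)
    (hN : p + 4 < N) {x y : A} (hr : Reach ψ (p + 5) x y) (hxy : S x (p + 5) = S y (p + 5)) :
    Reach ψ (p + 4) x y := by
  obtain ⟨κ, hκ⟩ : ∃ κ, S x (p + 5) = κ := ⟨_, rfl⟩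
  have hsh := ht.reach_sh le_rfl hr le_rfl le_rfl
  have hrem := (ht.walk x).removable (show p + 4 < p + 5 by omega)
  simp only [Nat.add_assoc, Nat.reduceAdd, hκ] at hrem
  obtain ⟨f, hf, -, hfmin⟩ := exists_least_above (K := sh (S x) (p + 5)) (t := 0) ⟨_, hrem.1, by omega⟩
  have h0 := zero_notMem_sh (S x) (p + 5)
  obtain ⟨g, rfl⟩ : ∃ g, f = g + 1 := ⟨f - 1, by
    rcases Nat.eq_zero_or_pos f with rfl | h1
    · contradiction
    · omega⟩
  have hmin : ∀ j ∈ sh (S x) (p + 5), (g : ℤ) + 1 ≤ (j : ℤ) := by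
    intro j hj
    by_contra h1
    exact hfmin j (by omega) (by omega) hj
  by_cases e : κ.natAbs = g
  · rcases le_or_gt 0 κ with h1 | h1
    · exact h.piece_unique_least ht hs hN (κ := g) (by omega) hr hmin (by omega) (by omega)
    · exact h.neg.piece_unique_least ht.neg hs.neg hN (κ := g) (by omega) hr (by rwa [sh_neg]) (by omega) (by omega)
  have hg : Removable (rmv (sh (S x) (p + 5)) κ) g := by
    refine ⟨?_, ?_⟩ <;> rw [mem_rmv]
    · refine ⟨by omega, Or.inr ⟨by omega, by simpa using hf⟩⟩
    · rintro ⟨h1, h2 | h2⟩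
      · omega
      · have := hmin _ h2.2
        omega
  have hκg : g + 1 ≤ κ.natAbs := by
    have h1 := hmin _ hrem.1
    omega
  have hκ2 : g + 2 ≤ κ.natAbs := by
    by_contra h1
    exact hrem.2 (by rwa [show κ.natAbs = g + 1 by omega])
  have key : ∀ z, Reach ψ (p + 5) x z → S z (p + 5) = κ → ∃ u, Reach ψ (p + 4) z u ∧
      S (ψ (p + 4) u) (p + 5) = g := by
    intro z hz hzκ
    have hsz := ht.reach_sh le_rfl hz le_rfl le_rfl
    obtain ⟨u, k1, k2, k3, k4, k5⟩ := ht.exists_pred (p := p + 4) (by omega) (x := z) hzκ (w := g) (by rwa [hsz])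
    have hA : Addable (sh (S u) (p + 3)) (S u (p + 4)) := (ht.walk u) (p + 3) (by omega)
    have hB : Addable (mv (sh (S u) (p + 3)) (S u (p + 4))) (S u (p + 5)) := (ht.walk u) (p + 4) (by omega)
    rw [k2] at hA hB
    rw [show p + 5 = p + 4 + 1 from rfl, k3] at hB
    have hC := (hA.swap hB (by omega) (by omega)).1
    obtain ⟨w, w1, w2⟩ : ∃ w, Removable (sh (S u) (p + 3)) w ∧ ((g < w ∧ w < κ) ∨ (κ < w ∧ w < g)) := by
      rcases lt_or_gt_of_ne (show (g : ℤ) ≠ κ by omega) with h1 | h1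
      · obtain ⟨w, w1, w2, w3⟩ := exists_removable_between (zero_notMem_sh _ _) hA hC h1
        exact ⟨w, w1, Or.inl ⟨w2, w3⟩⟩
      · obtain ⟨w, w1, w2, w3⟩ := exists_removable_between (zero_notMem_sh _ _) hC hA h1
        exact ⟨w, w1, Or.inr ⟨w2, w3⟩⟩
    obtain ⟨v, l1, l2⟩ := ht.exists_letter (p := p + 3) (by omega) u w1
    refine ⟨v, k1.trans (l1.mono (by omega)), ?_⟩
    have l3 : S v (p + 4) = g := by rw [ht.reach_letter (by omega) l1 (by omega) (by omega)]; exact k2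
    have l4 : S v (p + 5) = κ := by rw [ht.reach_letter (by omega) l1 (by omega) (by omega)]; exact k3
    exact (ht.act_tr (p := p + 2) (by omega) l2 l3 l4 (tr_swap_right w2 (by omega) (by omega))).2.2
  obtain ⟨u, u1, u2⟩ := key x Relation.ReflTransGen.refl hκ
  obtain ⟨v, v1, v2⟩ := key y hr (by rw [← hxy, hκ])
  have hst : ∀ w, Reach ψ (p + 5) w (ψ (p + 4) w) := fun w => Reach.step w ⟨by omega, by omega, by omega⟩
  have r1 : Reach ψ (p + 5) (ψ (p + 4) u) (ψ (p + 4) v) :=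
    (h.reach_symm (by omega) ((u1.mono (by omega)).trans (hst u))).trans
      (hr.trans ((v1.mono (by omega)).trans (hst v)))
  have hshu : sh (S (ψ (p + 4) u)) (p + 5) = sh (S x) (p + 5) :=
    ht.reach_sh le_rfl ((u1.mono (by omega)).trans (hst u)) le_rfl le_rfl
  have r2 := h.piece_unique_least ht hs hN (κ := g) (by omega) r1 (by rwa [hshu]) u2 v2
  have hiu : ψ (p + 4) (ψ (p + 4) u) = u := h.inv _ (by omega) hN u
  have hiv : ψ (p + 4) (ψ (p + 4) v) = v := h.inv _ (by omega) hN v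
  have r3 := h.swap_merge ht hs hN (κ := κ) r2
    (by rw [hiu, ht.reach_letter (by omega) u1 (by omega) (by omega), hκ])
    (by rw [hiv, ht.reach_letter (by omega) v1 (by omega) (by omega), ← hxy, hκ])
    (by rw [u2]; omega)
  rw [hiu, hiv] at r3
  exact (u1.trans r3).trans (h.reach_symm (by omega) v1)

theorem separates_succ (h : Loc N β ψ) (ht : Typed ψ β (p + 5) (p + 5) S) (hs : Separates ψ (p + 4) S)
    (hN : p + 4 < N) : Separates ψ (p + 5) S := fun x y hr he =>
  hs x y (h.piece_unique ht hs hN hr (he _ (by omega) le_rfl)) (fun j h1 h2 => he j h1 (by omega))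

/-- A typing by content walks that separates the points of each class. -/
theorem exists_typed (h : Loc N β ψ) (hN : 4 < N) (hm : 4 ≤ m) (hmN : m ≤ N) :
    ∃ S, Typed ψ β m m S ∧ (∀ x, S x 0 = 0) ∧ Separates ψ m S := by
  obtain ⟨p, rfl⟩ : ∃ p, m = p + 4 := ⟨m - 4, by omega⟩
  clear hm
  induction p with
  | zero => exact h.base hN
  | succ p ih =>
    obtain ⟨S, ht, h0, hs⟩ := ih (by omega)
    obtain ⟨S', ht', he⟩ := h.exists_extension ht hs (by omega) (by omega)
    have hs' : Separates ψ (p + 4) S' := fun x y hr hl => hs x y hr (fun j h1 h2 => by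
      rw [← he x j h2, ← he y j h2, hl j h1 h2])
    have h0' : ∀ x, S' x 0 = 0 := fun x => by rw [he x 0 (by omega), h0]
    have ht2 := h.top_act ht' hs' (by omega) h0'
    exact ⟨S', ht2, h0', h.separates_succ ht2 hs' (by omega)⟩

end Loc

end

end QueerDual

namespace QueerDual

/-! ### Strict partitions as sets of parts -/

/-- The number of parts larger than `t`. -/
def above (G : Finset ℕ) (t : ℕ) : ℕ := (G.filter (t < ·)).card

theorem lt_getD_iff {l : List ℕ} (hl : l.Pairwise (· > ·)) (t r : ℕ) :
    t < l.getD r 0 ↔ r < above l.toFinset t := by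
  unfold above
  induction l generalizing r with
  | nil => simp
  | cons a l ih =>
    rw [List.pairwise_cons] at hl
    have ha : a ∉ l.toFinset := by
      simp only [List.mem_toFinset]; intro h; exact lt_irrefl _ (hl.1 a h)
    rw [List.toFinset_cons, Finset.filter_insert]
    split_ifs with h
    · rw [Finset.card_insert_of_notMem (by simp only [Finset.mem_filter, not_and]; exact fun h => absurd h ha)]
      cases r with
      | zero => simpa using h
      | succ r => rw [List.getD_cons_succ, ih hl.2]; omega
    · have : l.toFinset.filter (t < ·) = ∅ := by
        ext j
        simp only [Finset.mem_filter, List.mem_toFinset, Finset.notMem_empty, iff_false, not_and]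
        intro hj
        have := hl.1 j hj
        omega
      rw [this, Finset.card_empty]
      cases r with
      | zero => simpa using h
      | succ r =>
        rw [List.getD_cons_succ, ih hl.2, this, Finset.card_empty]
        simp

namespace StrictPartition

variable {n : ℕ}

/-- The set of parts. -/
def beads (γ : StrictPartition n) : Finset ℕ := γ.parts.toFinset

theorem nodup (γ : StrictPartition n) : γ.parts.Nodup :=
  γ.strict.imp (fun h => ne_of_gt h)

theorem zero_notMem_beads (γ : StrictPartition n) : 0 ∉ γ.beads := by
  intro h
  exact lt_irrefl _ (γ.pos 0 (List.mem_toFinset.1 h))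

theorem sum_beads (γ : StrictPartition n) : ∑ i ∈ γ.beads, i = n := by
  rw [beads, List.sum_toFinset _ γ.nodup, List.map_id', γ.sum_eq]

theorem ext_beads {γ δ : StrictPartition n} (h : γ.beads = δ.beads) : γ = δ := by
  have hp := List.perm_of_nodup_nodup_toFinset_eq γ.nodup δ.nodup h
  exact StrictPartition.ext (hp.eq_of_pairwise (fun a b _ _ h1 h2 => by omega) γ.strict δ.strict)

theorem exists_of_finset {G : Finset ℕ} (h0 : 0 ∉ G) (hs : ∑ i ∈ G, i = n) :
    ∃ γ : StrictPartition n, γ.beads = G := by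
  refine ⟨⟨G.sort (· ≥ ·), ?_, ?_, ?_⟩, ?_⟩
  · exact (Finset.sortedGT_sort G).pairwise
  · intro p hp
    rw [Finset.mem_sort] at hp
    exact Nat.pos_of_ne_zero (fun h => h0 (h ▸ hp))
  · rw [← hs, ← List.map_id' (G.sort (· ≥ ·)), ← List.sum_toFinset _ (Finset.sort_nodup _ _), Finset.sort_toFinset]
  · simp [beads]

theorem mem_shiftedCells {γ : StrictPartition n} {x : ℕ × ℕ} :
    x ∈ γ.shiftedCells ↔ x.1 ≤ x.2 ∧ x.1 < above γ.beads (x.2 - x.1) := by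
  rw [beads, ← lt_getD_iff γ.strict]
  show x.1 ≤ x.2 ∧ x.2 < x.1 + γ.parts.getD x.1 0 ↔ _
  omega

end StrictPartition

theorem above_mv {G : Finset ℕ} {c : ℤ} (h : Addable G c) (t : ℕ) :
    above (mv G c) t = above G t + if t = c.natAbs then 1 else 0 := by
  unfold above mv
  obtain ⟨h1, h2⟩ := h
  rw [Finset.filter_insert, Finset.filter_erase]
  have hn : c.natAbs + 1 ∉ (G.filter (t < ·)).erase c.natAbs := by simp [h2]
  rcases lt_trichotomy t c.natAbs with h3 | h3 | h3
  · have hm : c.natAbs ∈ G.filter (t < ·) := by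
      rw [Finset.mem_filter]
      exact ⟨h1.resolve_left (by omega), h3⟩
    rw [if_pos (by omega), if_neg (by omega), Finset.card_insert_of_notMem hn, Finset.card_erase_add_one hm]
    rfl
  · rw [if_pos (by omega), if_pos h3, Finset.card_insert_of_notMem hn, Finset.erase_eq_of_notMem]
    simp [h3]
  · rw [if_neg (by omega), if_neg (by omega), Finset.erase_eq_of_notMem]
    · rfl
    · simp; omega

theorem above_anti {G : Finset ℕ} {t u : ℕ} (h : t ≤ u) : above G u ≤ above G t :=
  Finset.card_le_card (fun j => by simp only [Finset.mem_filter]; intro hj; exact ⟨hj.1, by omega⟩)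

theorem above_succ {G : Finset ℕ} (t : ℕ) : above G t = above G (t + 1) + if t + 1 ∈ G then 1 else 0 := by
  unfold above
  have : G.filter (t < ·) = G.filter (t + 1 < ·) ∪ (if t + 1 ∈ G then {t + 1} else ∅) := by
    ext j
    split_ifs with h
    · simp only [Finset.mem_filter, Finset.mem_union, Finset.mem_singleton]
      refine ⟨fun hj => ?_, fun hj => ?_⟩
      · rcases eq_or_ne j (t + 1) with e | e
        · exact Or.inr e
        · exact Or.inl ⟨hj.1, by omega⟩
      · rcases hj with hj | rfl
        · exact ⟨hj.1, by omega⟩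
        · exact ⟨h, by omega⟩
    · simp only [Finset.mem_filter, Finset.mem_union, Finset.notMem_empty, or_false]
      refine and_congr_right (fun hj => ?_)
      have : j ≠ t + 1 := fun e => h (e ▸ hj)
      omega
  rw [this, Finset.card_union_of_disjoint]
  · split_ifs <;> simp
  · rw [Finset.disjoint_left]
    intro j hj
    rw [Finset.mem_filter] at hj
    split_ifs <;> simp
    omega

theorem above_add_le {G : Finset ℕ} {t u : ℕ} (h : t ≤ u) : above G t + t ≤ above G u + u := by
  induction u, h using Nat.le_induction with
  | base => exact le_rfl
  | succ u hu ih =>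
    have := above_succ (G := G) u
    split_ifs at this <;> omega

/-- The cell that is added by the content `c`. -/
def newCell (G : Finset ℕ) (c : ℤ) : ℕ × ℕ := (above G c.natAbs, above G c.natAbs + c.natAbs)

theorem shiftedCells_mv {n : ℕ} {γ : StrictPartition n} {δ : StrictPartition (n + 1)} {c : ℤ}
    (h : Addable γ.beads c) (hδ : δ.beads = mv γ.beads c) :
    δ.shiftedCells = insert (newCell γ.beads c) γ.shiftedCells ∧ newCell γ.beads c ∉ γ.shiftedCells := by
  refine ⟨?_, ?_⟩
  · ext ⟨r, q⟩
    rw [Set.mem_insert_iff, StrictPartition.mem_shiftedCells, StrictPartition.mem_shiftedCells, hδ, above_mv h,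
      newCell, Prod.mk.injEq]
    simp only
    split_ifs with h1
    · rw [h1]; omega
    · omega
  · rw [StrictPartition.mem_shiftedCells, newCell]
    simp

/-- The row, in the symmetric diagram, of the cell with content `c`. -/
def symHeight (G : Finset ℕ) (c : ℤ) : ℤ := above G c.natAbs + max c 0

theorem symHeight_mono {G : Finset ℕ} {x y : ℤ} (h : x ≤ y) : symHeight G x ≤ symHeight G y := by
  unfold symHeight
  rcases le_total x.natAbs y.natAbs with h1 | h1
  · have h2 := above_add_le (G := G) h1
    have h3 := above_anti (G := G) h1
    omega
  · have h2 := above_add_le (G := G) h1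
    have h3 := above_anti (G := G) h1
    omega

theorem symHeight_lt {G : Finset ℕ} {x y : ℤ} (hx : Addable G x) (h : x < y) :
    symHeight G x < symHeight G y := by
  obtain ⟨h1, h2⟩ := hx
  unfold symHeight
  have h5 := above_succ (G := G) x.natAbs
  rw [if_neg h2] at h5
  rcases le_or_gt y.natAbs x.natAbs with h3 | h3
  · have h4 := above_anti (G := G) h3
    rcases le_or_gt y 0 with h6 | h6
    · have h7 := above_succ (G := G) (x.natAbs - 1)
      rw [Nat.sub_add_cancel (by omega), if_pos (h1.resolve_left (by omega))] at h7
      have h8 := above_anti (G := G) (show y.natAbs ≤ x.natAbs - 1 by omega)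
      omega
    · omega
  · have h4 := above_add_le (G := G) (show x.natAbs + 1 ≤ y.natAbs by omega)
    omega

end QueerDual

namespace QueerDual

variable {n : ℕ}

namespace SignedFilling

/-- Put the letter `a` into the cell `x`. -/
def place (S : SignedFilling) (a : ℕ) (x : ℕ × ℕ) (ε : Bool) : SignedFilling where
  pos := Function.update S.pos a x
  mark := Function.update S.mark a ε

theorem diag_place_self (S : SignedFilling) (a : ℕ) (x : ℕ × ℕ) (ε : Bool) :
    (S.place a x ε).diag a = if ε = true then (x.2 : ℤ) - x.1 else (x.1 : ℤ) - x.2 := by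
  simp [diag, place]

theorem diag_place_ne (S : SignedFilling) {a b : ℕ} (h : b ≠ a) (x : ℕ × ℕ) (ε : Bool) :
    (S.place a x ε).diag b = S.diag b := by
  simp [diag, place, h]

end SignedFilling

namespace IsSST

theorem diag_of_notMem {γ : StrictPartition n} {S : SignedFilling} (h : IsSST γ S) {a : ℕ}
    (ha : a ∉ Set.Icc 1 n) : S.diag a = 0 := by
  simp [SignedFilling.diag, h.pos_default a ha]

/-- Append the letter `n + 1`. -/
theorem place_succ {γ : StrictPartition n} {S : SignedFilling} (h : IsSST γ S) {δ : StrictPartition (n + 1)}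
    {c : ℤ} (hc : Addable γ.beads c) (hδ : δ.beads = mv γ.beads c) {ε : Bool}
    (hε : c = 0 → ε = false) : IsSST δ (S.place (n + 1) (newCell γ.beads c) ε) := by
  obtain ⟨hcells, hnew⟩ := shiftedCells_mv hc hδ
  obtain ⟨x, hx⟩ : ∃ x, newCell γ.beads c = x := ⟨_, rfl⟩
  have hxd : x.2 = x.1 + c.natAbs := by rw [← hx]; rfl
  rw [hx] at hcells hnew ⊢
  have hself : (S.place (n + 1) x ε).pos (n + 1) = x := by simp [SignedFilling.place]
  have hne : ∀ a, a ≠ n + 1 → (S.place (n + 1) x ε).pos a = S.pos a := fun a ha => by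
    simp [SignedFilling.place, ha]
  have hmem : ∀ a ∈ Set.Icc 1 (n + 1), a ≠ n + 1 → a ∈ Set.Icc 1 n := by
    intro a ha hne
    simp only [Set.mem_Icc] at *
    omega
  have hcell : ∀ a ∈ Set.Icc 1 n, S.pos a ∈ γ.shiftedCells := fun a ha => h.bijOn.mapsTo ha
  refine ⟨⟨?_, ?_, ?_⟩, ?_, ?_, ?_, ?_, ?_⟩
  · intro a ha
    rw [hcells]
    rcases eq_or_ne a (n + 1) with rfl | h1
    · rw [hself]; exact Set.mem_insert _ _
    · rw [hne a h1]; exact Set.mem_insert_of_mem _ (hcell a (hmem a ha h1))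
  · intro a ha b hb hab
    rcases eq_or_ne a (n + 1) with rfl | h1 <;> rcases eq_or_ne b (n + 1) with rfl | h2
    · rfl
    · rw [hself, hne b h2] at hab
      exact absurd (hab ▸ hcell b (hmem b hb h2)) hnew
    · rw [hself, hne a h1] at hab
      exact absurd (hab ▸ hcell a (hmem a ha h1)) hnew
    · rw [hne a h1, hne b h2] at hab
      exact h.bijOn.injOn (hmem a ha h1) (hmem b hb h2) hab
  · intro y hy
    rw [hcells] at hy
    rcases hy with rfl | hy
    · exact ⟨n + 1, by simp, hself⟩
    · obtain ⟨a, ha, rfl⟩ := h.bijOn.surjOn hy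
      simp only [Set.mem_Icc] at ha
      exact ⟨a, by simp only [Set.mem_Icc]; omega, hne a (by omega)⟩
  · intro a ha b hb h1 h2
    rcases eq_or_ne b (n + 1) with rfl | h3
    · rcases eq_or_ne a (n + 1) with rfl | h4
      · exact absurd h2 (lt_irrefl _)
      · have := (hmem a ha h4).2; omega
    rcases eq_or_ne a (n + 1) with rfl | h4
    · rw [hself, hne b h3] at h1 h2
      have h5 := hcell b (hmem b hb h3)
      refine absurd ?_ hnew
      rw [StrictPartition.mem_shiftedCells] at h5 ⊢
      exact ⟨by omega, by rw [h1]; exact h5.2.trans_le (above_anti (by omega))⟩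
    · rw [hne a h4, hne b h3] at h1 h2
      exact h.row_inc a (hmem a ha h4) b (hmem b hb h3) h1 h2
  · intro a ha b hb h1 h2
    rcases eq_or_ne b (n + 1) with rfl | h3
    · rcases eq_or_ne a (n + 1) with rfl | h4
      · exact absurd h2 (lt_irrefl _)
      · have := (hmem a ha h4).2; omega
    rcases eq_or_ne a (n + 1) with rfl | h4
    · rw [hself, hne b h3] at h1 h2
      have h5 := hcell b (hmem b hb h3)
      refine absurd ?_ hnew
      rw [StrictPartition.mem_shiftedCells] at h5 ⊢
      refine ⟨by omega, ?_⟩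
      have := above_add_le (G := γ.beads) (show (S.pos b).2 - (S.pos b).1 ≤ x.2 - x.1 by omega)
      omega
    · rw [hne a h4, hne b h3] at h1 h2
      exact h.col_inc a (hmem a ha h4) b (hmem b hb h3) h1 h2
  · intro a ha h1
    rcases eq_or_ne a (n + 1) with rfl | h3
    · rw [hself] at h1
      simp only [SignedFilling.place, Function.update_self]
      exact hε (by omega)
    · rw [hne a h3] at h1
      simp only [SignedFilling.place, Function.update_of_ne h3]
      exact h.diag_unmarked a (hmem a ha h3) h1
  · intro a ha
    have h3 : a ≠ n + 1 := by rintro rfl; simp at ha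
    rw [hne a h3]
    exact h.pos_default a (fun h4 => ha ⟨h4.1, by have := h4.2; omega⟩)
  · intro a ha
    have h3 : a ≠ n + 1 := by rintro rfl; simp at ha
    simp only [SignedFilling.place, Function.update_of_ne h3]
    exact h.mark_default a (fun h4 => ha ⟨h4.1, by have := h4.2; omega⟩)

/-- Remove the largest letter. -/
theorem exists_pred {δ : StrictPartition (n + 1)} {S : SignedFilling} (h : IsSST δ S) :
    ∃ (γ : StrictPartition n), IsSST γ (S.place (n + 1) (0, 0) false) ∧
      Addable γ.beads (S.diag (n + 1)) ∧ δ.beads = mv γ.beads (S.diag (n + 1)) ∧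
      S.pos (n + 1) = newCell γ.beads (S.diag (n + 1)) := by
  obtain ⟨⟨r, q⟩, hx⟩ : ∃ x, S.pos (n + 1) = x := ⟨_, rfl⟩
  have hN : n + 1 ∈ Set.Icc 1 (n + 1) := by simp
  have hxm : (r, q) ∈ δ.shiftedCells := hx ▸ h.bijOn.mapsTo hN
  rw [StrictPartition.mem_shiftedCells] at hxm
  obtain ⟨h1, h2⟩ := hxm
  simp only at h1 h2
  obtain ⟨t, rfl⟩ : ∃ t, q = r + t := ⟨q - r, by omega⟩
  rw [Nat.add_sub_cancel_left] at h2
  have hright : above δ.beads (t + 1) ≤ r := by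
    by_contra hcon
    obtain ⟨b, hb, hbx⟩ := h.bijOn.surjOn (show ((r, r + t + 1) : ℕ × ℕ) ∈ δ.shiftedCells by
      rw [StrictPartition.mem_shiftedCells]
      simp only
      rw [show r + t + 1 - r = t + 1 by omega]
      omega)
    have := h.row_inc (n + 1) hN b hb (by rw [hx, hbx]) (by rw [hx, hbx]; simp)
    have := hb.2
    omega
  have hup : t ≠ 0 → above δ.beads (t - 1) ≤ r + 1 := by
    intro ht
    by_contra hcon
    obtain ⟨b, hb, hbx⟩ := h.bijOn.surjOn (show ((r + 1, r + t) : ℕ × ℕ) ∈ δ.shiftedCells by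
      rw [StrictPartition.mem_shiftedCells]
      simp only
      rw [show r + t - (r + 1) = t - 1 by omega]
      omega)
    have := h.col_inc (n + 1) hN b hb (by rw [hx, hbx]) (by rw [hx, hbx]; simp)
    have := hb.2
    omega
  have hs := above_succ (G := δ.beads) t
  have htm : t + 1 ∈ δ.beads := by
    by_contra hcon
    rw [if_neg hcon] at hs
    omega
  rw [if_pos htm] at hs
  have htn : t ∉ δ.beads := by
    intro hcon
    rcases Nat.eq_zero_or_pos t with rfl | ht
    · exact δ.zero_notMem_beads hcon
    · have h3 := above_succ (G := δ.beads) (t - 1)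
      rw [Nat.sub_add_cancel ht, if_pos hcon] at h3
      have := hup (by omega)
      omega
  have hd : (S.diag (n + 1)).natAbs = t := by
    unfold SignedFilling.diag
    rw [hx]
    split_ifs <;> push_cast <;> omega
  obtain ⟨c, hc⟩ : ∃ c, S.diag (n + 1) = c := ⟨_, rfl⟩
  rw [hc] at hd ⊢
  have hG0 : 0 ∉ rmv δ.beads c := by simp [mem_rmv]
  have hadd : Addable (rmv δ.beads c) c := by
    refine ⟨?_, by rw [mem_rmv]; omega⟩
    rcases eq_or_ne c 0 with h3 | h3
    · exact Or.inl h3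
    · exact Or.inr (by rw [mem_rmv]; exact ⟨by omega, Or.inl rfl⟩)
  have hmv : mv (rmv δ.beads c) c = δ.beads := by
    ext j
    rw [mem_mv, mem_rmv, hd]
    have h0 := δ.zero_notMem_beads
    by_cases e1 : j = t + 1
    · subst e1; simp [htm]
    · by_cases e2 : j = t
      · subst e2; simp [htn]
      · by_cases e3 : j = 0
        · subst e3; simp [h0]
        · simp [e1, e2, e3]
  obtain ⟨γ, hγ⟩ := StrictPartition.exists_of_finset (n := n) hG0 (by
    have h3 := sum_mv hadd
    rw [hmv, δ.sum_beads] at h3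
    omega)
  refine ⟨γ, ?_, hγ ▸ hadd, by rw [hγ, hmv], ?_⟩
  swap
  · have h3 := above_mv hadd t
    rw [hmv, if_pos hd.symm] at h3
    rw [hx, newCell, hγ, hd]
    simp only [Prod.mk.injEq]
    omega
  obtain ⟨hcells, hnew⟩ := shiftedCells_mv (γ := γ) (δ := δ) (c := c) (hγ ▸ hadd) (by rw [hγ, hmv])
  have hcell : newCell γ.beads c = (r, r + t) := by
    have h3 := above_mv hadd t
    rw [hmv, if_pos hd.symm] at h3
    rw [newCell, hγ, hd]
    simp only [Prod.mk.injEq]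
    omega
  rw [hcell] at hcells hnew
  have hne : ∀ a, a ≠ n + 1 → (S.place (n + 1) (0, 0) false).pos a = S.pos a := fun a ha => by
    simp [SignedFilling.place, ha]
  have hmne : ∀ a, a ≠ n + 1 → (S.place (n + 1) (0, 0) false).mark a = S.mark a := fun a ha => by
    simp [SignedFilling.place, ha]
  have hmem : ∀ a ∈ Set.Icc 1 n, a ≠ n + 1 ∧ a ∈ Set.Icc 1 (n + 1) := by
    intro a ha
    simp only [Set.mem_Icc] at *
    omega
  refine ⟨⟨?_, ?_, ?_⟩, ?_, ?_, ?_, ?_, ?_⟩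
  · intro a ha
    obtain ⟨h3, h4⟩ := hmem a ha
    rw [hne a h3]
    have h5 := h.bijOn.mapsTo h4
    rw [hcells] at h5
    refine h5.resolve_left (fun h6 => h3 (h.bijOn.injOn h4 hN (by rw [h6, hx])))
  · intro a ha b hb hab
    rw [hne a (hmem a ha).1, hne b (hmem b hb).1] at hab
    exact h.bijOn.injOn (hmem a ha).2 (hmem b hb).2 hab
  · intro y hy
    obtain ⟨a, ha, rfl⟩ := h.bijOn.surjOn (show y ∈ δ.shiftedCells by rw [hcells]; exact Set.mem_insert_of_mem _ hy)
    have h3 : a ≠ n + 1 := by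
      rintro rfl
      rw [hx] at hy
      exact hnew hy
    simp only [Set.mem_Icc] at ha
    exact ⟨a, by simp only [Set.mem_Icc]; omega, hne a h3⟩
  · intro a ha b hb
    rw [hne a (hmem a ha).1, hne b (hmem b hb).1]
    exact h.row_inc a (hmem a ha).2 b (hmem b hb).2
  · intro a ha b hb
    rw [hne a (hmem a ha).1, hne b (hmem b hb).1]
    exact h.col_inc a (hmem a ha).2 b (hmem b hb).2
  · intro a ha
    rw [hne a (hmem a ha).1, hmne a (hmem a ha).1]
    exact h.diag_unmarked a (hmem a ha).2
  · intro a ha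
    rcases eq_or_ne a (n + 1) with rfl | h3
    · simp [SignedFilling.place]
    · rw [hne a h3]
      exact h.pos_default a (fun h4 => ha (by simp only [Set.mem_Icc] at *; omega))
  · intro a ha
    rcases eq_or_ne a (n + 1) with rfl | h3
    · simp [SignedFilling.place]
    · rw [hmne a h3]
      exact h.mark_default a (fun h4 => ha (by simp only [Set.mem_Icc] at *; omega))

/-- The contents of the letters form a walk, which determines the tableau. -/
theorem walk {γ : StrictPartition n} {S : SignedFilling} (h : IsSST γ S) :
    IsWalk n S.diag ∧ sh S.diag n = γ.beads ∧
      ∀ a < n, S.pos (a + 1) = newCell (sh S.diag a) (S.diag (a + 1)) := by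
  induction n generalizing S with
  | zero =>
    refine ⟨fun k hk => absurd hk (Nat.not_lt_zero k), ?_, fun k hk => absurd hk (Nat.not_lt_zero k)⟩
    have h1 := γ.sum_beads
    rw [Finset.sum_eq_zero_iff] at h1
    ext j
    simp only [sh, Finset.notMem_empty, false_iff]
    intro hj
    exact γ.zero_notMem_beads (h1 j hj ▸ hj)
  | succ n ih =>
    obtain ⟨γ', h1, h2, h3, h4⟩ := h.exists_pred
    obtain ⟨i1, i2, i3⟩ := ih h1
    have hd : ∀ a, a ≤ n → (S.place (n + 1) (0, 0) false).diag a = S.diag a :=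
      fun a ha => S.diag_place_ne (by omega) _ _
    have hsh : ∀ a, a ≤ n → sh (S.place (n + 1) (0, 0) false).diag a = sh S.diag a :=
      fun a ha => sh_congr (fun j _ h6 => hd j (by omega))
    have hG : sh S.diag n = γ'.beads := by rw [← hsh n le_rfl, i2]
    refine ⟨fun k hk => ?_, ?_, fun k hk => ?_⟩
    · rcases Nat.lt_or_ge k n with h5 | h5
      · have := i1 k h5
        rwa [hsh k h5.le, hd _ h5] at this
      · obtain rfl : k = n := by omega
        rwa [hG]
    · rw [sh, hG, h3]
    · rcases Nat.lt_or_ge k n with h5 | h5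
      · have := i3 k h5
        rw [hsh k h5.le, hd _ h5] at this
        rw [← this]
        simp [SignedFilling.place, h5.ne]
      · obtain rfl : k = n := by omega
        rw [hG, h4]

theorem mark_iff {γ : StrictPartition n} {S : SignedFilling} (h : IsSST γ S) (a : ℕ) :
    S.mark a = true ↔ 0 < S.diag a := by
  by_cases ha : a ∈ Set.Icc 1 n
  · have h1 := (StrictPartition.mem_shiftedCells.1 (h.bijOn.mapsTo ha)).1
    unfold SignedFilling.diag
    split_ifs with h2
    · refine iff_of_true h2 ?_
      have : (S.pos a).1 ≠ (S.pos a).2 := fun h3 => by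
        rw [h.diag_unmarked a ha h3] at h2
        exact absurd h2 (by decide)
      omega
    · exact iff_of_false h2 (by omega)
  · rw [h.mark_default a ha, h.diag_of_notMem ha]
    simp

theorem ext_diag {γ : StrictPartition n} {S T : SignedFilling} (hS : IsSST γ S) (hT : IsSST γ T)
    (h : ∀ a, 1 ≤ a → a ≤ n → S.diag a = T.diag a) : S = T := by
  have h' : S.diag = T.diag := by
    funext a
    by_cases ha : a ∈ Set.Icc 1 n
    · exact h a ha.1 ha.2
    · rw [hS.diag_of_notMem ha, hT.diag_of_notMem ha]
  refine SignedFilling.ext ?_ ?_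
  · funext a
    by_cases ha : a ∈ Set.Icc 1 n
    · obtain ⟨h1, h2⟩ := ha
      obtain ⟨b, rfl⟩ : ∃ b, a = b + 1 := ⟨a - 1, by omega⟩
      rw [hS.walk.2.2 b (by omega), hT.walk.2.2 b (by omega), h']
    · rw [hS.pos_default a ha, hT.pos_default a ha]
  · funext a
    have := hS.mark_iff a
    have h2 := hT.mark_iff a
    rw [h'] at this
    rw [← h2] at this
    exact Bool.eq_iff_iff.2 this

theorem diag_newCell (G : Finset ℕ) (c : ℤ) :
    (if decide (0 < c) = true then ((newCell G c).2 : ℤ) - (newCell G c).1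
      else ((newCell G c).1 : ℤ) - (newCell G c).2) = c := by
  simp only [newCell, decide_eq_true_eq]
  split_ifs <;> omega

/-- Every walk comes from a signed standard tableau. -/
theorem exists_of_walk {s : ℕ → ℤ} (hs : IsWalk n s) {γ : StrictPartition n} (hγ : γ.beads = sh s n) :
    ∃ S, IsSST γ S ∧ ∀ a, 1 ≤ a → a ≤ n → S.diag a = s a := by
  induction n with
  | zero =>
    refine ⟨⟨fun _ => (0, 0), fun _ => false⟩, ⟨?_, ?_, ?_, ?_, ?_, ?_⟩, fun a h1 h2 => by omega⟩
    · have : γ.shiftedCells = ∅ := by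
        ext x
        rw [StrictPartition.mem_shiftedCells, hγ]
        simp [sh, above]
      rw [this]
      simp
    all_goals simp
  | succ n ih =>
    have hs' : IsWalk n s := hs.mono (Nat.le_succ n)
    obtain ⟨γ', hγ'⟩ := StrictPartition.exists_of_finset (zero_notMem_sh s n) hs'.sum_sh
    obtain ⟨S, h1, h2⟩ := ih hs' hγ'
    have ha : Addable γ'.beads (s (n + 1)) := by rw [hγ']; exact hs n (Nat.lt_succ_self n)
    refine ⟨_, h1.place_succ (δ := γ) ha (by rw [hγ, hγ']; rfl) (ε := decide (0 < s (n + 1))) (fun h0 => by simp [h0]),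
      fun a h3 h4 => ?_⟩
    rcases eq_or_ne a (n + 1) with rfl | h5
    · rw [SignedFilling.diag_place_self]
      exact diag_newCell _ _
    · rw [SignedFilling.diag_place_ne _ h5]
      exact h2 a h3 (by omega)

/-- The symmetric row of a letter. -/
theorem hookPass_eq {γ : StrictPartition n} {S : SignedFilling} (h : IsSST γ S) {a : ℕ} (ha : a < n) :
    (S.hookPass (a + 1) : ℤ) = symHeight (sh S.diag a) (S.diag (a + 1)) := by
  have h1 := h.mark_iff (a + 1)
  unfold SignedFilling.hookPass symHeight
  rw [h.walk.2.2 a ha]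
  split_ifs with h2
  · rw [h1] at h2
    simp only [newCell]; omega
  · rw [h1] at h2
    simp only [newCell]; omega

theorem symHeight_mv {G : Finset ℕ} {x y : ℤ} (hx : Addable G x) (h : y.natAbs ≠ x.natAbs) :
    symHeight (mv G x) y = symHeight G y := by
  unfold symHeight
  rw [above_mv hx, if_neg h, Nat.add_zero]

/-- Descents are ascents of the contents. -/
theorem mem_des {γ : StrictPartition n} {S : SignedFilling} (h : IsSST γ S) {i : ℕ} :
    i ∈ S.des n ↔ 1 ≤ i ∧ i < n ∧ S.diag i < S.diag (i + 1) := by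
  unfold SignedFilling.des
  refine and_congr_right (fun h1 => and_congr_right (fun h2 => ?_))
  obtain ⟨a, rfl⟩ : ∃ a, i = a + 1 := ⟨i - 1, by omega⟩
  obtain ⟨w1, w2, w3⟩ := h.walk
  have hA := w1 a (by omega)
  have hB := w1 (a + 1) h2
  have hne := hB.natAbs_ne
  have e1 := h.hookPass_eq (a := a) (by omega)
  have e2 := h.hookPass_eq (a := a + 1) h2
  rw [show sh S.diag (a + 1) = mv (sh S.diag a) (S.diag (a + 1)) from rfl, symHeight_mv hA (Ne.symm hne)] at e2
  have hp := w3 a (by omega)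
  have hq := w3 (a + 1) h2
  have m1 := h.mark_iff (a + 1)
  have m2 := h.mark_iff (a + 1 + 1)
  unfold SignedFilling.hookBefore
  rcases lt_trichotomy (S.diag (a + 1)) (S.diag (a + 1 + 1)) with h3 | h3 | h3
  · have h4 := symHeight_lt hA h3
    exact iff_of_true (Or.inl (by omega)) h3
  · exact absurd (congrArg Int.natAbs h3) hne
  · have h4 := symHeight_mono (G := sh S.diag a) h3.le
    refine iff_of_false ?_ (by omega)
    rintro (h5 | ⟨h5, h6⟩)
    · omega
    · rw [hp, hq] at h6
      rw [← h5] at e1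
      rw [e1] at e2
      unfold symHeight at e2
      have h7 := above_mv hA (S.diag (a + 1 + 1)).natAbs
      rw [if_neg (Ne.symm hne)] at h7
      rw [← Bool.not_eq_true, ← Bool.not_eq_true, m1, m2] at h6
      rw [show sh S.diag (a + 1) = mv (sh S.diag a) (S.diag (a + 1)) from rfl] at h6
      simp only [newCell] at h6
      omega

end IsSST

namespace SignedFilling

theorem diag_toggle (S : SignedFilling) (a k : ℕ) :
    (S.toggle a).diag k = if k = a then -S.diag a else S.diag k := by
  unfold diag toggle
  by_cases h : k = a
  · subst h
    cases S.mark k <;> simp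
  · simp [h]

theorem diag_swap (S : SignedFilling) (a b k : ℕ) :
    (S.swap a b).diag k = S.diag (Equiv.swap a b k) := rfl

/-- The elementary involutions act on the contents. -/
theorem diag_d (S : SignedFilling) {n i : ℕ} (hn : 2 ≤ n) (hi : i < n) (h1 : i ≠ 1) {j : ℕ} :
    (S.d n i).diag j = dd i S.diag j := by
  rcases Nat.eq_zero_or_pos i with rfl | h0
  · simp only [d, if_pos, hn, dd, diag_toggle]
  obtain ⟨p, rfl⟩ : ∃ p, i = p + 2 := ⟨i - 2, by omega⟩
  obtain ⟨x, hx⟩ : ∃ x, S.diag (p + 1) = x := ⟨_, rfl⟩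
  obtain ⟨y, hy⟩ : ∃ y, S.diag (p + 2) = y := ⟨_, rfl⟩
  obtain ⟨z, hz⟩ : ∃ z, S.diag (p + 3) = z := ⟨_, rfl⟩
  have hk : ∀ u v : ℤ, (abs (abs u - abs v) = 1) ↔ (u.natAbs = v.natAbs + 1 ∨ v.natAbs = u.natAbs + 1) := by
    intro u v
    rw [Int.abs_eq_natAbs u, Int.abs_eq_natAbs v, Int.abs_eq_natAbs]
    omega
  have hl : |z - y| < |x - y| ↔ (z - y).natAbs < (x - y).natAbs := by
    rw [Int.abs_eq_natAbs, Int.abs_eq_natAbs]; omega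
  have hdd : dd (p + 2) S.diag j = if j = p + 1 then (tr x y z).1 else if j = p + 2 then (tr x y z).2.1
      else if j = p + 3 then (tr x y z).2.2 else S.diag j := by
    rw [← hx, ← hy, ← hz]
    simp only [dd, show p + 2 ≠ 0 by omega, if_false, show j + 1 = p + 2 ↔ j = p + 1 by omega]
    rfl
  have hd : S.d n (p + 2) = if (x ≤ y ∧ y ≤ z) ∨ (z ≤ y ∧ y ≤ x) then S
      else if x = z then S.toggle (p + 2)
      else if (z - y).natAbs < (x - y).natAbs then
        if x.natAbs = y.natAbs + 1 ∨ y.natAbs = x.natAbs + 1 then (S.toggle (p + 2)).toggle (p + 1)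
          else S.swap (p + 2) (p + 1)
      else if z.natAbs = y.natAbs + 1 ∨ y.natAbs = z.natAbs + 1 then (S.toggle (p + 2)).toggle (p + 3)
        else S.swap (p + 2) (p + 3) := by
    unfold d
    rw [if_neg (by omega), if_pos (show 1 < p + 2 ∧ p + 2 < n by omega)]
    simp only [show p + 2 - 1 = p + 1 by omega, show p + 2 + 1 = p + 3 by omega, hx, hy, hz, hl]
    by_cases c1 : (x ≤ y ∧ y ≤ z) ∨ (z ≤ y ∧ y ≤ x)
    · rw [if_pos c1, if_pos c1]
    rw [if_neg c1, if_neg c1]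
    by_cases c2 : x = z
    · rw [if_pos c2, if_pos c2]
    rw [if_neg c2, if_neg c2]
    by_cases c3 : (z - y).natAbs < (x - y).natAbs
    · simp only [if_pos c3, hx, hk]
    · simp only [if_neg c3, hz, hk]
  rw [hd, hdd]
  unfold tr
  by_cases e1 : j = p + 1
  · subst e1
    rw [if_pos rfl]
    split_ifs <;> simp [diag_toggle, diag_swap, Equiv.swap_apply_def, hx, hy, hz]
  by_cases e2 : j = p + 2
  · subst e2
    rw [if_neg (show ¬p + 2 = p + 1 by omega), if_pos rfl]
    split_ifs <;> simp [diag_toggle, diag_swap, Equiv.swap_apply_def, hx, hy, hz]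
  by_cases e3 : j = p + 3
  · subst e3
    rw [if_neg (show ¬p + 3 = p + 1 by omega), if_neg (show ¬p + 3 = p + 2 by omega), if_pos rfl]
    split_ifs <;> simp [diag_toggle, diag_swap, Equiv.swap_apply_def, hx, hy, hz]
  · rw [if_neg e1, if_neg e2, if_neg e3]
    split_ifs <;> simp [diag_toggle, diag_swap, Equiv.swap_apply_def, e1, e2, e3]

end SignedFilling

end QueerDual

namespace QueerDual

/-! ### Independence of the fundamental quasisymmetric functions -/

theorem monotone_eq_of_sum_single {m : ℕ} {s t : Fin m → ℕ} (hs : Monotone s) (ht : Monotone t)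
    (h : ∑ j, Finsupp.single (s j) 1 = ∑ j, Finsupp.single (t j) (1 : ℕ)) : s = t := by
  have h1 : ∀ u : Fin m → ℕ, Multiset.toFinsupp (Multiset.map u Finset.univ.val) =
      ∑ j, Finsupp.single (u j) 1 := by
    intro u
    ext a
    rw [Multiset.toFinsupp_apply, Finsupp.finsetSum_apply, Multiset.count_map, Finset.sum_congr rfl
      (fun j _ => Finsupp.single_apply), Finset.sum_boole]
    simp only [Nat.cast_id, eq_comm (a := a)]
    rfl
  have h2 : Multiset.map s Finset.univ.val = Multiset.map t Finset.univ.val :=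
    Multiset.toFinsupp.injective (by rw [h1, h1, h])
  have h3 : ∀ u : Fin m → ℕ, ((List.ofFn u : List ℕ) : Multiset ℕ) = Multiset.map u Finset.univ.val := by
    intro u
    rw [List.ofFn_eq_map, ← Multiset.map_coe]
    rfl
  have h4 : (List.ofFn s).Perm (List.ofFn t) := by
    rw [← Multiset.coe_eq_coe, h3, h3, h2]
  exact List.ofFn_injective (h4.eq_of_pairwise (fun a b _ _ h1 h2 => le_antisymm h1 h2)
    (List.sortedLE_ofFn_iff.2 hs).pairwise (List.sortedLE_ofFn_iff.2 ht).pairwise)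

/-- The sequence that increases exactly after the positions in `E`. -/
def blocks (m : ℕ) (E : Finset ℕ) (j : Fin m) : ℕ := (E.filter (· ≤ (j : ℕ))).card

theorem blocks_mono (m : ℕ) (E : Finset ℕ) : Monotone (blocks m E) := by
  intro j k hjk
  refine Finset.card_le_card (fun e => ?_)
  simp only [Finset.mem_filter]
  exact fun h => ⟨h.1, h.2.trans hjk⟩

theorem blocks_lt_iff {m : ℕ} {E : Finset ℕ} {j k : Fin m} (h : (k : ℕ) = (j : ℕ) + 1) :
    blocks m E j < blocks m E k ↔ (j : ℕ) + 1 ∈ E := by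
  unfold blocks
  refine ⟨fun h1 => ?_, fun h1 => ?_⟩
  · by_contra h2
    refine absurd h1 (not_lt.2 (Finset.card_le_card (fun e => ?_)))
    simp only [Finset.mem_filter]
    refine fun h3 => ⟨h3.1, ?_⟩
    have : e ≠ (j : ℕ) + 1 := fun h4 => h2 (h4 ▸ h3.1)
    omega
  · refine Finset.card_lt_card (Finset.ssubset_iff_of_subset (fun e => ?_) |>.2 ⟨(j : ℕ) + 1, ?_, ?_⟩)
    · simp only [Finset.mem_filter]
      exact fun h3 => ⟨h3.1, by omega⟩
    · simp only [Finset.mem_filter]; exact ⟨h1, by omega⟩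
    · simp

open Classical in
theorem fundamental_blocks (m : ℕ) (D : Set ℕ) (E : Finset ℕ) :
    fundamental m D (∑ j, Finsupp.single (blocks m E j) 1) =
      if (Finset.Icc 1 (m - 1)).filter (· ∈ D) ⊆ E then 1 else 0 := by
  unfold fundamental
  split_ifs with h
  · have : Unique {s : Fin m → ℕ // Monotone s ∧
        (∀ j k : Fin m, (k : ℕ) = (j : ℕ) + 1 → (j : ℕ) + 1 ∈ D → s j < s k) ∧
        ∑ j, Finsupp.single (s j) 1 = ∑ j, Finsupp.single (blocks m E j) 1} :=
      { default := ⟨blocks m E, blocks_mono m E, fun j k hk hD => (blocks_lt_iff hk).2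
          (h (Finset.mem_filter.2 ⟨Finset.mem_Icc.2 ⟨by omega, by have := k.2; omega⟩, hD⟩)), rfl⟩
        uniq := fun s => Subtype.ext (monotone_eq_of_sum_single s.2.1 (blocks_mono m E) s.2.2.2) }
    rw [Nat.card_unique]
    rfl
  · rw [Finset.not_subset] at h
    obtain ⟨i, h1, h2⟩ := h
    rw [Finset.mem_filter, Finset.mem_Icc] at h1
    have : IsEmpty {s : Fin m → ℕ // Monotone s ∧
        (∀ j k : Fin m, (k : ℕ) = (j : ℕ) + 1 → (j : ℕ) + 1 ∈ D → s j < s k) ∧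
        ∑ j, Finsupp.single (s j) 1 = ∑ j, Finsupp.single (blocks m E j) 1} := by
      refine ⟨fun s => h2 ?_⟩
      have h3 := monotone_eq_of_sum_single s.2.1 (blocks_mono m E) s.2.2.2
      have h4 := s.2.2.1 ⟨i - 1, by omega⟩ ⟨i, by omega⟩ (by simp only; omega)
        (by simp only [Nat.sub_add_cancel h1.1.1]; exact h1.2)
      rw [h3, blocks_lt_iff (by simp only; omega)] at h4
      simpa only [Nat.sub_add_cancel h1.1.1] using h4
    rw [Nat.card_of_isEmpty]
    rfl

theorem card_filter_subset {α : Type*} (u : Finset α) (k : α → Finset ℕ) (E : Finset ℕ) :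
    (u.filter (fun a => k a ⊆ E)).card =
      ∑ F ∈ E.ssubsets, (u.filter (fun a => k a = F)).card + (u.filter (fun a => k a = E)).card := by
  rw [Finset.card_eq_sum_card_fiberwise (f := k) (t := E.powerset) (fun a ha => by
    simpa using (Finset.mem_filter.1 ha).2), ← Finset.sum_erase_add _ _ (Finset.mem_powerset_self E)]
  have : ∀ F ⊆ E, (u.filter (fun a => k a ⊆ E)).filter (fun a => k a = F) = u.filter (fun a => k a = F) := by
    intro F hF
    ext a
    simp only [Finset.mem_filter]
    exact ⟨fun h => ⟨h.1.1, h.2⟩, fun h => ⟨⟨h.1, h.2 ▸ hF⟩, h.2⟩⟩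
  rw [this E subset_rfl]
  congr 1
  exact Finset.sum_congr rfl (fun F hF => by
    rw [this F (Finset.mem_powerset.1 (Finset.mem_of_mem_erase hF))])

theorem card_eq_of_card_subset {α β : Type*} (s : Finset α) (t : Finset β) (f : α → Finset ℕ)
    (g : β → Finset ℕ) (I : Finset ℕ) (h : ∀ E ⊆ I, (s.filter (fun a => f a ⊆ E)).card =
      (t.filter (fun b => g b ⊆ E)).card) (E : Finset ℕ) (hE : E ⊆ I) :
    (s.filter (fun a => f a = E)).card = (t.filter (fun b => g b = E)).card := by
  induction E using Finset.strongInduction with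
  | _ E ih =>
  have h1 := h E hE
  rw [card_filter_subset, card_filter_subset, Finset.sum_congr rfl (fun F hF => ih F (Finset.mem_ssubsets.1 hF)
    ((Finset.mem_ssubsets.1 hF).1.trans hE))] at h1
  omega

open Classical in
/-- The membership bits of `k, …, 1` in `D`. -/
noncomputable def bits (D : Set ℕ) : ℕ → List Bool
  | 0 => []
  | k + 1 => decide (k + 1 ∈ D) :: bits D k

theorem bits_eq_iff {D E : Set ℕ} {k : ℕ} :
    bits D k = bits E k ↔ ∀ j, 1 ≤ j → j ≤ k → (j ∈ D ↔ j ∈ E) := by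
  induction k with
  | zero => exact iff_of_true rfl (fun j h1 h2 => by omega)
  | succ k ih =>
    rw [bits, bits, List.cons.injEq, ih, decide_eq_decide]
    refine ⟨fun h j h1 h2 => ?_, fun h => ⟨h _ (by omega) le_rfl, fun j h1 h2 => h j h1 (by omega)⟩⟩
    rcases Nat.lt_or_ge k j with h3 | h3
    · obtain rfl : j = k + 1 := by omega
      exact h.1
    · exact h.2 j h1 h3

open Classical in
theorem card_bits_eq {A B : Type*} [Finite A] [Finite B] (m : ℕ) (C : Set A) (D : A → Set ℕ)
    (D' : B → Set ℕ) (h : ∑ᶠ U ∈ C, fundamental m (D U) = ∑ᶠ T : B, fundamental m (D' T)) (w : List Bool) :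
    {U ∈ C | bits (D U) (m - 1) = w}.ncard = {T | bits (D' T) (m - 1) = w}.ncard := by
  have := Fintype.ofFinite A
  have := Fintype.ofFinite B
  obtain ⟨key, hkey⟩ : ∃ key : Set ℕ → Finset ℕ, ∀ F, key F = (Finset.Icc 1 (m - 1)).filter (· ∈ F) :=
    ⟨_, fun _ => rfl⟩
  rw [finsum_mem_eq_finite_toFinset_sum _ (Set.toFinite C), finsum_eq_sum_of_fintype] at h
  have h1 : ∀ E ⊆ Finset.Icc 1 (m - 1), ((Set.toFinite C).toFinset.filter (fun a => key (D a) ⊆ E)).card =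
      (Finset.univ.filter (fun b => key (D' b) ⊆ E)).card := by
    intro E _
    have h2 := congrArg (MvPowerSeries.coeff (∑ j, Finsupp.single (blocks m E j) 1)) h
    rw [map_sum, map_sum] at h2
    have h3 : ∀ F, MvPowerSeries.coeff (∑ j, Finsupp.single (blocks m E j) 1) (fundamental m F) =
        if key F ⊆ E then 1 else 0 := fun F => by rw [hkey]; exact fundamental_blocks m F E
    simp only [h3, Finset.sum_boole] at h2
    exact_mod_cast h2
  by_cases hw : ∃ F, bits F (m - 1) = w
  swap
  · rw [Set.eq_empty_of_forall_notMem (s := {U ∈ C | bits (D U) (m - 1) = w}) (fun U hU => hw ⟨_, hU.2⟩),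
      Set.eq_empty_of_forall_notMem (s := {T | bits (D' T) (m - 1) = w}) (fun U hU => hw ⟨_, hU⟩)]
    simp
  obtain ⟨F, rfl⟩ := hw
  have h4 : ∀ G, bits G (m - 1) = bits F (m - 1) ↔ key G = key F := by
    intro G
    rw [bits_eq_iff, hkey, hkey, Finset.ext_iff]
    simp only [Finset.mem_filter, Finset.mem_Icc]
    exact ⟨fun h j => and_congr_right (fun h5 => h j h5.1 h5.2),
      fun h j h5 h6 => (and_congr_right_iff.1 (h j)) ⟨h5, h6⟩⟩
  simp only [h4]
  have h5 := card_eq_of_card_subset _ _ _ _ _ h1 (key F) (by rw [hkey]; exact Finset.filter_subset _ _)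
  rw [← Set.ncard_coe_finset, ← Set.ncard_coe_finset] at h5
  simpa using h5

end QueerDual

namespace QueerDual

/-! ### Standard Young tableaux and lattice words -/

/-- The word `ρ k, …, ρ 1`. -/
def word (ρ : ℕ → ℕ) : ℕ → List ℕ
  | 0 => []
  | k + 1 => ρ (k + 1) :: word ρ k

/-- The words of length `m` whose reversal is a lattice word. -/
def lat : ℕ → List (List ℕ)
  | 0 => [[]]
  | m + 1 => (lat m).flatMap fun w =>
      ((List.range (m + 1)).filter fun i => i = 0 ∨ w.count i < w.count (i - 1)).map (· :: w)

/-- The descents of a word of rows. -/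
def dbits : List ℕ → List Bool
  | a :: b :: w => decide (b < a) :: dbits (b :: w)
  | _ => []

/-- The descent bits of the lattice words with the same letters as `r`. -/
def table (m : ℕ) (r : List ℕ) : List (List Bool) :=
  ((lat m).filter fun w => ∀ i ∈ List.range m, w.count i = r.count i).map dbits

variable {ρ : ℕ → ℕ} {k m r : ℕ}

theorem count_word : (word ρ k).count r = ((Finset.Icc 1 k).filter (fun b => ρ b = r)).card := by
  induction k with
  | zero => rfl
  | succ k ih =>
    rw [word, List.count_cons, ih, ← Finset.insert_Icc_right_eq_Icc_add_one (by omega),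
      Finset.filter_insert]
    by_cases h : ρ (k + 1) = r
    · rw [if_pos h, Finset.card_insert_of_notMem (by simp), if_pos (by simpa using h)]
    · rw [if_neg h, if_neg (by simpa using h), add_zero]

theorem count_word_mono (h : k ≤ m) : (word ρ k).count r ≤ (word ρ m).count r := by
  rw [count_word, count_word]
  refine Finset.card_le_card (fun b => ?_)
  simp only [Finset.mem_filter, Finset.mem_Icc]
  exact fun hb => ⟨⟨hb.1.1, hb.1.2.trans h⟩, hb.2⟩

theorem count_word_lt (h1 : 1 ≤ k) (h : k ≤ m) :
    (word ρ (k - 1)).count (ρ k) < (word ρ m).count (ρ k) := by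
  refine lt_of_lt_of_le ?_ (count_word_mono h)
  obtain ⟨k, rfl⟩ : ∃ j, k = j + 1 := ⟨k - 1, by omega⟩
  simp [word]

/-- `ρ 1, …, ρ m` is a lattice word. -/
def IsLat (m : ℕ) (ρ : ℕ → ℕ) : Prop :=
  ∀ k < m, ρ (k + 1) = 0 ∨ (word ρ k).count (ρ (k + 1)) < (word ρ k).count (ρ (k + 1) - 1)

theorem IsLat.lt (h : IsLat m ρ) (h1 : 1 ≤ k) (hk : k ≤ m) : ρ k < k := by
  induction k using Nat.strong_induction_on with
  | _ k ih =>
  rcases h (k - 1) (by omega) with h2 | h2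
  · rw [Nat.sub_add_cancel h1] at h2; omega
  · rw [Nat.sub_add_cancel h1, count_word (r := ρ k - 1)] at h2
    obtain ⟨b, hb⟩ := Finset.card_pos.1 (Nat.zero_lt_of_lt h2)
    rw [Finset.mem_filter, Finset.mem_Icc] at hb
    have := ih b (by omega) (by omega) (by omega)
    omega

theorem IsLat.word_mem (h : IsLat m ρ) (hk : k ≤ m) : word ρ k ∈ lat k := by
  induction k with
  | zero => simp [lat, word]
  | succ k ih =>
    rw [lat, List.mem_flatMap]
    refine ⟨word ρ k, ih (by omega), List.mem_map.2 ⟨ρ (k + 1), List.mem_filter.2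
      ⟨List.mem_range.2 (h.lt (by omega) hk), ?_⟩, rfl⟩⟩
    simpa using h k hk

theorem word_eq {ρ' : ℕ → ℕ} (h : ∀ j, 1 ≤ j → j ≤ k → ρ j = ρ' j) : word ρ k = word ρ' k := by
  induction k with
  | zero => rfl
  | succ k ih => rw [word, word, ih (fun j h1 h2 => h j h1 (by omega)), h _ (by omega) le_rfl]

theorem exists_word {w : List ℕ} (h : w ∈ lat m) : ∃ ρ, IsLat m ρ ∧ word ρ m = w := by
  induction m generalizing w with
  | zero => exact ⟨fun _ => 0, fun k hk => absurd hk (by omega), by simpa [lat, word, eq_comm] using h⟩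
  | succ m ih =>
    rw [lat, List.mem_flatMap] at h
    obtain ⟨v, hv, h⟩ := h
    rw [List.mem_map] at h
    obtain ⟨i, hi, rfl⟩ := h
    rw [List.mem_filter] at hi
    obtain ⟨ρ, h1, rfl⟩ := ih hv
    have h2 : ∀ k ≤ m, word (Function.update ρ (m + 1) i) k = word ρ k := by
      exact fun k hk => word_eq (fun j h1 h2 => Function.update_of_ne (by omega) _ _)
    refine ⟨Function.update ρ (m + 1) i, fun k hk => ?_, by
      rw [word, h2 m le_rfl, Function.update_self]⟩
    rw [h2 k (by omega)]
    rcases Nat.lt_or_ge k m with h3 | h3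
    · rw [Function.update_of_ne (by omega)]
      exact h1 k h3
    · obtain rfl : k = m := by omega
      rw [Function.update_self]
      simpa using hi.2

theorem word_congr {ρ' : ℕ → ℕ} (h : word ρ m = word ρ' m) (h1 : 1 ≤ k) (hk : k ≤ m) : ρ k = ρ' k := by
  induction m with
  | zero => omega
  | succ m ih =>
    rw [word, word, List.cons.injEq] at h
    rcases Nat.lt_or_ge m k with h3 | h3
    · obtain rfl : k = m + 1 := by omega
      exact h.1
    · exact ih h.2 h3

theorem nodup_lat (m : ℕ) : (lat m).Nodup := by
  induction m with
  | zero => simp [lat]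
  | succ m ih =>
    rw [lat, List.nodup_flatMap]
    refine ⟨fun w _ => (List.nodup_range.filter _).map (fun a b h => (List.cons.inj h).1),
      ih.imp (fun {v w} hvw => ?_)⟩
    intro u h1 h2
    rw [List.mem_map] at h1 h2
    obtain ⟨i, -, rfl⟩ := h1
    obtain ⟨j, -, h2⟩ := h2
    exact hvw (List.cons.inj h2).2.symm

theorem IsLat.count_anti (h : IsLat m ρ) (hk : k ≤ m) {s : ℕ} (hrs : r ≤ s) :
    (word ρ k).count s ≤ (word ρ k).count r := by
  induction k generalizing r s with
  | zero => simp [word]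
  | succ k ih =>
    have h1 := ih (by omega) hrs
    have h2 := h k hk
    simp only [word, List.count_cons, beq_iff_eq]
    split_ifs with h3 h4 h4
    · omega
    · rcases h2 with h2 | h2
      · omega
      · rw [h3] at h2
        have := ih (r := r) (s := s - 1) (by omega) (by omega)
        omega
    · omega
    · omega

/-- The tableau of a lattice word. -/
def ofWord (m : ℕ) (ρ : ℕ → ℕ) (a : ℕ) : ℕ × ℕ :=
  if a ∈ Set.Icc 1 m then (ρ a, (word ρ (a - 1)).count (ρ a)) else (0, 0)

theorem IsSYT.count_eq {μ : YoungDiagram} {T : ℕ → ℕ × ℕ} (h : IsSYT μ T) (r : ℕ) :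
    (word (fun a => (T a).1) μ.card).count r = (μ.cells.filter (fun x => x.1 = r)).card := by
  rw [count_word]
  refine Finset.card_bij (fun a _ => T a) ?_ ?_ ?_
  · intro a ha
    rw [Finset.mem_filter, Finset.mem_Icc] at ha
    exact Finset.mem_filter.2 ⟨h.bijOn.mapsTo ha.1, ha.2⟩
  · intro a ha b hb hab
    rw [Finset.mem_filter, Finset.mem_Icc] at ha hb
    exact h.bijOn.injOn ha.1 hb.1 hab
  · intro x hx
    rw [Finset.mem_filter] at hx
    obtain ⟨a, ha, rfl⟩ := h.bijOn.surjOn hx.1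
    exact ⟨a, Finset.mem_filter.2 ⟨Finset.mem_Icc.2 ha, hx.2⟩, rfl⟩

theorem IsSYT.col_eq {μ : YoungDiagram} {T : ℕ → ℕ × ℕ} (h : IsSYT μ T) {a : ℕ}
    (ha : a ∈ Set.Icc 1 μ.card) :
    (word (fun a => (T a).1) (a - 1)).count (T a).1 = (T a).2 := by
  rw [count_word, ← Finset.card_range (T a).2]
  refine Finset.card_bij (fun b _ => (T b).2) ?_ ?_ ?_
  · intro b hb
    rw [Finset.mem_filter, Finset.mem_Icc] at hb
    have hb' : b ∈ Set.Icc 1 μ.card := ⟨hb.1.1, by have := ha.2; omega⟩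
    rw [Finset.mem_range]
    by_contra h1
    rcases (not_lt.1 h1).lt_or_eq with h2 | h2
    · have := h.row_inc a ha b hb' hb.2.symm h2
      omega
    · have := h.bijOn.injOn ha hb' (Prod.ext hb.2.symm h2)
      omega
  · intro b hb c hc hbc
    rw [Finset.mem_filter, Finset.mem_Icc] at hb hc
    have := ha.2
    exact h.bijOn.injOn ⟨hb.1.1, by omega⟩ ⟨hc.1.1, by omega⟩ (Prod.ext (hb.2.trans hc.2.symm) hbc)
  · intro c hc
    rw [Finset.mem_range] at hc
    have h1 : ((T a).1, c) ∈ μ.cells := μ.isLowerSet (a := T a) ⟨le_rfl, hc.le⟩ (h.bijOn.mapsTo ha)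
    obtain ⟨b, hb, h2⟩ := h.bijOn.surjOn h1
    have h3 := h.row_inc b hb a ha (by rw [h2]) (by rw [h2]; exact hc)
    exact ⟨b, Finset.mem_filter.2 ⟨Finset.mem_Icc.2 ⟨hb.1, by omega⟩, by rw [h2]⟩, by rw [h2]⟩

theorem IsSYT.isLat {μ : YoungDiagram} {T : ℕ → ℕ × ℕ} (h : IsSYT μ T) :
    IsLat μ.card (fun a => (T a).1) := by
  intro k hk
  have ha : k + 1 ∈ Set.Icc 1 μ.card := ⟨by omega, hk⟩
  by_cases h0 : (T (k + 1)).1 = 0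
  · exact Or.inl h0
  have h1 : ((T (k + 1)).1 - 1, (T (k + 1)).2) ∈ μ.cells :=
    μ.isLowerSet (a := T (k + 1)) ⟨Nat.sub_le _ _, le_rfl⟩ (h.bijOn.mapsTo ha)
  obtain ⟨b, hb, h2⟩ := h.bijOn.surjOn h1
  have h3 := h.col_inc b hb _ ha (by rw [h2]) (by rw [h2]; simp only; omega)
  have h4 := h.col_eq ha
  have h5 := h.col_eq hb
  have h6 := count_word_lt (ρ := fun a => (T a).1) hb.1 (by omega : b ≤ k)
  rw [Nat.add_sub_cancel] at h4
  refine Or.inr ?_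
  simp only at h6 ⊢
  rw [h2] at h5 h6
  simp only at h5 h6
  omega

theorem IsSYT.eq_ofWord {μ : YoungDiagram} {T : ℕ → ℕ × ℕ} (h : IsSYT μ T) :
    T = ofWord μ.card (fun a => (T a).1) := by
  funext a
  unfold ofWord
  split_ifs with ha
  · exact Prod.ext rfl (h.col_eq ha).symm
  · exact h.pos_default a ha

theorem IsLat.isSYT {μ : YoungDiagram} (h : IsLat μ.card ρ)
    (hc : ∀ r, (word ρ μ.card).count r = (μ.cells.filter (fun x => x.1 = r)).card) :
    IsSYT μ (ofWord μ.card ρ) := by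
  have e : ∀ a ∈ Set.Icc 1 μ.card, ofWord μ.card ρ a = (ρ a, (word ρ (a - 1)).count (ρ a)) :=
    fun a ha => if_pos ha
  have key : ∀ a ∈ Set.Icc 1 μ.card, ∀ b ∈ Set.Icc 1 μ.card, ρ a = ρ b →
      (word ρ (a - 1)).count (ρ a) < (word ρ (b - 1)).count (ρ b) → a < b := by
    intro a ha b hb hab hlt
    by_contra h1
    rw [hab] at hlt
    exact absurd hlt (not_lt.2 (count_word_mono (by omega)))
  have hinj : Set.InjOn (ofWord μ.card ρ) (Set.Icc 1 μ.card) := by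
    have : ∀ a ∈ Set.Icc 1 μ.card, ∀ b ∈ Set.Icc 1 μ.card, a < b →
        ofWord μ.card ρ a ≠ ofWord μ.card ρ b := by
      intro a ha b hb hab h1
      rw [e a ha, e b hb, Prod.mk.injEq] at h1
      have := count_word_lt (ρ := ρ) ha.1 (by omega : a ≤ b - 1)
      rw [h1.2, h1.1] at this
      exact absurd this (lt_irrefl _)
    intro a ha b hb hab
    rcases lt_trichotomy a b with h1 | h1 | h1
    · exact absurd hab (this a ha b hb h1)
    · exact h1
    · exact absurd hab.symm (this b hb a ha h1)
  have hmaps : Set.MapsTo (ofWord μ.card ρ) (Set.Icc 1 μ.card) {x | x ∈ μ.cells} := by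
    intro a ha
    have h1 := count_word_lt (ρ := ρ) ha.1 ha.2
    rw [hc] at h1
    rw [e a ha]
    change (_, _) ∈ μ
    rw [YoungDiagram.mem_iff_lt_rowLen, YoungDiagram.rowLen_eq_card]
    exact h1
  refine ⟨⟨hmaps, hinj, ?_⟩, ?_, ?_, fun a ha => if_neg ha⟩
  · have h1 : (Finset.Icc 1 μ.card).image (ofWord μ.card ρ) = μ.cells := by
      refine Finset.eq_of_subset_of_card_le (fun x hx => ?_) ?_
      · obtain ⟨a, ha, rfl⟩ := Finset.mem_image.1 hx
        exact hmaps (Finset.mem_Icc.1 ha)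
      · rw [Finset.card_image_of_injOn (by simpa using hinj), Nat.card_Icc]
        exact le_of_eq (by simp [YoungDiagram.card])
    intro x hx
    have h2 : x ∈ (Finset.Icc 1 μ.card).image (ofWord μ.card ρ) := by rw [h1]; exact hx
    obtain ⟨a, ha, rfl⟩ := Finset.mem_image.1 h2
    exact ⟨a, Finset.mem_Icc.1 ha, rfl⟩
  · intro a ha b hb h1 h2
    rw [e a ha, e b hb] at h1 h2
    exact key a ha b hb h1 h2
  · intro a ha b hb h1 h2
    rw [e a ha, e b hb] at h1 h2
    simp only at h1 h2
    by_contra h3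
    have hab : a ≠ b := by rintro rfl; omega
    rcases h (b - 1) (by have := hb.1; have := hb.2; omega) with h4 | h4
    · rw [Nat.sub_add_cancel hb.1] at h4; omega
    · rw [Nat.sub_add_cancel hb.1] at h4
      have h5 := h.count_anti (k := b - 1) (by have := hb.2; omega) (r := ρ a) (s := ρ b - 1) (by omega)
      have h6 := count_word_mono (ρ := ρ) (r := ρ a) (by omega : b - 1 ≤ a - 1)
      omega

theorem bits_desSYT {μ : YoungDiagram} {T : ℕ → ℕ × ℕ} (h : IsSYT μ T) (hk : k < μ.card) :
    bits (desSYT μ.card T) k = dbits (word (fun a => (T a).1) (k + 1)) := by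
  induction k with
  | zero => rfl
  | succ k ih =>
    rw [bits, ih (by omega)]
    refine congrArg (· :: dbits (word (fun a => (T a).1) (k + 1))) ?_
    rw [decide_eq_decide]
    refine ⟨fun h1 => ?_, fun h1 => ⟨by omega, hk, Or.inl h1⟩⟩
    rcases h1.2.2 with h2 | h2
    · exact h2
    · have := h.row_inc (k + 1 + 1) ⟨by omega, hk⟩ (k + 1) ⟨by omega, by omega⟩ h2.1.symm h2.2
      omega

theorem card_SYT_bits {μ : YoungDiagram} (T₀ : SYT μ) (hm : 1 ≤ μ.card) (w : List Bool) :
    {T : SYT μ | bits (desSYT μ.card T.1) (μ.card - 1) = w}.ncard =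
      (table μ.card (word (fun a => (T₀.1 a).1) μ.card)).count w := by
  rw [table, List.count_eq_countP, List.countP_map, List.countP_filter, List.countP_eq_length_filter,
    ← List.toFinset_card_of_nodup ((nodup_lat _).filter _), ← Set.ncard_coe_finset]
  refine Set.ncard_congr (fun T _ => word (fun a => (T.1 a).1) μ.card) ?_ ?_ ?_
  · intro T hT
    have h1 := bits_desSYT T.2 (k := μ.card - 1) (by omega)
    rw [Nat.sub_add_cancel hm] at h1
    simp only [List.coe_toFinset, List.mem_filter, Function.comp_apply, Bool.and_eq_true,
      decide_eq_true_eq, beq_iff_eq]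
    refine ⟨T.2.isLat.word_mem le_rfl, h1.symm.trans hT, fun i _ => ?_⟩
    rw [T.2.count_eq, T₀.2.count_eq]
  · intro T U _ _ h1
    refine Subtype.ext ?_
    rw [T.2.eq_ofWord, U.2.eq_ofWord]
    funext a
    unfold ofWord
    split_ifs with ha
    · have h2 := word_congr h1 ha.1 ha.2
      have h3 : word (fun a => (T.1 a).1) (a - 1) = word (fun a => (U.1 a).1) (a - 1) :=
        word_eq (fun j h3 h4 => word_congr h1 h3 (by have := ha.2; omega))
      rw [h3]
      simp only at h2 ⊢
      rw [h2]
    · rfl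
  · intro v hv
    simp only [List.coe_toFinset, List.mem_filter, Function.comp_apply, Bool.and_eq_true,
      decide_eq_true_eq, beq_iff_eq] at hv
    obtain ⟨ρ, h1, rfl⟩ := exists_word hv.1
    have h2 : ∀ r, (word ρ μ.card).count r = (μ.cells.filter (fun x => x.1 = r)).card := by
      intro r
      rw [← T₀.2.count_eq]
      rcases Nat.lt_or_ge r μ.card with h3 | h3
      · exact hv.2.2 r (List.mem_range.2 h3)
      · have h4 : ∀ {ρ'}, IsLat μ.card ρ' → (word ρ' μ.card).count r = 0 := by
          intro ρ' h'
          rw [count_word, Finset.card_eq_zero, Finset.filter_eq_empty_iff]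
          intro b hb
          rw [Finset.mem_Icc] at hb
          have := h'.lt hb.1 hb.2
          omega
        rw [h4 h1, h4 T₀.2.isLat]
    have h3 := h1.isSYT h2
    have h4 : word (fun a => (ofWord μ.card ρ a).1) μ.card = word ρ μ.card :=
      word_eq (fun j h1 h2 => by rw [ofWord, if_pos ⟨h1, h2⟩])
    refine ⟨⟨_, h3⟩, ?_, h4⟩
    have h6 := bits_desSYT h3 (k := μ.card - 1) (by omega)
    rw [Nat.sub_add_cancel hm, h4] at h6
    exact h6.trans hv.2.1

/-- The words `D U`, for `U ∈ C`, are those of the list `L`, with multiplicities. -/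
def HasBits {A : Type*} (C : Set A) (D : A → List Bool) (L : List (List Bool)) : Prop :=
  ∀ w, {U ∈ C | D U = w}.ncard = L.count w

theorem hasBits_of_schur {A : Type*} [Finite A] (m : ℕ) (hm : 1 ≤ m) (C : Set A) (hC : C.Nonempty) (D : A → Set ℕ)
    (h : ∃ μ : YoungDiagram, μ.card = m ∧ ∑ᶠ U ∈ C, fundamental m (D U) = schur μ) :
    ∃ r ∈ lat m, HasBits C (fun U => bits (D U) (m - 1)) (table m r) := by
  obtain ⟨μ, rfl, h⟩ := h
  have h1 := card_bits_eq μ.card C D _ h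
  obtain ⟨x, hx⟩ := hC
  have h2 : {T : SYT μ | bits (desSYT μ.card T.1) (μ.card - 1) = bits (D x) (μ.card - 1)}.Nonempty := by
    rw [← Set.ncard_pos, ← h1, Set.ncard_pos]
    exact ⟨x, hx, rfl⟩
  obtain ⟨T₀, -⟩ := h2
  exact ⟨_, T₀.2.isLat.word_mem le_rfl, fun w => (h1 w).trans (card_SYT_bits T₀ hm w)⟩

section HasBits

variable {A : Type*} [Finite A] {C : Set A} {D : A → List Bool} {L : List (List Bool)} {x y : A}

theorem HasBits.mem (h : HasBits C D L) (hx : x ∈ C) : D x ∈ L := by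
  rw [← List.count_pos_iff, ← h, Set.ncard_pos]
  exact ⟨x, hx, rfl⟩

theorem HasBits.exists_of_mem (h : HasBits C D L) {w : List Bool} (hw : w ∈ L) : ∃ x ∈ C, D x = w := by
  rw [← List.count_pos_iff, ← h, Set.ncard_pos] at hw
  exact hw

theorem HasBits.eq (h : HasBits C D L) (hL : L.count (D x) ≤ 1) (hx : x ∈ C) (hy : y ∈ C)
    (hxy : D x = D y) : x = y := by
  rw [← h, Set.ncard_le_one] at hL
  exact hL x ⟨hx, rfl⟩ y ⟨hy, hxy.symm⟩

end HasBits

end QueerDual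

namespace QueerDual

/-! ### Dual equivalences in small degrees -/

section

variable {A : Type*} {φ : ℕ → A → A} {I : Set ℕ} {x y : A} {N : ℕ} {Des : A → Set ℕ}

theorem mem_genClass_self : x ∈ genClass φ I x := Relation.EqvGen.refl x

theorem apply_mem_genClass {g : ℕ} (hg : g ∈ I) (hy : y ∈ genClass φ I x) : φ g y ∈ genClass φ I x :=
  Relation.EqvGen.trans _ _ _ hy (Relation.EqvGen.rel _ _ ⟨g, hg, rfl⟩)

theorem genClass_induction {P : A → Prop} (hφ : ∀ g ∈ I, ∀ x, φ g (φ g x) = x) (hx : P x)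
    (h : ∀ g ∈ I, ∀ y, P y → P (φ g y)) (hy : y ∈ genClass φ I x) : P y := by
  have key : ∀ u v, Relation.EqvGen (fun V W => ∃ i ∈ I, φ i V = W) u v → (P u ↔ P v) := by
    intro u v huv
    induction huv with
    | rel u v huv =>
      obtain ⟨g, hg, rfl⟩ := huv
      exact ⟨h g hg u, fun h1 => by simpa [hφ g hg u] using h g hg _ h1⟩
    | refl u => exact Iff.rfl
    | symm u v _ ih => exact ih.symm
    | trans u v w _ _ ih1 ih2 => exact ih1.trans ih2
  exact (key x y hy).1 hx

theorem genClass_eq (hy : y ∈ genClass φ I x) : genClass φ I y = genClass φ I x := by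
  ext z
  exact ⟨fun h => Relation.EqvGen.trans _ _ _ hy h,
    fun h => Relation.EqvGen.trans _ _ _ (Relation.EqvGen.symm _ _ hy) h⟩

open Classical in
/-- Whether `j` is a descent of `x`. -/
noncomputable def bit (Des : A → Set ℕ) (j : ℕ) (x : A) : Bool := decide (j ∈ Des x)

/-- The bits at `i + k, …, i + 1`. -/
noncomputable def win (Des : A → Set ℕ) (i : ℕ) : ℕ → A → List Bool
  | 0, _ => []
  | k + 1, x => bit Des (i + (k + 1)) x :: win Des i k x

theorem win_eq (i k : ℕ) (x : A) : win Des i k x = bits {j | i + j ∈ Des x} k := by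
  induction k with
  | zero => rfl
  | succ k ih => rw [win, bits, ih]; rfl

variable [Finite A]

theorem IsDualEquivalence.hasBits (h : IsDualEquivalence N Des φ) {i k : ℕ} (h1 : 1 ≤ k) (h4 : k ≤ 4)
    (hN : i + k + 1 < N) (x : A) : ∃ r ∈ lat (k + 2),
      HasBits (genClass φ (Set.Icc (i + 2) (i + k + 1)) x) (win Des i (k + 1)) (table (k + 2) r) := by
  obtain ⟨μ, h5, h6⟩ := h.schur_class (i + 2) (i + k + 1) (by omega) (by omega) hN (by omega) x
  have h7 : i + k + 1 - (i + 2) + 3 = k + 2 := by omega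
  rw [h7] at h5 h6
  obtain ⟨r, hr, h8⟩ := hasBits_of_schur (k + 2) (by omega) _ ⟨x, mem_genClass_self⟩ _ ⟨μ, h5, h6⟩
  refine ⟨r, hr, ?_⟩
  convert h8 using 2
  rw [win_eq, show k + 2 - 1 = k + 1 from rfl, bits_eq_iff]
  intro j hj1 hj2
  refine ⟨fun h9 => ⟨i + j, h9, by omega, by omega, by omega⟩, ?_⟩
  rintro ⟨m, h9, -, -, h10⟩
  have : m = i + j := by omega
  change i + j ∈ Des _
  exact this ▸ h9

theorem deg_three : ∀ r ∈ lat 3, ∀ w ∈ table 3 r, (table 3 r).count w ≤ 1 ∧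
    ∀ a b, w = [a, b] → if a = b then ∀ v ∈ table 3 r, v = w else [!a, !b] ∈ table 3 r := by decide

theorem IsDualEquivalence.fix (h : IsDualEquivalence N Des φ) {i : ℕ} (hN : i + 2 < N) (x : A)
    (hx : bit Des (i + 1) x = bit Des (i + 2) x) : φ (i + 2) x = x := by
  obtain ⟨r, hr, h1⟩ := h.hasBits (i := i) (k := 1) le_rfl (by omega) hN x
  have hx0 := mem_genClass_self (x := x) (φ := φ) (I := Set.Icc (i + 2) (i + 1 + 1))
  have h2 := deg_three r hr _ (h1.mem hx0)
  have h3 := h2.2 _ _ rfl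
  rw [if_pos hx.symm] at h3
  have h4 := apply_mem_genClass (g := i + 2) (by constructor <;> omega) hx0
  exact (h1.eq h2.1 hx0 h4 (h3 _ (h1.mem h4)).symm).symm

theorem IsDualEquivalence.flip (h : IsDualEquivalence N Des φ) {i : ℕ} (hN : i + 2 < N) (x : A)
    (hx : bit Des (i + 1) x ≠ bit Des (i + 2) x) : bit Des (i + 1) (φ (i + 2) x) = !bit Des (i + 1) x ∧
      bit Des (i + 2) (φ (i + 2) x) = !bit Des (i + 2) x := by
  obtain ⟨r, hr, h1⟩ := h.hasBits (i := i) (k := 1) le_rfl (by omega) hN x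
  have hx0 := mem_genClass_self (x := x) (φ := φ) (I := Set.Icc (i + 2) (i + 1 + 1))
  have h2 := deg_three r hr _ (h1.mem hx0)
  have h3 := h2.2 _ _ rfl
  rw [if_neg hx.symm] at h3
  obtain ⟨y, hy, h4⟩ := h1.exists_of_mem h3
  have h5 : y = x ∨ y = φ (i + 2) x := by
    refine genClass_induction (P := fun y => y = x ∨ y = φ (i + 2) x) ?_ (Or.inl rfl) ?_ hy
    · exact fun g hg => h.involutive g (by have := hg.1; omega) (by have := hg.2; omega)
    · intro g hg y hy
      obtain rfl : g = i + 2 := by have := hg.1; have := hg.2; omega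
      rcases hy with rfl | rfl
      · exact Or.inr rfl
      · exact Or.inl (h.involutive _ (by omega) hN x)
  simp only [win, List.cons.injEq, and_true] at h4
  rcases h5 with rfl | rfl
  · exact absurd h4.1.symm (Bool.not_ne_self _)
  · exact ⟨h4.2, h4.1⟩

theorem deg_four_right : ∀ r ∈ lat 4, ∀ b₁ b₂ b₃ c, b₁ ≠ b₂ → b₂ = b₃ →
    [b₃, b₂, b₁] ∈ table 4 r → [c, !b₂, !b₁] ∈ table 4 r → c = b₃ := by decide

theorem deg_four_left : ∀ r ∈ lat 4, ∀ b₁ b₂ b₃ c, b₂ ≠ b₃ → b₁ = b₂ →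
    [b₃, b₂, b₁] ∈ table 4 r → [!b₃, !b₂, c] ∈ table 4 r → c = b₁ := by decide

theorem deg_four_alt : ∀ r ∈ lat 4, ∀ b₁ b₂ b₃ c d, b₁ ≠ b₂ → b₂ ≠ b₃ →
    [b₃, b₂, b₁] ∈ table 4 r → [c, !b₂, !b₁] ∈ table 4 r → [!b₃, !b₂, d] ∈ table 4 r →
    (table 4 r).count [!b₃, !b₂, d] ≤ 1 ∧
      ((c ≠ b₃ ∧ [!b₃, !b₂, d] = [c, !b₂, !b₁]) ∨ (c = b₃ ∧ d = b₁)) := by decide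

theorem IsDualEquivalence.keep_right (h : IsDualEquivalence N Des φ) {i : ℕ} (hN : i + 3 < N) (x : A)
    (hx : bit Des (i + 2) x = bit Des (i + 3) x) :
    bit Des (i + 3) (φ (i + 2) x) = bit Des (i + 3) x := by
  by_cases h12 : bit Des (i + 1) x = bit Des (i + 2) x
  · rw [h.fix (by omega) x h12]
  obtain ⟨r, hr, h1⟩ := h.hasBits (i := i) (k := 2) (by omega) (by omega) hN x
  have hx0 := mem_genClass_self (x := x) (φ := φ) (I := Set.Icc (i + 2) (i + 2 + 1))
  have h2 := h1.mem (apply_mem_genClass (g := i + 2) (by constructor <;> omega) hx0)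
  have h3 := h.flip (by omega) x h12
  simp only [win, zero_add, h3] at h2
  exact deg_four_right r hr _ _ _ _ h12 hx (h1.mem hx0) h2

theorem IsDualEquivalence.keep_left (h : IsDualEquivalence N Des φ) {i : ℕ} (hN : i + 3 < N) (x : A)
    (hx : bit Des (i + 1) x = bit Des (i + 2) x) :
    bit Des (i + 1) (φ (i + 3) x) = bit Des (i + 1) x := by
  by_cases h12 : bit Des (i + 2) x = bit Des (i + 3) x
  · rw [h.fix (i := i + 1) hN x h12]
  obtain ⟨r, hr, h1⟩ := h.hasBits (i := i) (k := 2) (by omega) (by omega) hN x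
  have hx0 := mem_genClass_self (x := x) (φ := φ) (I := Set.Icc (i + 2) (i + 2 + 1))
  have h2 := h1.mem (apply_mem_genClass (g := i + 3) (by constructor <;> omega) hx0)
  have h3 := h.flip (i := i + 1) hN x h12
  simp only [Nat.add_assoc, Nat.reduceAdd] at h3
  simp only [win, zero_add, Nat.reduceAdd, h3] at h2
  exact deg_four_left r hr _ _ _ _ h12 hx (h1.mem hx0) h2

theorem IsDualEquivalence.alt (h : IsDualEquivalence N Des φ) {i : ℕ} (hN : i + 3 < N) (x : A)
    (h12 : bit Des (i + 1) x ≠ bit Des (i + 2) x) (h23 : bit Des (i + 2) x ≠ bit Des (i + 3) x) :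
    (bit Des (i + 3) (φ (i + 2) x) ≠ bit Des (i + 3) x ∧ φ (i + 3) x = φ (i + 2) x) ∨
    (bit Des (i + 3) (φ (i + 2) x) = bit Des (i + 3) x ∧
      bit Des (i + 1) (φ (i + 3) x) = bit Des (i + 1) x) := by
  obtain ⟨r, hr, h1⟩ := h.hasBits (i := i) (k := 2) (by omega) (by omega) hN x
  have hx0 := mem_genClass_self (x := x) (φ := φ) (I := Set.Icc (i + 2) (i + 2 + 1))
  have hy := apply_mem_genClass (g := i + 2) (by constructor <;> omega) hx0
  have hz := apply_mem_genClass (g := i + 3) (by constructor <;> omega) hx0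
  have h2 := h1.mem hy
  have h2' := h1.mem hz
  have h3 := h.flip (by omega) x h12
  have h4 := h.flip (i := i + 1) hN x h23
  simp only [Nat.add_assoc, Nat.reduceAdd] at h4
  simp only [win, zero_add, Nat.reduceAdd, h3] at h2
  simp only [win, zero_add, Nat.reduceAdd, h4] at h2'
  have h5 := deg_four_alt r hr _ _ _ _ _ h12 h23 (h1.mem hx0) h2 h2'
  rcases h5.2 with h6 | h6
  · refine Or.inl ⟨h6.1, h1.eq ?_ hz hy ?_⟩
    · simp only [win, zero_add, Nat.reduceAdd, h4]
      exact h5.1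
    · simp only [win, zero_add, Nat.reduceAdd, h4, h3]
      exact h6.2
  · exact Or.inr h6

end

end QueerDual

namespace QueerDual

/-- The value at `w` of the map that sends the entries of `t` to those of `p`. -/
def look (t p : List (List Bool)) (w : List Bool) : List Bool := p.getD (t.idxOf w) []

theorem look_map {t : List (List Bool)} (P : List Bool → List Bool) {w : List Bool} (hw : w ∈ t) :
    look t (t.map P) w = P w := by
  have h := List.idxOf_lt_length_of_mem hw
  rw [look, List.getD_eq_getElem _ _ (by simpa using h), List.getElem_map, List.getElem_idxOf]

/-- The possible bits `v` of `φ 2 x`, if those of `x` are `w`. -/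
def stepLow : List Bool → List Bool → Bool
  | [d, c, b, a], [d', c', b', a'] =>
    if a = b then [d', c', b', a'] = [d, c, b, a] else b' = !b ∧ a' = !a ∧ (b = c → c' = c)
  | _, _ => false

/-- The possible bits `v` of `φ 3 x`, if those of `x` are `w`. -/
def stepMid : List Bool → List Bool → Bool
  | [d, c, b, a], [d', c', b', a'] =>
    if b = c then [d', c', b', a'] = [d, c, b, a]
    else c' = !c ∧ b' = !b ∧ (a = b → a' = a) ∧ (c = d → d' = d)
  | _, _ => false

/-- The possible bits `v` of `φ 4 x`, if those of `x` are `w`. -/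
def stepHigh : List Bool → List Bool → Bool
  | [d, c, b, a], [d', c', b', a'] =>
    if c = d then [d', c', b', a'] = [d, c, b, a] else d' = !d ∧ c' = !c ∧ (b = c → b' = b)
  | _, _ => false

/-- The condition on the bits `u`, `v` of `φ 2 x`, `φ 3 x`, if those of `x` are `w`. -/
def altLow : List Bool → List Bool → List Bool → Bool
  | [_, c, b, a], u, v =>
    (a ≠ b ∧ b ≠ c) → (u.getD 1 a ≠ c ∧ v = u) ∨ (u.getD 1 a = c ∧ v.getD 3 a = a)
  | _, _, _ => false

/-- The condition on the bits `u`, `v` of `φ 3 x`, `φ 4 x`, if those of `x` are `w`. -/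
def altHigh : List Bool → List Bool → List Bool → Bool
  | [d, c, b, _], u, v =>
    (b ≠ c ∧ c ≠ d) → (u.getD 0 b ≠ d ∧ v = u) ∨ (u.getD 0 b = d ∧ v.getD 2 b = b)
  | _, _, _ => false

/-- The tables of degree five. -/
def tables : List (List (List Bool)) :=
  ([[0], [8, 4, 2, 1], [4, 10, 2, 9, 5], [12, 10, 6, 9, 5, 3], [10, 6, 13, 5, 11], [14, 13, 11, 7],
    [15]] : List (List ℕ)).map (·.map fun a => [a.testBit 3, a.testBit 2, a.testBit 1, a.testBit 0])

/-- The conclusions on the maps `p`, `q`, `s` on bits, induced by `φ 2`, `φ 3`, `φ 4`. -/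
def conclusion (p q s : List Bool → List Bool) : List Bool → Bool
  | [d, c, b, a] => (p [d, c, b, a]).getD 0 d = d ∧ (s [d, c, b, a]).getD 3 a = a ∧
    ((a ≠ b ∧ b = c ∧ c ≠ d) → (p (s [d, c, b, a])).getD 1 a = (q (p [d, c, b, a])).getD 0 a ∧
      ((q (p [d, c, b, a])).getD 0 a ≠ b → p (s [d, c, b, a]) = s (p [d, c, b, a])))
  | _ => false

/-- Three maps that agree at an entry of `t` generate at most two entries. -/
def thin (t : List (List Bool)) (p q s : List Bool → List Bool) : Bool :=
  ∀ w ∈ t, p w = q w → q w = s w → ∀ v ∈ t, v = w ∨ v = p w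

theorem table_five : ∀ r ∈ lat 5, table 5 r ∈ tables := by decide +kernel

theorem tables_nodup : ∀ t ∈ tables, t.Nodup := by decide +kernel

theorem tables_conclusion : ∀ t ∈ tables,
    ∀ p ∈ (t.map fun w => t.filter (stepLow w)).sections, (∀ w ∈ t, look t p (look t p w) = w) →
    ∀ q ∈ (t.map fun w => t.filter (stepMid w)).sections, (∀ w ∈ t, look t q (look t q w) = w) →
    (∀ w ∈ t, altLow w (look t p w) (look t q w) = true) →
    ∀ s ∈ (t.map fun w => t.filter (stepHigh w)).sections, (∀ w ∈ t, look t s (look t s w) = w) →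
    (∀ w ∈ t, altHigh w (look t q w) (look t s w) = true) →
    thin t (look t p) (look t q) (look t s) = true →
    ∀ w ∈ t, conclusion (look t p) (look t q) (look t s) w = true := by decide +kernel

theorem conclusion_of_maps {t : List (List Bool)} (ht : t ∈ tables) (p q s : List Bool → List Bool)
    (hp : ∀ w ∈ t, p w ∈ t ∧ stepLow w (p w) ∧ p (p w) = w)
    (hq : ∀ w ∈ t, q w ∈ t ∧ stepMid w (q w) ∧ q (q w) = w)
    (hs : ∀ w ∈ t, s w ∈ t ∧ stepHigh w (s w) ∧ s (s w) = w)
    (hl : ∀ w ∈ t, altLow w (p w) (q w)) (hh : ∀ w ∈ t, altHigh w (q w) (s w))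
    (hc : ∀ w ∈ t, p w = q w → q w = s w → ∀ v ∈ t, v = w ∨ v = p w) :
    ∀ w ∈ t, conclusion p q s w := by
  have sec : ∀ (E : List Bool → List Bool → Bool) (g : List Bool → List Bool),
      (∀ w ∈ t, g w ∈ t ∧ E w (g w) ∧ g (g w) = w) →
      t.map g ∈ (t.map fun w => t.filter (E w)).sections ∧
      ∀ w ∈ t, look t (t.map g) (look t (t.map g) w) = w := by
    intro E g hg
    refine ⟨?_, fun w hw => by rw [look_map g hw, look_map g (hg w hw).1, (hg w hw).2.2]⟩
    rw [List.mem_sections, List.forall₂_map_right_iff, List.forall₂_map_left_iff,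
      List.forall₂_same]
    exact fun w hw => List.mem_filter.2 ⟨(hg w hw).1, (hg w hw).2.1⟩
  intro w hw
  have h1 := tables_conclusion t ht _ (sec _ p hp).1 (sec _ p hp).2 _ (sec _ q hq).1 (sec _ q hq).2
    (fun w hw => by rw [look_map p hw, look_map q hw]; exact hl w hw) _ (sec _ s hs).1 (sec _ s hs).2
    (fun w hw => by rw [look_map q hw, look_map s hw]; exact hh w hw)
    (decide_eq_true fun w hw => by
      rw [look_map p hw, look_map q hw, look_map s hw]; exact hc w hw) w hw
  unfold conclusion at h1 ⊢
  split at h1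
  · rw [look_map p hw, look_map s hw, look_map q (hp _ hw).1, look_map p (hs _ hw).1,
      look_map s (hp _ hw).1] at h1
    exact h1
  · exact h1

section

variable {A : Type*} {φ : ℕ → A → A} {x : A} {N : ℕ} {Des : A → Set ℕ} [Finite A]

theorem IsDualEquivalence.conclusion (h : IsDualEquivalence N Des φ) {i : ℕ} (hN : i + 4 < N) (x : A) :
    bit Des (i + 4) (φ (i + 2) x) = bit Des (i + 4) x ∧
    bit Des (i + 1) (φ (i + 4) x) = bit Des (i + 1) x ∧
    (bit Des (i + 1) x ≠ bit Des (i + 2) x → bit Des (i + 2) x = bit Des (i + 3) x →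
      bit Des (i + 3) x ≠ bit Des (i + 4) x →
      bit Des (i + 3) (φ (i + 2) (φ (i + 4) x)) = bit Des (i + 4) (φ (i + 3) (φ (i + 2) x)) ∧
      (bit Des (i + 4) (φ (i + 3) (φ (i + 2) x)) ≠ bit Des (i + 2) x →
        φ (i + 2) (φ (i + 4) x) = φ (i + 4) (φ (i + 2) x))) := by
  classical
  obtain ⟨r, hr, h1⟩ := h.hasBits (i := i) (k := 3) (by omega) (by omega) hN x
  have ht := table_five r hr
  simp only [Nat.reduceAdd] at h1
  revert h1 ht
  generalize table 5 r = t
  intro h1 ht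
  have hC : ∀ g, i + 2 ≤ g → g ≤ i + 4 → ∀ y ∈ genClass φ (Set.Icc (i + 2) (i + 3 + 1)) x,
      φ g y ∈ genClass φ (Set.Icc (i + 2) (i + 3 + 1)) x :=
    fun g h2 h3 y hy => apply_mem_genClass ⟨h2, h3⟩ hy
  have hx := mem_genClass_self (x := x) (φ := φ) (I := Set.Icc (i + 2) (i + 3 + 1))
  have hind : ∀ Q : A → Prop, ∀ y ∈ genClass φ (Set.Icc (i + 2) (i + 3 + 1)) x,
      Q y → (∀ g, i + 2 ≤ g → g ≤ i + 4 → ∀ z, Q z → Q (φ g z)) →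
      ∀ z ∈ genClass φ (Set.Icc (i + 2) (i + 3 + 1)) x, Q z := by
    intro Q y hy hQ1 hQ2 z hz
    rw [← genClass_eq hy] at hz
    exact genClass_induction (fun g hg => h.involutive g (by have := hg.1; omega)
      (by have := hg.2; omega)) hQ1 (fun g hg => hQ2 g hg.1 hg.2) hz
  revert hC hx h1 hind
  generalize genClass φ (Set.Icc (i + 2) (i + 3 + 1)) x = C
  intro h1 hC hx hind
  have hinj : ∀ y ∈ C, ∀ z ∈ C, win Des i 4 y = win Des i 4 z → y = z := fun y hy z hz hyz =>
    h1.eq (List.nodup_iff_count_le_one.1 (tables_nodup t ht) _) hy hz hyz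
  have hex : ∀ w, ∃ y, w ∈ t → y ∈ C ∧ win Des i 4 y = w := by
    intro w
    by_cases hw : w ∈ t
    · obtain ⟨y, hy⟩ := h1.exists_of_mem hw
      exact ⟨y, fun _ => hy⟩
    · exact ⟨x, fun h => absurd h hw⟩
  choose u hu using hex
  have hu' := fun w hw => (hu w hw).2
  replace hu := fun w hw => (hu w hw).1
  have hu2 : ∀ y ∈ C, u (win Des i 4 y) = y := fun y hy =>
    hinj _ (hu _ (h1.mem hy)) _ hy (hu' _ (h1.mem hy))
  obtain ⟨P, hP⟩ : ∃ P : ℕ → List Bool → List Bool, ∀ g w, P g w = win Des i 4 (φ g (u w)) :=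
    ⟨_, fun _ _ => rfl⟩
  have hPx : ∀ g, ∀ y ∈ C, P g (win Des i 4 y) = win Des i 4 (φ g y) := fun g y hy => by
    rw [hP, hu2 y hy]
  have hall : ∀ Q : List Bool → Prop, (∀ y ∈ C, Q (win Des i 4 y)) → ∀ w ∈ t, Q w := by
    intro Q hQ w hw
    rw [← hu' w hw]
    exact hQ _ (hu w hw)
  have hinv : ∀ g, i + 2 ≤ g → g ≤ i + 4 → ∀ y ∈ C, P g (P g (win Des i 4 y)) = win Des i 4 y :=
    fun g h2 h3 y hy => by
      rw [hPx g y hy, hPx g _ (hC g h2 h3 y hy), h.involutive g (by omega) (by omega)]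
  have key := conclusion_of_maps ht (P (i + 2)) (P (i + 3)) (P (i + 4))
    (hall _ fun y hy => ⟨?_, ?_, hinv _ (by omega) (by omega) y hy⟩)
    (hall _ fun y hy => ⟨?_, ?_, hinv _ (by omega) (by omega) y hy⟩)
    (hall _ fun y hy => ⟨?_, ?_, hinv _ (by omega) (by omega) y hy⟩)
    (hall _ fun y hy => ?_) (hall _ fun y hy => ?_)
    (hall _ fun y hy e1 e2 => hall _ fun z hz => ?_) _ (h1.mem hx)
  · simp only [win, Nat.zero_add, Nat.reduceAdd] at hPx
    simp only [QueerDual.conclusion, win, Nat.zero_add, Nat.reduceAdd, decide_eq_true_eq] at key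
    rw [hPx _ x hx, hPx _ x hx, hPx _ _ (hC (i + 2) (by omega) (by omega) x hx),
      hPx _ _ (hC (i + 4) (by omega) (by omega) x hx),
      hPx _ _ (hC (i + 2) (by omega) (by omega) x hx)] at key
    refine ⟨key.1, key.2.1, fun h2 h3 h4 => ⟨(key.2.2 ⟨h2, h3, h4⟩).1, fun h5 => ?_⟩⟩
    exact hinj _ (hC _ (by omega) (by omega) _ (hC _ (by omega) (by omega) _ hx)) _
      (hC _ (by omega) (by omega) _ (hC _ (by omega) (by omega) _ hx)) ((key.2.2 ⟨h2, h3, h4⟩).2 h5)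
  · rw [hPx _ y hy]; exact h1.mem (hC _ (by omega) (by omega) y hy)
  · rw [hPx _ y hy]
    simp only [stepLow, win, Nat.zero_add, Nat.reduceAdd]
    split_ifs with h2
    · rw [h.fix (by omega) y h2]; simp
    · have h3 := h.flip (by omega) y h2
      simp only [h3, decide_eq_true_eq, true_and]
      exact h.keep_right (by omega) y
  · rw [hPx _ y hy]; exact h1.mem (hC _ (by omega) (by omega) y hy)
  · rw [hPx _ y hy]
    simp only [stepMid, win, Nat.zero_add, Nat.reduceAdd]
    split_ifs with h2
    · rw [h.fix (i := i + 1) (by omega) y h2]; simp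
    · have h3 := h.flip (i := i + 1) (by omega) y h2
      simp only [Nat.add_assoc, Nat.reduceAdd] at h3
      simp only [h3, decide_eq_true_eq, true_and]
      exact ⟨h.keep_left (by omega) y, h.keep_right (i := i + 1) (by omega) y⟩
  · rw [hPx _ y hy]; exact h1.mem (hC _ (by omega) (by omega) y hy)
  · rw [hPx _ y hy]
    simp only [stepHigh, win, Nat.zero_add, Nat.reduceAdd]
    split_ifs with h2
    · rw [h.fix (i := i + 2) (by omega) y h2]; simp
    · have h3 := h.flip (i := i + 2) (by omega) y h2
      simp only [Nat.add_assoc, Nat.reduceAdd] at h3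
      simp only [h3, decide_eq_true_eq, true_and]
      exact h.keep_left (i := i + 1) (by omega) y
  · rw [hPx _ y hy, hPx _ y hy]
    simp only [altLow, win, Nat.zero_add, Nat.reduceAdd, decide_eq_true_eq]
    intro h2
    rcases h.alt (by omega) y h2.1 h2.2 with h3 | h3
    · exact Or.inl ⟨h3.1, by rw [h3.2]⟩
    · exact Or.inr h3
  · rw [hPx _ y hy, hPx _ y hy]
    simp only [altHigh, win, Nat.zero_add, Nat.reduceAdd, decide_eq_true_eq]
    intro h2
    rcases h.alt (i := i + 1) (by omega) y h2.1 h2.2 with h3 | h3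
    · exact Or.inl ⟨h3.1, by rw [show i + 4 = i + 1 + 3 from rfl, h3.2]⟩
    · exact Or.inr h3
  · rw [hPx _ y hy, hPx _ y hy] at e1
    rw [hPx _ y hy, hPx _ y hy] at e2
    rw [hPx _ y hy]
    have e3 := hinj _ (hC _ (by omega) (by omega) y hy) _ (hC _ (by omega) (by omega) y hy) e1
    have e4 := hinj _ (hC _ (by omega) (by omega) y hy) _ (hC _ (by omega) (by omega) y hy) e2
    have e5 : z = y ∨ z = φ (i + 2) y := by
      refine hind (fun z => z = y ∨ z = φ (i + 2) y) y hy (Or.inl rfl) ?_ z hz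
      intro g hg1 hg2 z hz
      have hg : φ g y = φ (i + 2) y := by
        obtain rfl | rfl | rfl : g = i + 2 ∨ g = i + 3 ∨ g = i + 4 := by omega
        · rfl
        · exact e3.symm
        · rw [← e4, e3]
      rcases hz with rfl | rfl
      · exact Or.inr hg
      · rw [← hg]
        exact Or.inl (h.involutive g (by omega) (by omega) y)
    exact e5.imp (fun h => by rw [h]) (fun h => by rw [h])

end

end QueerDual

namespace QueerDual

set_option maxRecDepth 10000 in
theorem table_six : ∀ r ∈ lat 6, ∀ t ∈ tables, ∃ w ∈ t, (∀ b, (table 6 r).count (b :: w) ≤ 1) ∧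
    ¬((true :: w) ∈ table 6 r ∧ (false :: w) ∈ table 6 r) := by decide +kernel

variable {A : Type*} {φ ψ : ℕ → A → A} {x : A} {N : ℕ} {Des : A → Set ℕ} [Finite A]

theorem IsDualEquivalence.rigid (h : IsDualEquivalence N Des φ) {i : ℕ} (hN : i + 5 < N) (x y : A)
    (hxy : Relation.ReflTransGen (fun a b => ∃ j, i + 2 ≤ j ∧ j ≤ i + 5 ∧ b = φ j a) x y)
    (hl : ∀ l : List ℕ, (∀ j ∈ l, i + 2 ≤ j ∧ j ≤ i + 4) → ∀ j, i + 1 ≤ j → j ≤ i + 4 →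
      bit Des j (l.foldl (fun a j => φ j a) x) = bit Des j (l.foldl (fun a j => φ j a) y)) : x = y := by
  obtain ⟨r, hr, h6⟩ := h.hasBits (i := i) (k := 4) (by omega) (by omega) hN x
  obtain ⟨r', hr', h5⟩ := h.hasBits (i := i) (k := 3) (by omega) (by omega) (by omega) x
  obtain ⟨w, hw, hw1, hw2⟩ := table_six r hr _ (table_five r' hr')
  obtain ⟨z, hz, rfl⟩ := h5.exists_of_mem hw
  obtain ⟨l, hl1, rfl⟩ : ∃ l : List ℕ, (∀ j ∈ l, i + 2 ≤ j ∧ j ≤ i + 4) ∧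
      l.foldl (fun a j => φ j a) x = z := by
    refine genClass_induction (P := fun z => ∃ l : List ℕ, (∀ j ∈ l, i + 2 ≤ j ∧ j ≤ i + 4) ∧
      l.foldl (fun a j => φ j a) x = z) ?_ ⟨[], by simp, rfl⟩ ?_ hz
    · exact fun g hg => h.involutive g (by have := hg.1; omega) (by have := hg.2; omega)
    · rintro g hg _ ⟨l, h1, rfl⟩
      refine ⟨l ++ [g], fun j hj => ?_, by simp⟩
      rcases List.mem_append.1 hj with h2 | h2
      · exact h1 j h2
      · rw [List.mem_singleton.1 h2]; exact ⟨hg.1, hg.2⟩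
  have hmem : ∀ l : List ℕ, (∀ j ∈ l, i + 2 ≤ j ∧ j ≤ i + 4) →
      ∀ u ∈ genClass φ (Set.Icc (i + 2) (i + 4 + 1)) x,
      l.foldl (fun a j => φ j a) u ∈ genClass φ (Set.Icc (i + 2) (i + 4 + 1)) x := by
    intro l
    induction l with
    | nil => exact fun _ u hu => hu
    | cons a l ih =>
      intro hl u hu
      have := hl a (by simp)
      exact ih (fun j hj => hl j (by simp [hj])) _ (apply_mem_genClass ⟨this.1, by omega⟩ hu)
  have hx := mem_genClass_self (x := x) (φ := φ) (I := Set.Icc (i + 2) (i + 4 + 1))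
  have hy : y ∈ genClass φ (Set.Icc (i + 2) (i + 4 + 1)) x := by
    clear hl
    induction hxy with
    | refl => exact hx
    | tail _ h1 ih =>
      obtain ⟨j, hj1, hj2, rfl⟩ := h1
      exact apply_mem_genClass ⟨hj1, hj2⟩ ih
  have hinj : ∀ l : List ℕ, (∀ j ∈ l, i + 2 ≤ j ∧ j ≤ i + 4) → ∀ u v,
      l.foldl (fun a j => φ j a) u = l.foldl (fun a j => φ j a) v → u = v := by
    intro l
    induction l with
    | nil => exact fun _ u v huv => huv
    | cons a l ih =>
      intro hl u v huv
      have h1 := hl a (by simp)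
      have h2 := ih (fun j hj => hl j (by simp [hj])) _ _ huv
      exact (h.involutive a (by omega) (by omega)).injective h2
  have hw3 := hl l hl1
  have hzx := hmem l hl1 x hx
  have hzy := hmem l hl1 y hy
  refine hinj l hl1 x y ?_
  revert hw1 hw2 hw3 hzx hzy
  generalize l.foldl (fun a j => φ j a) x = u
  generalize l.foldl (fun a j => φ j a) y = v
  intro hw1 hw2 hw3 hu hv
  have h7 : win Des i 4 v = win Des i 4 u := by
    simp only [win, Nat.zero_add, Nat.reduceAdd]
    rw [hw3 (i + 4) (by omega) (by omega), hw3 (i + 3) (by omega) (by omega),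
      hw3 (i + 2) (by omega) (by omega), hw3 (i + 1) (by omega) (by omega)]
  have h8 : ∀ u, win Des i (4 + 1) u = bit Des (i + 5) u :: win Des i 4 u := fun _ => rfl
  have hu' := h6.mem hu
  have hv' := h6.mem hv
  rw [h8] at hu'
  rw [h8, h7] at hv'
  have h9 : bit Des (i + 5) u = bit Des (i + 5) v := by
    cases h1 : bit Des (i + 5) u <;> cases h2 : bit Des (i + 5) v
    · rfl
    · rw [h1] at hu'; rw [h2] at hv'; exact absurd ⟨hv', hu'⟩ hw2
    · rw [h1] at hu'; rw [h2] at hv'; exact absurd ⟨hu', hv'⟩ hw2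
    · rfl
  exact h6.eq (by rw [h8]; exact hw1 _) hu hv (by rw [h8, h8, h7, h9])

end QueerDual

namespace QueerDual

/-! ### Signed standard tableaux of small size -/

instance (G : Finset ℕ) (c : ℤ) : Decidable (Addable G c) :=
  inferInstanceAs (Decidable ((c = 0 ∨ c.natAbs ∈ G) ∧ c.natAbs + 1 ∉ G))

/-- The word `s k, …, s 1`. -/
def letters (s : ℕ → ℤ) : ℕ → List ℤ
  | 0 => []
  | k + 1 => s (k + 1) :: letters s k

/-- The shape of a word of contents. -/
def shape : List ℤ → Finset ℕ
  | [] => ∅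
  | c :: w => mv (shape w) c

/-- The words of contents of walks of length `m`. -/
def walks : ℕ → List (List ℤ)
  | 0 => [[]]
  | m + 1 => (walks m).flatMap fun w =>
      (((List.range (2 * m + 1)).map fun i : ℕ => (i : ℤ) - m).filter fun c => Addable (shape w) c).map
        (· :: w)

/-- The ascents of a word of contents. -/
def abits : List ℤ → List Bool
  | a :: b :: w => decide (b < a) :: abits (b :: w)
  | _ => []

/-- The ascent bits of the walks to the shape `G`. -/
def walkTable (m : ℕ) (G : Finset ℕ) : List (List Bool) :=
  ((walks m).filter fun w => shape w = G).map abits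

variable {s t : ℕ → ℤ} {m k n : ℕ}

theorem shape_letters (s : ℕ → ℤ) (k : ℕ) : shape (letters s k) = sh s k := by
  induction k with
  | zero => rfl
  | succ k ih => rw [letters, shape, ih, sh]

theorem letters_congr : letters s m = letters t m ↔ ∀ k, 1 ≤ k → k ≤ m → s k = t k := by
  induction m with
  | zero => exact iff_of_true rfl (fun j h1 h2 => by omega)
  | succ m ih =>
    rw [letters, letters, List.cons.injEq, ih]
    refine ⟨fun h j h1 h2 => ?_, fun h => ⟨h _ (by omega) le_rfl, fun j h1 h2 => h j h1 (by omega)⟩⟩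
    rcases Nat.lt_or_ge m j with h3 | h3
    · obtain rfl : j = m + 1 := by omega
      exact h.1
    · exact h.2 j h1 h3

theorem IsWalk.letters_mem (h : IsWalk m s) (hk : k ≤ m) : letters s k ∈ walks k := by
  induction k with
  | zero => simp [walks, letters]
  | succ k ih =>
    have h1 := h k hk
    rw [walks, List.mem_flatMap]
    refine ⟨letters s k, ih (by omega), List.mem_map.2 ⟨s (k + 1), List.mem_filter.2
      ⟨List.mem_map.2 ⟨(s (k + 1) + k).toNat, List.mem_range.2 ?_, ?_⟩, ?_⟩, rfl⟩⟩
    all_goals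
      have h2 : (s (k + 1)).natAbs ≤ k := by
        rcases h1.1 with h2 | h2
        · rw [h2]; exact Nat.zero_le _
        · have h3 := Finset.single_le_sum (f := fun i => i) (fun _ _ => Nat.zero_le _) h2
          rwa [(h.mono (by omega : k ≤ m)).sum_sh] at h3
    · omega
    · omega
    · rw [shape_letters]; exact decide_eq_true h1

theorem exists_walk_letters {w : List ℤ} (h : w ∈ walks m) : ∃ s, IsWalk m s ∧ letters s m = w := by
  induction m generalizing w with
  | zero => exact ⟨fun _ => 0, fun k hk => absurd hk (by omega), by simpa [walks, letters, eq_comm] using h⟩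
  | succ m ih =>
    rw [walks, List.mem_flatMap] at h
    obtain ⟨v, hv, h⟩ := h
    rw [List.mem_map] at h
    obtain ⟨c, hc, rfl⟩ := h
    have hc := of_decide_eq_true (List.mem_filter.1 hc).2
    obtain ⟨s, h1, rfl⟩ := ih hv
    rw [shape_letters] at hc
    have h2 : ∀ j, j ≠ m + 1 → Function.update s (m + 1) c j = s j :=
      fun j hj => Function.update_of_ne hj _ _
    refine ⟨Function.update s (m + 1) c, fun k hk => ?_, ?_⟩
    · rw [sh_congr (fun j h3 h4 => h2 j (by omega))]
      rcases Nat.lt_or_ge k m with h3 | h3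
      · rw [h2 _ (by omega)]
        exact h1 k h3
      · obtain rfl : k = m := by omega
        rw [Function.update_self]
        exact hc
    · rw [letters, Function.update_self, letters_congr.2 (fun j _ h4 => h2 j (by omega))]

theorem nodup_walks (m : ℕ) : (walks m).Nodup := by
  induction m with
  | zero => simp [walks]
  | succ m ih =>
    rw [walks, List.nodup_flatMap]
    refine ⟨fun w _ => ((List.nodup_range.map (fun a b h => by simpa using h)).filter _).map
      (fun a b h => (List.cons.inj h).1), ih.imp (fun {v w} hvw => ?_)⟩
    intro u h1 h2
    rw [List.mem_map] at h1 h2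
    obtain ⟨i, -, rfl⟩ := h1
    obtain ⟨j, -, h2⟩ := h2
    exact hvw (List.cons.inj h2).2.symm

theorem bits_des {γ : StrictPartition n} {S : SignedFilling} (h : IsSST γ S) (hk : k < n) :
    bits (S.des n) k = abits (letters S.diag (k + 1)) := by
  induction k with
  | zero => rfl
  | succ k ih =>
    rw [bits, ih (by omega)]
    refine congrArg (· :: abits (letters S.diag (k + 1))) ?_
    rw [decide_eq_decide, h.mem_des]
    exact ⟨fun h1 => h1.2.2, fun h1 => ⟨by omega, hk, h1⟩⟩

theorem card_SST_bits (γ : StrictPartition n) (hn : 1 ≤ n) (w : List Bool) :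
    {S : SST γ | bits (S.1.des n) (n - 1) = w}.ncard = (walkTable n γ.beads).count w := by
  rw [walkTable, List.count_eq_countP, List.countP_map, List.countP_filter, List.countP_eq_length_filter,
    ← List.toFinset_card_of_nodup ((nodup_walks _).filter _), ← Set.ncard_coe_finset]
  refine Set.ncard_congr (fun S _ => letters S.1.diag n) ?_ ?_ ?_
  · intro S hS
    have h1 := bits_des S.2 (k := n - 1) (by omega)
    rw [Nat.sub_add_cancel hn] at h1
    simp only [List.coe_toFinset, List.mem_filter, Function.comp_apply, Bool.and_eq_true,
      decide_eq_true_eq, beq_iff_eq]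
    exact ⟨S.2.walk.1.letters_mem le_rfl, h1.symm.trans hS, by rw [shape_letters, S.2.walk.2.1]⟩
  · intro S U _ _ h1
    exact Subtype.ext (S.2.ext_diag U.2 (letters_congr.1 h1))
  · intro v hv
    simp only [List.coe_toFinset, List.mem_filter, Function.comp_apply, Bool.and_eq_true,
      decide_eq_true_eq, beq_iff_eq] at hv
    obtain ⟨s, h1, rfl⟩ := exists_walk_letters hv.1
    have hv' : shape (letters s n) = γ.beads := hv.2.2
    rw [shape_letters] at hv'
    obtain ⟨S, h2, h3⟩ := IsSST.exists_of_walk h1 hv'.symm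
    have h4 : letters S.diag n = letters s n := letters_congr.2 h3
    have h6 := bits_des h2 (k := n - 1) (by omega)
    rw [Nat.sub_add_cancel hn, h4] at h6
    exact ⟨⟨S, h2⟩, h6.trans hv.2.1, h4⟩

theorem IsQueerDualEquivalence.hasBits {A : Type*} [Finite A] {N : ℕ} {Des : A → Set ℕ} {ψ : ℕ → A → A}
    (h : IsQueerDualEquivalence N Des ψ) {i : ℕ} (h1 : 1 ≤ i) (h3 : i ≤ 3) (hN : i < N) (x : A) :
    ∃ w ∈ walks (i + 1), HasBits (restrictedClass ψ i x) (win Des 0 i) (walkTable (i + 1) (shape w)) := by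
  obtain ⟨γ, hγ⟩ := h.schurP_class i h1 h3 hN x
  have h4 := card_bits_eq (i + 1) _ _ _ hγ
  have h5 : ∀ U, bits (Des U ∩ Set.Icc 1 i) (i + 1 - 1) = win Des 0 i U := by
    intro U
    rw [win_eq, Nat.add_sub_cancel, bits_eq_iff]
    intro j hj1 hj2
    rw [Set.mem_ofPred_eq, Nat.zero_add]
    exact ⟨fun h => h.1, fun h => ⟨h, hj1, hj2⟩⟩
  simp only [h5, card_SST_bits γ (Nat.le_add_left 1 i)] at h4
  have h6 : win Des 0 i x ∈ walkTable (i + 1) γ.beads := by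
    rw [← List.count_pos_iff, ← h4, Set.ncard_pos]
    exact ⟨x, mem_genClass_self, rfl⟩
  rw [walkTable, List.mem_map] at h6
  obtain ⟨w, hw, -⟩ := h6
  rw [List.mem_filter, decide_eq_true_eq] at hw
  exact ⟨w, hw.1, by rw [hw.2]; exact h4⟩

theorem walkTable_two : ∀ w ∈ walks 2, walkTable 2 (shape w) = [[false], [true]] := by decide

end QueerDual

namespace QueerDual

theorem walkTable_three : ∀ w ∈ walks 3, (∀ v, (walkTable 3 (shape w)).count v ≤ 1) ∧
    ((∀ a b, [b, a] ∈ walkTable 3 (shape w) → a = !b) ∨ ∀ a b, [b, a] ∈ walkTable 3 (shape w)) := by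
  have : ∀ w ∈ walks 3, (walkTable 3 (shape w)).Nodup ∧
      ((∀ a b, [b, a] ∈ walkTable 3 (shape w) → a = !b) ∨ ∀ a b, [b, a] ∈ walkTable 3 (shape w)) := by
    decide
  exact fun w hw => ⟨List.nodup_iff_count_le_one.1 (this w hw).1, (this w hw).2⟩

theorem walkTable_four : ∀ w ∈ walks 4,
    (∀ a b c, (walkTable 4 (shape w)).count [c, b, a] = 1) ∨
    ∀ a b c, (walkTable 4 (shape w)).count [c, b, a] =
      if a = b ∧ b = c then 0 else if a = b ∨ b = c then 1 else 2 := by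
  decide

section

variable {A : Type*} {ψ : ℕ → A → A} {x y z : A} {N k g : ℕ} {Des : A → Set ℕ}

theorem IsQueerDualEquivalence.inv (h : IsQueerDualEquivalence N Des ψ) (hg : g ≠ 1) (hN : g < N) (x : A) :
    ψ g (ψ g x) = x := by
  rcases Nat.eq_zero_or_pos g with rfl | h0
  · exact h.involutive_zero x
  · exact h.dual.involutive g (by omega) hN x

theorem mem_restricted_self : x ∈ restrictedClass ψ k x := mem_genClass_self

theorem apply_mem_restricted (hk : g ≤ k) (hg : g ≠ 1) (hy : y ∈ restrictedClass ψ k x) :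
    ψ g y ∈ restrictedClass ψ k x := apply_mem_genClass ⟨hk, hg⟩ hy

theorem restricted_eq (hy : y ∈ restrictedClass ψ k x) : restrictedClass ψ k y = restrictedClass ψ k x :=
  genClass_eq hy

theorem IsQueerDualEquivalence.restricted_induction (h : IsQueerDualEquivalence N Des ψ) {P : A → Prop}
    (hN : k < N) (hx : P x) (hP : ∀ g, g ≤ k → g ≠ 1 → ∀ y, P y → P (ψ g y))
    (hy : y ∈ restrictedClass ψ k x) : P y :=
  genClass_induction (fun g hg => h.inv hg.2 (lt_of_le_of_lt hg.1 hN)) hx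
    (fun g hg => hP g hg.1 hg.2) hy

theorem restricted_mono {l : ℕ} (hkl : k ≤ l) (hy : y ∈ restrictedClass ψ k x) : y ∈ restrictedClass ψ l x :=
  Relation.EqvGen.mono (fun _ _ ⟨i, hi, h⟩ => ⟨i, ⟨hi.1.trans hkl, hi.2⟩, h⟩) _ _ hy

/-- The class of `x` of degree three has type `(3)`. -/
def Free₃ (Des : A → Set ℕ) (ψ : ℕ → A → A) (x : A) : Prop :=
  ∃ y ∈ restrictedClass ψ 2 x, bit Des 1 y = bit Des 2 y

/-- The class of `x` of degree four has type `(4)`. -/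
def Free₄ (Des : A → Set ℕ) (ψ : ℕ → A → A) (x : A) : Prop :=
  ∃ y ∈ restrictedClass ψ 3 x, bit Des 1 y = bit Des 2 y ∧ bit Des 2 y = bit Des 3 y

theorem free₃_congr (hy : y ∈ restrictedClass ψ 2 x) : Free₃ Des ψ y ↔ Free₃ Des ψ x := by
  rw [Free₃, Free₃, restricted_eq hy]

theorem free₄_congr (hy : y ∈ restrictedClass ψ 3 x) : Free₄ Des ψ y ↔ Free₄ Des ψ x := by
  rw [Free₄, Free₄, restricted_eq hy]

theorem not_free₃ (hx : ¬Free₃ Des ψ x) : bit Des 1 x ≠ bit Des 2 x :=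
  fun h1 => hx ⟨x, mem_restricted_self, h1⟩

variable [Finite A]

theorem IsQueerDualEquivalence.flip_zero (h : IsQueerDualEquivalence N Des ψ) (hN : 1 < N) (x : A) :
    bit Des 1 (ψ 0 x) = !bit Des 1 x := by
  obtain ⟨w, hw, h1⟩ := h.hasBits le_rfl (by omega) hN x
  rw [walkTable_two w hw] at h1
  obtain ⟨y, hy, h2⟩ := h1.exists_of_mem (w := [!bit Des 1 x]) (by cases bit Des 1 x <;> decide)
  have h3 : y = x ∨ y = ψ 0 x := by
    refine h.restricted_induction (P := fun y => y = x ∨ y = ψ 0 x) hN (Or.inl rfl) ?_ hy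
    intro g hg hg1 y hy
    obtain rfl : g = 0 := by omega
    rcases hy with rfl | rfl
    · exact Or.inr rfl
    · exact Or.inl (h.involutive_zero x)
  simp only [win, List.cons.injEq, and_true] at h2
  rcases h3 with rfl | rfl
  · exact absurd h2.symm (Bool.not_ne_self _)
  · exact h2

theorem IsQueerDualEquivalence.inj₃ (h : IsQueerDualEquivalence N Des ψ) (hN : 2 < N)
    (hy : y ∈ restrictedClass ψ 2 x) (hz : z ∈ restrictedClass ψ 2 x)
    (h1 : bit Des 1 y = bit Des 1 z) (h2 : bit Des 2 y = bit Des 2 z) : y = z := by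
  obtain ⟨w, hw, h3⟩ := h.hasBits (i := 2) (by omega) (by omega) hN x
  exact h3.eq ((walkTable_three w hw).1 _) hy hz (by simp [win, h1, h2])

theorem IsQueerDualEquivalence.free₃ (h : IsQueerDualEquivalence N Des ψ) (hN : 2 < N)
    (hx : Free₃ Des ψ x) (a b : Bool) :
    ∃ y ∈ restrictedClass ψ 2 x, bit Des 1 y = a ∧ bit Des 2 y = b := by
  obtain ⟨w, hw, h3⟩ := h.hasBits (i := 2) (by omega) (by omega) hN x
  obtain ⟨y, hy, h1⟩ := hx
  rcases (walkTable_three w hw).2 with h2 | h2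
  · have := h2 _ _ (h3.mem hy)
    rw [h1] at this
    exact absurd this.symm (Bool.not_ne_self _)
  · obtain ⟨z, hz, h4⟩ := h3.exists_of_mem (h2 a b)
    simp only [win, List.cons.injEq, and_true, Nat.zero_add, Nat.reduceAdd] at h4
    exact ⟨z, hz, h4.2, h4.1⟩

theorem IsQueerDualEquivalence.flip_two (h : IsQueerDualEquivalence N Des ψ) (hN : 2 < N)
    (hx : bit Des 1 x ≠ bit Des 2 x) :
    bit Des 1 (ψ 2 x) = !bit Des 1 x ∧ bit Des 2 (ψ 2 x) = !bit Des 2 x :=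
  h.dual.flip (i := 0) hN x hx

theorem IsQueerDualEquivalence.zero_eq_two (h : IsQueerDualEquivalence N Des ψ) (hN : 2 < N)
    (hx : ¬Free₃ Des ψ x) : ψ 0 x = ψ 2 x := by
  have h1 := not_free₃ hx
  have h0 : ψ 0 x ∈ restrictedClass ψ 2 x := apply_mem_restricted (by omega) (by omega) mem_restricted_self
  have h2 := h.flip_two hN h1
  have h3 := not_free₃ (fun h4 => hx ((free₃_congr h0).1 h4))
  have h4 := h.flip_zero (by omega) x
  refine h.inj₃ hN h0 (apply_mem_restricted le_rfl (by omega) mem_restricted_self) (h4.trans h2.1.symm) ?_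
  rw [h2.2]
  rw [h4] at h3
  revert h1 h3
  generalize bit Des 1 x = a
  generalize bit Des 2 x = b
  generalize bit Des 2 (ψ 0 x) = c
  revert a b c
  decide

theorem IsQueerDualEquivalence.keep_zero (h : IsQueerDualEquivalence N Des ψ) (hN : 2 < N)
    (hx : Free₃ Des ψ x) : bit Des 2 (ψ 0 x) = bit Des 2 x := by
  by_contra h1
  have h2 : bit Des 2 (ψ 0 x) = !bit Des 2 x := by
    revert h1; cases bit Des 2 (ψ 0 x) <;> cases bit Des 2 x <;> simp
  have h3 := h.flip_zero (by omega) x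
  have h0 : ψ 0 x ∈ restrictedClass ψ 2 x := apply_mem_restricted (by omega) (by omega) mem_restricted_self
  have h4 : (ψ 2 x = x ∧ ψ 2 (ψ 0 x) = ψ 0 x) ∨ ψ 2 x = ψ 0 x := by
    by_cases h5 : bit Des 1 x = bit Des 2 x
    · refine Or.inl ⟨h.dual.fix (i := 0) hN x h5, h.dual.fix (i := 0) hN _ ?_⟩
      rw [zero_add, h3, h2, h5]
    · have h6 := h.flip_two hN h5
      exact Or.inr (h.inj₃ hN (apply_mem_restricted le_rfl (by omega) mem_restricted_self) h0
        (h6.1.trans h3.symm) (h6.2.trans h2.symm))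
  obtain ⟨y, hy, h5, h6⟩ := h.free₃ hN hx (bit Des 1 x) (!bit Des 2 x)
  have h7 : y = x ∨ y = ψ 0 x := by
    refine h.restricted_induction (P := fun y => y = x ∨ y = ψ 0 x) hN (Or.inl rfl) ?_ hy
    intro g hg hg1 y hy
    obtain rfl | rfl : g = 0 ∨ g = 2 := by omega
    · rcases hy with rfl | rfl
      · exact Or.inr rfl
      · exact Or.inl (h.involutive_zero x)
    · rcases h4 with h4 | h4
      · rcases hy with rfl | rfl
        · exact Or.inl h4.1
        · exact Or.inr h4.2
      · rcases hy with rfl | rfl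
        · exact Or.inr h4
        · rw [← h4]; exact Or.inl (h.inv (by omega) hN x)
  rcases h7 with rfl | rfl
  · exact absurd h6.symm (Bool.not_ne_self _)
  · rw [h3] at h5; exact absurd h5 (Bool.not_ne_self _)

theorem IsQueerDualEquivalence.free₄ (h : IsQueerDualEquivalence N Des ψ) (hN : 3 < N)
    (hx : Free₄ Des ψ x) (a b c : Bool) :
    {y ∈ restrictedClass ψ 3 x | bit Des 1 y = a ∧ bit Des 2 y = b ∧ bit Des 3 y = c}.ncard = 1 := by
  obtain ⟨w, hw, h3⟩ := h.hasBits (i := 3) (by omega) (by omega) hN x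
  obtain ⟨y, hy, h1⟩ := hx
  rcases walkTable_four w hw with h2 | h2
  · refine Eq.trans ?_ ((h3 _).trans (h2 a b c))
    simp only [win, List.cons.injEq, and_true, Nat.zero_add, Nat.reduceAdd]
    congr 1
    ext u
    constructor <;> exact fun hu => ⟨hu.1, hu.2.2.2, hu.2.2.1, hu.2.1⟩
  · have h4 := h3.mem hy
    rw [← List.count_pos_iff] at h4
    simp only [win, Nat.zero_add, Nat.reduceAdd] at h4
    rw [h2, if_pos h1] at h4
    exact absurd h4 (lt_irrefl _)

theorem IsQueerDualEquivalence.not_free₄ (h : IsQueerDualEquivalence N Des ψ) (hN : 3 < N)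
    (hx : ¬Free₄ Des ψ x) (a b c : Bool) :
    {y ∈ restrictedClass ψ 3 x | bit Des 1 y = a ∧ bit Des 2 y = b ∧ bit Des 3 y = c}.ncard =
      if a = b ∧ b = c then 0 else if a = b ∨ b = c then 1 else 2 := by
  obtain ⟨w, hw, h3⟩ := h.hasBits (i := 3) (by omega) (by omega) hN x
  rcases walkTable_four w hw with h2 | h2
  · have h4 : [false, false, false] ∈ walkTable (3 + 1) (shape w) := by
      rw [← List.count_pos_iff, h2]; exact Nat.one_pos
    obtain ⟨y, hy, h5⟩ := h3.exists_of_mem h4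
    simp only [win, List.cons.injEq, and_true, Nat.zero_add, Nat.reduceAdd] at h5
    exact absurd ⟨y, hy, h5.2.2.trans h5.2.1.symm, h5.2.1.trans h5.1.symm⟩ hx
  · refine Eq.trans ?_ ((h3 _).trans (h2 a b c))
    simp only [win, List.cons.injEq, and_true, Nat.zero_add, Nat.reduceAdd]
    congr 1
    ext u
    constructor <;> exact fun hu => ⟨hu.1, hu.2.2.2, hu.2.2.1, hu.2.1⟩

end

end QueerDual

namespace QueerDual

variable {A : Type*} {ψ : ℕ → A → A} {x y z : A} {N k g : ℕ} {Des : A → Set ℕ} [Finite A]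

namespace IsQueerDualEquivalence

theorem exists₄ (h : IsQueerDualEquivalence N Des ψ) (hN : 3 < N) (hx : Free₄ Des ψ x) (a b c : Bool) :
    ∃ y ∈ restrictedClass ψ 3 x, bit Des 1 y = a ∧ bit Des 2 y = b ∧ bit Des 3 y = c := by
  have := h.free₄ hN hx a b c
  exact (Set.ncard_pos (Set.toFinite _)).1 (this.symm ▸ Nat.one_pos)

theorem inj₄ (h : IsQueerDualEquivalence N Des ψ) (hN : 3 < N) (hx : Free₄ Des ψ x)
    (hy : y ∈ restrictedClass ψ 3 x) (hz : z ∈ restrictedClass ψ 3 x) (h1 : bit Des 1 y = bit Des 1 z)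
    (h2 : bit Des 2 y = bit Des 2 z) (h3 : bit Des 3 y = bit Des 3 z) : y = z :=
  (Set.ncard_le_one (Set.toFinite _)).1 (h.free₄ hN hx (bit Des 1 z) (bit Des 2 z) (bit Des 3 z)).le
    y ⟨hy, h1, h2, h3⟩ z ⟨hz, rfl, rfl, rfl⟩

theorem free₃_of_free₄ (h : IsQueerDualEquivalence N Des ψ) (hN : 3 < N) (hx : Free₄ Des ψ x) :
    Free₃ Des ψ x := by
  by_contra h3
  obtain ⟨p, hp, p1, p2, p3⟩ := h.exists₄ hN hx true true true
  obtain ⟨q, hq, q1, q2, q3⟩ := h.exists₄ hN hx true true false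
  have fp : Free₃ Des ψ p := ⟨p, mem_restricted_self, p1.trans p2.symm⟩
  have fq : Free₃ Des ψ q := ⟨q, mem_restricted_self, q1.trans q2.symm⟩
  obtain ⟨p', hp', p1', p2'⟩ := h.free₃ (by omega) fp (bit Des 1 x) (bit Des 2 x)
  obtain ⟨q', hq', q1', q2'⟩ := h.free₃ (by omega) fq (bit Des 1 x) (bit Des 2 x)
  have hp4 : p' ∈ restrictedClass ψ 3 x := restricted_eq hp ▸ restricted_mono (by omega) hp'
  have hq4 : q' ∈ restrictedClass ψ 3 x := restricted_eq hq ▸ restricted_mono (by omega) hq'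
  have e1 : p' ≠ x := fun e => h3 (e ▸ (free₃_congr hp').2 fp)
  have e2 : q' ≠ x := fun e => h3 (e ▸ (free₃_congr hq').2 fq)
  have e3 : p' ≠ q' := by
    intro e
    have h4 : q ∈ restrictedClass ψ 2 p := by
      rw [← restricted_eq hp', e, restricted_eq hq']; exact mem_restricted_self
    have h5 := h.inj₃ (by omega) mem_restricted_self h4 (p1.trans q1.symm) (p2.trans q2.symm)
    rw [h5, q3] at p3
    exact absurd p3 (by decide)
  have f1 : bit Des 3 p' ≠ bit Des 3 x := fun e => e1 (h.inj₄ hN hx hp4 mem_restricted_self p1' p2' e)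
  have f2 : bit Des 3 q' ≠ bit Des 3 x := fun e => e2 (h.inj₄ hN hx hq4 mem_restricted_self q1' q2' e)
  exact e3 (h.inj₄ hN hx hp4 hq4 (p1'.trans q1'.symm) (p2'.trans q2'.symm)
    ((Bool.eq_not.2 f1).trans (Bool.eq_not.2 f2).symm))

theorem third_of_free₃ (h : IsQueerDualEquivalence N Des ψ) (hN : 3 < N) (hx : ¬Free₄ Des ψ x)
    (h3 : Free₃ Des ψ x) : bit Des 3 x = !bit Des 2 x := by
  by_contra hb
  have hb3 : bit Des 3 x = bit Des 2 x := by simpa using Bool.eq_not.2 hb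
  have hb2 : bit Des 2 x = !bit Des 1 x :=
    Bool.eq_not.2 (fun e => hx ⟨x, mem_restricted_self, e.symm, hb3.symm⟩)
  obtain ⟨a, ha⟩ : ∃ a, bit Des 1 x = a := ⟨_, rfl⟩
  rw [ha] at hb2
  rw [hb2] at hb3
  have hna : (!a) ≠ a := Bool.not_ne_self a
  obtain ⟨w, hw, w1, w2, w3⟩ : {y ∈ restrictedClass ψ 3 x |
      bit Des 1 y = !a ∧ bit Des 2 y = a ∧ bit Des 3 y = a}.Nonempty := by
    rw [← Set.ncard_pos, h.not_free₄ hN hx]; simp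
  have v12 := h.flip_two (x := w) (by omega) (by rw [w1, w2]; exact hna)
  have v3 := h.dual.keep_right (i := 0) hN w (w2.trans w3.symm)
  rw [w1, w2, Bool.not_not] at v12
  rw [zero_add, w3] at v3
  have hv : ψ 2 w ∈ restrictedClass ψ 3 x := apply_mem_restricted (by omega) (by omega) hw
  obtain ⟨v', ⟨hv', v1', v2', v3'⟩, hne⟩ : ∃ v' ∈ {y ∈ restrictedClass ψ 3 x |
      bit Des 1 y = a ∧ bit Des 2 y = !a ∧ bit Des 3 y = a}, v' ≠ ψ 2 w := by
    refine Set.exists_ne_of_one_lt_ncard ?_ _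
    rw [h.not_free₄ hN hx, if_neg (fun e => hna e.1.symm), if_neg (fun e => e.elim (fun e => hna e.symm) hna)]
    decide
  have hx' : v' ∉ restrictedClass ψ 2 x := by
    intro e
    have := h.inj₃ (by omega) e mem_restricted_self (v1'.trans ha.symm) (v2'.trans hb2.symm)
    rw [this, hb3] at v3'
    exact hna v3'
  have hf : ¬Free₃ Des ψ v' := by
    intro hf
    obtain ⟨p, hp, p1, p2⟩ := h.free₃ (by omega) hf a a
    obtain ⟨q, hq, q1, q2⟩ := h.free₃ (by omega) h3 a a
    have hp4 : p ∈ restrictedClass ψ 3 x := restricted_eq hv' ▸ restricted_mono (by omega) hp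
    have hq4 : q ∈ restrictedClass ψ 3 x := restricted_mono (by omega) hq
    have p3 : bit Des 3 p = !a := Bool.eq_not.2
      (fun e => hx ⟨p, hp4, p1.trans p2.symm, p2.trans e.symm⟩)
    have q3 : bit Des 3 q = !a := Bool.eq_not.2
      (fun e => hx ⟨q, hq4, q1.trans q2.symm, q2.trans e.symm⟩)
    have h5 := h.not_free₄ hN hx a a (!a)
    rw [if_neg (fun e => hna e.2.symm), if_pos (Or.inl rfl)] at h5
    have h6 := (Set.ncard_le_one (Set.toFinite _)).1 h5.le p ⟨hp4, p1, p2, p3⟩ q ⟨hq4, q1, q2, q3⟩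
    apply hx'
    rw [← restricted_eq hq, ← h6, restricted_eq hp]
    exact mem_restricted_self
  have u12 := h.flip_two (x := v') (by omega) (by rw [v1', v2']; exact hna.symm)
  rw [v1', v2', Bool.not_not] at u12
  have u3 : bit Des 3 (ψ 2 v') ≠ bit Des 3 v' := by
    intro e
    rw [v3'] at e
    have h5 := h.not_free₄ hN hx (!a) a a
    rw [if_neg (fun e => hna e.1), if_pos (Or.inr rfl)] at h5
    have h6 := (Set.ncard_le_one (Set.toFinite _)).1 h5.le (ψ 2 v')
      ⟨apply_mem_restricted (by omega) (by omega) hv', u12.1, u12.2, e⟩ w ⟨hw, w1, w2, w3⟩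
    rw [← h6, h.inv (by omega) (by omega)] at hne
    exact hne rfl
  have e3 : ψ 3 v' = ψ 2 v' := by
    rcases h.dual.alt (i := 0) hN v' (by rw [zero_add, v1', v2']; exact hna.symm)
      (by rw [zero_add, v2', v3']; exact hna) with h5 | h5
    · exact h5.2
    · exact absurd h5.1 u3
  have e0 := h.zero_eq_two (by omega) hf
  have hmem : x ∈ restrictedClass ψ 3 v' := by rw [restricted_eq hv']; exact mem_restricted_self
  have : x = v' ∨ x = ψ 2 v' := by
    refine h.restricted_induction (P := fun y => y = v' ∨ y = ψ 2 v') hN (Or.inl rfl) ?_ hmem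
    intro g hg hg1 y hy
    have hg2 : ψ g v' = ψ 2 v' := by
      obtain rfl | rfl | rfl : g = 0 ∨ g = 2 ∨ g = 3 := by omega
      · exact e0
      · rfl
      · exact e3
    rcases hy with rfl | rfl
    · exact Or.inr hg2
    · rw [← hg2]; exact Or.inl (h.inv hg1 (by omega) _)
  rcases this with rfl | e
  · rw [v3'] at hb3; exact hna hb3.symm
  · rw [e, u12.1] at ha; exact hna ha

theorem alternating_pair (h : IsQueerDualEquivalence N Des ψ) (hN : 3 < N) (hx : ¬Free₄ Des ψ x) (a : Bool) :
    ∃ w u, ¬Free₃ Des ψ (ψ 2 w) ∧ bit Des 3 w = a ∧ Free₃ Des ψ u ∧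
      {y ∈ restrictedClass ψ 3 x | bit Des 1 y = a ∧ bit Des 2 y = !a ∧ bit Des 3 y = a} = {ψ 2 w, u} := by
  have hna : (!a) ≠ a := Bool.not_ne_self a
  obtain ⟨w, hw, w1, w2, w3⟩ : {y ∈ restrictedClass ψ 3 x |
      bit Des 1 y = !a ∧ bit Des 2 y = a ∧ bit Des 3 y = a}.Nonempty := by
    rw [← Set.ncard_pos, h.not_free₄ hN hx]; simp
  have wf : ¬Free₃ Des ψ w := by
    intro hf
    have := h.third_of_free₃ hN (fun e => hx ((free₄_congr hw).1 e)) hf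
    rw [w2, w3] at this
    exact hna this.symm
  have v12 := h.flip_two (x := w) (by omega) (by rw [w1, w2]; exact hna)
  have v3 := h.dual.keep_right (i := 0) hN w (w2.trans w3.symm)
  rw [w1, w2, Bool.not_not] at v12
  rw [zero_add, w3] at v3
  have vf : ¬Free₃ Des ψ (ψ 2 w) := fun hf =>
    wf ((free₃_congr (apply_mem_restricted le_rfl (by omega) mem_restricted_self)).1 hf)
  have hv : ψ 2 w ∈ restrictedClass ψ 3 x := apply_mem_restricted (by omega) (by omega) hw
  obtain ⟨u, hu, u1, u2, u3⟩ : {y ∈ restrictedClass ψ 3 x |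
      bit Des 1 y = !a ∧ bit Des 2 y = !a ∧ bit Des 3 y = a}.Nonempty := by
    rw [← Set.ncard_pos, h.not_free₄ hN hx]; simp
  have uf : Free₃ Des ψ u := ⟨u, mem_restricted_self, u1.trans u2.symm⟩
  obtain ⟨u', hu', u1', u2'⟩ := h.free₃ (by omega) uf a (!a)
  have hu4 : u' ∈ restrictedClass ψ 3 x := restricted_eq hu ▸ restricted_mono (by omega) hu'
  have uf' := (free₃_congr hu').2 uf
  have u3' := h.third_of_free₃ hN (fun e => hx ((free₄_congr hu4).1 e)) uf'
  rw [u2', Bool.not_not] at u3'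
  refine ⟨w, u', vf, w3, uf', Eq.symm (Set.eq_of_subset_of_ncard_le ?_ ?_)⟩
  · rintro z (rfl | rfl)
    · exact ⟨hv, v12.1, v12.2, v3⟩
    · exact ⟨hu4, u1', u2', u3'⟩
  · rw [Set.ncard_pair (fun e => vf (by rw [e]; exact uf')), h.not_free₄ hN hx]
    split_ifs <;> omega

theorem third_of_not_free₃ (h : IsQueerDualEquivalence N Des ψ) (hN : 3 < N)
    (h3 : ¬Free₃ Des ψ x) : bit Des 3 (ψ 2 x) = bit Des 3 x := by
  have hx : ¬Free₄ Des ψ x := fun h4 => h3 (h.free₃_of_free₄ hN h4)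
  by_cases h23 : bit Des 2 x = bit Des 3 x
  · exact h.dual.keep_right (i := 0) hN x h23
  have x2 : bit Des 2 x = !bit Des 1 x := Bool.eq_not.2 (not_free₃ h3).symm
  have x3 : bit Des 3 x = bit Des 1 x := by
    rw [x2] at h23
    simpa using Bool.eq_not.2 (Ne.symm h23)
  obtain ⟨w, u, h1, h2, h4, h5⟩ := h.alternating_pair hN hx (bit Des 1 x)
  have m1 : x ∈ ({ψ 2 w, u} : Set A) := h5 ▸ ⟨mem_restricted_self, rfl, x2, x3⟩
  rcases m1 with m1 | m1
  · have : ψ 2 x = w := by rw [m1, h.inv (by omega) (by omega)]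
    rw [this, h2, x3]
  · exact absurd (m1 ▸ h4) h3

theorem third_two (h : IsQueerDualEquivalence N Des ψ) (hN : 3 < N)
    (hx : Free₄ Des ψ x ∨ ¬Free₃ Des ψ x) : bit Des 3 (ψ 2 x) = bit Des 3 x := by
  rcases hx with hx | hx
  · by_cases h12 : bit Des 1 x = bit Des 2 x
    · rw [h.dual.fix (i := 0) (by omega) x h12]
    by_cases h23 : bit Des 2 x = bit Des 3 x
    · exact h.dual.keep_right (i := 0) hN x h23
    obtain ⟨w, hw, w1, w2, w3⟩ := h.exists₄ hN hx (bit Des 2 x) (bit Des 1 x) (bit Des 1 x)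
    have v12 := h.flip_two (x := w) (by omega) (by rw [w1, w2]; exact Ne.symm h12)
    have v3 := h.dual.keep_right (i := 0) hN w (w2.trans w3.symm)
    rw [w1, w2] at v12
    rw [zero_add, w3] at v3
    have e1 := Bool.eq_not.2 h12
    have e2 := Bool.eq_not.2 h23
    have : ψ 2 w = x := h.inj₄ hN hx (apply_mem_restricted (by omega) (by omega) hw) mem_restricted_self
      (v12.1.trans e1.symm) (by rw [v12.2, e1, Bool.not_not]) (v3.trans (by rw [e1, e2, Bool.not_not]))
    rw [← this, h.inv (by omega) (by omega), this, w3, e1, e2, Bool.not_not]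
  · exact h.third_of_not_free₃ hN hx

theorem first_three (h : IsQueerDualEquivalence N Des ψ) (hN : 3 < N)
    (hx : Free₄ Des ψ x ∨ ¬Free₃ Des ψ x) (h23 : bit Des 2 x ≠ bit Des 3 x) :
    bit Des 1 (ψ 3 x) = bit Des 1 x := by
  by_cases h12 : bit Des 1 x = bit Des 2 x
  · exact h.dual.keep_left (i := 0) hN x h12
  · rcases h.dual.alt (i := 0) hN x h12 h23 with h1 | h1
    · exact absurd (h.third_two hN hx) h1.1
    · exact h1.2

theorem three_eq_two (h : IsQueerDualEquivalence N Des ψ) (hN : 3 < N) (h3 : Free₃ Des ψ x)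
    (hx : ¬Free₄ Des ψ x) (h12 : bit Des 1 x ≠ bit Des 2 x) : ψ 3 x = ψ 2 x := by
  have b3 := h.third_of_free₃ hN hx h3
  have b3' := h.third_of_free₃ (x := ψ 2 x) hN
    (fun e => hx ((free₄_congr (apply_mem_restricted (by omega) (by omega) mem_restricted_self)).1 e))
    ((free₃_congr (apply_mem_restricted (by omega) (by omega) mem_restricted_self)).2 h3)
  rw [(h.flip_two (by omega) h12).2, ← b3] at b3'
  rcases h.dual.alt (i := 0) hN x h12 (fun e => by
    simp only [zero_add] at e; rw [b3] at e; exact Bool.not_ne_self _ e.symm) with h1 | h1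
  · exact h1.2
  · have h2 := h1.1
    simp only [zero_add] at h2
    rw [b3'] at h2
    exact absurd h2 (Bool.not_ne_self _)

theorem descent_four_zero (h : IsQueerDualEquivalence N Des ψ) (hN : 4 < N)
    (hx : bit Des 3 x = bit Des 4 x) : bit Des 3 (ψ 0 x) = bit Des 4 (ψ 0 x) := by
  by_contra h1
  have h2 := (h.dual.flip (i := 2) hN _ h1).1
  rw [← h.comm_zero 4 (by omega) hN, h.dual.fix (i := 2) hN x hx] at h2
  exact Bool.not_ne_self _ h2.symm

theorem third_zero_congr (h : IsQueerDualEquivalence N Des ψ) (hN : 3 < N) (hx : Free₄ Des ψ x)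
    (hy : y ∈ restrictedClass ψ 3 x) (h2 : bit Des 2 y = bit Des 2 x)
    (hb : bit Des 3 (ψ 0 x) ≠ bit Des 3 x) : bit Des 3 (ψ 0 y) ≠ bit Des 3 y := by
  have key : ∀ y ∈ restrictedClass ψ 3 x, bit Des 2 y = bit Des 2 x → bit Des 1 y = bit Des 1 x →
      bit Des 3 (ψ 0 y) ≠ bit Des 3 y := by
    intro y hy h2 h1 h3
    have fy := (free₄_congr hy).2 hx
    by_cases hb3 : bit Des 3 y = bit Des 3 x
    · rw [h.inj₄ hN hx hy mem_restricted_self h1 h2 hb3] at h3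
      exact hb h3
    · have := h.inj₄ hN hx (y := ψ 0 y) (z := ψ 0 x) (apply_mem_restricted (by omega) (by omega) hy)
        (apply_mem_restricted (by omega) (by omega) mem_restricted_self)
        (by rw [h.flip_zero (by omega), h.flip_zero (by omega), h1])
        (by rw [h.keep_zero (by omega) (h.free₃_of_free₄ hN fy),
          h.keep_zero (by omega) (h.free₃_of_free₄ hN hx), h2])
        (h3.trans ((Bool.eq_not.2 hb3).trans (Bool.eq_not.2 hb).symm))
      have e := congrArg (ψ 0) this
      rw [h.involutive_zero, h.involutive_zero] at e
      exact hb3 (by rw [e])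
  by_cases h1 : bit Des 1 y = bit Des 1 x
  · exact key y hy h2 h1
  · have hy0 : ψ 0 y ∈ restrictedClass ψ 3 x := apply_mem_restricted (by omega) (by omega) hy
    have fy := (free₄_congr hy).2 hx
    have := key (ψ 0 y) hy0 (by rw [h.keep_zero (by omega) (h.free₃_of_free₄ hN fy), h2])
      (by rw [h.flip_zero (by omega), Bool.eq_not.2 h1, Bool.not_not])
    rw [h.involutive_zero] at this
    exact this.symm

theorem third_zero (h : IsQueerDualEquivalence N Des ψ) (hN : 4 < N) (hx : Free₄ Des ψ x) :
    bit Des 3 (ψ 0 x) = bit Des 3 x := by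
  by_contra hb
  have hN' : 3 < N := by omega
  obtain ⟨d, hd⟩ : ∃ d, bit Des 2 x = d := ⟨_, rfl⟩
  have hnd : (!d) ≠ d := Bool.not_ne_self d
  have hf : ∀ y ∈ restrictedClass ψ 3 x, Free₄ Des ψ y := fun y hy => (free₄_congr hy).2 hx
  have b1 : ∀ y, bit Des 1 (ψ 0 y) = !bit Des 1 y := h.flip_zero (by omega)
  have b2 : ∀ y ∈ restrictedClass ψ 3 x, bit Des 2 (ψ 0 y) = bit Des 2 y := fun y hy =>
    h.keep_zero (by omega) (h.free₃_of_free₄ hN' (hf y hy))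
  have b3 : ∀ y ∈ restrictedClass ψ 3 x, bit Des 2 y = d → bit Des 3 (ψ 0 y) = !bit Des 3 y :=
    fun y hy h2 => Bool.eq_not.2 (h.third_zero_congr hN' hx hy (h2.trans hd.symm) hb)
  have happ : ∀ g, g ≤ 3 → g ≠ 1 → ∀ y ∈ restrictedClass ψ 3 x, ψ g y ∈ restrictedClass ψ 3 x :=
    fun g h1 h2 y hy => apply_mem_restricted h1 h2 hy
  by_cases hk : ∀ y ∈ restrictedClass ψ 3 x, bit Des 2 y = !d → bit Des 3 (ψ 0 y) = bit Des 3 y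
  · obtain ⟨p, hp, p1, p2, p3⟩ := h.exists₄ hN' hx d (!d) d
    obtain ⟨q, hq, q1, q2, q3⟩ := h.exists₄ hN' hx (!d) d d
    obtain ⟨s, hs, s1, s2, s3⟩ := h.exists₄ hN' hx d d (!d)
    have e1 : ψ 2 q = p := by
      have v12 := h.flip_two (x := q) (by omega) (by rw [q1, q2]; exact hnd)
      rw [q1, q2, Bool.not_not] at v12
      exact h.inj₄ hN' hx (happ _ (by omega) (by omega) q hq) hp (v12.1.trans p1.symm)
        (v12.2.trans p2.symm) ((h.third_two hN' (Or.inl (hf q hq))).trans (q3.trans p3.symm))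
    have e2 : ψ 3 p = s := by
      have h23 : bit Des 2 p ≠ bit Des 3 p := by rw [p2, p3]; exact hnd
      have v23 := h.dual.flip (i := 1) hN' p h23
      simp only [Nat.reduceAdd] at v23
      rw [p2, p3, Bool.not_not] at v23
      exact h.inj₄ hN' hx (happ _ (by omega) (by omega) p hp) hs
        ((h.first_three hN' (Or.inl (hf p hp)) h23).trans (p1.trans s1.symm))
        (v23.1.trans s2.symm) (v23.2.trans s3.symm)
    have e3 : ψ 0 s = q := h.inj₄ hN' hx (happ _ (by omega) (by omega) s hs) hq
      ((b1 s).trans (by rw [s1, q1])) ((b2 s hs).trans (by rw [s2, q2]))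
      ((b3 s hs s2).trans (by rw [s3, q3, Bool.not_not]))
    have f1 : bit Des 4 p = bit Des 4 q := by
      rw [← e1]; exact (h.dual.conclusion (i := 0) hN q).1
    have f2 : bit Des 4 s = !bit Des 4 p := by
      refine Bool.eq_not.2 (fun e => ?_)
      by_cases h1 : bit Des 3 s = bit Des 4 s
      · have h2 := h.descent_four_zero hN h1
        rw [e3, q3, ← f1, ← e, ← h1, s3] at h2
        exact hnd h2.symm
      · have h2 : bit Des 3 q = bit Des 4 q := by
          rw [q3, ← f1, ← e]
          rw [s3] at h1
          simpa using (Bool.eq_not.2 (Ne.symm h1)).symm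
        have h4 := h.descent_four_zero hN h2
        rw [← e3, h.involutive_zero] at h4
        exact h1 h4
    have f3 : bit Des 4 p = !d := by
      refine Bool.eq_not.2 (fun e => ?_)
      have := h.dual.keep_right (i := 1) hN p (p3.trans e.symm)
      simp only [Nat.reduceAdd] at this
      rw [e2, f2] at this
      exact Bool.not_ne_self _ this
    have f4 : ψ 4 p = s := by
      rcases h.dual.alt (i := 1) hN p (by rw [p2]; exact fun e => hnd (e.trans p3))
        (fun e => hnd ((f3.symm.trans e.symm).trans p3)) with h1 | h1
      · exact h1.2.trans e2
      · have h2 := h1.1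
        simp only [Nat.reduceAdd] at h2
        rw [e2, f2] at h2
        exact absurd h2 (Bool.not_ne_self _)
    have f5 : ψ 4 (ψ 0 p) = q := by rw [← h.comm_zero 4 (by omega) hN, f4, e3]
    have r3 : bit Des 3 (ψ 0 p) = d := (hk p hp p2).trans p3
    have r4 : bit Des 3 (ψ 0 p) ≠ bit Des 4 (ψ 0 p) := by
      intro h1
      have h2 := h.descent_four_zero hN h1
      rw [h.involutive_zero, p3, f3] at h2
      exact hnd h2.symm
    have h5 := (h.dual.flip (i := 2) hN _ r4).1
    simp only [Nat.reduceAdd] at h5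
    rw [f5, q3, r3] at h5
    exact hnd h5.symm
  · push Not at hk
    obtain ⟨y, hy, y2, y3⟩ := hk
    have b3' : ∀ z ∈ restrictedClass ψ 3 x, bit Des 3 (ψ 0 z) = !bit Des 3 z := by
      intro z hz
      by_cases hz2 : bit Des 2 z = d
      · exact b3 z hz hz2
      · refine Bool.eq_not.2 (h.third_zero_congr hN' (hf y hy) ?_ ((Bool.eq_not.2 hz2).trans y2.symm) y3)
        rw [restricted_eq hy]
        exact hz
    obtain ⟨z, hz, z1, z2, z3⟩ := h.exists₄ hN' hx (bit Des 1 x) (bit Des 2 x) (!bit Des 3 x)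
    have hpar : z ∈ restrictedClass ψ 3 x ∧ xor (bit Des 1 z) (xor (bit Des 2 z) (bit Des 3 z)) =
        xor (bit Des 1 x) (xor (bit Des 2 x) (bit Des 3 x)) := by
      refine h.restricted_induction (P := fun z => z ∈ restrictedClass ψ 3 x ∧
        xor (bit Des 1 z) (xor (bit Des 2 z) (bit Des 3 z)) =
        xor (bit Des 1 x) (xor (bit Des 2 x) (bit Des 3 x))) hN' ⟨mem_restricted_self, rfl⟩ ?_ hz
      rintro g hg hg1 u ⟨hu, hu1⟩
      refine ⟨happ g hg hg1 u hu, hu1 ▸ ?_⟩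
      obtain rfl | rfl | rfl : g = 0 ∨ g = 2 ∨ g = 3 := by omega
      · rw [b1, b2 u hu, b3' u hu]
        simp
      · by_cases h12 : bit Des 1 u = bit Des 2 u
        · rw [h.dual.fix (i := 0) (by omega) u h12]
        · rw [(h.flip_two (by omega) h12).1, (h.flip_two (by omega) h12).2,
            h.third_two hN' (Or.inl (hf u hu))]
          simp
      · by_cases h23 : bit Des 2 u = bit Des 3 u
        · rw [h.dual.fix (i := 1) hN' u h23]
        · have v23 := h.dual.flip (i := 1) hN' u h23
          simp only [Nat.reduceAdd] at v23
          rw [v23.1, v23.2, h.first_three hN' (Or.inl (hf u hu)) h23]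
          simp
    have h9 := hpar.2
    rw [z1, z2, z3] at h9
    simp at h9

end IsQueerDualEquivalence

end QueerDual

namespace QueerDual

variable {A : Type*} {ψ : ℕ → A → A} {x y z : A} {N k g : ℕ} {Des : A → Set ℕ}

/-- The contents of the first four letters, determined by the types `p` and `q` of the classes of
degrees three and four and by the first three bits. -/
def code (p q a b c : Bool) : ℕ → ℤ
  | 2 => if a then 1 else -1
  | 3 => if p then (if b then 2 else -2) else 0
  | 4 => if p then (if q then (if c then 3 else -3) else 0) else (if c then 2 else -2)
  | _ => 0

/-- The relations between the types and the bits. -/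
def Compatible (p q a b c : Bool) : Prop :=
  (q = true → p = true) ∧ (p = false → b = !a) ∧ (p = true → q = false → c = !b)

instance (p q a b c : Bool) : Decidable (Compatible p q a b c) := by unfold Compatible; infer_instance

theorem code_walk (p q a b c : Bool) : IsWalk 4 (code p q a b c) := by
  have : ∀ p q a b c, ∀ k < 4, Addable (sh (code p q a b c) k) (code p q a b c (k + 1)) := by decide
  exact this p q a b c

theorem code_bit {p q a b c : Bool} (h : Compatible p q a b c) :
    (a = true ↔ code p q a b c 1 < code p q a b c 2) ∧
    (b = true ↔ code p q a b c 2 < code p q a b c 3) ∧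
    (c = true ↔ code p q a b c 3 < code p q a b c 4) := by
  revert p q a b c
  decide

theorem code_inj {p p' q a b c a' b' c' : Bool} (h : Compatible p q a b c) (h' : Compatible p' q a' b' c')
    (e : ∀ j, 1 ≤ j → j ≤ 4 → code p q a b c j = code p' q a' b' c' j) :
    p = p' ∧ a = a' ∧ b = b' ∧ c = c' := by
  have e2 := e 2 (by omega) (by omega)
  have e3 := e 3 (by omega) (by omega)
  have e4 := e 4 (by omega) (by omega)
  clear e
  revert p p' q a b c a' b' c'
  decide

theorem code_zero {p q a b c b' c' : Bool} (h : Compatible p q a b c) (h' : Compatible p q (!a) b' c')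
    (hb : p = true → b' = b) (hc : q = true ∨ p = false → c' = c) :
    ∀ j ≤ 4, code p q (!a) b' c' j = dd 0 (code p q a b c) j := by
  intro j hj
  rw [← Nat.lt_succ_iff] at hj
  revert j
  revert p q a b c b' c'
  decide

theorem code_two_fixed {p q a c : Bool} (h : Compatible p q a a c) : ∀ j ≤ 4, code p q a a c j = dd 2 (code p q a a c) j := by
  intro j hj
  rw [← Nat.lt_succ_iff] at hj
  revert j
  revert p q a c
  decide

theorem code_two {p q a b c c' : Bool} (hab : a ≠ b) (h : Compatible p q a b c) (h' : Compatible p q (!a) (!b) c')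
    (hc : q = true ∨ p = false → c' = c) :
    ∀ j ≤ 4, code p q (!a) (!b) c' j = dd 2 (code p q a b c) j := by
  intro j hj
  rw [← Nat.lt_succ_iff] at hj
  revert j
  revert p q a b c c'
  decide

theorem code_three_fixed {p q a b : Bool} (h : Compatible p q a b b) :
    ∀ j ≤ 4, code p q a b b j = dd 3 (code p q a b b) j := by
  intro j hj
  rw [← Nat.lt_succ_iff] at hj
  revert j
  revert p q a b
  decide

set_option synthInstance.maxSize 1000 in
set_option synthInstance.maxHeartbeats 200000 in
theorem code_three {p p' q a a' b c : Bool} (hbc : b ≠ c) (h : Compatible p q a b c)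
    (h' : Compatible p' q a' (!b) (!c)) (h1 : q = true ∨ p = false ∨ a = b → a' = a)
    (h2 : q = true ∨ p = false ∨ a ≠ b → p' = true) (h3 : p = true → q = false → a ≠ b → a' = !a)
    (h4 : p = true → q = false → a = b → p' = false) :
    ∀ j ≤ 4, code p' q a' (!b) (!c) j = dd 3 (code p q a b c) j := by
  intro j hj
  rw [← Nat.lt_succ_iff] at hj
  revert j
  revert p p' q a a' b c
  decide

open Classical in
/-- The contents of the first four letters. -/
noncomputable def contents (Des : A → Set ℕ) (ψ : ℕ → A → A) (x : A) : ℕ → ℤ :=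
  code (decide (Free₃ Des ψ x)) (decide (Free₄ Des ψ x)) (bit Des 1 x) (bit Des 2 x) (bit Des 3 x)

theorem mem_restricted_iff_reach (h : IsQueerDualEquivalence N Des ψ) (hk : 1 ≤ k) (hN : k < N) :
    y ∈ restrictedClass ψ k x ↔ Reach ψ (k + 1) x y := by
  refine ⟨fun hy => ?_, fun hy => ?_⟩
  · refine h.restricted_induction (P := fun y => Reach ψ (k + 1) x y) hN Relation.ReflTransGen.refl ?_ hy
    exact fun g hg hg1 y hy => hy.tail ⟨g, ⟨by omega, hg1, by omega⟩, rfl⟩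
  · induction hy with
    | refl => exact mem_restricted_self
    | tail _ h1 ih =>
      obtain ⟨i, hi, rfl⟩ := h1
      exact apply_mem_restricted (by have := hi.1; omega) hi.2.1 ih

variable [Finite A]

namespace IsQueerDualEquivalence

open Classical in
theorem compatible (h : IsQueerDualEquivalence N Des ψ) (hN : 3 < N) (x : A) :
    Compatible (decide (Free₃ Des ψ x)) (decide (Free₄ Des ψ x)) (bit Des 1 x) (bit Des 2 x) (bit Des 3 x) := by
  refine ⟨fun h1 => ?_, fun h1 => ?_, fun h1 h2 => ?_⟩
  · exact decide_eq_true (h.free₃_of_free₄ hN (of_decide_eq_true h1))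
  · exact Bool.eq_not.2 (not_free₃ (of_decide_eq_false h1)).symm
  · exact h.third_of_free₃ hN (of_decide_eq_false h2) (of_decide_eq_true h1)

theorem typed_four (h : IsQueerDualEquivalence N Des ψ) (hN : 4 < N) :
    Typed ψ (fun j x => bit Des j x = true) 4 4 (contents Des ψ) where
  le := le_rfl
  walk x := code_walk _ _ _ _ _
  bit x j h1 h2 := by
    have := code_bit (h.compatible (by omega) x)
    obtain rfl | rfl | rfl : j = 1 ∨ j = 2 ∨ j = 3 := by omega
    · exact this.1
    · exact this.2.1
    · exact this.2.2
  act x i hi := by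
    classical
    have hN' : 3 < N := by omega
    have hc := h.compatible hN' x
    have hc' := h.compatible hN' (ψ i x)
    have h4 : Free₄ Des ψ (ψ i x) ↔ Free₄ Des ψ x :=
      free₄_congr (apply_mem_restricted (by have := hi.1; omega) hi.2.1 mem_restricted_self)
    have hor : (decide (Free₄ Des ψ x) = true ∨ decide (Free₃ Des ψ x) = false) ↔
        (Free₄ Des ψ x ∨ ¬Free₃ Des ψ x) := by simp
    unfold contents
    rw [decide_eq_decide.2 h4] at hc' ⊢
    obtain rfl | rfl | rfl : i = 0 ∨ i = 2 ∨ i = 3 := by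
      have := hi.1; have := hi.2.1; omega
    · have h3 : Free₃ Des ψ (ψ 0 x) ↔ Free₃ Des ψ x :=
        free₃_congr (apply_mem_restricted (by omega) (by omega) mem_restricted_self)
      rw [decide_eq_decide.2 h3, h.flip_zero (by omega)] at hc' ⊢
      refine code_zero hc hc' (fun e => h.keep_zero (by omega) (of_decide_eq_true e)) (fun e => ?_)
      by_cases hf : Free₄ Des ψ x
      · exact h.third_zero hN hf
      · have hf3 := (hor.1 e).resolve_left hf
        rw [h.zero_eq_two (by omega) hf3]
        exact h.third_of_not_free₃ hN' hf3
    · have h3 : Free₃ Des ψ (ψ 2 x) ↔ Free₃ Des ψ x :=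
        free₃_congr (apply_mem_restricted (by omega) (by omega) mem_restricted_self)
      rw [decide_eq_decide.2 h3] at hc' ⊢
      by_cases h12 : bit Des 1 x = bit Des 2 x
      · rw [h.dual.fix (i := 0) (by omega) x h12]
        rw [h12] at hc ⊢
        exact code_two_fixed hc
      · have hf := h.flip_two (by omega) h12
        rw [hf.1, hf.2] at hc' ⊢
        exact code_two h12 hc hc' (fun e => h.third_two hN' (hor.1 e))
    · by_cases h23 : bit Des 2 x = bit Des 3 x
      · rw [h.dual.fix (i := 1) hN' x h23, ← h23]
        rw [← h23] at hc
        exact code_three_fixed hc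
      · have hf := h.dual.flip (i := 1) hN' x h23
        simp only [Nat.reduceAdd] at hf
        have hfr : ∀ y, bit Des 1 y = bit Des 2 y → Free₃ Des ψ y := fun y hy => ⟨y, mem_restricted_self, hy⟩
        have hne : ∀ {a b : Bool}, a = b → ¬(a = !b) := by decide
        rw [hf.1, hf.2] at hc' ⊢
        refine code_three h23 hc hc' ?_ ?_ ?_ ?_
        · intro e
          by_cases e1 : Free₄ Des ψ x ∨ ¬Free₃ Des ψ x
          · exact h.first_three hN' e1 h23
          · rw [← or_assoc, hor] at e
            exact h.dual.keep_left (i := 0) hN' x (e.resolve_left e1)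
        · intro e
          by_cases e4 : Free₄ Des ψ x
          · exact decide_eq_true (h.free₃_of_free₄ hN' (h4.2 e4))
          by_cases e3 : Free₃ Des ψ x
          · have e1 : bit Des 1 x ≠ bit Des 2 x := by
              rcases e with e | e | e
              · exact absurd (of_decide_eq_true e) e4
              · exact absurd e3 (of_decide_eq_false e)
              · exact e
            rw [h.three_eq_two hN' e3 e4 e1]
            exact decide_eq_true ((free₃_congr (apply_mem_restricted (by omega) (by omega) mem_restricted_self)).2 e3)
          · refine decide_eq_true (hfr _ ?_)
            rw [h.first_three hN' (Or.inr e3) h23, hf.1]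
            exact Bool.eq_not.2 (not_free₃ e3)
        · intro e1 e2 e3
          rw [h.three_eq_two hN' (of_decide_eq_true e1) (of_decide_eq_false e2) e3]
          exact (h.flip_two (by omega) e3).1
        · intro e1 e2 e3
          refine decide_eq_false (fun e => ?_)
          have g1 := h.dual.keep_left (i := 0) hN' x e3
          simp only [zero_add] at g1
          have g2 : bit Des 1 (ψ 3 x) ≠ bit Des 2 (ψ 3 x) := by
            rw [g1, hf.1, e3]; exact (Bool.not_ne_self _).symm
          have g3 := h.three_eq_two hN' e (fun e => of_decide_eq_false e2 (h4.1 e)) g2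
          have g4 := (h.flip_two (by omega) g2).1
          rw [← g3, h.inv (by omega) (by omega), g1] at g4
          exact Bool.not_ne_self _ g4.symm

theorem contents_inj (h : IsQueerDualEquivalence N Des ψ) (hN : 3 < N) (hr : Reach ψ 4 x y)
    (hS : ∀ j, 1 ≤ j → j ≤ 4 → contents Des ψ x j = contents Des ψ y j) : x = y := by
  classical
  have hy : y ∈ restrictedClass ψ 3 x := (mem_restricted_iff_reach h (by omega) hN).2 hr
  have h4 : Free₄ Des ψ y ↔ Free₄ Des ψ x := free₄_congr hy
  have hx := h.compatible hN x
  have hy' := h.compatible hN y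
  unfold contents at hS
  rw [decide_eq_decide.2 h4] at hy' hS
  obtain ⟨e3, e1, e2, e5⟩ := code_inj hx hy' hS
  by_cases hf : Free₄ Des ψ x
  · exact h.inj₄ hN hf mem_restricted_self hy e1 e2 e5
  have hn := h.not_free₄ hN hf (bit Des 1 x) (bit Des 2 x) (bit Des 3 x)
  split_ifs at hn with h1 h2
  · rw [Set.ncard_eq_zero] at hn
    exact absurd hn (Set.Nonempty.ne_empty ⟨x, mem_restricted_self, rfl, rfl, rfl⟩)
  · exact (Set.ncard_le_one (Set.toFinite _)).1 hn.le x ⟨mem_restricted_self, rfl, rfl, rfl⟩ y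
      ⟨hy, e1.symm, e2.symm, e5.symm⟩
  · push Not at h2
    have x2 := Bool.eq_not.2 h2.1.symm
    have x3 : bit Des 3 x = bit Des 1 x := by
      have := Bool.eq_not.2 h2.2.symm
      rw [this, x2, Bool.not_not]
    obtain ⟨w, u, g1, -, g2, g3⟩ := h.alternating_pair hN hf (bit Des 1 x)
    have m1 : x ∈ ({ψ 2 w, u} : Set A) := g3 ▸ ⟨mem_restricted_self, rfl, x2, x3⟩
    have m2 : y ∈ ({ψ 2 w, u} : Set A) := g3 ▸ ⟨hy, e1.symm, e2.symm.trans x2, e5.symm.trans x3⟩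
    rw [decide_eq_decide] at e3
    rcases m1 with rfl | rfl <;> rcases m2 with rfl | rfl
    · rfl
    · exact absurd (e3.2 g2) g1
    · exact absurd (e3.1 g2) g1
    · rfl

theorem loc (h : IsQueerDualEquivalence N Des ψ) : Loc N (fun j x => bit Des j x = true) ψ where
  inv i h1 hN x := h.inv h1 hN x
  comm i j h1 hij hj hN x := by
    rcases Nat.eq_zero_or_pos i with rfl | h0
    · exact (h.comm_zero j (by omega) hN x).symm
    · exact h.dual.comm i j (by omega) hij hN x
  fix i hN x hx := h.dual.fix hN x (Bool.eq_iff_iff.2 hx)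
  flip i hN x hx := by
    have := h.dual.flip hN x (fun e => hx (Bool.eq_iff_iff.1 e))
    rw [this.1, this.2]
    simp
  alt i hN x h1 h2 := by
    rw [← Bool.eq_iff_iff] at h1 h2
    rw [← Bool.eq_iff_iff, ← Bool.eq_iff_iff]
    exact h.dual.alt hN x h1 h2
  keep_right i hN x h1 := Bool.eq_iff_iff.1 (h.dual.keep_right hN x (Bool.eq_iff_iff.2 h1))
  keep_left i hN x h1 := Bool.eq_iff_iff.1 (h.dual.keep_left hN x (Bool.eq_iff_iff.2 h1))
  far_right i hN x := Bool.eq_iff_iff.1 (h.dual.conclusion hN x).1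
  far_left i hN x := Bool.eq_iff_iff.1 (h.dual.conclusion hN x).2.1
  pin i hN x h1 h2 h3 := by
    rw [← Bool.eq_iff_iff] at h1 h2 h3 ⊢
    exact ((h.dual.conclusion hN x).2.2 h1 h2 h3).1
  hook i hN x h1 h2 h3 h4 := by
    rw [← Bool.eq_iff_iff] at h1 h2 h3 h4
    exact ((h.dual.conclusion hN x).2.2 h1 h2 h3).2 h4
  rigid i hN x y hxy hl := h.dual.rigid hN x y hxy
    (fun l h1 j h2 h3 => Bool.eq_iff_iff.2 (hl l h1 j h2 h3))
  two_edge k hk hN x y hr := h.two_edge k hN x y ((mem_restricted_iff_reach h (by omega) hN).2 hr)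
  base hN := ⟨contents Des ψ, h.typed_four hN, fun _ => rfl,
    fun x y hr hS => h.contents_inj (by omega) hr hS⟩

end IsQueerDualEquivalence

end QueerDual

namespace QueerDual

/-! ### The symmetric diagram -/

namespace StrictPartition

variable {n : ℕ} {γ : StrictPartition n}

theorem above_zero (γ : StrictPartition n) : above γ.beads 0 = γ.parts.length := by
  rw [above, Finset.filter_true_of_mem, beads, List.toFinset_card_of_nodup γ.nodup]
  intro j hj
  exact γ.pos j (List.mem_toFinset.1 hj)

theorem lt_symRow {r x : ℕ} : x < γ.symRow r ↔ min r x < above γ.beads ((x : ℤ) - r).natAbs := by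
  have h0 := γ.above_zero
  have hle : ∀ t, above γ.beads t ≤ γ.parts.length := fun t => h0 ▸ above_anti (Nat.zero_le t)
  have hlt : ∀ t s, t < γ.parts.getD s 0 ↔ s < above γ.beads t := lt_getD_iff γ.strict
  unfold symRow
  rcases le_or_gt r x with hrx | hrx
  · rw [min_eq_left hrx, show ((x : ℤ) - r).natAbs = x - r by omega, ← hlt]
    split_ifs with hr
    · omega
    · have h1 := (hlt (x - r) r).1.mt (by have := hle (x - r); omega)
      have h2 := (Finset.card_filter_le (Finset.range γ.parts.length)
        (fun j => r < γ.parts.getD j 0 + j)).trans_eq (Finset.card_range _)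
      exact iff_of_false (by omega) h1
  · rw [min_eq_right hrx.le, show ((x : ℤ) - r).natAbs = r - x by omega]
    split_ifs with hr
    · have h1 := above_add_le (G := γ.beads) (Nat.zero_le (r - x))
      exact iff_of_true (by omega) (by omega)
    · have hp : ∀ j, j ≤ r → (r < γ.parts.getD j 0 + j ↔ j < above γ.beads (r - j)) := by
        intro j hj
        rw [← hlt]; omega
      constructor
      · intro h1
        by_contra h2
        refine absurd h1 (not_lt.2 ((Finset.card_le_card (fun j hj => ?_)).trans_eq (Finset.card_range x)))
        rw [Finset.mem_filter, Finset.mem_range] at hj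
        rw [Finset.mem_range]
        by_contra h3
        have h4 := (hp j (by omega)).1 hj.2
        have h5 := above_add_le (G := γ.beads) (by omega : r - j ≤ r - x)
        omega
      · intro h1
        have h2 : Finset.range (x + 1) ⊆ (Finset.range γ.parts.length).filter
            (fun j => r < γ.parts.getD j 0 + j) := by
          intro j hj
          rw [Finset.mem_range] at hj
          rw [Finset.mem_filter, Finset.mem_range]
          have h5 := above_add_le (G := γ.beads) (by omega : r - x ≤ r - j)
          have h6 := hle (r - x)
          exact ⟨by omega, (hp j (by omega)).2 (by omega)⟩
        have := Finset.card_le_card h2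
        rw [Finset.card_range] at this
        omega

/-- The cell of content `c` in the symmetric diagram. -/
def symNew (G : Finset ℕ) (c : ℤ) : ℕ × ℕ := if 0 < c then (newCell G c).swap else newCell G c

theorem isSymAddable_iff {r q : ℕ} : γ.IsSymAddable (r, q) ↔ ¬q < γ.symRow r ∧
    (q = 0 ∨ q - 1 < γ.symRow r) ∧ (r = 0 ∨ q < γ.symRow (r - 1)) := by
  unfold IsSymAddable
  simp only
  constructor
  · rintro ⟨h1, h2⟩
    refine ⟨by omega, by omega, ?_⟩
    rwa [h1]
  · rintro ⟨h1, h2, h3⟩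
    have h4 : q = γ.symRow r := by omega
    exact ⟨h4, h4 ▸ h3⟩

theorem isSymAddable_symNew {c : ℤ} (h : Addable γ.beads c) : γ.IsSymAddable (symNew γ.beads c) := by
  have h1 := above_succ (G := γ.beads) c.natAbs
  have h2 := above_succ (G := γ.beads) (c.natAbs - 1)
  rw [if_neg h.2] at h1
  obtain ⟨a, ha⟩ : ∃ a, above γ.beads c.natAbs = a := ⟨_, rfl⟩
  rw [ha] at h1
  have h3 : c ≠ 0 → above γ.beads (c.natAbs - 1) = a + 1 := by
    intro h0
    rw [h2, Nat.sub_add_cancel (by omega), if_pos (h.1.resolve_left h0), ha]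
  unfold symNew newCell
  rw [ha]
  split_ifs with h0
  · rw [Prod.swap_prod_mk, isSymAddable_iff, lt_symRow, lt_symRow, lt_symRow,
      show ((a : ℤ) - (a + c.natAbs : ℕ)).natAbs = c.natAbs by omega, ha]
    refine ⟨by omega, ?_, ?_⟩
    · rcases Nat.eq_zero_or_pos a with h4 | h4
      · exact Or.inl h4
      · rw [show ((a - 1 : ℕ) - (a + c.natAbs : ℕ) : ℤ).natAbs = c.natAbs + 1 by omega]
        omega
    · rw [show ((a : ℤ) - (a + c.natAbs - 1 : ℕ)).natAbs = c.natAbs - 1 by omega, h3 (by omega)]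
      omega
  · rw [isSymAddable_iff, lt_symRow, lt_symRow, lt_symRow,
      show ((a + c.natAbs : ℕ) - (a : ℤ)).natAbs = c.natAbs by omega, ha]
    refine ⟨by omega, ?_, ?_⟩
    · by_cases h4 : c = 0
      · rcases Nat.eq_zero_or_pos a with h5 | h5
        · omega
        · rw [show ((a + c.natAbs - 1 : ℕ) - (a : ℤ)).natAbs = c.natAbs + 1 by omega]
          omega
      · rw [show ((a + c.natAbs - 1 : ℕ) - (a : ℤ)).natAbs = c.natAbs - 1 by omega, h3 h4]
        omega
    · rcases Nat.eq_zero_or_pos a with h4 | h4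
      · exact Or.inl h4
      · rw [show ((a + c.natAbs : ℕ) - (a - 1 : ℕ) : ℤ).natAbs = c.natAbs + 1 by omega]
        omega

theorem exists_of_isSymAddable {x : ℕ × ℕ} (h : γ.IsSymAddable x) :
    ∃ c, Addable γ.beads c ∧ x = symNew γ.beads c := by
  obtain ⟨r, q⟩ := x
  rw [isSymAddable_iff, lt_symRow, lt_symRow, lt_symRow] at h
  obtain ⟨h1, h2, h3⟩ := h
  obtain ⟨c, hc⟩ : ∃ c : ℤ, c = (r : ℤ) - q := ⟨_, rfl⟩
  rw [show ((q : ℤ) - r).natAbs = c.natAbs by omega] at h1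
  have e1 := above_succ (G := γ.beads) c.natAbs
  have e2 := above_succ (G := γ.beads) (c.natAbs - 1)
  refine ⟨c, ?_⟩
  have key : above γ.beads (c.natAbs + 1) ≥ min r q := by
    rcases le_or_gt r q with h4 | h4
    · rcases Nat.eq_zero_or_pos r with h5 | h5
      · omega
      · have := h3.resolve_left (by omega)
        rw [show ((q : ℤ) - (r - 1 : ℕ)).natAbs = c.natAbs + 1 by omega] at this
        omega
    · rcases Nat.eq_zero_or_pos q with h5 | h5
      · omega
      · have := h2.resolve_left (by omega)
        rw [show (((q - 1 : ℕ) : ℤ) - r).natAbs = c.natAbs + 1 by omega] at this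
        omega
  have hn : c.natAbs + 1 ∉ γ.beads := fun h => by rw [if_pos h] at e1; omega
  have ha : above γ.beads c.natAbs = min r q := by rw [if_neg hn] at e1; omega
  refine ⟨⟨?_, hn⟩, ?_⟩
  · by_contra h0
    push Not at h0
    rw [Nat.sub_add_cancel (by omega), if_neg h0.2] at e2
    rcases le_or_gt r q with h4 | h4
    · have := h2.resolve_left (by omega)
      rw [show (((q - 1 : ℕ) : ℤ) - r).natAbs = c.natAbs - 1 by omega] at this
      omega
    · have := h3.resolve_left (by omega)
      rw [show ((q : ℤ) - (r - 1 : ℕ)).natAbs = c.natAbs - 1 by omega] at this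
      omega
  · unfold symNew newCell
    rw [ha]
    split_ifs with h5
    · exact Prod.ext (by simp only [Prod.swap_prod_mk]; omega) (by simp only [Prod.swap_prod_mk]; omega)
    · exact Prod.ext (by simp only; omega) (by simp only; omega)

theorem fst_symNew (G : Finset ℕ) (c : ℤ) : ((symNew G c).1 : ℤ) = symHeight G c := by
  unfold symNew symHeight newCell
  split_ifs <;> simp only [Prod.fst_swap] <;> omega

theorem symNew_min_max (G : Finset ℕ) (c : ℤ) :
    (min (symNew G c).1 (symNew G c).2, max (symNew G c).1 (symNew G c).2) = newCell G c := by
  unfold symNew newCell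
  split_ifs <;> simp only [Prod.fst_swap, Prod.snd_swap] <;> exact Prod.ext (by simp) (by simp)

theorem symNew_lt (G : Finset ℕ) (c : ℤ) : (symNew G c).2 < (symNew G c).1 ↔ 0 < c := by
  unfold symNew newCell
  split_ifs with h <;> simp only [Prod.fst_swap, Prod.snd_swap] <;> omega

theorem symCell_lt_symNew {S : SignedFilling} (h : IsSST γ S) {c : ℤ} (hc : Addable γ.beads c) :
    (S.symCell n).1 < (symNew γ.beads c).1 ↔ S.diag n < c := by
  rw [← Nat.cast_lt (α := ℤ), fst_symNew]
  have e : (S.symCell n).1 = S.hookPass n := by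
    unfold SignedFilling.symCell SignedFilling.hookPass
    split_ifs <;> rfl
  rw [e]
  obtain ⟨w1, w2, -⟩ := h.walk
  cases n with
  | zero =>
    have h1 : S.hookPass 0 = 0 := by
      unfold SignedFilling.hookPass
      rw [h.mark_default 0 (by simp), h.pos_default 0 (by simp)]
      rfl
    have h2 : γ.beads = ∅ := by rw [← w2]; rfl
    have h3 : c = 0 := hc.1.resolve_right (by rw [h2]; simp)
    rw [h1, h.diag_of_notMem (by simp), h3, h2]
    simp [symHeight, above]
  | succ k =>
    have hA := w1 k (by omega)
    have hne : c.natAbs ≠ (S.diag (k + 1)).natAbs := by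
      rw [← w2] at hc
      exact Addable.natAbs_ne (G := sh S.diag k) (c := S.diag (k + 1)) (d := c) hc |> fun h => by omega
    rw [h.hookPass_eq (by omega), ← w2, sh, IsSST.symHeight_mv hA hne]
    rcases lt_trichotomy (S.diag (k + 1)) c with h3 | h3 | h3
    · exact iff_of_true (symHeight_lt hA h3) h3
    · exact absurd (congrArg Int.natAbs h3.symm) hne
    · exact iff_of_false (not_lt.2 (symHeight_mono h3.le)) (not_lt.2 h3.le)

end StrictPartition

theorem natAbs_eq_of_mv {G : Finset ℕ} {c d : ℤ} (hc : Addable G c) (h : mv G c = mv G d) :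
    c.natAbs = d.natAbs := by
  have h1 : c.natAbs + 1 ∈ mv G d := h ▸ mem_mv.2 (Or.inl rfl)
  rcases mem_mv.1 h1 with h2 | h2
  · omega
  · exact absurd h2.2 hc.2

end QueerDual

namespace QueerDual

theorem IsWalk.sh_one {m : ℕ} {s : ℕ → ℤ} (h : IsWalk m s) (hm : 1 ≤ m) : sh s 1 = {1} := by
  rw [show sh s 1 = mv ∅ (s 1) from rfl, h.one hm]; rfl

theorem IsWalk.two {m : ℕ} {s : ℕ → ℤ} (h : IsWalk m s) (hm : 2 ≤ m) :
    (s 2 = 1 ∨ s 2 = -1) ∧ sh s 2 = {2} := by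
  have h1 := h 1 (by omega)
  rw [h.sh_one (by omega)] at h1
  simp only [Addable, Finset.mem_singleton, Nat.reduceAdd] at h1
  have h2 : (s 2).natAbs = 1 := by omega
  refine ⟨by omega, ?_⟩
  rw [show sh s 2 = mv (sh s 1) (s 2) from rfl, h.sh_one (by omega), mv, h2]
  decide

theorem IsWalk.three {m : ℕ} {s : ℕ → ℤ} (h : IsWalk m s) (hm : 3 ≤ m) :
    ((s 3).natAbs = 2 ∧ sh s 3 = {3}) ∨ (s 3 = 0 ∧ sh s 3 = {1, 2}) := by
  have h1 := h 2 (by omega)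
  rw [(h.two (by omega)).2] at h1
  simp only [Addable, Finset.mem_singleton, Nat.reduceAdd] at h1
  rw [show sh s 3 = mv (sh s 2) (s 3) from rfl, (h.two (by omega)).2, mv]
  rcases h1.1 with h2 | h2
  · rw [h2]; exact Or.inr ⟨rfl, by decide⟩
  · rw [h2]; exact Or.inl ⟨rfl, by decide⟩

section

variable {A : Type*} {n : ℕ} {Des : A → Set ℕ} {ψ : ℕ → A → A} {γ : StrictPartition n}
  {f : A → SST γ} {T : A}

/-- A map to tableaux that intertwines the involutions is a typing of the class. -/
theorem exists_typed_of_map (hn : 2 ≤ n)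
    (hfd : ∀ U ∈ restrictedClass ψ (n - 1) T, ∀ i, i ≤ n - 1 → i ≠ 1 →
      (f (ψ i U)).1 = (f U).1.d n i) :
    ∃ ψ' : ℕ → restrictedClass ψ (n - 1) T → restrictedClass ψ (n - 1) T,
      (∀ i y, IsGen n i → (ψ' i y).1 = ψ i y.1) ∧
      Typed ψ' (fun j y => (f y.1).1.diag j < (f y.1).1.diag (j + 1)) n n (fun y => (f y.1).1.diag) := by
  classical
  have hcl : ∀ i, IsGen n i → ∀ y ∈ restrictedClass ψ (n - 1) T, ψ i y ∈ restrictedClass ψ (n - 1) T :=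
    fun i hi y hy => apply_mem_restricted (by have := hi.1; omega) hi.2.1 hy
  refine ⟨fun i y => if hi : IsGen n i then ⟨ψ i y.1, hcl i hi y.1 y.2⟩ else y,
    fun i y hi => by simp only [dif_pos hi], ⟨le_rfl, fun y => (f y.1).2.walk.1, fun y j _ _ => Iff.rfl, ?_⟩⟩
  intro y i hi j _
  simp only [dif_pos hi]
  have h1 := hi.1
  rw [hfd y.1 y.2 i (by omega) hi.2.1, SignedFilling.diag_d _ hn h1 hi.2.1]

theorem mem_des_iff (hfDes : ∀ U ∈ restrictedClass ψ (n - 1) T,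
      (f U).1.des n ∩ Set.Icc 1 (n - 1) = Des U ∩ Set.Icc 1 (n - 1))
    {U : A} (hU : U ∈ restrictedClass ψ (n - 1) T) {j : ℕ} (h1 : 1 ≤ j) (hj : j < n) :
    j ∈ Des U ↔ (f U).1.diag j < (f U).1.diag (j + 1) := by
  have h2 := Set.ext_iff.1 (hfDes U hU) j
  simp only [Set.mem_inter_iff, Set.mem_Icc, (f U).2.mem_des] at h2
  constructor
  · exact fun h => (h2.2 ⟨h, by omega, by omega⟩).1.2.2
  · exact fun h => (h2.1 ⟨⟨h1, hj, h⟩, by omega, by omega⟩).1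

/-- Every removable content is the content of the last letter of some element. -/
theorem exists_last
    (hfd : ∀ U ∈ restrictedClass ψ (n - 1) T, ∀ i, i ≤ n - 1 → i ≠ 1 →
      (f (ψ i U)).1 = (f U).1.d n i) {a : ℤ} (ha : Removable γ.beads a) :
    1 ≤ n ∧ ∃ U ∈ restrictedClass ψ (n - 1) T, (f U).1.diag n = a := by
  have hT : T ∈ restrictedClass ψ (n - 1) T := mem_restricted_self
  have hw := (f T).2.walk
  obtain rfl | rfl | hn : n = 0 ∨ n = 1 ∨ 2 ≤ n := by omega
  · rw [← hw.2.1] at ha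
    exact absurd ha.1 (Finset.notMem_empty _)
  · refine ⟨le_rfl, T, hT, ?_⟩
    have h1 := hw.1.one le_rfl
    have h2 := ha.1
    rw [← hw.2.1, mem_sh_succ] at h2
    simp only [Nat.zero_add, sh, Finset.notMem_empty, and_false, or_false] at h2
    omega
  · obtain ⟨ψ', h1, h2⟩ := exists_typed_of_map hn hfd
    obtain ⟨y, -, hy⟩ := h2.exists_letter le_rfl ⟨T, hT⟩ (w := a) (by rw [hw.2.1]; exact ha)
    exact ⟨by omega, y.1, y.2, hy⟩

theorem cut_unique
    (hfd : ∀ U ∈ restrictedClass ψ (n - 1) T, ∀ i, i ≤ n - 1 → i ≠ 1 →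
      (f (ψ i U)).1 = (f U).1.d n i) {c d : ℤ} (hc : Addable γ.beads c) (hd : Addable γ.beads d)
    (h1 : 1 ≤ n → ∀ U ∈ restrictedClass ψ (n - 1) T, n ∈ Des U ↔ (f U).1.diag n < c)
    (h2 : 1 ≤ n → ∀ U ∈ restrictedClass ψ (n - 1) T, n ∈ Des U ↔ (f U).1.diag n < d) : c = d := by
  refine addable_cut_unique γ.zero_notMem_beads (P := fun a => a < c) hc hd (fun a _ => Iff.rfl) ?_
  intro a ha
  obtain ⟨hn, U, hU, rfl⟩ := exists_last hfd ha
  rw [← h1 hn U hU, h2 hn U hU]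

/-- The content of the new letter under an embedding that appends a letter. -/
theorem IsAppendEmbedding.exists_content {δ : StrictPartition (n + 1)} {ε : Bool} {e : SST γ → SST δ}
    (h : IsAppendEmbedding γ δ ε e) (S : SST γ) : Addable γ.beads ((e S).1.diag (n + 1)) ∧
      δ.beads = mv γ.beads ((e S).1.diag (n + 1)) ∧ ε = decide (0 < (e S).1.diag (n + 1)) ∧
      ∀ a ∈ Set.Icc 1 n, (e S).1.diag a = S.1.diag a := by
  have hd : ∀ a ∈ Set.Icc 1 n, (e S).1.diag a = S.1.diag a := by
    intro a ha
    unfold SignedFilling.diag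
    rw [h.pos_eq S a ha, h.mark_eq S a ha]
  obtain ⟨w1, w2, -⟩ := (e S).2.walk
  have h1 : sh (e S).1.diag n = γ.beads := by
    rw [← S.2.walk.2.1]
    exact sh_congr (fun j h1 h2 => hd j ⟨h1, h2⟩)
  refine ⟨h1 ▸ w1 n (by omega), by rw [← w2, ← h1]; rfl, ?_, hd⟩
  rw [← h.mark_new S, Bool.eq_iff_iff, (e S).2.mark_iff, decide_eq_true_iff]

variable [Finite A]

open Classical in
/-- The bit `n` compares the last content with an addable content. -/
theorem IsQueerDualEquivalence.exists_cut (hψ : IsQueerDualEquivalence (n + 1) Des ψ) (hγ : γ.parts ≠ [3])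
    (hf : Set.BijOn f (restrictedClass ψ (n - 1) T) Set.univ)
    (hfd : ∀ U ∈ restrictedClass ψ (n - 1) T, ∀ i, i ≤ n - 1 → i ≠ 1 →
      (f (ψ i U)).1 = (f U).1.d n i)
    (hfDes : ∀ U ∈ restrictedClass ψ (n - 1) T,
      (f U).1.des n ∩ Set.Icc 1 (n - 1) = Des U ∩ Set.Icc 1 (n - 1)) :
    ∃ c, Addable γ.beads c ∧ ∀ U ∈ restrictedClass ψ (n - 1) T, n ∈ Des U ↔ (f U).1.diag n < c := by
  have hbit : ∀ j U, bit Des j U = true ↔ j ∈ Des U := fun j U => decide_eq_true_iff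
  have hT : T ∈ restrictedClass ψ (n - 1) T := mem_restricted_self
  obtain rfl | rfl | rfl | rfl | hn : n = 0 ∨ n = 1 ∨ n = 2 ∨ n = 3 ∨ 4 ≤ n := by omega
  · have h1 : γ.beads = ∅ := by rw [← (f T).2.walk.2.1]; rfl
    refine ⟨0, by rw [h1]; decide, fun U _ => iff_of_false (fun h => ?_) ?_⟩
    · have := (hψ.dual.des_subset U h).1
      omega
    · rw [(f U).2.diag_of_notMem (by simp)]; omega
  · have h1 := hfd T hT 0 (by omega) (by omega)
    have h2 : (f T).1.d 1 0 = (f T).1 := by simp [SignedFilling.d]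
    have h3 := hf.injOn (apply_mem_restricted (by omega) (by omega) hT) hT (Subtype.ext (h1.trans h2))
    have h4 := hψ.flip_zero (by omega) T
    rw [h3] at h4
    exact absurd h4.symm (Bool.not_ne_self _)
  · have hb : γ.beads = {2} := by rw [← (f T).2.walk.2.1]; exact ((f T).2.walk.1.two le_rfl).2
    have hU : ∀ U ∈ restrictedClass ψ (2 - 1) T, ((f U).1.diag 2 = 1 ∨ (f U).1.diag 2 = -1) ∧
        (1 ∈ Des U ↔ (f U).1.diag 2 = 1) := by
      intro U hU
      have w := (f U).2.walk.1
      have h2 := (w.two le_rfl).1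
      rw [mem_des_iff hfDes hU le_rfl (by omega), w.one (by omega)]
      simp only [Nat.reduceAdd]
      omega
    by_cases hF : Free₃ Des ψ T
    · have hc : ∀ U ∈ restrictedClass ψ (2 - 1) T, U ∈ restrictedClass ψ 2 T ∧ bit Des 2 U = bit Des 2 T := by
        intro U hU
        refine hψ.restricted_induction (P := fun U => U ∈ restrictedClass ψ 2 T ∧ bit Des 2 U = bit Des 2 T)
          (by omega) ⟨mem_restricted_self, rfl⟩ ?_ hU
        rintro g hg hg1 U ⟨h1, h2⟩
        obtain rfl : g = 0 := by omega
        exact ⟨apply_mem_restricted (by omega) (by omega) h1,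
          (hψ.keep_zero (by omega) ((free₃_congr h1).2 hF)).trans h2⟩
      by_cases h2 : 2 ∈ Des T
      · refine ⟨2, by rw [hb]; decide, fun U h3 => iff_of_true ?_ ?_⟩
        · rw [← hbit, (hc U h3).2, hbit]; exact h2
        · have := (hU U h3).1; omega
      · refine ⟨-2, by rw [hb]; decide, fun U h3 => iff_of_false ?_ ?_⟩
        · rw [← hbit, (hc U h3).2, hbit]; exact h2
        · have := (hU U h3).1; omega
    · refine ⟨0, by rw [hb]; decide, fun U h3 => ?_⟩
      have h4 := not_free₃ (fun h => hF ((free₃_congr (restricted_mono (by omega) h3)).1 h))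
      rw [Ne, Bool.eq_iff_iff, hbit, hbit] at h4
      have h5 := hU U h3
      constructor
      · intro h6
        have : ¬(f U).1.diag 2 = 1 := fun h7 => h4 ⟨fun _ => h6, fun _ => h5.2.2 h7⟩
        omega
      · intro h6
        by_contra h7
        exact h4 ⟨fun h8 => absurd (h5.2.1 h8) (by omega), fun h8 => absurd h8 h7⟩
  · have hU : ∀ U, ((f U).1.diag 2 = 1 ∨ (f U).1.diag 2 = -1) ∧ (f U).1.diag 3 = 0 := by
      intro U
      have w := (f U).2.walk
      refine ⟨(w.1.two (by omega)).1, ?_⟩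
      rcases w.1.three le_rfl with h1 | h1
      · obtain ⟨δ, hδ⟩ : ∃ δ : StrictPartition 3, δ.parts = [3] := ⟨⟨[3], by simp, by simp, by simp⟩, rfl⟩
        have h9 : γ = δ := StrictPartition.ext_beads
          (by rw [← w.2.1, h1.2, StrictPartition.beads, hδ]; rfl)
        exact absurd (h9 ▸ hδ) hγ
      · exact h1.1
    have hb : γ.beads = {1, 2} := by
      rw [← (f T).2.walk.2.1]
      rcases (f T).2.walk.1.three le_rfl with h1 | h1
      · have := (hU T).2; omega
      · exact h1.2
    have hF : ∀ U ∈ restrictedClass ψ 2 T, bit Des 1 U ≠ bit Des 2 U := by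
      intro U h3
      rw [Ne, Bool.eq_iff_iff, hbit, hbit, mem_des_iff hfDes h3 le_rfl (by omega),
        mem_des_iff hfDes h3 (by omega) (by omega)]
      have h1 := (f U).2.walk.1.one (by omega)
      have := hU U
      simp only [Nat.reduceAdd]
      omega
    have hF' : ¬Free₃ Des ψ T := by
      rintro ⟨U, h1, h2⟩
      exact hF U h1 h2
    have hc : ∀ U ∈ restrictedClass ψ 2 T, U ∈ restrictedClass ψ 2 T ∧ bit Des 3 U = bit Des 3 T := by
      intro U hU
      refine hψ.restricted_induction (P := fun U => U ∈ restrictedClass ψ 2 T ∧ bit Des 3 U = bit Des 3 T)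
        (by omega) ⟨mem_restricted_self, rfl⟩ ?_ hU
      rintro g hg hg1 U ⟨h1, h2⟩
      refine ⟨apply_mem_restricted hg hg1 h1, Eq.trans ?_ h2⟩
      have h3 : ¬Free₃ Des ψ U := fun h => hF' ((free₃_congr h1).1 h)
      obtain rfl | rfl : g = 0 ∨ g = 2 := by omega
      · rw [hψ.zero_eq_two (by omega) h3]
        exact hψ.third_of_not_free₃ (by omega) h3
      · exact hψ.third_of_not_free₃ (by omega) h3
    by_cases h2 : 3 ∈ Des T
    · refine ⟨2, by rw [hb]; decide, fun U h3 => iff_of_true ?_ ?_⟩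
      · rw [← hbit, (hc U h3).2, hbit]; exact h2
      · rw [(hU U).2]; omega
    · refine ⟨-2, by rw [hb]; decide, fun U h3 => iff_of_false ?_ ?_⟩
      · rw [← hbit, (hc U h3).2, hbit]; exact h2
      · rw [(hU U).2]; omega
  · obtain ⟨S, hS, -, hsep⟩ := hψ.loc.exists_typed (m := n) (by omega) hn (by omega)
    obtain ⟨ψ', h1, h2⟩ := exists_typed_of_map (by omega : 2 ≤ n) hfd
    have h3 : ∀ U (hU : U ∈ restrictedClass ψ (n - 1) T), ∀ j, 1 ≤ j → j ≤ n → S U j = (f U).1.diag j := by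
      intro U hU j hj1 hj2
      refine hS.letters_unique h2 le_rfl le_rfl (R := fun a b => a = b.1) ?_ ?_
        (a := U) (b := ⟨U, hU⟩) rfl hj1 hj2
      · rintro a b i rfl hi
        exact (h1 i b hi).symm
      · rintro a b i rfl hi1 hi2
        rw [hbit, mem_des_iff hfDes b.2 hi1 hi2]
    obtain ⟨c, hc, hcut, -⟩ := hψ.loc.exists_next hS hsep hn (by omega) T
    rw [sh_congr (h3 T hT), (f T).2.walk.2.1] at hc
    refine ⟨c, hc, fun U hU => ?_⟩
    have h4 : Reach ψ (n - 1 + 1) T U := (mem_restricted_iff_reach hψ (by omega) (by omega)).1 hU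
    rw [Nat.sub_add_cancel (by omega)] at h4
    rw [← hbit, hcut U h4, h3 U hU n (by omega) le_rfl]

end

end QueerDual

theorem mainTheorem11 {A : Type*} [Finite A] (n : ℕ) (Des : A → Set ℕ) (ψ : ℕ → A → A)
    (hψ : IsQueerDualEquivalence (n + 1) Des ψ)
    (T : A) (γ : StrictPartition n) (hγ : γ.parts ≠ [3])
    (f : A → SST γ)
    (hf : Set.BijOn f (restrictedClass ψ (n - 1) T) Set.univ)
    (hfd : ∀ U ∈ restrictedClass ψ (n - 1) T, ∀ i, i ≤ n - 1 → i ≠ 1 →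
      (f (ψ i U)).1 = (f U).1.d n i)
    (hfDes : ∀ U ∈ restrictedClass ψ (n - 1) T,
      (f U).1.des n ∩ Set.Icc 1 (n - 1) = Des U ∩ Set.Icc 1 (n - 1)) :
    ∃ (δ : StrictPartition (n + 1)) (ε : Bool) (c : ℕ × ℕ),
      -- the embedding of `SST(γ)` into `SST(δ)` with mark `ε` makes `f` descent-preserving
      IsDescentExtension Des (restrictedClass ψ (n - 1) T) γ f δ ε ∧
      -- `δ` is unique, and so is the mark
      (∀ (δ' : StrictPartition (n + 1)) (ε' : Bool),
        IsDescentExtension Des (restrictedClass ψ (n - 1) T) γ f δ' ε' → δ' = δ ∧ ε' = ε) ∧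
      -- `c` is the only addable cell of `sym(γ)` that separates the descent pattern at `n`
      (γ.IsSymAddable c ∧
        ∀ U ∈ restrictedClass ψ (n - 1) T, n ∈ Des U ↔ ((f U).1.symCell n).1 < c.1) ∧
      (∀ c' : ℕ × ℕ, γ.IsSymAddable c' →
        (∀ U ∈ restrictedClass ψ (n - 1) T, n ∈ Des U ↔ ((f U).1.symCell n).1 < c'.1) →
        c' = c) ∧
      -- and `c` determines `δ` and the mark
      δ.shiftedCells = insert (min c.1 c.2, max c.1 c.2) γ.shiftedCells ∧
      (ε = true ↔ c.2 < c.1) := by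
  classical
  have hT : T ∈ restrictedClass ψ (n - 1) T := mem_restricted_self
  obtain ⟨c, hc, hcut⟩ := hψ.exists_cut hγ hf hfd hfDes
  obtain ⟨δ, hδ⟩ := StrictPartition.exists_of_finset (n := n + 1) (zero_notMem_mv γ.zero_notMem_beads)
    ((sum_mv hc).trans (by rw [γ.sum_beads]))
  have hcells := (shiftedCells_mv hc hδ).1
  have hε : c = 0 → decide (0 < c) = false := by rintro rfl; rfl
  refine ⟨δ, decide (0 < c), StrictPartition.symNew γ.beads c, ⟨?_, fun S => ⟨_, S.2.place_succ hc hδ hε⟩,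
    ⟨fun S a ha => ?_, fun S a ha => ?_, fun S => ?_⟩, fun U hU => ?_⟩, ?_,
    ⟨StrictPartition.isSymAddable_symNew hc, fun U hU => ?_⟩, ?_, ?_, ?_⟩
  · rw [hcells]; exact Set.subset_insert _ _
  · exact Function.update_of_ne (by have := ha.2; omega) _ _
  · exact Function.update_of_ne (by have := ha.2; omega) _ _
  · exact Function.update_self _ _ _
  · ext i
    rw [((f U).2.place_succ hc hδ hε).mem_des]
    rcases Nat.lt_trichotomy i n with hi | rfl | hi
    · rw [SignedFilling.diag_place_ne _ (by omega), SignedFilling.diag_place_ne _ (by omega)]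
      constructor
      · exact fun h => (mem_des_iff hfDes hU h.1 hi).2 h.2.2
      · intro h
        have h1 := (hψ.dual.des_subset U h).1
        exact ⟨h1, by omega, (mem_des_iff hfDes hU h1 hi).1 h⟩
    · rw [SignedFilling.diag_place_ne _ (by omega), SignedFilling.diag_place_self,
        IsSST.diag_newCell, ← hcut U hU]
      exact ⟨fun h => h.2.2, fun h => ⟨(hψ.dual.des_subset U h).1, by omega, h⟩⟩
    · refine iff_of_false (by omega) (fun h => ?_)
      have := (hψ.dual.des_subset U h).2
      omega
  · rintro δ' ε' ⟨-, e, he, hdes⟩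
    obtain ⟨h1, h2, h3, -⟩ := he.exists_content (f T)
    have key : ∀ U, (e (f U)).1.diag (n + 1) = (e (f T)).1.diag (n + 1) := by
      intro U
      obtain ⟨g1, g2, g3, -⟩ := he.exists_content (f U)
      have h4 := natAbs_eq_of_mv h1 (h2.symm.trans g2)
      have h5 := h3.symm.trans g3
      rw [decide_eq_decide] at h5
      omega
    have h4 : (e (f T)).1.diag (n + 1) = c := by
      refine cut_unique hfd h1 hc (fun hn U hU => ?_) (fun _ => hcut)
      rw [← hdes U hU, (e (f U)).2.mem_des, key U, (he.exists_content (f U)).2.2.2 n ⟨hn, le_rfl⟩]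
      exact ⟨fun h => h.2.2, fun h => ⟨hn, by omega, h⟩⟩
    rw [h4] at h2 h3
    exact ⟨StrictPartition.ext_beads (h2.trans hδ.symm), h3⟩
  · rw [StrictPartition.symCell_lt_symNew (f U).2 hc, hcut U hU]
  · intro c' hc' h
    obtain ⟨d, hd, rfl⟩ := StrictPartition.exists_of_isSymAddable hc'
    rw [cut_unique hfd hd hc (fun _ U hU => ?_) (fun _ => hcut)]
    rw [h U hU, StrictPartition.symCell_lt_symNew (f U).2 hd]
  · rw [StrictPartition.symNew_min_max, hcells]
  · rw [StrictPartition.symNew_lt, decide_eq_true_iff]
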